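/- Let $\kappa>0$ and let $\gamma=(\gamma_1,\gamma_2):\mathbb R\to\mathbb R^2$ be a real-analytic, $2\pi$-periodic parametrization, injective on $[0,2\pi)$ and with $\gamma'(t)\neq0$ for all $t$, of a simple closed curve $\Gamma$ (the boundary of the cavity). Put $n(t)=(\gamma_2'(t),-\gamma_1'(t))$ and $\rho=|\gamma(t)-\gamma(\zeta)|$. All functions are complex valued and $2\pi$-periodic. **Operators.** Let $L,S,K,R,H$ be the integral operators $\phi\mapsto\int_0^{2\pi}\chi(t,\zeta)\phi(\zeta)\,d\zeta$ with kernels $\chi=l,s,k,r,h$, $$l=\tfrac{i\kappa}{2}\,n(\zeta)\cdot[\gamma(t)-\gamma(\zeta)]\,\frac{H^{(1)}_1(\kappa\rho)}{\rho},\quad s=\tfrac i2H^{(1)}_0(i\kappa\rho),\quad k=\tfrac{\kappa}{2}\,n(t)\cdot[\gamma(t)-\gamma(\zeta)]\,\frac{H^{(1)}_1(i\kappa\rho)}{\rho},\quad r=\tfrac{i\kappa^2}{2}H^{(1)}_0(\kappa\rho)\,n(t)\cdot n(\zeta),$$ $$h=\tfrac i2\tilde h\Big\{\kappa^2H_0^{(1)}(\kappa\rho)-\frac{2\kappa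 H_1^{(1)}(\kappa\rho)}{\rho}\Big\}+\frac{i\kappa\,\gamma'(t)\cdot\gamma'(\zeta)}{2\rho}H_1^{(1)}(\kappa\rho)+\frac1{4\pi\sin^2\frac{t-\zeta}2},$$ where $\tilde h=\rho^{-2}[\gamma'(t)\cdot(\gamma(t)-\gamma(\zeta))][\gamma'(\zeta)\cdot(\gamma(t)-\gamma(\zeta))]$. Let $M_0\phi=\frac{i}{2\pi}\int_0^{2\pi}\phi$, let $T_0=\tilde T_0+M_0$ with $(\tilde T_0\phi)(t)=\frac1{2\pi}\,\mathrm{p.v.}\!\int_0^{2\pi}\cot(\frac{\zeta-t}2)\phi'(\zeta)\,d\zeta$, let $S_0=\tilde S_0+M_0$, and let $\tilde S_0,S_1,S_2$ be the integral operators with kernels $-\frac1{2\pi}\Lambda$, $\frac1{4\pi}\Lambda\sin(t-\zeta)$, $-\frac1{8\pi}\Lambda\sin^2(t-\zeta)$, where $\Lambda=\ln(4\sin^2\frac{t-\zeta}2)$. Let $E_1,E_2,E_3,E_4,E_5$ be multiplication by $\kappa^2|\gamma'|^2$, $\kappa^2n\cdot\gamma''$, $\kappa^2\gamma'\cdot\gamma''$,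 $\kappa^4|\gamma'|^4+2\kappa^2\gamma'\cdot\gamma'''$, $-\frac34\kappa^4|\gamma'|^4+\kappa^2\gamma'\cdot\gamma'''$, and $E_6=E_4-E_5$. Put $\tilde S=S-\tilde S_0-E_1S_2$, $\tilde L=L-E_2S_2$, $\tilde K=K+E_2S_2$, $\tilde R=R-E_1\tilde S_0-2E_3S_1-E_4S_2$, $\tilde H=H-\frac12E_1\tilde S_0-E_3S_1-E_5S_2$. On pairs of functions let $$\mathcal N=\begin{pmatrix}I&0\\T_0&-I\end{pmatrix}+\begin{pmatrix}E_2S_2&S_0+E_1S_2\\\frac12E_1S_0+E_3S_1+E_6S_2&-E_2S_2\end{pmatrix},\quad \mathcal D=\begin{pmatrix}\tilde L&\tilde S-M_0\\\tilde R-\tilde H-M_0-\frac12E_1M_0&\tilde K\end{pmatrix},$$ $\mathcal A=\mathcal N+\mathcal D$, $\mathcal E=\mathrm{diag}(E_1,E_1)$, $\mathcal U=\mathrm{diag}(I+S_0T_0+E_1S_0S_0,\ I+T_0S_0+E_1S_0S_0)$, $\mathcal J=\mathcal N^2-\mathcal U$, $\mathcal V=\mathcal N\mathcal D+\mathcal D\mathcal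 N+\mathcal D^2$. **Discretization.** For $n\ge1$ let $X_n$ be the space of functions $\sum_{m=0}^na_m\cos mt+\sum_{m=1}^{n-1}b_m\sin mt$, let $P_n$ be interpolation into $X_n$ at the points $\pi j/n$, $0\le j\le2n-1$, and let $\mathcal P_n$ act as $P_n$ on both components. Let $\|u\|_p^2=\sum_{m\in\mathbb Z}(1+m^2)^p|\hat u_m|^2$ with $\hat u_m=\frac1{2\pi}\int_0^{2\pi}u(t)e^{-imt}dt$, and $\|(u_1,u_2)\|_p=\|u_1\|_p+\|u_2\|_p$. **Standing assumption.** The coupled boundary integral system in parametrized form, that is, the system with the operator $$\begin{pmatrix}I&0\\T_0&-I\end{pmatrix}+\begin{pmatrix}L&S\\R-H-M_0&K\end{pmatrix},$$ has at most one smooth $2\pi$-periodic solution for each right-hand side. **Theorem.** Let $p\ge0$. There are $C>0$ and $N\ge1$, depending only on $p,\gamma,\kappa$, such that for every smooth $2\pi$-periodic pair $\eta$ (in particular for the data $\eta=(-2u^{\rm inc}\circ\gamma,\ -2|\gamma'|\,(\partial_\nu u^{\rm inc})\circ\gamma)$ of an incident plane wave $u^{\rm inc}$) the equation $\mathcal A\psi=\eta$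 has a unique smooth $2\pi$-periodic solution $\psi$, and for all $n\ge N$ the semi-discrete collocation equation $$\mathcal E^{-1}\mathcal U\psi^n+\mathcal P_n[\mathcal E^{-1}(\mathcal J+\mathcal V)]\psi^n=\mathcal P_n(\mathcal E^{-1}\mathcal A)\eta$$ has a unique solution $\psi^n\in X_n^2$, which satisfies $$\|\psi^n-\psi\|_p\le C\,\|\mathcal P_n(\mathcal E^{-1}\mathcal U)\psi-\mathcal E^{-1}\mathcal U\psi\|_{p+2}.$$ -/

import Mathlib

open Real Set
open scoped ENNReal NNReal ContDiff

noncomputable section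

namespace BiharmonicCavity

/-! ### Bessel and Hankel functions of integer order -/

/-- Bessel function of the first kind `J_n`. -/
def besselJ (n : ℕ) (z : ℂ) : ℂ :=
  ∑' k : ℕ, (-1 : ℂ) ^ k / ((k.factorial : ℂ) * ((n + k).factorial : ℂ)) * (z / 2) ^ (2 * k + n)

/-- The digamma function at the positive integer `k + 1`, that is `-C + 1 + 1/2 + ... + 1/k`
with `C` Euler's constant. -/
def digammaSucc (k : ℕ) : ℂ := ((harmonic k : ℚ) : ℂ) - (Real.eulerMascheroniConstant : ℂ)

/-- Bessel function of the second kind `Y_n` (principal branch), by its ascending series. -/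
def besselY (n : ℕ) (z : ℂ) : ℂ :=
  2 / (π : ℂ) * Complex.log (z / 2) * besselJ n z
    - 1 / (π : ℂ) * ∑ k ∈ Finset.range n,
        ((n - k - 1).factorial : ℂ) / (k.factorial : ℂ) * ((z / 2) ^ (2 * k) / (z / 2) ^ n)
    - 1 / (π : ℂ) * ∑' k : ℕ, (digammaSucc k + digammaSucc (n + k)) *
        ((-1 : ℂ) ^ k / ((k.factorial : ℂ) * ((n + k).factorial : ℂ))) * (z / 2) ^ (2 * k + n)

/-- Hankel function of the first kind `H_n^{(1)} = J_n + i Y_n`. -/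
def hankel (n : ℕ) (z : ℂ) : ℂ := besselJ n z + Complex.I * besselY n z

/-! ### The boundary curve -/

/-- The plane. -/
abbrev Plane : Type := EuclideanSpace ℝ (Fin 2)

/-- `γ` is a regular analytic `2π`-periodic parametrization of a simple closed curve. -/
structure IsBoundaryCurve (γ : ℝ → Plane) : Prop where
  analytic : AnalyticOnNhd ℝ γ univ
  periodic : Function.Periodic γ (2 * π)
  regular : ∀ t, deriv γ t ≠ 0
  simple : InjOn γ (Ico 0 (2 * π))

/-- The (not normalized) normal `n(t) = (γ₂'(t), -γ₁'(t))`. -/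
def normal (γ : ℝ → Plane) (t : ℝ) : Plane := !₂[deriv γ t 1, -(deriv γ t 0)]

/-- The distance `|γ(t) - γ(ζ)|`. -/
def chord (γ : ℝ → Plane) (t ζ : ℝ) : ℝ := ‖γ t - γ ζ‖

/-! ### Periodic functions, Sobolev norms -/

/-- Smooth `2π`-periodic complex functions. -/
def SmoothPeriodic (φ : ℝ → ℂ) : Prop := ContDiff ℝ ∞ φ ∧ Function.Periodic φ (2 * π)

/-- Smooth `2π`-periodic pairs. -/
def SmoothPeriodicPair (ψ : (ℝ → ℂ) × (ℝ → ℂ)) : Prop :=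
  SmoothPeriodic ψ.1 ∧ SmoothPeriodic ψ.2

/-- The Fourier coefficient `û_m`. -/
def fourierCoef (u : ℝ → ℂ) (m : ℤ) : ℂ :=
  1 / (2 * (π : ℂ)) * ∫ t in (0 : ℝ)..(2 * π), u t * Complex.exp (-(Complex.I * m * t))

/-- The norm of `H^p[0,2π]`, with value `∞` on functions that are not in the space. -/
def sobolevNorm (p : ℝ) (u : ℝ → ℂ) : ℝ≥0∞ :=
  (∑' m : ℤ, ENNReal.ofReal ((1 + (m : ℝ) ^ 2) ^ p * ‖fourierCoef u m‖ ^ 2)) ^ (1 / 2 : ℝ)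

/-- The norm `‖ψ‖_p = ‖ψ₁‖_p + ‖ψ₂‖_p` of `H^p[0,2π]²`. -/
def sobolevNormPair (p : ℝ) (ψ : (ℝ → ℂ) × (ℝ → ℂ)) : ℝ≥0∞ :=
  sobolevNorm p ψ.1 + sobolevNorm p ψ.2

/-! ### Operators on functions and on pairs -/

/-- Operators on functions; sums and scalar multiples are taken pointwise. -/
abbrev Op : Type := (ℝ → ℂ) → (ℝ → ℂ)

/-- Operators on pairs of functions. -/
abbrev PairOp : Type := (ℝ → ℂ) × (ℝ → ℂ) → (ℝ → ℂ) × (ℝ → ℂ)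

/-- The 2 × 2 block operator with rows `(a, b)` and `(c, d)`. -/
def block (a b c d : Op) : PairOp := fun ψ => (a ψ.1 + b ψ.2, c ψ.1 + d ψ.2)

/-- The integral operator on `[0,2π]` with the given kernel. -/
def kernelOp (χ : ℝ → ℝ → ℂ) : Op := fun φ t => ∫ ζ in (0 : ℝ)..(2 * π), χ t ζ * φ ζ

/-- Multiplication by a real function. -/
def mulOp (f : ℝ → ℝ) : Op := fun φ t => (f t : ℂ) * φ t

/-- `ln (4 sin² ((t - ζ)/2))`. -/
def logSin (t ζ : ℝ) : ℝ := Real.log (4 * Real.sin ((t - ζ) / 2) ^ 2)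

/-! #### Integral operators of the parametrized boundary integral equations -/

section Kernels

variable (γ : ℝ → Plane) (κ : ℝ)

/-- The kernel `l` (double-layer potential of the Helmholtz equation). -/
def kerL (t ζ : ℝ) : ℂ :=
  Complex.I * κ / 2 * (inner ℝ (normal γ ζ) (γ t - γ ζ) : ℝ)
    * (hankel 1 (κ * chord γ t ζ) / chord γ t ζ)

/-- The kernel `s` (single-layer potential of the modified Helmholtz equation). -/
def kerS (t ζ : ℝ) : ℂ := Complex.I / 2 * hankel 0 (Complex.I * κ * chord γ t ζ)

/-- The kernel `k` (normal derivative of the single-layer potential of the modified Helmholtz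
equation). -/
def kerK (t ζ : ℝ) : ℂ :=
  (κ : ℂ) / 2 * (inner ℝ (normal γ t) (γ t - γ ζ) : ℝ)
    * (hankel 1 (Complex.I * κ * chord γ t ζ) / chord γ t ζ)

/-- The kernel `r`. -/
def kerR (t ζ : ℝ) : ℂ :=
  Complex.I * κ ^ 2 / 2 * hankel 0 (κ * chord γ t ζ) * (inner ℝ (normal γ t) (normal γ ζ) : ℝ)

/-- The function `h̃`. -/
def hTilde (t ζ : ℝ) : ℝ :=
  inner ℝ (deriv γ t) (γ t - γ ζ) * inner ℝ (deriv γ ζ) (γ t - γ ζ) / chord γ t ζ ^ 2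

/-- The kernel `h`. -/
def kerH (t ζ : ℝ) : ℂ :=
  Complex.I / 2 * (hTilde γ t ζ : ℝ) *
      (κ ^ 2 * hankel 0 (κ * chord γ t ζ)
        - 2 * κ * hankel 1 (κ * chord γ t ζ) / chord γ t ζ)
    + Complex.I * κ * (inner ℝ (deriv γ t) (deriv γ ζ) : ℝ) / (2 * chord γ t ζ)
        * hankel 1 (κ * chord γ t ζ)
    + 1 / (4 * (π : ℂ)) * (1 / (Real.sin ((t - ζ) / 2) : ℂ) ^ 2)

/-- The operator `L`. -/
def opL : Op := kernelOp (kerL γ κ)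
/-- The operator `S`. -/
def opS : Op := kernelOp (kerS γ κ)
/-- The operator `K`. -/
def opK : Op := kernelOp (kerK γ κ)
/-- The operator `R`. -/
def opR : Op := kernelOp (kerR γ κ)
/-- The operator `H`. -/
def opH : Op := kernelOp (kerH γ κ)

end Kernels

/-! #### Model operators -/

/-- `M₀`. -/
def opM0 : Op := fun φ _ => Complex.I / (2 * (π : ℂ)) * ∫ ζ in (0 : ℝ)..(2 * π), φ ζ

/-- `T̃₀`, that is `(1/2π) p.v. ∫ cot((ζ - t)/2) φ'(ζ) dζ` over a period. The principal value
is written in symmetrized form: with `ζ = t ± s` and the cotangent odd, the integral over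
`ε < |ζ - t| < π` is `∫_ε^π cot(s/2) (φ'(t+s) - φ'(t-s)) ds`, and for smooth `φ` the last
integrand is bounded, so that `ε` may be set to `0`. -/
def opT0tilde : Op := fun φ t =>
  1 / (2 * (π : ℂ)) * ∫ s in (0 : ℝ)..π, (Real.cot (s / 2) : ℂ) * (deriv φ (t + s) - deriv φ (t - s))

/-- `T₀ = T̃₀ + M₀`. -/
def opT0 : Op := opT0tilde + opM0

/-- `S̃₀`. -/
def opS0tilde : Op := kernelOp fun t ζ => -(1 / (2 * (π : ℂ))) * logSin t ζ

/-- `S₀ = S̃₀ + M₀`. -/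
def opS0 : Op := opS0tilde + opM0

/-- `S₁`. -/
def opS1 : Op := kernelOp fun t ζ => 1 / (4 * (π : ℂ)) * logSin t ζ * Real.sin (t - ζ)

/-- `S₂`. -/
def opS2 : Op := kernelOp fun t ζ => -(1 / (8 * (π : ℂ))) * logSin t ζ * (Real.sin (t - ζ) : ℂ) ^ 2

section System

variable (γ : ℝ → Plane) (κ : ℝ)

/-- Multiplication by `κ² |γ'|²`. -/
def opE1 : Op := mulOp fun t => κ ^ 2 * ‖deriv γ t‖ ^ 2
/-- The inverse of `E₁`. -/
def opE1inv : Op := mulOp fun t => (κ ^ 2 * ‖deriv γ t‖ ^ 2)⁻¹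
/-- Multiplication by `κ² n · γ''`. -/
def opE2 : Op := mulOp fun t => κ ^ 2 * inner ℝ (normal γ t) (iteratedDeriv 2 γ t)
/-- Multiplication by `κ² γ' · γ''`. -/
def opE3 : Op := mulOp fun t => κ ^ 2 * inner ℝ (deriv γ t) (iteratedDeriv 2 γ t)
/-- Multiplication by `κ⁴ |γ'|⁴ + 2 κ² γ' · γ'''`. -/
def opE4 : Op := mulOp fun t =>
  κ ^ 4 * ‖deriv γ t‖ ^ 4 + 2 * κ ^ 2 * inner ℝ (deriv γ t) (iteratedDeriv 3 γ t)
/-- Multiplication by `-(3/4) κ⁴ |γ'|⁴ + κ² γ' · γ'''`. -/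
def opE5 : Op := mulOp fun t =>
  -(3 / 4) * κ ^ 4 * ‖deriv γ t‖ ^ 4 + κ ^ 2 * inner ℝ (deriv γ t) (iteratedDeriv 3 γ t)
/-- `E₆ = E₄ - E₅`. -/
def opE6 : Op := opE4 γ κ - opE5 γ κ

/-- The remainder `S̃ = S - S̃₀ - E₁S₂`. -/
def opStilde : Op := opS γ κ - opS0tilde - opE1 γ κ ∘ opS2
/-- The remainder `L̃ = L - E₂S₂`. -/
def opLtilde : Op := opL γ κ - opE2 γ κ ∘ opS2
/-- The remainder `K̃ = K + E₂S₂`. -/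
def opKtilde : Op := opK γ κ + opE2 γ κ ∘ opS2
/-- The remainder `R̃ = R - E₁S̃₀ - 2E₃S₁ - E₄S₂`. -/
def opRtilde : Op :=
  opR γ κ - opE1 γ κ ∘ opS0tilde - (2 : ℂ) • (opE3 γ κ ∘ opS1) - opE4 γ κ ∘ opS2
/-- The remainder `H̃ = H - ½E₁S̃₀ - E₃S₁ - E₅S₂`. -/
def opHtilde : Op :=
  opH γ κ - (1 / 2 : ℂ) • (opE1 γ κ ∘ opS0tilde) - opE3 γ κ ∘ opS1 - opE5 γ κ ∘ opS2

/-- The operator of the parametrized coupled boundary integral equations, in the unknowns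
`ψ₁ = g₁ ∘ γ` and `ψ₂ = (g₂ ∘ γ)|γ'|`. -/
def coupledOp : PairOp :=
  block id 0 opT0 (-id) + block (opL γ κ) (opS γ κ) (opR γ κ - opH γ κ - opM0) (opK γ κ)

/-- `𝒩 = 𝒩₁ + 𝒩₂`. -/
def opN : PairOp :=
  block id 0 opT0 (-id)
    + block (opE2 γ κ ∘ opS2) (opS0 + opE1 γ κ ∘ opS2)
        ((1 / 2 : ℂ) • (opE1 γ κ ∘ opS0) + opE3 γ κ ∘ opS1 + opE6 γ κ ∘ opS2)
        (-(opE2 γ κ ∘ opS2))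

/-- `𝒟`. -/
def opD : PairOp :=
  block (opLtilde γ κ) (opStilde γ κ - opM0)
    (opRtilde γ κ - opHtilde γ κ - opM0 - (1 / 2 : ℂ) • (opE1 γ κ ∘ opM0)) (opKtilde γ κ)

/-- `𝒜 = 𝒩 + 𝒟`. -/
def opA : PairOp := opN γ κ + opD γ κ

/-- `𝒰`. -/
def opU : PairOp :=
  block (id + opS0 ∘ opT0 + opE1 γ κ ∘ opS0 ∘ opS0) 0
    0 (id + opT0 ∘ opS0 + opE1 γ κ ∘ opS0 ∘ opS0)

/-- `𝒥`, the difference in the splitting `𝒩² = 𝒰 + 𝒥`. -/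
def opJ : PairOp := opN γ κ ∘ opN γ κ - opU γ κ

/-- `𝒱 = 𝒩𝒟 + 𝒟𝒩 + 𝒟²`. -/
def opV : PairOp := opN γ κ ∘ opD γ κ + opD γ κ ∘ opN γ κ + opD γ κ ∘ opD γ κ

/-- `ℰ⁻¹`. -/
def opEinv : PairOp := block (opE1inv γ κ) 0 0 (opE1inv γ κ)

end System

/-! ### Trigonometric interpolation and the semi-discrete equation -/

/-- The space `X_n` of functions `∑_{m=0}^{n} a_m cos mt + ∑_{m=1}^{n-1} b_m sin mt`. -/
def IsTrigPoly (n : ℕ) (φ : ℝ → ℂ) : Prop :=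
  ∃ a b : ℕ → ℂ, ∀ t : ℝ,
    φ t = ∑ m ∈ Finset.range (n + 1), a m * (Real.cos (m * t) : ℂ)
      + ∑ m ∈ Finset.Ico 1 n, b m * (Real.sin (m * t) : ℂ)

/-- The space `X_n²`. -/
def IsTrigPolyPair (n : ℕ) (ψ : (ℝ → ℂ) × (ℝ → ℂ)) : Prop :=
  IsTrigPoly n ψ.1 ∧ IsTrigPoly n ψ.2

/-- The interpolation point `ζ_j = π j / n`. -/
def node (n j : ℕ) : ℝ := π * j / n

/-- The Lagrange basis of `X_n` for the nodes `ζ_0, ..., ζ_{2n-1}`. -/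
def lagrangeTrig (n j : ℕ) (t : ℝ) : ℝ :=
  1 / (2 * n) * (1 + 2 * ∑ k ∈ Finset.Ico 1 n, Real.cos (k * (t - node n j))
    + Real.cos (n * (t - node n j)))

/-- The interpolation operator `P_n`: the element of `X_n` (`n ≥ 1`) that agrees with `g` at the
nodes `ζ_0, ..., ζ_{2n-1}`. -/
def interp (n : ℕ) : Op := fun g t =>
  ∑ j ∈ Finset.range (2 * n), g (node n j) * (lagrangeTrig n j t : ℂ)

/-- The interpolation operator `𝒫_n` on pairs. -/
def interpPair (n : ℕ) : PairOp := fun g => (interp n g.1, interp n g.2)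

/-- `ψⁿ ∈ X_n²` solves the semi-discrete collocation equation
`ℰ⁻¹𝒰ψⁿ + 𝒫_n[ℰ⁻¹(𝒥 + 𝒱)]ψⁿ = 𝒫_n(ℰ⁻¹𝒜)η`. -/
def IsSemiDiscreteSolution (γ : ℝ → Plane) (κ : ℝ) (n : ℕ) (η ψn : (ℝ → ℂ) × (ℝ → ℂ)) : Prop :=
  IsTrigPolyPair n ψn ∧
    opEinv γ κ (opU γ κ ψn) + interpPair n (opEinv γ κ ((opJ γ κ + opV γ κ) ψn))
      = interpPair n (opEinv γ κ (opA γ κ η))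

end BiharmonicCavity

end

open BiharmonicCavity

noncomputable section

namespace BiharmonicCavity

/-! On the Fourier side a smooth periodic function is a rapidly decaying sequence, and every
operator occurring here is an infinite matrix `g m k` bounded, for each `N`, by a multiple of `wt k
^ d / wt (m - k) ^ N`. These matrices of order `d` are the pseudodifferential operators of the
circle in elementary form. Orders add under composition (`IsOrd.mul`), smooth multiplication
operators have order 0, `T₀` has order 1, `S₀` has order -1, and the commutator of `T₀` with a
multiplication operator has order 0 instead of 1 (`isOrd_commutator`). A kernel that is smooth times
the logarithm gains one order for each factor `e^{it} - e^{iζ}` that can be split off, because such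
a factor takes a difference of the Fourier coefficients of the logarithm, which are proportional to
`1/|k|` (`IsLogOp.exists_rep`).

The ascending series of the Hankel functions, together with `|γ(t) - γ(ζ)|² = |e^{it} - e^{iζ}|²
g(t,ζ)` for a smooth positive `g`, writes each kernel as `A ln(4 sin²((t-ζ)/2)) + B` with smooth `A`
and `B`. The operators `E_i S_j` are chosen to match `A` near the diagonal; what is left has order
-4 for `S̃`, `L̃`, `K̃` and order -3 for `R̃`, `H̃`.

The operator `𝒜` itself is not of the form invertible plus compact on a single Sobolev scale, but
its square is tame. The mean value terms `M₀` make `S₀T₀ = T₀S₀ = -1` exact, so `ℰ⁻¹𝒰` is just `S₀²`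
on both components. In `𝒜² - 𝒰` every term of order above -3 cancels or turns into a commutator
(`IsOrderCalculus.sq_sub_order`). Hence `ℰ⁻¹𝒜² = S₀² + B` with `B` of order -3, and multiplication
by `T₀² = (S₀²)⁻¹` gives the identity plus an operator of order -1
(`IsBoundaryCurve.exists_repPair`, `precond`).

An operator of order -1 is Hilbert–Schmidt in every weighted `ℓ²` with `p ≥ 0`, so the Fredholm
alternative applies. Injectivity comes from the standing assumption, since `𝒜` is the coupled
operator, and solutions are smooth because each use of the equation gains one order of decay
(`exists_solution_act`). If `𝒜²X = η`, then `ψ = 𝒜X` solves `𝒜ψ = η`.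

For the scheme, interpolation satisfies `‖P_n u - u‖_{p+2} = O(n^{-1/2}) ‖u‖_{p+3}`, and `B` maps
`H^p` to `H^{p+3}`. So `S₀² + 𝒫_n B` is a small perturbation of `S₀² + B` and is stable for large
`n` (`exists_stability`). The multiplier `S₀²` preserves `X_n`, so the discrete equation is a square
linear system and stability gives unique solvability. Finally `ψⁿ - ψ` solves the projected equation
with right-hand side `𝒫_n S₀²ψ - S₀²ψ`, and the stability estimate is the asserted error bound. -/

/-! ### Matrices with off-diagonal decay -/

/-- The weight `1 + |k|`. -/
def wt (k : ℤ) : ℝ := 1 + |(k : ℝ)|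

lemma one_le_wt (k : ℤ) : 1 ≤ wt k := by unfold wt; linarith [abs_nonneg (k : ℝ)]

lemma wt_pos (k : ℤ) : 0 < wt k := lt_of_lt_of_le one_pos (one_le_wt k)

lemma wt_neg (k : ℤ) : wt (-k) = wt k := by simp [wt]

lemma wt_sub_comm (m k : ℤ) : wt (m - k) = wt (k - m) := by rw [← wt_neg, neg_sub]

lemma wt_add_le (m k : ℤ) : wt (m + k) ≤ wt m * wt k := by
  unfold wt
  push_cast
  nlinarith [abs_add_le (m : ℝ) k, abs_nonneg (m : ℝ), abs_nonneg (k : ℝ),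
    mul_nonneg (abs_nonneg (m : ℝ)) (abs_nonneg (k : ℝ))]

lemma wt_le_mul_sub (m k : ℤ) : wt m ≤ wt k * wt (m - k) := by
  simpa using wt_add_le k (m - k)

lemma wt_pow_le_mul_sub (m k : ℤ) (N : ℕ) : wt m ^ N ≤ wt k ^ N * wt (m - k) ^ N := by
  rw [← mul_pow]; exact pow_le_pow_left₀ (wt_pos m).le (wt_le_mul_sub m k) N

/-- Peetre's inequality: a weight may be moved from one index to another at the price of `|d|`
powers of the distance of the indices, which off-diagonal decay can always pay. -/
lemma wt_zpow_le (d : ℤ) (m k : ℤ) : wt k ^ d ≤ wt m ^ d * wt (m - k) ^ d.natAbs := by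
  obtain ⟨n, rfl | rfl⟩ := d.eq_nat_or_neg
  · simp only [zpow_natCast, Int.natAbs_natCast]
    rw [wt_sub_comm]; exact wt_pow_le_mul_sub k m n
  · simp only [zpow_neg, zpow_natCast, Int.natAbs_neg, Int.natAbs_natCast]
    rw [inv_le_iff_one_le_mul₀' (pow_pos (wt_pos k) n), ← mul_assoc, mul_comm (wt k ^ n), mul_assoc,
      ← div_eq_inv_mul, one_le_div (pow_pos (wt_pos m) n)]
    exact wt_pow_le_mul_sub m k n

lemma summable_inv_wt_sq : Summable fun k : ℤ => (wt k ^ 2)⁻¹ := by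
  have h : Summable fun k : ℤ => (1 : ℝ) / (k : ℝ) ^ 2 :=
    Real.summable_one_div_int_pow.mpr one_lt_two
  refine Summable.of_norm_bounded_eventually (g := fun k : ℤ => (1 : ℝ) / (k : ℝ) ^ 2) h ?_
  have : ({0} : Set ℤ).Finite := Set.finite_singleton 0
  filter_upwards [this.compl_mem_cofinite] with k hk
  have hk : (k : ℝ) ≠ 0 := by simpa using hk
  rw [Real.norm_of_nonneg (by positivity [wt_pos k]), one_div]
  apply inv_anti₀ (by positivity)
  rw [← sq_abs]
  exact pow_le_pow_left₀ (abs_nonneg _) (by unfold wt; linarith) 2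

lemma summable_inv_wt_sub_sq (m : ℤ) : Summable fun k : ℤ => (wt (m - k) ^ 2)⁻¹ :=
  (Equiv.subLeft m).summable_iff.mpr summable_inv_wt_sq

/-- The sum of `(1 + |k|)⁻²`. -/
def wtSum : ℝ := ∑' k : ℤ, (wt k ^ 2)⁻¹

lemma tsum_inv_wt_sub_sq (m : ℤ) : ∑' k : ℤ, (wt (m - k) ^ 2)⁻¹ = wtSum :=
  (Equiv.subLeft m).tsum_eq fun k => (wt k ^ 2)⁻¹

lemma wtSum_nonneg : 0 ≤ wtSum := tsum_nonneg fun k => by positivity [wt_pos k]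

/-! ### Rapidly decaying sequences -/

/-- Rapidly decaying sequences. -/
def RapidDecay (u : ℤ → ℂ) : Prop := ∀ N : ℕ, ∃ C : ℝ, ∀ k, ‖u k‖ ≤ C / wt k ^ N

/-- The space of rapidly decaying sequences. -/
def RD : Submodule ℂ (ℤ → ℂ) where
  carrier := {u | RapidDecay u}
  zero_mem' := fun N => ⟨0, fun k => by simp⟩
  add_mem' := by
    intro u v hu hv N
    obtain ⟨C, hC⟩ := hu N
    obtain ⟨D, hD⟩ := hv N
    exact ⟨C + D, fun k => (norm_add_le _ _).trans (by rw [add_div]; exact add_le_add (hC k) (hD k))⟩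
  smul_mem' := by
    intro c u hu N
    obtain ⟨C, hC⟩ := hu N
    refine ⟨‖c‖ * C, fun k => ?_⟩
    rw [Pi.smul_apply, norm_smul, mul_div_assoc]
    exact mul_le_mul_of_nonneg_left (hC k) (norm_nonneg _)

lemma rapidDecay_of_zpow {u : ℤ → ℂ} (h : ∀ N : ℕ, ∃ C : ℝ, ∀ k, ‖u k‖ ≤ C * wt k ^ (-(N : ℤ))) :
    RapidDecay u := by
  intro N
  obtain ⟨C, hC⟩ := h N
  exact ⟨C, fun k => by simpa [div_eq_mul_inv] using hC k⟩

lemma RapidDecay.zpow {u : ℤ → ℂ} (h : RapidDecay u) (r : ℤ) :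
    ∃ C : ℝ, 0 ≤ C ∧ ∀ k, ‖u k‖ ≤ C * wt k ^ r := by
  obtain ⟨C, hC⟩ := h r.natAbs
  have hC0 : 0 ≤ C := by
    have := (norm_nonneg _).trans (hC 0)
    simpa [wt] using this
  refine ⟨C, hC0, fun k => (hC k).trans ?_⟩
  rw [div_eq_mul_inv]
  refine mul_le_mul_of_nonneg_left ?_ hC0
  rw [← zpow_natCast, ← zpow_neg]
  exact zpow_le_zpow_right₀ (one_le_wt k) (by omega)

lemma summable_wt_zpow {r : ℤ} (hr : r ≤ -2) : Summable fun k : ℤ => wt k ^ r := by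
  refine Summable.of_nonneg_of_le (fun k => by positivity [wt_pos k]) (fun k => ?_) summable_inv_wt_sq
  have := zpow_le_zpow_right₀ (one_le_wt k) hr
  simpa [zpow_neg] using this

lemma RapidDecay.summable {u : ℤ → ℂ} (h : RapidDecay u) : Summable fun k => ‖u k‖ := by
  obtain ⟨C, -, hC⟩ := h.zpow (-2)
  exact Summable.of_nonneg_of_le (fun k => norm_nonneg _) hC ((summable_wt_zpow le_rfl).mul_left C)

/-! ### The calculus of matrices of finite order -/

/-- Infinite matrices of order `d`, with rapid decay off the diagonal. -/
def OrdMat (d : ℤ) (g : ℤ → ℤ → ℂ) : Prop :=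
  ∀ N : ℕ, ∃ C : ℝ, 0 ≤ C ∧ ∀ m k, ‖g m k‖ ≤ C * wt k ^ d / wt (m - k) ^ N

lemma OrdMat.mono {d d' : ℤ} {g : ℤ → ℤ → ℂ} (h : OrdMat d g) (hd : d ≤ d') : OrdMat d' g := by
  intro N
  obtain ⟨C, hC0, hC⟩ := h N
  refine ⟨C, hC0, fun m k => (hC m k).trans ?_⟩
  have := zpow_le_zpow_right₀ (one_le_wt k) hd
  have := wt_pos (m - k)
  gcongr

lemma OrdMat.add {d : ℤ} {g h : ℤ → ℤ → ℂ} (hg : OrdMat d g) (hh : OrdMat d h) :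
    OrdMat d (g + h) := by
  intro N
  obtain ⟨C, hC0, hC⟩ := hg N
  obtain ⟨D, hD0, hD⟩ := hh N
  refine ⟨C + D, by positivity, fun m k => (norm_add_le _ _).trans ?_⟩
  rw [add_mul, add_div]
  exact add_le_add (hC m k) (hD m k)

lemma OrdMat.smul {d : ℤ} {g : ℤ → ℤ → ℂ} (hg : OrdMat d g) (c : ℂ) : OrdMat d (c • g) := by
  intro N
  obtain ⟨C, hC0, hC⟩ := hg N
  refine ⟨‖c‖ * C, by positivity, fun m k => ?_⟩
  rw [Pi.smul_apply, Pi.smul_apply, norm_smul, mul_assoc, mul_div_assoc]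
  exact mul_le_mul_of_nonneg_left (hC m k) (norm_nonneg _)

/-- A matrix of order `d` maps sequences of order `r` to sequences of order `d + r`. -/
lemma OrdMat.apply_bound {d r : ℤ} {g : ℤ → ℤ → ℂ} (hg : OrdMat d g) {u : ℤ → ℂ} {C : ℝ}
    (hu : ∀ k, ‖u k‖ ≤ C * wt k ^ r) :
    (∀ m, Summable fun k => ‖g m k * u k‖) ∧
      ∃ D : ℝ, 0 ≤ D ∧ ∀ m, ‖∑' k, g m k * u k‖ ≤ D * wt m ^ (d + r) := by
  -- Of the off-diagonal decay, `|d + r|` powers move the weight from `k` to `m` and two powers make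
  -- the sum over `k` converge uniformly in `m`.
  obtain ⟨B, hB0, hB⟩ := hg ((d + r).natAbs + 2)
  have hC0 : 0 ≤ C := by simpa [wt] using (norm_nonneg _).trans (hu 0)
  have key : ∀ m k, ‖g m k * u k‖ ≤ B * C * wt m ^ (d + r) * (wt (m - k) ^ 2)⁻¹ := by
    intro m k
    have h0 := wt_pos k
    have h1 := wt_pos (m - k)
    have h2 := wt_pos m
    calc ‖g m k * u k‖ ≤ (B * wt k ^ d / wt (m - k) ^ ((d + r).natAbs + 2)) * (C * wt k ^ r) := by
          rw [norm_mul]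
          exact mul_le_mul (hB m k) (hu k) (norm_nonneg _) (by positivity)
      _ = B * C * (wt k ^ (d + r) / wt (m - k) ^ (d + r).natAbs) * (wt (m - k) ^ 2)⁻¹ := by
          rw [zpow_add₀ h0.ne']; field_simp; ring
      _ ≤ B * C * wt m ^ (d + r) * (wt (m - k) ^ 2)⁻¹ := by
          gcongr
          rw [div_le_iff₀ (by positivity)]
          exact wt_zpow_le _ _ _
  have hs : ∀ m, Summable fun k => ‖g m k * u k‖ := fun m =>
    Summable.of_nonneg_of_le (fun k => norm_nonneg _) (key m) ((summable_inv_wt_sub_sq m).mul_left _)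
  refine ⟨hs, B * C * wtSum, by have := wtSum_nonneg; positivity, fun m => ?_⟩
  calc ‖∑' k, g m k * u k‖ ≤ ∑' k, ‖g m k * u k‖ := norm_tsum_le_tsum_norm (hs m)
    _ ≤ ∑' k, B * C * wt m ^ (d + r) * (wt (m - k) ^ 2)⁻¹ :=
        (hs m).tsum_le_tsum (key m) ((summable_inv_wt_sub_sq m).mul_left _)
    _ = B * C * wtSum * wt m ^ (d + r) := by rw [tsum_mul_left, tsum_inv_wt_sub_sq]; ring

/-- The sequence `∑ₖ g(m,k) u(k)`. -/
def matApply (g : ℤ → ℤ → ℂ) (u : ℤ → ℂ) : ℤ → ℂ := fun m => ∑' k, g m k * u k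

lemma OrdMat.summable {d : ℤ} {g : ℤ → ℤ → ℂ} (hg : OrdMat d g) {u : ℤ → ℂ} (hu : RapidDecay u)
    (m : ℤ) : Summable fun k => g m k * u k := by
  obtain ⟨C, -, hC⟩ := hu.zpow 0
  exact ((hg.apply_bound hC).1 m).of_norm

lemma OrdMat.rapidDecay {d : ℤ} {g : ℤ → ℤ → ℂ} (hg : OrdMat d g) {u : ℤ → ℂ} (hu : RapidDecay u) :
    RapidDecay (matApply g u) := by
  refine rapidDecay_of_zpow fun N => ?_
  obtain ⟨C, -, hC⟩ := hu.zpow (-N - d)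
  obtain ⟨D, -, hD⟩ := (hg.apply_bound hC).2
  exact ⟨D, fun m => by simpa [matApply] using hD m⟩

/-- The operator on rapidly decaying sequences given by a matrix of finite order. -/
def OrdMat.toEnd {d : ℤ} {g : ℤ → ℤ → ℂ} (hg : OrdMat d g) : Module.End ℂ RD where
  toFun u := ⟨matApply g u, hg.rapidDecay u.2⟩
  map_add' u v := by
    ext m
    simp only [matApply, Submodule.coe_add, Pi.add_apply, mul_add]
    exact (hg.summable u.2 m).tsum_add (hg.summable v.2 m)
  map_smul' c u := by
    ext m
    simp only [matApply, Submodule.coe_smul, Pi.smul_apply, smul_eq_mul, RingHom.id_apply,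
      ← tsum_mul_left]
    exact tsum_congr fun k => by ring

/-! ### Operators of finite order on rapidly decaying sequences -/

/-- `A` is an operator of order `d`. -/
def IsOrd (d : ℤ) (A : Module.End ℂ RD) : Prop :=
  ∃ g, OrdMat d g ∧ ∀ u : RD, (A u : ℤ → ℂ) = matApply g u

lemma OrdMat.isOrd {d : ℤ} {g : ℤ → ℤ → ℂ} (hg : OrdMat d g) : IsOrd d hg.toEnd :=
  ⟨g, hg, fun _ => rfl⟩

lemma IsOrd.mono {d d' : ℤ} {A : Module.End ℂ RD} (h : IsOrd d A) (hd : d ≤ d') : IsOrd d' A := by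
  obtain ⟨g, hg, h⟩ := h
  exact ⟨g, hg.mono hd, h⟩

lemma IsOrd.add {d : ℤ} {A B : Module.End ℂ RD} (hA : IsOrd d A) (hB : IsOrd d B) :
    IsOrd d (A + B) := by
  obtain ⟨g, hg, hA⟩ := hA
  obtain ⟨h, hh, hB⟩ := hB
  refine ⟨g + h, hg.add hh, fun u => ?_⟩
  ext m
  simp only [LinearMap.add_apply, Submodule.coe_add, hA, hB, Pi.add_apply, matApply, add_mul]
  exact ((hg.summable u.2 m).tsum_add (hh.summable u.2 m)).symm

lemma IsOrd.smul {d : ℤ} {A : Module.End ℂ RD} (hA : IsOrd d A) (c : ℂ) : IsOrd d (c • A) := by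
  obtain ⟨g, hg, hA⟩ := hA
  refine ⟨c • g, hg.smul c, fun u => ?_⟩
  ext m
  simp only [LinearMap.smul_apply, Submodule.coe_smul, hA, Pi.smul_apply, matApply, smul_eq_mul,
    ← tsum_mul_left]
  exact tsum_congr fun k => by ring

lemma IsOrd.sub {d : ℤ} {A B : Module.End ℂ RD} (hA : IsOrd d A) (hB : IsOrd d B) :
    IsOrd d (A - B) := by
  have e : A - B = A + (-1 : ℂ) • B := by ext; simp [sub_eq_add_neg]
  rw [e]; exact hA.add (hB.smul (-1))

/-- A bound summable in the middle index `l`. The first factor spends two powers on summability, the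
second spends `|d|` powers on replacing `wt l ^ d` by `wt k ^ d`, and the remaining `N` powers
combine by `wt (m - k) ≤ wt (m - l) * wt (l - k)`. -/
lemma OrdMat.comp_bound {d e : ℤ} {g h : ℤ → ℤ → ℂ} (hg : OrdMat d g) (hh : OrdMat e h) (N : ℕ) :
    ∃ C : ℝ, 0 ≤ C ∧ ∀ m l k, ‖g m l * h l k‖ ≤
      C * wt k ^ (d + e) / wt (m - k) ^ N * (wt (m - l) ^ 2)⁻¹ := by
  obtain ⟨C, hC0, hC⟩ := hg (N + 2)
  obtain ⟨D, hD0, hD⟩ := hh (N + d.natAbs)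
  refine ⟨C * D, by positivity, fun m l k => ?_⟩
  have h5 : wt (m - k) ^ N ≤ wt (l - k) ^ N * wt (m - l) ^ N := by
    have := wt_pow_le_mul_sub (m - k) (l - k) N
    simpa using this
  have h6 := wt_zpow_le d k l
  rw [wt_sub_comm k l] at h6
  have h1 := wt_pos (m - l)
  have h2 := wt_pos (l - k)
  have h3 := wt_pos k
  have h4 := wt_pos (m - k)
  have h7 := wt_pos l
  have hC := hC m l
  have hD := hD l k
  rw [zpow_add₀ h3.ne']
  generalize wt (m - l) = x at *
  generalize wt (l - k) = y at *
  generalize wt (m - k) = z at *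
  have e1 := zpow_pos h3 d
  have e2 := zpow_pos h3 e
  have e3 := zpow_pos h7 d
  generalize wt k ^ d = p at *
  generalize wt k ^ e = q at *
  generalize wt l ^ d = r at *
  calc ‖g m l * h l k‖ ≤ (C * r / x ^ (N + 2)) * (D * q / y ^ (N + d.natAbs)) := by
        rw [norm_mul]
        exact mul_le_mul hC hD (norm_nonneg _) (by positivity)
    _ ≤ (C * (p * y ^ d.natAbs) / x ^ (N + 2)) * (D * q / y ^ (N + d.natAbs)) := by gcongr
    _ = C * D * (p * q) / (y ^ N * x ^ N) * (x ^ 2)⁻¹ := by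
        rw [pow_add, pow_add]; field_simp
    _ ≤ C * D * (p * q) / z ^ N * (x ^ 2)⁻¹ := by gcongr

lemma OrdMat.comp {d e : ℤ} {g h : ℤ → ℤ → ℂ} (hg : OrdMat d g) (hh : OrdMat e h) :
    OrdMat (d + e) (fun m k => ∑' l, g m l * h l k) := by
  intro N
  obtain ⟨C, hC0, hC⟩ := hg.comp_bound hh N
  refine ⟨C * wtSum, mul_nonneg hC0 wtSum_nonneg, fun m k => ?_⟩
  have hs := (summable_inv_wt_sub_sq m).mul_left (C * wt k ^ (d + e) / wt (m - k) ^ N)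
  have hn : Summable fun l => ‖g m l * h l k‖ :=
    Summable.of_nonneg_of_le (fun l => norm_nonneg _) (fun l => hC m l k) hs
  calc _ ≤ ∑' l, ‖g m l * h l k‖ := norm_tsum_le_tsum_norm hn
    _ ≤ _ := hn.tsum_le_tsum (fun l => hC m l k) hs
    _ = _ := by rw [tsum_mul_left, tsum_inv_wt_sub_sq]; ring

/-- Fubini for double series. The decay of `u` is used to order `-(d + e) - 2`, which cancels the
growth of the product and leaves a convergent sum over `k`. -/
lemma OrdMat.matApply_comp {d e : ℤ} {g h : ℤ → ℤ → ℂ} (hg : OrdMat d g) (hh : OrdMat e h)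
    {u : ℤ → ℂ} (hu : RapidDecay u) :
    matApply g (matApply h u) = matApply (fun m k => ∑' l, g m l * h l k) u := by
  ext m
  obtain ⟨C, hC0, hC⟩ := hg.comp_bound hh 0
  obtain ⟨D, hD0, hD⟩ := hu.zpow (-(d + e) - 2)
  have hdom : Summable fun x : ℤ × ℤ => (wt (m - x.1) ^ 2)⁻¹ * (C * D * wt x.2 ^ (-2 : ℤ)) := by
    have s1 := summable_inv_wt_sub_sq m
    have s2 := (summable_wt_zpow (r := -2) le_rfl).mul_left (C * D)
    have p1 : ∀ l, 0 ≤ (wt (m - l) ^ 2)⁻¹ := fun l => inv_nonneg.mpr (sq_nonneg _)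
    have p2 : ∀ k, 0 ≤ C * D * wt k ^ (-2 : ℤ) := fun k =>
      mul_nonneg (mul_nonneg hC0 hD0) (zpow_nonneg (wt_pos k).le _)
    exact Summable.mul_of_nonneg s1 s2 p1 p2
  have hsum : Summable fun x : ℤ × ℤ => g m x.1 * (h x.1 x.2 * u x.2) := by
    refine Summable.of_norm_bounded hdom ?_
    rintro ⟨l, k⟩
    have h3 := wt_pos k
    have h4 := wt_pos (m - l)
    have e0 : wt k ^ (-2 : ℤ) = wt k ^ (d + e) * wt k ^ (-(d + e) - 2) := by
      rw [← zpow_add₀ h3.ne']; congr 1; ring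
    have hC := hC m l k
    rw [pow_zero, div_one] at hC
    calc ‖g m l * (h l k * u k)‖ = ‖g m l * h l k‖ * ‖u k‖ := by
          rw [← mul_assoc, norm_mul]
      _ ≤ (C * wt k ^ (d + e) * (wt (m - l) ^ 2)⁻¹) * (D * wt k ^ (-(d + e) - 2)) :=
          mul_le_mul hC (hD k) (norm_nonneg _) (by positivity)
      _ = (wt (m - l) ^ 2)⁻¹ * (C * D * wt k ^ (-2 : ℤ)) := by rw [e0]; ring
  calc matApply g (matApply h u) m = ∑' l, ∑' k, g m l * (h l k * u k) :=
        tsum_congr fun l => tsum_mul_left.symm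
    _ = ∑' k, ∑' l, g m l * (h l k * u k) := 
        (Summable.tsum_comm (f := fun l k => g m l * (h l k * u k)) hsum).symm
    _ = ∑' k, (∑' l, g m l * h l k) * u k := tsum_congr fun k => by
        rw [← tsum_mul_right]
        exact tsum_congr fun l => by ring

lemma IsOrd.mul {d e : ℤ} {A B : Module.End ℂ RD} (hA : IsOrd d A) (hB : IsOrd e B) :
    IsOrd (d + e) (A * B) := by
  obtain ⟨g, hg, hA⟩ := hA
  obtain ⟨h, hh, hB⟩ := hB
  refine ⟨_, hg.comp hh, fun u => ?_⟩
  rw [Module.End.mul_apply, hA, hB, hg.matApply_comp hh u.2]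

/-! ### Multipliers and convolutions -/

/-- The diagonal matrix with entries `σ`. -/
def diagMat (σ : ℤ → ℂ) : ℤ → ℤ → ℂ := fun m k => if m = k then σ k else 0

lemma ordMat_diagMat {σ : ℤ → ℂ} {d : ℤ} {C : ℝ} (hσ : ∀ k, ‖σ k‖ ≤ C * wt k ^ d) :
    OrdMat d (diagMat σ) := by
  have hC0 : 0 ≤ C := by simpa [wt] using (norm_nonneg _).trans (hσ 0)
  refine fun N => ⟨C, hC0, fun m k => ?_⟩
  unfold diagMat
  split_ifs with h
  · subst h; simpa [wt] using hσ m
  · simp only [norm_zero]; positivity [wt_pos k, wt_pos (m - k)]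

lemma matApply_diagMat (σ u : ℤ → ℂ) : matApply (diagMat σ) u = fun m => σ m * u m := by
  ext m
  unfold matApply diagMat
  rw [tsum_eq_single m (fun k hk => by simp [Ne.symm hk])]
  simp

/-- The multiplier `u ↦ (σ(m) u(m))`. -/
def multEnd {σ : ℤ → ℂ} {d : ℤ} {C : ℝ} (hσ : ∀ k, ‖σ k‖ ≤ C * wt k ^ d) : Module.End ℂ RD :=
  (ordMat_diagMat hσ).toEnd

lemma multEnd_apply {σ : ℤ → ℂ} {d : ℤ} {C : ℝ} (hσ : ∀ k, ‖σ k‖ ≤ C * wt k ^ d) (u : RD) (m : ℤ) :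
    (multEnd hσ u : ℤ → ℂ) m = σ m * (u : ℤ → ℂ) m :=
  congrFun (matApply_diagMat σ u) m

lemma isOrd_multEnd {σ : ℤ → ℂ} {d : ℤ} {C : ℝ} (hσ : ∀ k, ‖σ k‖ ≤ C * wt k ^ d) :
    IsOrd d (multEnd hσ) := (ordMat_diagMat hσ).isOrd

lemma ordMat_conv {a : ℤ → ℂ} (ha : RapidDecay a) : OrdMat 0 (fun m k => a (m - k)) := by
  intro N
  obtain ⟨C, hC0, hC⟩ := ha.zpow (-N)
  refine ⟨C, hC0, fun m k => (hC _).trans_eq ?_⟩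
  simp [div_eq_mul_inv]

/-- Convolution with a rapidly decaying sequence. -/
def convEnd {a : ℤ → ℂ} (ha : RapidDecay a) : Module.End ℂ RD := (ordMat_conv ha).toEnd

lemma isOrd_convEnd {a : ℤ → ℂ} (ha : RapidDecay a) : IsOrd 0 (convEnd ha) := (ordMat_conv ha).isOrd

/-- The commutator of a multiplier with Lipschitz symbol and a convolution has order `0`. -/
lemma isOrd_commutator {σ : ℤ → ℂ} {d : ℤ} {C : ℝ} (hσ : ∀ k, ‖σ k‖ ≤ C * wt k ^ d) {B : ℝ}
    (hB : ∀ m k, ‖σ m - σ k‖ ≤ B * wt (m - k)) {a : ℤ → ℂ} (ha : RapidDecay a) :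
    IsOrd 0 (multEnd hσ * convEnd ha - convEnd ha * multEnd hσ) := by
  -- The commutator has entries `(σ m - σ k) a (m - k)`; the Lipschitz bound costs one power of `wt
  -- (m - k)`, which is why `a` is used with decay `N + 1`.
  refine ⟨fun m k => (σ m - σ k) * a (m - k), fun N => ?_, fun u => ?_⟩
  · obtain ⟨D, hD0, hD⟩ := ha.zpow (-N - 1)
    have hB0 : 0 ≤ B := by simpa [wt] using (norm_nonneg _).trans (hB 0 0)
    refine ⟨B * D, by positivity, fun m k => ?_⟩
    have h := wt_pos (m - k)
    calc ‖(σ m - σ k) * a (m - k)‖ ≤ (B * wt (m - k)) * (D * wt (m - k) ^ (-(N : ℤ) - 1)) := by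
          rw [norm_mul]; exact mul_le_mul (hB m k) (hD _) (norm_nonneg _) (by positivity)
      _ = _ := by
          rw [zpow_sub₀ h.ne', zpow_neg]; simp; field_simp
  · ext m
    have h1 := ((ordMat_conv ha).summable u.2 m).mul_left (σ m)
    have h2 : Summable fun k => a (m - k) * (σ k * (u : ℤ → ℂ) k) := by
      have := (ordMat_conv ha).summable (multEnd hσ u).2 m
      simpa only [multEnd_apply] using this
    have e1 : ((multEnd hσ * convEnd ha) u : ℤ → ℂ) m =
        ∑' k, σ m * (a (m - k) * (u : ℤ → ℂ) k) := by
      rw [Module.End.mul_apply, multEnd_apply, tsum_mul_left]; rfl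
    have e2 : ((convEnd ha * multEnd hσ) u : ℤ → ℂ) m =
        ∑' k, a (m - k) * (σ k * (u : ℤ → ℂ) k) := by
      rw [Module.End.mul_apply]
      exact tsum_congr fun k => by rw [multEnd_apply]
    rw [LinearMap.sub_apply, Submodule.coe_sub, Pi.sub_apply, e1, e2, ← h1.tsum_sub h2]
    exact tsum_congr fun k => by ring

/-! ### Fourier series of smooth periodic functions -/

/-- The exponential `e^{ikt}`. -/
def expo (k : ℤ) (t : ℝ) : ℂ := Complex.exp (Complex.I * k * t)

lemma expo_eq (k : ℤ) (t : ℝ) : expo k t = Complex.exp (((k * t : ℝ) : ℂ) * Complex.I) := by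
  unfold expo; congr 1; push_cast; ring

lemma norm_expo (k : ℤ) (t : ℝ) : ‖expo k t‖ = 1 := by
  rw [expo_eq, Complex.norm_exp_ofReal_mul_I]

lemma expo_ne_zero (k : ℤ) (t : ℝ) : expo k t ≠ 0 := Complex.exp_ne_zero _

lemma expo_zero (t : ℝ) : expo 0 t = 1 := by simp [expo]

lemma expo_add (k l : ℤ) (t : ℝ) : expo (k + l) t = expo k t * expo l t := by
  unfold expo; rw [← Complex.exp_add]; congr 1; push_cast; ring

lemma expo_neg (k : ℤ) (t : ℝ) : expo (-k) t = (expo k t)⁻¹ := by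
  unfold expo; rw [← Complex.exp_neg]; congr 1; push_cast; ring

lemma expo_sub (k l : ℤ) (t : ℝ) : expo (k - l) t = expo k t * expo (-l) t := by
  rw [sub_eq_add_neg, expo_add]

lemma expo_add_arg (k : ℤ) (s t : ℝ) : expo k (s + t) = expo k s * expo k t := by
  unfold expo; rw [← Complex.exp_add]; congr 1; push_cast; ring

lemma expo_neg_arg (k : ℤ) (t : ℝ) : expo k (-t) = expo (-k) t := by
  unfold expo; congr 1; push_cast; ring

lemma expo_periodic (k : ℤ) : Function.Periodic (expo k) (2 * π) := by
  intro t
  unfold expo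
  have := Complex.exp_periodic.int_mul k (Complex.I * k * t)
  rw [← this]; congr 1; push_cast; ring

lemma hasDerivAt_expo (k : ℤ) (t : ℝ) : HasDerivAt (expo k) (Complex.I * k * expo k t) t := by
  unfold expo
  have h : HasDerivAt (fun t : ℝ => Complex.I * k * (t : ℂ)) (Complex.I * k) t := by
    simpa using (Complex.ofRealCLM.hasDerivAt (x := t)).const_mul (Complex.I * (k : ℂ))
  convert h.cexp using 1; ring

lemma contDiff_expo (k : ℤ) : ContDiff ℝ ∞ (expo k) :=
  (contDiff_const.mul Complex.ofRealCLM.contDiff).cexp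

lemma continuous_expo (k : ℤ) : Continuous (expo k) := (contDiff_expo k).continuous

lemma smoothPeriodic_expo (k : ℤ) : SmoothPeriodic (expo k) := ⟨contDiff_expo k, expo_periodic k⟩

lemma norm_iteratedFDeriv_cexp_mul_I (n : ℕ) (s : ℝ) :
    ‖iteratedFDeriv ℝ n (fun s : ℝ => Complex.exp ((s : ℂ) * Complex.I)) s‖ = 1 := by
  rw [norm_iteratedFDeriv_eq_norm_iteratedDeriv]
  have : ∀ n : ℕ, iteratedDeriv n (fun s : ℝ => Complex.exp ((s : ℂ) * Complex.I)) =
      fun s : ℝ => Complex.I ^ n * Complex.exp ((s : ℂ) * Complex.I) := by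
    intro n
    induction n with
    | zero => simp
    | succ n ih =>
      rw [iteratedDeriv_succ, ih]
      ext s
      have h : HasDerivAt (fun s : ℝ => (s : ℂ) * Complex.I) Complex.I s := by
        simpa using (Complex.ofRealCLM.hasDerivAt (x := s)).mul_const Complex.I
      rw [(h.cexp.const_mul (Complex.I ^ n)).deriv]; ring
  rw [this]
  simp [Complex.norm_exp_ofReal_mul_I]

/-- Series of exponentials of linear functionals are smooth when the coefficients decay fast
compared to the functionals. -/
lemma contDiff_tsum_cexp {ι E : Type*} [NormedAddCommGroup E] [NormedSpace ℝ E] (c : ι → ℂ)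
    (ℓ : ι → E →L[ℝ] ℝ) (h : ∀ n : ℕ, Summable fun i => ‖c i‖ * ‖ℓ i‖ ^ n) :
    ContDiff ℝ ∞ fun x => ∑' i, c i * Complex.exp ((ℓ i x : ℂ) * Complex.I) := by
  have hf : ContDiff ℝ ∞ (fun s : ℝ => Complex.exp ((s : ℂ) * Complex.I)) :=
    (Complex.ofRealCLM.contDiff.mul contDiff_const).cexp
  have hc : ∀ i, ContDiff ℝ ∞ (fun x => c i * Complex.exp ((ℓ i x : ℂ) * Complex.I)) := fun i =>
    contDiff_const.mul (hf.comp (ℓ i).contDiff)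
  refine contDiff_tsum hc (fun k _ => h k) ?_
  intro n i x _
  have e1 : (fun x => c i * Complex.exp ((ℓ i x : ℂ) * Complex.I)) =
      c i • ((fun s : ℝ => Complex.exp ((s : ℂ) * Complex.I)) ∘ ℓ i) := by
    ext x; simp
  rw [e1, iteratedFDeriv_const_smul_apply ((hf.comp (ℓ i).contDiff).of_le (mod_cast le_top)).contDiffAt,
    norm_smul, (ℓ i).iteratedFDeriv_comp_right (hf.of_le (mod_cast le_top)) x le_rfl]
  refine mul_le_mul_of_nonneg_left ?_ (norm_nonneg _)
  refine (ContinuousMultilinearMap.norm_compContinuousLinearMap_le _ _).trans ?_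
  rw [norm_iteratedFDeriv_cexp_mul_I]
  simp

/-! ### Synthesis and Fourier inversion -/

/-- The function with the given Fourier coefficients. -/
def synth (u : ℤ → ℂ) (t : ℝ) : ℂ := ∑' k, u k * expo k t

lemma RapidDecay.summable_mul_wt_pow {u : ℤ → ℂ} (hu : RapidDecay u) (n : ℕ) :
    Summable fun k => ‖u k‖ * wt k ^ n := by
  obtain ⟨C, hC0, hC⟩ := hu.zpow (-2 - n)
  refine Summable.of_nonneg_of_le (fun k => ?_) (fun k => ?_)
    ((summable_wt_zpow (r := -2) le_rfl).mul_left C)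
  · exact mul_nonneg (norm_nonneg _) (pow_nonneg (wt_pos k).le _)
  · have := wt_pos k
    calc ‖u k‖ * wt k ^ n ≤ C * wt k ^ (-2 - n : ℤ) * wt k ^ (n : ℤ) := by
          rw [zpow_natCast]; exact mul_le_mul_of_nonneg_right (hC k) (by positivity)
      _ = C * wt k ^ (-2 : ℤ) := by rw [mul_assoc, ← zpow_add₀ this.ne']; congr 2; ring

lemma RapidDecay.summable_expo {u : ℤ → ℂ} (hu : RapidDecay u) (t : ℝ) :
    Summable fun k => u k * expo k t := by
  refine Summable.of_norm ?_
  simpa [norm_expo] using hu.summable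

lemma RapidDecay.smoothPeriodic {u : ℤ → ℂ} (hu : RapidDecay u) : SmoothPeriodic (synth u) := by
  constructor
  · have := contDiff_tsum_cexp u (fun k => (k : ℝ) • ContinuousLinearMap.id ℝ ℝ) (fun n => by
      refine Summable.of_nonneg_of_le (fun k => by positivity) (fun k => ?_)
        (hu.summable_mul_wt_pow n)
      gcongr
      calc ‖(k : ℝ) • ContinuousLinearMap.id ℝ ℝ‖ ≤ ‖(k : ℝ)‖ * 1 := by
            rw [norm_smul]; gcongr; exact ContinuousLinearMap.norm_id_le
        _ ≤ wt k := by simp [wt])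
    convert this using 2 with t
    exact tsum_congr fun k => by simp [expo_eq]
  · intro t
    unfold synth
    exact tsum_congr fun k => by rw [expo_periodic]

lemma integral_expo (k : ℤ) : ∫ t in (0 : ℝ)..(2 * π), expo k t = if k = 0 then 2 * (π : ℂ) else 0 := by
  split_ifs with h
  · subst h; simp [expo]
  · have hk : Complex.I * (k : ℂ) ≠ 0 := by simp [h]
    have : ∀ t ∈ uIcc (0 : ℝ) (2 * π),
        HasDerivAt (fun t => (Complex.I * (k : ℂ))⁻¹ * expo k t) (expo k t) t := by
      intro t _
      have := (hasDerivAt_expo k t).const_mul (Complex.I * (k : ℂ))⁻¹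
      rwa [inv_mul_cancel_left₀ hk] at this
    rw [intervalIntegral.integral_eq_sub_of_hasDerivAt this
      ((continuous_expo k).intervalIntegrable _ _)]
    have := expo_periodic k 0
    rw [zero_add] at this
    rw [this, sub_self]

lemma fourierCoef_eq (u : ℝ → ℂ) (m : ℤ) :
    fourierCoef u m = 1 / (2 * (π : ℂ)) * ∫ t in (0 : ℝ)..(2 * π), u t * expo (-m) t := by
  unfold fourierCoef expo
  congr 2; ext t; congr 2; push_cast; ring

lemma two_pi_ne_zero' : (2 * (π : ℂ)) ≠ 0 := by simp [Real.pi_ne_zero]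

/-- Termwise integration by dominated convergence. The factor `ℓ` is only integrable, so that the
logarithmic kernel is admitted. -/
lemma integral_tsum_mul_expo {ι : Type*} [Countable ι] {c : ι → ℂ} (hc : Summable fun i => ‖c i‖)
    (f : ι → ℝ → ℂ) (hf : ∀ i, Continuous (f i)) (hf1 : ∀ i t, ‖f i t‖ ≤ 1)
    (ℓ : ℝ → ℂ) {a b : ℝ} (hℓ : IntervalIntegrable ℓ MeasureTheory.volume a b) :
    ∫ t in a..b, (∑' i, c i * f i t) * ℓ t = ∑' i, c i * ∫ t in a..b, f i t * ℓ t := by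
  have h := intervalIntegral.hasSum_integral_of_dominated_convergence (μ := MeasureTheory.volume)
    (a := a) (b := b)
    (F := fun i t => c i * f i t * ℓ t) (f := fun t => (∑' i, c i * f i t) * ℓ t)
    (fun i t => ‖c i‖ * ‖ℓ t‖) (fun i => ?_) (fun i => ?_) ?_ ?_ ?_
  · rw [← h.tsum_eq]
    refine tsum_congr fun i => ?_
    rw [← intervalIntegral.integral_const_mul]
    simp only [mul_assoc]
  · exact ((continuous_const.mul (hf i)).aestronglyMeasurable).mul hℓ.aestronglyMeasurable_restrict_uIoc
  · refine Filter.Eventually.of_forall fun t _ => ?_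
    rw [norm_mul, norm_mul]
    calc ‖c i‖ * ‖f i t‖ * ‖ℓ t‖ ≤ ‖c i‖ * 1 * ‖ℓ t‖ := by gcongr; exact hf1 i t
      _ = _ := by ring
  · exact Filter.Eventually.of_forall fun t _ => hc.mul_right _
  · simp_rw [tsum_mul_right]
    exact hℓ.norm.const_mul _
  · refine Filter.Eventually.of_forall fun t _ => ?_
    refine HasSum.mul_right _ ?_
    refine (Summable.of_norm_bounded hc fun i => ?_).hasSum
    rw [norm_mul]
    calc _ ≤ ‖c i‖ * 1 := by gcongr; exact hf1 i t
      _ = _ := by ring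

lemma fourierCoef_synth_of_summable {u : ℤ → ℂ} (hu : Summable fun k => ‖u k‖) (m : ℤ) :
    fourierCoef (synth u) m = u m := by
  rw [fourierCoef_eq]
  unfold synth
  rw [integral_tsum_mul_expo hu expo continuous_expo (fun k t => (norm_expo k t).le) _
    ((continuous_expo (-m)).intervalIntegrable _ _), tsum_eq_single m]
  · simp only [← expo_add, integral_expo]
    simp only [add_neg_cancel, if_true]
    field_simp
  · intro k hk
    simp only [← expo_add, integral_expo]
    rw [if_neg (by omega), mul_zero]

lemma fourierCoef_synth {u : ℤ → ℂ} (hu : RapidDecay u) (m : ℤ) : fourierCoef (synth u) m = u m :=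
  fourierCoef_synth_of_summable hu.summable m

lemma synth_injective {u v : ℤ → ℂ} (hu : RapidDecay u) (hv : RapidDecay v)
    (h : synth u = synth v) : u = v := by
  ext m
  rw [← fourierCoef_synth hu, ← fourierCoef_synth hv, h]

/-- A continuous periodic function with summable Fourier coefficients is the sum of its Fourier
series. -/
lemma synth_fourierCoef_of_summable {φ : ℝ → ℂ} (hc : Continuous φ)
    (hp : Function.Periodic φ (2 * π)) (hs : Summable fun m => ‖fourierCoef φ m‖) :
    synth (fourierCoef φ) = φ := by
  have : Fact (0 < 2 * π) := ⟨by positivity⟩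
  let f : C(AddCircle (2 * π), ℂ) := ⟨hp.lift, by
    exact continuous_quot_lift _ hc⟩
  have hf : ∀ t : ℝ, f (t : AddCircle (2 * π)) = φ t := fun t => hp.lift_coe t
  have hfe : ∀ (n : ℤ) (t : ℝ), fourier n (t : AddCircle (2 * π)) = expo n t := by
    intro n t
    rw [fourier_coe_apply]
    unfold expo
    congr 1
    have := two_pi_ne_zero'
    push_cast
    field_simp
  have hcoef : ∀ m, fourierCoeff f m = fourierCoef φ m := by
    intro m
    rw [fourierCoeff_eq_intervalIntegral f m 0, fourierCoef_eq, zero_add]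
    simp only [hfe, hf, smul_eq_mul, mul_comm (expo _ _)]
    rw [Complex.real_smul]; push_cast; rfl
  have hs' : Summable (fourierCoeff f) := by
    refine Summable.of_norm ?_
    simpa only [hcoef] using hs
  ext t
  have := has_pointwise_sum_fourier_series_of_summable hs' (t : AddCircle (2 * π))
  simp only [hcoef, hfe, hf, smul_eq_mul] at this
  exact this.tsum_eq

lemma SmoothPeriodic.continuous {φ : ℝ → ℂ} (h : SmoothPeriodic φ) : Continuous φ := h.1.continuous

lemma SmoothPeriodic.differentiable {φ : ℝ → ℂ} (h : SmoothPeriodic φ) : Differentiable ℝ φ :=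
  h.1.differentiable (by simp)

lemma SmoothPeriodic.deriv {φ : ℝ → ℂ} (h : SmoothPeriodic φ) : SmoothPeriodic (deriv φ) := by
  refine ⟨(contDiff_infty_iff_deriv.mp h.1).2, fun t => ?_⟩
  have : φ = fun x => φ (x + 2 * π) := by ext x; exact (h.2 x).symm
  conv_rhs => rw [this]
  rw [deriv_comp_add_const]

lemma SmoothPeriodic.add {φ ψ : ℝ → ℂ} (h : SmoothPeriodic φ) (h' : SmoothPeriodic ψ) :
    SmoothPeriodic (φ + ψ) := ⟨h.1.add h'.1, h.2.add h'.2⟩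

lemma SmoothPeriodic.sub {φ ψ : ℝ → ℂ} (h : SmoothPeriodic φ) (h' : SmoothPeriodic ψ) :
    SmoothPeriodic (φ - ψ) := ⟨h.1.sub h'.1, h.2.sub h'.2⟩

lemma SmoothPeriodic.mul {φ ψ : ℝ → ℂ} (h : SmoothPeriodic φ) (h' : SmoothPeriodic ψ) :
    SmoothPeriodic (φ * ψ) := ⟨h.1.mul h'.1, h.2.mul h'.2⟩

lemma fourierCoef_deriv {φ : ℝ → ℂ} (h : SmoothPeriodic φ) (m : ℤ) :
    fourierCoef (deriv φ) m = Complex.I * m * fourierCoef φ m := by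
  rw [fourierCoef_eq, fourierCoef_eq]
  have h1 := intervalIntegral.integral_deriv_mul_eq_sub (a := 0) (b := 2 * π)
    (u := φ) (v := expo (-m)) (u' := deriv φ) (v' := fun t => Complex.I * (-m : ℤ) * expo (-m) t)
    (fun t _ => (h.differentiable t).hasDerivAt) (fun t _ => hasDerivAt_expo _ t)
    (h.deriv.continuous.intervalIntegrable _ _)
    ((continuous_const.mul (continuous_expo _)).intervalIntegrable _ _)
  have e1 := h.2 0
  have e2 := expo_periodic (-m) 0
  rw [zero_add] at e1 e2
  have i1 : IntervalIntegrable (fun t => deriv φ t * expo (-m) t) MeasureTheory.volume 0 (2 * π) :=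
    (h.deriv.continuous.mul (continuous_expo _)).intervalIntegrable _ _
  have i2 : IntervalIntegrable (fun t => φ t * (Complex.I * (-m : ℤ) * expo (-m) t))
      MeasureTheory.volume 0 (2 * π) :=
    (h.continuous.mul (continuous_const.mul (continuous_expo _))).intervalIntegrable _ _
  rw [e1, e2, sub_self, intervalIntegral.integral_add i1 i2] at h1
  have h2 : ∫ t in (0 : ℝ)..(2 * π), φ t * (Complex.I * (-m : ℤ) * expo (-m) t) =
      -(Complex.I * m) * ∫ t in (0 : ℝ)..(2 * π), φ t * expo (-m) t := by
    rw [← intervalIntegral.integral_const_mul]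
    congr 1; ext t; push_cast; ring
  rw [h2] at h1
  linear_combination (1 / (2 * (π : ℂ))) * h1

lemma norm_fourierCoef_le {φ : ℝ → ℂ} {C : ℝ} (hC : ∀ t, ‖φ t‖ ≤ C) (m : ℤ) :
    ‖fourierCoef φ m‖ ≤ C := by
  rw [fourierCoef_eq, norm_mul]
  have h : ‖∫ t in (0 : ℝ)..(2 * π), φ t * expo (-m) t‖ ≤ C * |2 * π - 0| :=
    intervalIntegral.norm_integral_le_of_norm_le_const fun t _ => by
      rw [norm_mul, norm_expo, mul_one]; exact hC t
  have hp : (0 : ℝ) < 2 * π := by positivity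
  rw [sub_zero, abs_of_pos hp] at h
  calc _ ≤ ‖1 / (2 * (π : ℂ))‖ * (C * (2 * π)) := by gcongr
    _ = C := by
      rw [norm_div, norm_one, norm_mul, Complex.norm_real, Real.norm_of_nonneg pi_pos.le]
      simp only [Complex.norm_ofNat]
      field_simp

lemma exists_bound_of_periodic {φ : ℝ → ℂ} (hc : Continuous φ) (hp : Function.Periodic φ (2 * π)) :
    ∃ C : ℝ, ∀ t, ‖φ t‖ ≤ C := by
  obtain ⟨C, hC⟩ := (isCompact_Icc (a := (0 : ℝ)) (b := 2 * π)).exists_bound_of_continuousOn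
    hc.continuousOn
  refine ⟨C, fun t => ?_⟩
  obtain ⟨s, hs, e⟩ := hp.exists_mem_Ico₀ (by positivity) t
  rw [e]; exact hC s (Ico_subset_Icc_self hs)

lemma fourierCoef_sub {φ ψ : ℝ → ℂ} (h : Continuous φ) (h' : Continuous ψ) (m : ℤ) :
    fourierCoef (φ - ψ) m = fourierCoef φ m - fourierCoef ψ m := by
  simp only [fourierCoef_eq, Pi.sub_apply, sub_mul]
  have i1 : IntervalIntegrable (fun t => φ t * expo (-m) t) MeasureTheory.volume 0 (2 * π) :=
    (h.mul (continuous_expo _)).intervalIntegrable _ _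
  have i2 : IntervalIntegrable (fun t => ψ t * expo (-m) t) MeasureTheory.volume 0 (2 * π) :=
    (h'.mul (continuous_expo _)).intervalIntegrable _ _
  rw [intervalIntegral.integral_sub i1 i2, mul_sub]

lemma wt_le_two_mul (k : ℤ) : wt k ≤ 2 * (1 + (k : ℝ) ^ 2) := by
  unfold wt; nlinarith [sq_abs (k : ℝ), sq_nonneg (|(k : ℝ)| - 1), abs_nonneg (k : ℝ)]

lemma le_div_wt_pow {x C : ℝ} {N : ℕ} {k : ℤ} (h : (1 + (k : ℝ) ^ 2) ^ N * x ≤ C) (hx : 0 ≤ x) :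
    x ≤ 2 ^ N * C / wt k ^ N := by
  rw [le_div_iff₀ (pow_pos (wt_pos k) N)]
  calc x * wt k ^ N ≤ x * (2 * (1 + (k : ℝ) ^ 2)) ^ N := by
        gcongr
        · exact (wt_pos k).le
        · exact wt_le_two_mul k
    _ = 2 ^ N * ((1 + (k : ℝ) ^ 2) ^ N * x) := by rw [mul_pow]; ring
    _ ≤ 2 ^ N * C := by gcongr

lemma SmoothPeriodic.rapidDecay {φ : ℝ → ℂ} (h : SmoothPeriodic φ) : RapidDecay (fourierCoef φ) := by
  have key : ∀ N : ℕ, ∀ φ : ℝ → ℂ, SmoothPeriodic φ →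
      ∃ C : ℝ, ∀ m : ℤ, (1 + (m : ℝ) ^ 2) ^ N * ‖fourierCoef φ m‖ ≤ C := by
    intro N
    induction N with
    | zero =>
      intro φ h
      obtain ⟨C, hC⟩ := exists_bound_of_periodic h.continuous h.2
      exact ⟨C, fun m => by simpa using norm_fourierCoef_le hC m⟩
    | succ N ih =>
      intro φ h
      -- Integration by parts in the form of the operator `φ - φ''`, which multiplies the
      -- coefficients by `1 + m²`; no coefficient is lost at `m = 0`.
      obtain ⟨C, hC⟩ := ih _ (h.sub h.deriv.deriv)
      refine ⟨C, fun m => ?_⟩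
      convert hC m using 1
      rw [fourierCoef_sub h.continuous h.deriv.deriv.continuous, fourierCoef_deriv h.deriv,
        fourierCoef_deriv h]
      have : fourierCoef φ m - Complex.I * m * (Complex.I * m * fourierCoef φ m) =
          ((1 + (m : ℝ) ^ 2 : ℝ) : ℂ) * fourierCoef φ m := by
        push_cast
        linear_combination (-(m : ℂ) ^ 2 * fourierCoef φ m) * Complex.I_sq
      rw [this, norm_mul, Complex.norm_real, Real.norm_of_nonneg (by positivity)]
      ring
  intro N
  obtain ⟨C, hC⟩ := key N φ h
  exact ⟨2 ^ N * C, fun k => le_div_wt_pow (hC k) (norm_nonneg _)⟩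

lemma SmoothPeriodic.synth_eq {φ : ℝ → ℂ} (h : SmoothPeriodic φ) : synth (fourierCoef φ) = φ :=
  synth_fourierCoef_of_summable h.continuous h.2 h.rapidDecay.summable

lemma SmoothPeriodic.exists_synth {φ : ℝ → ℂ} (h : SmoothPeriodic φ) : ∃ u : RD, synth u = φ :=
  ⟨⟨_, h.rapidDecay⟩, h.synth_eq⟩

lemma synth_add (u v : RD) : synth (u + v : RD) = synth u + synth v := by
  ext t
  simp only [synth, Submodule.coe_add, Pi.add_apply, add_mul]
  exact (u.2.summable_expo t).tsum_add (v.2.summable_expo t)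

lemma synth_smul (c : ℂ) (u : RD) : synth (c • u : RD) = c • synth u := by
  ext t
  simp only [synth, Submodule.coe_smul, Pi.smul_apply, smul_eq_mul, ← tsum_mul_left, mul_assoc]

lemma synth_neg (u : RD) : synth (-u : RD) = -synth u := by
  have := synth_smul (-1) u
  simpa using this

lemma synth_sub (u v : RD) : synth (u - v : RD) = synth u - synth v := by
  rw [sub_eq_add_neg, synth_add, synth_neg, sub_eq_add_neg]

lemma synth_zero : synth (0 : RD) = 0 := by
  have := synth_smul 0 0
  simpa using this

lemma RD.synth_inj {u v : RD} : synth u = synth v ↔ u = v :=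
  ⟨fun h => Subtype.ext (synth_injective u.2 v.2 h), fun h => by rw [h]⟩

/-! ### Smooth biperiodic functions -/

/-- Smooth functions of two variables, `2π`-periodic in both. -/
structure BiSmooth (F : ℝ → ℝ → ℂ) : Prop where
  contDiff : ContDiff ℝ ∞ (fun x : ℝ × ℝ => F x.1 x.2)
  periodic_left : ∀ t ζ, F (t + 2 * π) ζ = F t ζ
  periodic_right : ∀ t ζ, F t (ζ + 2 * π) = F t ζ

namespace BiSmooth

variable {F G : ℝ → ℝ → ℂ}

lemma continuous (h : BiSmooth F) : Continuous (fun x : ℝ × ℝ => F x.1 x.2) := h.contDiff.continuous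

lemma left (h : BiSmooth F) (ζ : ℝ) : SmoothPeriodic (fun t => F t ζ) :=
  ⟨h.contDiff.comp (contDiff_id.prodMk contDiff_const), fun t => h.periodic_left t ζ⟩

lemma right (h : BiSmooth F) (t : ℝ) : SmoothPeriodic (F t) :=
  ⟨h.contDiff.comp (contDiff_const.prodMk contDiff_id), fun ζ => h.periodic_right t ζ⟩

lemma swap (h : BiSmooth F) : BiSmooth (fun t ζ => F ζ t) :=
  ⟨h.contDiff.comp (contDiff_snd.prodMk contDiff_fst), fun t ζ => h.periodic_right ζ t,
    fun t ζ => h.periodic_left ζ t⟩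

lemma add (hF : BiSmooth F) (hG : BiSmooth G) : BiSmooth (fun t ζ => F t ζ + G t ζ) :=
  ⟨hF.contDiff.add hG.contDiff, fun t ζ => by rw [hF.periodic_left, hG.periodic_left],
    fun t ζ => by rw [hF.periodic_right, hG.periodic_right]⟩

lemma sub (hF : BiSmooth F) (hG : BiSmooth G) : BiSmooth (fun t ζ => F t ζ - G t ζ) :=
  ⟨hF.contDiff.sub hG.contDiff, fun t ζ => by rw [hF.periodic_left, hG.periodic_left],
    fun t ζ => by rw [hF.periodic_right, hG.periodic_right]⟩

lemma mul (hF : BiSmooth F) (hG : BiSmooth G) : BiSmooth (fun t ζ => F t ζ * G t ζ) :=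
  ⟨hF.contDiff.mul hG.contDiff, fun t ζ => by rw [hF.periodic_left, hG.periodic_left],
    fun t ζ => by rw [hF.periodic_right, hG.periodic_right]⟩

lemma comp (hF : BiSmooth F) {g : ℂ → ℂ} (hg : ContDiff ℝ ∞ g) : BiSmooth (fun t ζ => g (F t ζ)) :=
  ⟨hg.comp hF.contDiff, fun t ζ => by rw [hF.periodic_left], fun t ζ => by rw [hF.periodic_right]⟩

lemma inv (hF : BiSmooth F) (h0 : ∀ t ζ, F t ζ ≠ 0) : BiSmooth (fun t ζ => (F t ζ)⁻¹) :=
  ⟨hF.contDiff.inv fun x => h0 x.1 x.2, fun t ζ => by rw [hF.periodic_left],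
    fun t ζ => by rw [hF.periodic_right]⟩

lemma const (c : ℂ) : BiSmooth (fun _ _ => c) := ⟨contDiff_const, fun _ _ => rfl, fun _ _ => rfl⟩

lemma neg (hF : BiSmooth F) : BiSmooth (fun t ζ => -F t ζ) :=
  ⟨hF.contDiff.neg, fun t ζ => by rw [hF.periodic_left], fun t ζ => by rw [hF.periodic_right]⟩

lemma ofLeft {φ : ℝ → ℂ} (h : SmoothPeriodic φ) : BiSmooth (fun t _ => φ t) :=
  ⟨h.1.comp contDiff_fst, fun t _ => h.2 t, fun _ _ => rfl⟩

lemma ofRight {φ : ℝ → ℂ} (h : SmoothPeriodic φ) : BiSmooth (fun _ ζ => φ ζ) :=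
  ⟨h.1.comp contDiff_snd, fun _ _ => rfl, fun _ ζ => h.2 ζ⟩

lemma exists_bound (h : BiSmooth F) : ∃ C : ℝ, ∀ t ζ, ‖F t ζ‖ ≤ C := by
  obtain ⟨C, hC⟩ := ((isCompact_Icc (a := (0 : ℝ)) (b := 2 * π)).prod
    (isCompact_Icc (a := (0 : ℝ)) (b := 2 * π))).exists_bound_of_continuousOn
    h.continuous.continuousOn
  refine ⟨C, fun t ζ => ?_⟩
  have hp : (0 : ℝ) < 2 * π := by positivity
  obtain ⟨s, hs, e⟩ := Function.Periodic.exists_mem_Ico₀ (f := fun t => F t ζ)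
    (fun t => h.periodic_left t ζ) hp t
  obtain ⟨s', hs', e'⟩ := Function.Periodic.exists_mem_Ico₀ (f := F s)
    (fun ζ => h.periodic_right s ζ) hp ζ
  have e : F t ζ = F s ζ := e
  rw [e, e']
  exact hC (s, s') ⟨Ico_subset_Icc_self hs, Ico_subset_Icc_self hs'⟩

/-- The derivative in the second variable is smooth and biperiodic. -/
lemma derivRight (h : BiSmooth F) : BiSmooth (fun t ζ => deriv (F t) ζ) := by
  refine ⟨?_, fun t ζ => ?_, fun t ζ => (h.right t).deriv.2 ζ⟩
  · have h1 : (fun x : ℝ × ℝ => deriv (F x.1) x.2) =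
        fun x => fderiv ℝ (fun x : ℝ × ℝ => F x.1 x.2) x (0, 1) := by
      ext x
      have h2 : HasDerivAt (fun s : ℝ => ((x.1, s) : ℝ × ℝ)) (0, 1) x.2 :=
        (hasDerivAt_const x.2 x.1).prodMk (hasDerivAt_id x.2)
      have h3 : HasFDerivAt (fun x : ℝ × ℝ => F x.1 x.2) _ ((x.1, x.2) : ℝ × ℝ) :=
        (h.contDiff.differentiable (by simp) x).hasFDerivAt
      exact (h3.comp_hasDerivAt x.2 h2).deriv
    rw [h1]
    exact (h.contDiff.fderiv_right (m := ∞) (by simp)).clm_apply contDiff_const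
  · have : F (t + 2 * π) = F t := by ext s; exact h.periodic_left t s
    rw [this]

end BiSmooth

/-! ### Double Fourier series of biperiodic functions -/

/-- The double Fourier coefficients. -/
def biCoef (F : ℝ → ℝ → ℂ) (a b : ℤ) : ℂ := fourierCoef (fun t => fourierCoef (F t) b) a

lemma BiSmooth.continuous_coef {F : ℝ → ℝ → ℂ} (h : BiSmooth F) (b : ℤ) :
    Continuous (fun t => fourierCoef (F t) b) := by
  simp only [fourierCoef_eq]
  refine continuous_const.mul ?_
  refine intervalIntegral.continuous_parametric_intervalIntegral_of_continuous' ?_ _ _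
  exact h.continuous.mul ((continuous_expo _).comp continuous_snd)

lemma BiSmooth.periodic_coef {F : ℝ → ℝ → ℂ} (h : BiSmooth F) (b : ℤ) :
    Function.Periodic (fun t => fourierCoef (F t) b) (2 * π) := by
  intro t
  have : F (t + 2 * π) = F t := by ext s; exact h.periodic_left t s
  simp only [this]

lemma BiSmooth.biCoef_swap {F : ℝ → ℝ → ℂ} (h : BiSmooth F) (a b : ℤ) :
    biCoef (fun t ζ => F ζ t) a b = biCoef F b a := by
  unfold biCoef
  simp only [fourierCoef_eq]
  have hc : Continuous (fun x : ℝ × ℝ => F x.1 x.2 * expo (-a) x.2 * expo (-b) x.1) :=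
    (h.continuous.mul ((continuous_expo _).comp continuous_snd)).mul
      ((continuous_expo _).comp continuous_fst)
  have hs := MeasureTheory.intervalIntegral_intervalIntegral_swap (a := 0) (b := 2 * π) (c := 0) (d := 2 * π)
    (F := fun x y => F x y * expo (-a) y * expo (-b) x) ?_
  · simp only [mul_assoc, intervalIntegral.integral_const_mul] at hs ⊢
    congr 2
    simp only [← intervalIntegral.integral_mul_const, mul_assoc] at hs ⊢
    rw [hs]
    congr 1; ext y; congr 1; ext x; ring
  · refine ((hc.continuousOn (s := Icc 0 (2 * π) ×ˢ Icc 0 (2 * π))).integrableOn_compact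
      (isCompact_Icc.prod isCompact_Icc)).mono_set ?_
    rw [uIoc_of_le (by positivity)]
    exact prod_mono Ioc_subset_Icc_self Ioc_subset_Icc_self

lemma BiSmooth.biCoef_derivRight {F : ℝ → ℝ → ℂ} (h : BiSmooth F) (a b : ℤ) :
    biCoef (fun t ζ => deriv (F t) ζ) a b = Complex.I * b * biCoef F a b := by
  unfold biCoef
  have : ∀ t, fourierCoef (fun ζ => deriv (F t) ζ) b = Complex.I * b * fourierCoef (F t) b :=
    fun t => fourierCoef_deriv (h.right t) b
  simp only [this]
  simp only [fourierCoef_eq _ a, mul_assoc, intervalIntegral.integral_const_mul]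
  ring

lemma BiSmooth.biCoef_sub {F G : ℝ → ℝ → ℂ} (hF : BiSmooth F) (hG : BiSmooth G) (a b : ℤ) :
    biCoef (fun t ζ => F t ζ - G t ζ) a b = biCoef F a b - biCoef G a b := by
  unfold biCoef
  have : (fun t => fourierCoef (fun ζ => F t ζ - G t ζ) b) =
      (fun t => fourierCoef (F t) b) - (fun t => fourierCoef (G t) b) := by
    ext t
    exact fourierCoef_sub (hF.right t).continuous (hG.right t).continuous b
  rw [this, fourierCoef_sub (hF.continuous_coef b) (hG.continuous_coef b)]

lemma BiSmooth.biCoef_laplaceRight {F : ℝ → ℝ → ℂ} (h : BiSmooth F) (a b : ℤ) :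
    ‖biCoef (fun t ζ => F t ζ - deriv (fun s => deriv (F t) s) ζ) a b‖ =
      (1 + (b : ℝ) ^ 2) * ‖biCoef F a b‖ := by
  rw [h.biCoef_sub h.derivRight.derivRight, h.derivRight.biCoef_derivRight, h.biCoef_derivRight]
  have : biCoef F a b - Complex.I * b * (Complex.I * b * biCoef F a b) =
      ((1 + (b : ℝ) ^ 2 : ℝ) : ℂ) * biCoef F a b := by
    push_cast
    linear_combination (-(b : ℂ) ^ 2 * biCoef F a b) * Complex.I_sq
  rw [this, norm_mul, Complex.norm_real, Real.norm_of_nonneg (by positivity)]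

lemma BiSmooth.exists_biCoef_bound_right {F : ℝ → ℝ → ℂ} (h : BiSmooth F) (N : ℕ) :
    ∃ G : ℝ → ℝ → ℂ, BiSmooth G ∧
      ∀ a b : ℤ, ‖biCoef G a b‖ = (1 + (b : ℝ) ^ 2) ^ N * ‖biCoef F a b‖ := by
  induction N with
  | zero => exact ⟨F, h, by simp⟩
  | succ N ih =>
    obtain ⟨G, hG, e⟩ := ih
    refine ⟨_, hG.sub hG.derivRight.derivRight, fun a b => ?_⟩
    rw [hG.biCoef_laplaceRight, e]; ring

/-- Apply `(1 - ∂²)^N` in the second variable, swap the variables and apply it again; the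
coefficients of the resulting continuous function are bounded. -/
lemma BiSmooth.exists_biCoef_bound {F : ℝ → ℝ → ℂ} (h : BiSmooth F) (N : ℕ) :
    ∃ C : ℝ, 0 ≤ C ∧ ∀ a b : ℤ, ‖biCoef F a b‖ ≤ C / (wt a ^ N * wt b ^ N) := by
  obtain ⟨G, hG, e⟩ := h.exists_biCoef_bound_right N
  obtain ⟨K, hK, e'⟩ := hG.swap.exists_biCoef_bound_right N
  obtain ⟨C, hC⟩ := hK.exists_bound
  have hb : ∀ a b : ℤ, (1 + (a : ℝ) ^ 2) ^ N * ((1 + (b : ℝ) ^ 2) ^ N * ‖biCoef F a b‖) ≤ C := by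
    intro a b
    rw [← e, ← hG.biCoef_swap, ← e']
    exact norm_fourierCoef_le (fun t => norm_fourierCoef_le (hC t) _) _
  have hC0 : 0 ≤ C := (norm_nonneg _).trans (hC 0 0)
  refine ⟨2 ^ N * (2 ^ N * C), by positivity, fun a b => ?_⟩
  have h1 := le_div_wt_pow (hb a b) (by positivity)
  have h2 := le_div_wt_pow h1 (norm_nonneg _)
  calc _ ≤ _ := h2
    _ = _ := by field_simp

/-- Rapid decay in two indices. -/
def RapidDecay₂ (c : ℤ → ℤ → ℂ) : Prop :=
  ∀ N : ℕ, ∃ C : ℝ, 0 ≤ C ∧ ∀ a b : ℤ, ‖c a b‖ ≤ C / (wt a ^ N * wt b ^ N)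

lemma RapidDecay₂.summable {c : ℤ → ℤ → ℂ} (h : RapidDecay₂ c) (n : ℕ) :
    Summable fun x : ℤ × ℤ => ‖c x.1 x.2‖ * (wt x.1 * wt x.2) ^ n := by
  obtain ⟨C, hC0, hC⟩ := h (n + 2)
  have hs : Summable fun x : ℤ × ℤ => C * ((wt x.1 ^ 2)⁻¹ * (wt x.2 ^ 2)⁻¹) :=
    (Summable.mul_of_nonneg summable_inv_wt_sq summable_inv_wt_sq
      (fun x => inv_nonneg.mpr (sq_nonneg _)) (fun x => inv_nonneg.mpr (sq_nonneg _))).mul_left C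
  refine Summable.of_nonneg_of_le (fun x => ?_) (fun x => ?_) hs
  · have := wt_pos x.1
    have := wt_pos x.2
    positivity
  · obtain ⟨a, b⟩ := x
    have h1 := wt_pos a
    have h2 := wt_pos b
    calc ‖c a b‖ * (wt a * wt b) ^ n ≤ C / (wt a ^ (n + 2) * wt b ^ (n + 2)) * (wt a * wt b) ^ n := by
          gcongr; exact hC a b
      _ = _ := by simp only [mul_pow, pow_add]; field_simp

lemma RapidDecay₂.summable_norm {c : ℤ → ℤ → ℂ} (h : RapidDecay₂ c) :
    Summable fun x : ℤ × ℤ => ‖c x.1 x.2‖ := by simpa using h.summable 0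

lemma BiSmooth.rapidDecay {F : ℝ → ℝ → ℂ} (h : BiSmooth F) : RapidDecay₂ (biCoef F) :=
  fun N => h.exists_biCoef_bound N

/-- One-dimensional inversion used twice. The partial coefficients need only be continuous in `t`,
since the summability of their own coefficients is read off from the decay of `biCoef`. -/
lemma BiSmooth.tsum_biCoef {F : ℝ → ℝ → ℂ} (h : BiSmooth F) (t ζ : ℝ) :
    F t ζ = ∑' x : ℤ × ℤ, biCoef F x.1 x.2 * (expo x.1 t * expo x.2 ζ) := by
  have hn := h.rapidDecay.summable_norm
  have hs : Summable fun x : ℤ × ℤ => biCoef F x.1 x.2 * (expo x.1 t * expo x.2 ζ) := by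
    refine Summable.of_norm ?_
    simpa [norm_expo] using hn
  have h1 : ∀ b : ℤ, fourierCoef (F t) b = ∑' a, biCoef F a b * expo a t := by
    intro b
    have := synth_fourierCoef_of_summable (h.continuous_coef b) (h.periodic_coef b)
      ((hn.prod_symm.prod_factor b))
    exact (congrFun this t).symm
  calc F t ζ = synth (fourierCoef (F t)) ζ := by rw [(h.right t).synth_eq]
    _ = ∑' b, ∑' a, biCoef F a b * (expo a t * expo b ζ) := by
        refine tsum_congr fun b => ?_
        rw [h1, ← tsum_mul_right]
        exact tsum_congr fun a => by ring
    _ = ∑' a, ∑' b, biCoef F a b * (expo a t * expo b ζ) :=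
        Summable.tsum_comm (f := fun a b => biCoef F a b * (expo a t * expo b ζ)) hs
    _ = _ := (hs.tsum_prod).symm

/-! ### Integral operators with weakly singular kernels -/

/-- The operator `a` on functions is represented by `A` on Fourier coefficients. -/
def Rep (a : Op) (A : Module.End ℂ RD) : Prop := ∀ u : RD, a (synth u) = synth (A u)

lemma integral_expo_mul_comp_sub {ℓ : ℝ → ℂ} (hp : Function.Periodic ℓ (2 * π)) (b : ℤ) (t : ℝ) :
    ∫ ζ in (0 : ℝ)..(2 * π), expo b ζ * ℓ (t - ζ) =
      expo b t * ∫ s in (0 : ℝ)..(2 * π), ℓ s * expo (-b) s := by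
  have hper : Function.Periodic (fun s => ℓ s * expo (-b) s) (2 * π) :=
    fun s => by simp only [hp s, expo_periodic (-b) s]
  have h1 := intervalIntegral.integral_comp_sub_left (a := 0) (b := 2 * π)
    (fun s => expo b t * (ℓ s * expo (-b) s)) t
  have h2 := hper.intervalIntegral_add_eq (t - 2 * π) 0
  rw [sub_add_cancel, zero_add] at h2
  rw [sub_zero, intervalIntegral.integral_const_mul, intervalIntegral.integral_const_mul, h2,
    ← intervalIntegral.integral_const_mul] at h1
  rw [← h1]
  congr 1; ext ζ
  rw [← expo_neg_arg, show -(t - ζ) = ζ + -t by ring, expo_add_arg, expo_neg_arg, expo_neg]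
  field_simp [expo_ne_zero]

/-- The weight bookkeeping of `OrdMat.comp_bound`, for a diagonal factor of order `d` placed between
two rapidly decaying convolutions. -/
lemma wt_comp_bound (d : ℤ) (N : ℕ) (m l k : ℤ) :
    wt l ^ d / (wt (m - l) ^ (N + 2) * wt (l - k) ^ (N + d.natAbs)) ≤
      wt k ^ d / wt (m - k) ^ N * (wt (m - l) ^ 2)⁻¹ := by
  have h5 : wt (m - k) ^ N ≤ wt (l - k) ^ N * wt (m - l) ^ N := by
    have := wt_pow_le_mul_sub (m - k) (l - k) N
    simpa using this
  have h6 := wt_zpow_le d k l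
  rw [wt_sub_comm k l] at h6
  have h1 := wt_pos (m - l)
  have h2 := wt_pos (l - k)
  have h4 := wt_pos (m - k)
  have e1 := zpow_pos (wt_pos k) d
  have e3 := zpow_pos (wt_pos l) d
  generalize wt (m - l) = x at *
  generalize wt (l - k) = y at *
  generalize wt (m - k) = z at *
  generalize wt k ^ d = p at *
  generalize wt l ^ d = r at *
  calc r / (x ^ (N + 2) * y ^ (N + d.natAbs)) ≤
        p * y ^ d.natAbs / (x ^ (N + 2) * y ^ (N + d.natAbs)) := by gcongr
    _ = p / (y ^ N * x ^ N) * (x ^ 2)⁻¹ := by rw [pow_add, pow_add]; field_simp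
    _ ≤ p / z ^ N * (x ^ 2)⁻¹ := by gcongr

/-- The integral operator with kernel `F(t,ζ) ℓ(t - ζ)`, where `F` is smooth and the Fourier
coefficients of `ℓ` are `O(|k|^d)`, has order `d`. -/
theorem BiSmooth.exists_rep_kernelOp {F : ℝ → ℝ → ℂ} (hF : BiSmooth F) {ℓ : ℝ → ℂ}
    (hp : Function.Periodic ℓ (2 * π))
    (hi : IntervalIntegrable ℓ MeasureTheory.volume 0 (2 * π)) {d : ℤ} {C : ℝ}
    (hC : ∀ k : ℤ, ‖∫ s in (0 : ℝ)..(2 * π), ℓ s * expo (-k) s‖ ≤ C * wt k ^ d) :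
    ∃ A, IsOrd d A ∧ Rep (kernelOp fun t ζ => F t ζ * ℓ (t - ζ)) A := by
  set lam : ℤ → ℂ := fun k => ∫ s in (0 : ℝ)..(2 * π), ℓ s * expo (-k) s with hlam
  set c := biCoef F with hc
  have hC0 : 0 ≤ C := by simpa [wt] using (norm_nonneg _).trans (hC 0)
  have key : ∀ N : ℕ, ∃ D : ℝ, 0 ≤ D ∧ ∀ m b k : ℤ, ‖c (m - b) (b - k) * lam b‖ ≤
      D * wt k ^ d / wt (m - k) ^ N * (wt (m - b) ^ 2)⁻¹ := by
    intro N
    obtain ⟨B, hB0, hB⟩ := hF.rapidDecay (N + 2 + d.natAbs)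
    refine ⟨B * C, by positivity, fun m b k => ?_⟩
    have h1 := one_le_wt (m - b)
    have h2 := one_le_wt (b - k)
    have h3 := wt_pos b
    have h1' := wt_pos (m - b)
    have h2' := wt_pos (b - k)
    calc ‖c (m - b) (b - k) * lam b‖ ≤
        B / (wt (m - b) ^ (N + 2 + d.natAbs) * wt (b - k) ^ (N + 2 + d.natAbs)) *
          (C * wt b ^ d) := by
          rw [norm_mul]; exact mul_le_mul (hB _ _) (hC b) (norm_nonneg _) (by positivity)
      _ ≤ B / (wt (m - b) ^ (N + 2) * wt (b - k) ^ (N + d.natAbs)) * (C * wt b ^ d) := by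
          have p1 := pow_le_pow_right₀ h1 (show N + 2 ≤ N + 2 + d.natAbs by omega)
          have p2 := pow_le_pow_right₀ h2 (show N + d.natAbs ≤ N + 2 + d.natAbs by omega)
          have p3 := zpow_pos h3 d
          gcongr
      _ = B * C * (wt b ^ d / (wt (m - b) ^ (N + 2) * wt (b - k) ^ (N + d.natAbs))) := by ring
      _ ≤ B * C * (wt k ^ d / wt (m - k) ^ N * (wt (m - b) ^ 2)⁻¹) :=
          mul_le_mul_of_nonneg_left (wt_comp_bound d N m b k) (by positivity)
      _ = _ := by ring
  -- Expanding `F` in a double series, the term `e^{iat} e^{ibζ}` sends `e^{ikζ}` to `lam (b+k)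
  -- e^{i(a+b+k)t}`. With `m = a + b + k`, and `b + k` renamed `b`, this is the matrix entry below.
  have hg : OrdMat d (fun m k => ∑' b, c (m - b) (b - k) * lam b) := by
    intro N
    obtain ⟨D, hD0, hD⟩ := key N
    refine ⟨D * wtSum, mul_nonneg hD0 wtSum_nonneg, fun m k => ?_⟩
    have hs := (summable_inv_wt_sub_sq m).mul_left (D * wt k ^ d / wt (m - k) ^ N)
    have hn : Summable fun b => ‖c (m - b) (b - k) * lam b‖ :=
      Summable.of_nonneg_of_le (fun l => norm_nonneg _) (fun l => hD m l k) hs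
    calc _ ≤ ∑' b, ‖c (m - b) (b - k) * lam b‖ := norm_tsum_le_tsum_norm hn
      _ ≤ _ := hn.tsum_le_tsum (fun l => hD m l k) hs
      _ = _ := by rw [tsum_mul_left, tsum_inv_wt_sub_sq]; ring
  refine ⟨hg.toEnd, hg.isOrd, fun u => ?_⟩
  ext t
  obtain ⟨M, hM⟩ : ∃ M : ℝ, ∀ k, ‖lam k‖ ≤ M := by
    refine ⟨∫ s in (0 : ℝ)..(2 * π), ‖ℓ s‖, fun k => ?_⟩
    refine (intervalIntegral.norm_integral_le_integral_norm (by positivity)).trans_eq ?_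
    simp [norm_expo]
  have hn : Summable fun i : (ℤ × ℤ) × ℤ => ‖c i.1.1 i.1.2 * (u : ℤ → ℂ) i.2 * expo i.1.1 t‖ := by
    have := Summable.mul_of_nonneg hF.rapidDecay.summable_norm u.2.summable
      (fun _ => norm_nonneg _) (fun _ => norm_nonneg _)
    simpa [norm_mul, norm_expo] using this
  have hper : Function.Periodic (fun ζ => ℓ (t - ζ)) (2 * π) := fun ζ => by
    have := hp (t - ζ - 2 * π)
    simp only [sub_add_cancel] at this
    change ℓ (t - (ζ + 2 * π)) = ℓ (t - ζ)
    rw [this]; congr 1; ring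
  have hit : IntervalIntegrable (fun ζ => ℓ (t - ζ)) MeasureTheory.volume 0 (2 * π) := by
    have h0 := hp.intervalIntegrable₀ (by positivity) hi (t - 0) (t - 2 * π)
    have := h0.comp_sub_left t
    simpa using this
  have hexp : ∀ ζ, F t ζ * synth u ζ =
      ∑' i : (ℤ × ℤ) × ℤ, (c i.1.1 i.1.2 * (u : ℤ → ℂ) i.2 * expo i.1.1 t) *
        expo (i.1.2 + i.2) ζ := by
    intro ζ
    rw [hF.tsum_biCoef t ζ]
    unfold synth
    rw [tsum_mul_tsum_of_summable_norm]
    · exact tsum_congr fun i => by rw [expo_add]; ring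
    · simpa [norm_expo] using hF.rapidDecay.summable_norm
    · simpa [norm_expo] using u.2.summable
  have hL : kernelOp (fun t ζ => F t ζ * ℓ (t - ζ)) (synth u) t =
      ∑' i : (ℤ × ℤ) × ℤ, c i.1.1 i.1.2 * lam (i.1.2 + i.2) * (u : ℤ → ℂ) i.2 *
        expo (i.1.1 + (i.1.2 + i.2)) t := by
    calc _ = ∫ ζ in (0 : ℝ)..(2 * π), (∑' i : (ℤ × ℤ) × ℤ,
          (c i.1.1 i.1.2 * (u : ℤ → ℂ) i.2 * expo i.1.1 t) * expo (i.1.2 + i.2) ζ) * ℓ (t - ζ) := by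
            unfold kernelOp
            congr 1; ext ζ
            rw [← hexp]; ring
      _ = _ := by
          rw [integral_tsum_mul_expo hn _ (fun i => continuous_expo _)
            (fun i s => (norm_expo _ s).le) _ hit]
          refine tsum_congr fun i => ?_
          rw [integral_expo_mul_comp_sub hp, expo_add i.1.1]
          ring
  -- The change of summation indices from frequencies of `F` and `u` to output frequency, input
  -- frequency and the frequency at which `ℓ` is evaluated.
  let e : (ℤ × ℤ) × ℤ ≃ ℤ × (ℤ × ℤ) :=
    { toFun := fun i => (i.1.1 + (i.1.2 + i.2), (i.2, i.1.2 + i.2))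
      invFun := fun j => ((j.1 - j.2.2, j.2.2 - j.2.1), j.2.1)
      left_inv := fun i => by ext <;> simp
      right_inv := fun j => by ext <;> simp }
  have hsum : Summable fun j : ℤ × (ℤ × ℤ) =>
      c (j.1 - j.2.2) (j.2.2 - j.2.1) * lam j.2.2 * (u : ℤ → ℂ) j.2.1 * expo j.1 t := by
    rw [← e.summable_iff]
    refine Summable.of_norm_bounded (hn.mul_left M) fun i => ?_
    simp only [Function.comp, e, Equiv.coe_fn_mk, norm_mul, norm_expo, add_sub_cancel_right, mul_one]
    calc _ ≤ ‖c i.1.1 i.1.2‖ * M * ‖(u : ℤ → ℂ) i.2‖ := by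
          gcongr; exact hM _
      _ = _ := by ring
  rw [hL]
  have he : ∀ i : (ℤ × ℤ) × ℤ, c i.1.1 i.1.2 * lam (i.1.2 + i.2) * (u : ℤ → ℂ) i.2 *
        expo (i.1.1 + (i.1.2 + i.2)) t =
      (fun j : ℤ × (ℤ × ℤ) => c (j.1 - j.2.2) (j.2.2 - j.2.1) * lam j.2.2 *
        (u : ℤ → ℂ) j.2.1 * expo j.1 t) (e i) := by
    intro i
    simp only [e, Equiv.coe_fn_mk, add_sub_cancel_right]
  rw [tsum_congr he, e.tsum_eq (fun j : ℤ × (ℤ × ℤ) => c (j.1 - j.2.2) (j.2.2 - j.2.1) *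
    lam j.2.2 * (u : ℤ → ℂ) j.2.1 * expo j.1 t), hsum.tsum_prod]
  refine tsum_congr fun m => ?_
  rw [(hsum.prod_factor m).tsum_prod]
  change _ = (∑' k, (∑' b, c (m - b) (b - k) * lam b) * (u : ℤ → ℂ) k) * expo m t
  rw [← tsum_mul_right]
  refine tsum_congr fun k => ?_
  rw [← tsum_mul_right, ← tsum_mul_right]

/-! ### Division by `e^{it} - e^{iζ}` -/

/-- The function `e^{it} - e^{iζ}`. -/
def expDiff (t ζ : ℝ) : ℂ := expo 1 t - expo 1 ζ

lemma biSmooth_expDiff : BiSmooth expDiff :=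
  (BiSmooth.ofLeft (smoothPeriodic_expo 1)).sub (BiSmooth.ofRight (smoothPeriodic_expo 1))

/-- The signed indicator of the integers between `0` and `a`. -/
def signInd (a j : ℤ) : ℂ := if 0 ≤ j ∧ j < a then 1 else if a ≤ j ∧ j < 0 then -1 else 0

lemma hasSum_signInd (G : ℤ → ℂ) (a : ℤ) :
    HasSum (fun j => signInd a j * (G (j + 1) - G j)) (G a - G 0) := by
  induction a using Int.induction_on with
  | zero =>
    have : (fun j => signInd 0 j * (G (j + 1) - G j)) = fun _ => 0 := by
      ext j
      unfold signInd
      rw [if_neg (by omega), if_neg (by omega), zero_mul]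
    rw [this, sub_self]; exact hasSum_zero
  | succ n ih =>
    have h := ih.add (hasSum_ite_eq (n : ℤ) (G (n + 1) - G n))
    have e : (fun j => signInd (n + 1) j * (G (j + 1) - G j)) = fun j =>
        signInd n j * (G (j + 1) - G j) + if j = (n : ℤ) then G (n + 1) - G n else 0 := by
      ext j
      unfold signInd
      split_ifs <;> first | omega | (subst_vars; ring)
    rw [e, show G (n + 1) - G 0 = G n - G 0 + (G (n + 1) - G n) by ring]
    exact h
  | pred n ih =>
    have h := ih.sub (hasSum_ite_eq (-(n : ℤ) - 1) (G (-(n : ℤ) - 1 + 1) - G (-(n : ℤ) - 1)))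
    have e : (fun j => signInd (-(n : ℤ) - 1) j * (G (j + 1) - G j)) = fun j =>
        signInd (-n) j * (G (j + 1) - G j) -
          if j = -(n : ℤ) - 1 then G (-(n : ℤ) - 1 + 1) - G (-(n : ℤ) - 1) else 0 := by
      ext j
      unfold signInd
      split_ifs <;> first | omega | (subst_vars; ring)
    rw [e, show G (-(n : ℤ) - 1) - G 0 =
      G (-n) - G 0 - (G (-(n : ℤ) - 1 + 1) - G (-(n : ℤ) - 1)) by rw [sub_add_cancel]; ring]
    exact h

lemma norm_signInd_le (a j : ℤ) : ‖signInd a j‖ ≤ wt a ^ 2 * (wt j ^ 2)⁻¹ := by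
  have hj := wt_pos j
  have ha := wt_pos a
  have key : |(j : ℝ)| ≤ |(a : ℝ)| → (1 : ℝ) ≤ wt a ^ 2 * (wt j ^ 2)⁻¹ := by
    intro h
    rw [← div_eq_mul_inv, one_le_div (by positivity)]
    exact pow_le_pow_left₀ hj.le (by unfold wt; linarith) 2
  have hZ : |j| ≤ |a| → (1 : ℝ) ≤ wt a ^ 2 * (wt j ^ 2)⁻¹ := fun h => key (by exact_mod_cast h)
  unfold signInd
  split_ifs with h1 h2
  · rw [norm_one]; exact hZ (abs_le_abs_of_nonneg h1.1 h1.2.le)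
  · rw [norm_neg, norm_one]; exact hZ (abs_le_abs_of_nonpos h2.2.le h2.1)
  · rw [norm_zero]; positivity

lemma abs_le_of_signInd_ne_zero {a j : ℤ} (h : signInd a j ≠ 0) : |(j : ℝ)| ≤ |(a : ℝ)| := by
  have : |j| ≤ |a| := by
    unfold signInd at h
    split_ifs at h with h1 h2
    · exact abs_le_abs_of_nonneg h1.1 h1.2.le
    · exact abs_le_abs_of_nonpos h2.2.le h2.1
    · exact absurd rfl h
  exact_mod_cast this

lemma norm_combination_le (x y : ℝ) :
    ‖x • ContinuousLinearMap.fst ℝ ℝ ℝ + y • ContinuousLinearMap.snd ℝ ℝ ℝ‖ ≤ |x| + |y| := by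
  refine (norm_add_le _ _).trans ?_
  rw [norm_smul, norm_smul, Real.norm_eq_abs, Real.norm_eq_abs]
  have h1 := ContinuousLinearMap.norm_fst_le ℝ ℝ ℝ
  have h2 := ContinuousLinearMap.norm_snd_le ℝ ℝ ℝ
  nlinarith [abs_nonneg x, abs_nonneg y]

/-- A smooth biperiodic function that vanishes on the diagonal is divisible by
`e^{it} - e^{iζ}`. -/
theorem BiSmooth.exists_eq_expDiff_mul {F : ℝ → ℝ → ℂ} (hF : BiSmooth F) (h0 : ∀ t, F t t = 0) :
    ∃ H, BiSmooth H ∧ ∀ t ζ, F t ζ = expDiff t ζ * H t ζ := by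
  set c := biCoef F with hc
  -- Telescoping gives `e^{iat} - e^{iaζ} = (e^{it} - e^{iζ}) ∑_j ± e^{ijt} e^{i(a-1-j)ζ}` with `j`
  -- between `0` and `a`. The quotient therefore has coefficients `C` and frequencies `ℓ`.
  let C : (ℤ × ℤ) × ℤ → ℂ := fun i => c i.1.1 i.1.2 * signInd i.1.1 i.2
  let ℓ : (ℤ × ℤ) × ℤ → (ℝ × ℝ →L[ℝ] ℝ) := fun i =>
    (i.2 : ℝ) • ContinuousLinearMap.fst ℝ ℝ ℝ +
      ((i.1.2 + i.1.1 - 1 - i.2 : ℤ) : ℝ) • ContinuousLinearMap.snd ℝ ℝ ℝ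
  -- Only `|j| ≤ |a|` contributes, so `1 ≤ wt a ^ 2 / wt j ^ 2` on the support of `signInd`:
  -- summability in `j` is bought with two powers of the decay in `a`, and the frequencies are
  -- controlled by `a` and `b`.
  have hS : ∀ n : ℕ, Summable fun i => ‖C i‖ * ‖ℓ i‖ ^ n := by
    intro n
    have hs := (Summable.mul_of_nonneg (hF.rapidDecay.summable (n + 2)) summable_inv_wt_sq
      (fun x => mul_nonneg (norm_nonneg _)
        (pow_nonneg (mul_nonneg (wt_pos _).le (wt_pos _).le) _))
      (fun x => inv_nonneg.mpr (sq_nonneg _))).mul_left (4 ^ n : ℝ)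
    refine Summable.of_nonneg_of_le (fun i => by positivity) (fun i => ?_) hs
    obtain ⟨⟨a, b⟩, j⟩ := i
    have ha := one_le_wt a
    have hb := one_le_wt b
    have ha0 := wt_pos a
    have hb0 := wt_pos b
    have hj := wt_pos j
    by_cases hz : signInd a j = 0
    · simp only [C, hz, mul_zero, norm_zero, zero_mul]
      positivity
    have hle : ‖ℓ ((a, b), j)‖ ≤ 4 * (wt a * wt b) := by
      refine (norm_combination_le _ _).trans ?_
      have h1 := abs_le_of_signInd_ne_zero hz
      have h2 : |((b + a - 1 - j : ℤ) : ℝ)| ≤ |(b : ℝ)| + |(a : ℝ)| + 1 + |(j : ℝ)| := by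
        push_cast
        have e1 := abs_sub ((b : ℝ) + a - 1) j
        have e2 := abs_sub ((b : ℝ) + a) 1
        have e3 := abs_add_le (b : ℝ) a
        rw [abs_one] at e2
        linarith
      have h3 : |(a : ℝ)| = wt a - 1 := by unfold wt; ring
      have h4 : |(b : ℝ)| = wt b - 1 := by unfold wt; ring
      simp only
      nlinarith [mul_le_mul ha hb zero_le_one ha0.le]
    calc ‖C ((a, b), j)‖ * ‖ℓ ((a, b), j)‖ ^ n ≤
        (‖c a b‖ * (wt a ^ 2 * (wt j ^ 2)⁻¹)) * (4 * (wt a * wt b)) ^ n := by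
          simp only [C, norm_mul]
          gcongr
          exact norm_signInd_le a j
      _ ≤ (‖c a b‖ * ((wt a * wt b) ^ 2 * (wt j ^ 2)⁻¹)) * (4 * (wt a * wt b)) ^ n := by
          gcongr
          nlinarith
      _ = 4 ^ n * (‖c a b‖ * (wt a * wt b) ^ (n + 2) * (wt j ^ 2)⁻¹) := by ring
  have hexp : ∀ (i : (ℤ × ℤ) × ℤ) (x : ℝ × ℝ), Complex.exp ((ℓ i x : ℂ) * Complex.I) =
      expo i.2 x.1 * expo (i.1.2 + i.1.1 - 1 - i.2) x.2 := by
    intro i x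
    rw [expo_eq, expo_eq, ← Complex.exp_add]
    congr 1
    simp [ℓ]; ring
  have hsm := contDiff_tsum_cexp C ℓ hS
  simp only [hexp] at hsm
  refine ⟨fun t ζ => ∑' i : (ℤ × ℤ) × ℤ, C i * (expo i.2 t * expo (i.1.2 + i.1.1 - 1 - i.2) ζ),
    ⟨hsm, fun t ζ => ?_, fun t ζ => ?_⟩, fun t ζ => ?_⟩
  · exact tsum_congr fun i => by rw [expo_periodic]
  · exact tsum_congr fun i => by rw [expo_periodic]
  · have hsC : Summable fun i => ‖C i‖ := by simpa using hS 0
    have hterm : Summable fun i : (ℤ × ℤ) × ℤ =>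
        expDiff t ζ * (C i * (expo i.2 t * expo (i.1.2 + i.1.1 - 1 - i.2) ζ)) := by
      refine Summable.mul_left _ (Summable.of_norm ?_)
      simpa [norm_expo] using hsC
    have hsc : ∀ s : ℝ, Summable fun x : ℤ × ℤ => c x.1 x.2 * (expo x.1 s * expo x.2 ζ) := by
      intro s
      refine Summable.of_norm ?_
      simpa [norm_expo] using hF.rapidDecay.summable_norm
    rw [← tsum_mul_left, hterm.tsum_prod]
    calc F t ζ = F t ζ - F ζ ζ := by rw [h0, sub_zero]
      _ = ∑' x : ℤ × ℤ, (c x.1 x.2 * (expo x.1 t * expo x.2 ζ) -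
            c x.1 x.2 * (expo x.1 ζ * expo x.2 ζ)) := by
          rw [hF.tsum_biCoef t ζ, hF.tsum_biCoef ζ ζ, (hsc t).tsum_sub (hsc ζ)]
      _ = _ := by
          refine tsum_congr fun x => ?_
          have h := (hasSum_signInd (fun j => expo j t * expo (x.1 - j) ζ) x.1).mul_left
            (c x.1 x.2 * expo x.2 ζ)
          rw [sub_self, sub_zero, expo_zero, expo_zero] at h
          rw [show c x.1 x.2 * (expo x.1 t * expo x.2 ζ) - c x.1 x.2 * (expo x.1 ζ * expo x.2 ζ) =
            c x.1 x.2 * expo x.2 ζ * (expo x.1 t * 1 - 1 * expo x.1 ζ) by ring, ← h.tsum_eq]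
          refine tsum_congr fun j => ?_
          have e1 : expo (x.2 + x.1 - 1 - j) ζ = expo x.2 ζ * expo (x.1 - (j + 1)) ζ := by
            rw [← expo_add]; congr 1; ring
          have e2 : expo (x.1 - j) ζ = expo 1 ζ * expo (x.1 - (j + 1)) ζ := by
            rw [← expo_add]; congr 1; ring
          have e3 : expo (j + 1) t = expo j t * expo 1 t := expo_add _ _ _
          simp only [C, expDiff]
          rw [e1, e2, e3]; ring

/-! ### The logarithmic kernel -/

/-- The function `ln (4 sin² (s/2))`. -/
def logKer (s : ℝ) : ℂ := (Real.log (4 * Real.sin (s / 2) ^ 2) : ℝ)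

lemma logSin_eq (t ζ : ℝ) : (logSin t ζ : ℂ) = logKer (t - ζ) := rfl

lemma logKer_periodic : Function.Periodic logKer (2 * π) := by
  intro s
  unfold logKer
  rw [show (s + 2 * π) / 2 = s / 2 + π by ring, Real.sin_add_pi, neg_sq]

lemma intervalIntegrable_logKer (a b : ℝ) :
    IntervalIntegrable logKer MeasureTheory.volume a b := by
  have h : MeromorphicOn (fun s : ℝ => 4 * Real.sin (s / 2) ^ 2) (uIcc a b) := by
    intro s _
    have : AnalyticAt ℝ (fun s : ℝ => 4 * Real.sin (s / 2) ^ 2) s := by fun_prop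
    exact this.meromorphicAt
  have h' := h.intervalIntegrable_log
  exact ⟨h'.1.ofReal, h'.2.ofReal⟩

/-- The Fourier integrals of the logarithmic kernel. -/
def logCoef (k : ℤ) : ℂ := ∫ s in (0 : ℝ)..(2 * π), logKer s * expo (-k) s

lemma logCoef_zero : logCoef 0 = 0 := by
  unfold logCoef logKer
  simp only [neg_zero, expo_zero, mul_one]
  rw [intervalIntegral.integral_ofReal]
  -- The mean of the logarithm vanishes because `∫₀^π ln sin = -π ln 2` exactly offsets the factor
  -- 4.
  have h1 := intervalIntegral.integral_comp_div (a := 0) (b := 2 * π)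
    (fun x => Real.log (4 * Real.sin x ^ 2)) (two_ne_zero (α := ℝ))
  rw [h1]
  have h2 : ∫ x in (0 : ℝ) / 2..2 * π / 2, Real.log (4 * Real.sin x ^ 2) =
      ∫ x in (0 : ℝ)..π, (Real.log 4 + 2 * Real.log (Real.sin x)) := by
    rw [zero_div, mul_div_cancel_left₀ _ two_ne_zero]
    refine intervalIntegral.integral_congr_ae ?_
    filter_upwards [MeasureTheory.compl_mem_ae_iff.mpr (MeasureTheory.measure_singleton (π : ℝ))]
      with x hx hx'
    rw [uIoc_of_le pi_pos.le] at hx'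
    have : Real.sin x ≠ 0 := (Real.sin_pos_of_pos_of_lt_pi hx'.1
      (lt_of_le_of_ne hx'.2 (by simpa using hx))).ne'
    rw [Real.log_mul (by norm_num) (by positivity), Real.log_pow]; norm_num
  have h3 : IntervalIntegrable (fun x => 2 * Real.log (Real.sin x)) MeasureTheory.volume 0 π := by
    have : IntervalIntegrable (Real.log ∘ Real.sin) MeasureTheory.volume 0 π :=
      intervalIntegrable_log_sin
    exact this.const_mul 2
  have h4 : Real.log 4 = 2 * Real.log 2 := by
    rw [show (4 : ℝ) = 2 ^ 2 by norm_num, Real.log_pow]; norm_num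
  rw [h2, intervalIntegral.integral_add intervalIntegrable_const h3,
    intervalIntegral.integral_const_mul, integral_log_sin_zero_pi,
    intervalIntegral.integral_const, h4]
  simp only [smul_eq_mul, sub_zero, Complex.ofReal_eq_zero]
  ring

lemma expo_one_sub_one (s : ℝ) :
    expo 1 s - 1 = 2 * Complex.I * (Real.sin (s / 2) : ℂ) * Complex.exp ((s / 2 : ℝ) * Complex.I) := by
  have h1 : expo 1 s = Complex.exp ((s / 2 : ℝ) * Complex.I) * Complex.exp ((s / 2 : ℝ) * Complex.I) := by
    unfold expo; rw [← Complex.exp_add]; congr 1; push_cast; ring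
  have h2 : Complex.exp ((s / 2 : ℝ) * Complex.I) =
      (Real.cos (s / 2) : ℂ) + (Real.sin (s / 2) : ℂ) * Complex.I := by
    rw [Complex.exp_mul_I]; push_cast; rfl
  have h3 : ((Real.cos (s / 2) : ℝ) : ℂ) ^ 2 + ((Real.sin (s / 2) : ℝ) : ℂ) ^ 2 = 1 := by
    exact_mod_cast Real.cos_sq_add_sin_sq (s / 2)
  rw [h1, h2]
  linear_combination (((Real.sin (s / 2) : ℝ) : ℂ) ^ 2) * Complex.I_sq + h3 -
    2 * (((Real.sin (s / 2) : ℝ) : ℂ) ^ 2) * Complex.I_sq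

lemma continuous_sub_one_mul_logKer : Continuous fun s => (expo 1 s - 1) * logKer s := by
  have : (fun s => (expo 1 s - 1) * logKer s) = fun s : ℝ =>
      2 * Complex.I * Complex.exp ((s / 2 : ℝ) * Complex.I) *
        (((2 * Real.sin (s / 2)) * Real.log (2 * Real.sin (s / 2)) : ℝ) : ℂ) := by
    ext s
    have : logKer s = 2 * (Real.log (2 * Real.sin (s / 2)) : ℂ) := by
      unfold logKer
      rw [show 4 * Real.sin (s / 2) ^ 2 = (2 * Real.sin (s / 2)) ^ 2 by ring, Real.log_pow]
      push_cast; ring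
    rw [expo_one_sub_one, this]; push_cast; ring
  rw [this]
  have h := Real.continuous_mul_log.comp
    (show Continuous fun s : ℝ => 2 * Real.sin (s / 2) by fun_prop)
  refine Continuous.mul (by fun_prop) (Complex.continuous_ofReal.comp h)

lemma hasDerivAt_logKer {s : ℝ} (h : Real.sin (s / 2) ≠ 0) :
    HasDerivAt logKer ((Real.cos (s / 2) / Real.sin (s / 2) : ℝ) : ℂ) s := by
  have h1 : HasDerivAt (fun s : ℝ => 4 * Real.sin (s / 2) ^ 2)
      (4 * (2 * Real.sin (s / 2) * (Real.cos (s / 2) * (1 / 2)))) s := by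
    have := ((((hasDerivAt_id s).div_const 2).sin).pow 2).const_mul 4
    simpa using this
  have h2 := (h1.log (by positivity)).ofReal_comp
  refine h2.congr_deriv ?_
  congr 1
  field_simp

/-- The function `(e^{is} - 1) ln(4 sin²(s/2)) e^{-iks}` is continuous and vanishes at both ends of
the period. Its derivative contains no singular term since `(e^{is} - 1) cot(s/2) = i (e^{is} + 1)`,
so integrating it relates consecutive coefficients. -/
lemma logCoef_recursion (k : ℤ) :
    k * logCoef k = (k - 1) * logCoef (k - 1) -
      2 * π * ((if k = 1 then 1 else 0) + (if k = 0 then 1 else 0)) := by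
  let W : ℝ → ℂ := fun s => ((expo 1 s - 1) * logKer s) * expo (-k) s
  let W' : ℝ → ℂ := fun s => Complex.I * ((1 - k) * (logKer s * expo (-(k - 1)) s) +
    k * (logKer s * expo (-k) s) + (expo (1 - k) s + expo (-k) s))
  have hW : ContinuousOn W (Icc 0 (2 * π)) :=
    (continuous_sub_one_mul_logKer.mul (continuous_expo _)).continuousOn
  have i1 : ∀ j, IntervalIntegrable (fun s => logKer s * expo j s) MeasureTheory.volume 0 (2 * π) :=
    fun j => (intervalIntegrable_logKer _ _).mul_continuousOn (continuous_expo j).continuousOn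
  have i2 : ∀ j, IntervalIntegrable (expo j) MeasureTheory.volume 0 (2 * π) :=
    fun j => (continuous_expo j).intervalIntegrable _ _
  have i3 := (((i1 (-(k - 1))).const_mul (1 - k : ℂ)).add ((i1 (-k)).const_mul (k : ℂ)))
  have i4 := (i2 (1 - k)).add (i2 (-k))
  have hder : ∀ s ∈ Ioo 0 (2 * π), HasDerivAt W (W' s) s := by
    intro s hs
    have hsin : Real.sin (s / 2) ≠ 0 :=
      (Real.sin_pos_of_pos_of_lt_pi (by linarith [hs.1]) (by linarith [hs.2])).ne'
    have h := ((((hasDerivAt_expo 1 s).sub_const 1).mul (hasDerivAt_logKer hsin)).mul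
      (hasDerivAt_expo (-k) s))
    refine h.congr_deriv ?_
    have e1 : (expo 1 s - 1) * ((Real.cos (s / 2) / Real.sin (s / 2) : ℝ) : ℂ) =
        Complex.I * (expo 1 s + 1) := by
      have hsinC : ((Real.sin (s / 2) : ℝ) : ℂ) ≠ 0 := by exact_mod_cast hsin
      have e2 : Complex.exp ((s / 2 : ℝ) * Complex.I) =
          (Real.cos (s / 2) : ℂ) + (Real.sin (s / 2) : ℂ) * Complex.I := by
        rw [Complex.exp_mul_I]; push_cast; rfl
      have h3 : ((Real.cos (s / 2) : ℝ) : ℂ) ^ 2 + ((Real.sin (s / 2) : ℝ) : ℂ) ^ 2 = 1 := by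
        exact_mod_cast Real.cos_sq_add_sin_sq (s / 2)
      have e4 : expo 1 s + 1 = (expo 1 s - 1) + 2 := by ring
      rw [e4, expo_one_sub_one, e2]
      push_cast at *
      field_simp
      linear_combination (-Complex.sin (s / 2) ^ 2) * Complex.I_sq + h3
    have e5 : expo (1 - k) s = expo 1 s * expo (-k) s := expo_sub _ _ _
    have e6 : expo (-(k - 1)) s = expo 1 s * expo (-k) s := by rw [← expo_add]; congr 1; ring
    simp only [W', e5, e6, Pi.mul_apply, Int.cast_neg, Int.cast_one]
    linear_combination expo (-k) s * e1
  have hint : IntervalIntegrable W' MeasureTheory.volume 0 (2 * π) :=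
    (i3.add i4).const_mul Complex.I
  have h := intervalIntegral.integral_eq_sub_of_hasDerivAt_of_le (by positivity) hW hder hint
  have h0 : W (2 * π) - W 0 = 0 := by
    have e1 := expo_periodic 1 0
    rw [zero_add] at e1
    simp only [W, e1]
    have : expo 1 0 = 1 := by simp [expo]
    rw [this]; ring
  have h2 : ∫ s in (0 : ℝ)..(2 * π), W' s = Complex.I * (((1 - k) * logCoef (k - 1) + k * logCoef k) +
      (2 * π * ((if k = 1 then 1 else 0) + (if k = 0 then 1 else 0)))) := by
    simp only [W']
    rw [intervalIntegral.integral_const_mul, intervalIntegral.integral_add i3 i4,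
      intervalIntegral.integral_add ((i1 (-(k - 1))).const_mul (1 - k : ℂ))
        ((i1 (-k)).const_mul (k : ℂ)),
      intervalIntegral.integral_add (i2 _) (i2 _), intervalIntegral.integral_const_mul,
      intervalIntegral.integral_const_mul, integral_expo, integral_expo]
    simp only [logCoef, sub_eq_zero, neg_eq_zero, eq_comm (a := (1 : ℤ))]
    congr 2
    split_ifs <;> ring
  rw [h0, h2] at h
  have h3 := (mul_eq_zero.mp h).resolve_left Complex.I_ne_zero
  linear_combination h3

lemma mul_logCoef_of_pos (n : ℕ) : ((n : ℤ) + 1 : ℤ) * logCoef (n + 1) = -(2 * π) := by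
  induction n with
  | zero =>
    have := logCoef_recursion 1
    simp at this ⊢
    rw [this]
  | succ n ih =>
    have := logCoef_recursion ((n + 1 : ℕ) + 1)
    rw [if_neg (by omega), if_neg (by omega), add_sub_cancel_right] at this
    rw [this]
    push_cast at ih ⊢
    rw [← ih]; ring

lemma mul_logCoef_of_neg (n : ℕ) : (-(n : ℤ) - 1 : ℤ) * logCoef (-n - 1) = 2 * π := by
  induction n with
  | zero =>
    have := logCoef_recursion 0
    simp at this ⊢
    linear_combination -this
  | succ n ih =>
    have := logCoef_recursion (-(n : ℤ) - 1)
    rw [if_neg (by omega), if_neg (by omega), ih] at this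
    push_cast at this ⊢
    rw [show -((n : ℤ) + 1) - 1 = -n - 1 - 1 by ring]
    linear_combination -this

lemma logCoef_of_pos {k : ℤ} (hk : 0 < k) : logCoef k = -(2 * π) / k := by
  obtain ⟨n, rfl⟩ := Int.eq_succ_of_zero_lt hk
  have := mul_logCoef_of_pos n
  have hn : ((n : ℂ) + 1) ≠ 0 := by exact_mod_cast n.succ_ne_zero
  push_cast at this ⊢
  rw [eq_div_iff hn, ← this]; ring

lemma logCoef_of_neg {k : ℤ} (hk : k < 0) : logCoef k = (2 * π) / k := by
  obtain ⟨n, hn⟩ := Int.eq_succ_of_zero_lt (show 0 < -k by omega)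
  obtain rfl : k = -n - 1 := by omega
  have := mul_logCoef_of_neg n
  have hk' : (((-n - 1 : ℤ)) : ℂ) ≠ 0 := by exact_mod_cast hk.ne
  rw [eq_div_iff hk', ← this]; ring

/-! ### Calculus of representations -/

lemma Rep.add {a b : Op} {A B : Module.End ℂ RD} (ha : Rep a A) (hb : Rep b B) :
    Rep (a + b) (A + B) := fun u => by
  rw [Pi.add_apply, ha, hb, LinearMap.add_apply, synth_add]

lemma Rep.sub {a b : Op} {A B : Module.End ℂ RD} (ha : Rep a A) (hb : Rep b B) :
    Rep (a - b) (A - B) := fun u => by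
  rw [Pi.sub_apply, ha, hb, LinearMap.sub_apply, synth_sub]

lemma Rep.neg {a : Op} {A : Module.End ℂ RD} (ha : Rep a A) : Rep (-a) (-A) := fun u => by
  rw [Pi.neg_apply, ha, LinearMap.neg_apply, synth_neg]

lemma Rep.smul {a : Op} {A : Module.End ℂ RD} (ha : Rep a A) (c : ℂ) : Rep (c • a) (c • A) :=
  fun u => by rw [Pi.smul_apply, ha, LinearMap.smul_apply, synth_smul]

lemma Rep.comp {a b : Op} {A B : Module.End ℂ RD} (ha : Rep a A) (hb : Rep b B) :
    Rep (a ∘ b) (A * B) := fun u => by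
  rw [Function.comp_apply, hb, ha, Module.End.mul_apply]

lemma Rep.id : Rep (id : Op) 1 := fun _ => rfl

lemma Rep.zero : Rep (0 : Op) 0 := fun u => by
  rw [LinearMap.zero_apply, synth_zero]; rfl

/-- `a` acts on the Fourier coefficients as multiplication by `σ`. -/
def RepMult (a : Op) (σ : ℤ → ℂ) : Prop :=
  ∀ u : RD, a (synth u) = fun t => ∑' k, σ k * (u : ℤ → ℂ) k * expo k t

lemma RepMult.rep {a : Op} {σ : ℤ → ℂ} (h : RepMult a σ) {d : ℤ} {C : ℝ}
    (hσ : ∀ k, ‖σ k‖ ≤ C * wt k ^ d) : Rep a (multEnd hσ) := by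
  intro u
  rw [h]
  ext t
  exact tsum_congr fun k => by rw [multEnd_apply]

lemma RepMult.add {a b : Op} {σ τ : ℤ → ℂ} (ha : RepMult a σ) (hb : RepMult b τ) {d e : ℤ} {C D : ℝ}
    (hσ : ∀ k, ‖σ k‖ ≤ C * wt k ^ d) (hτ : ∀ k, ‖τ k‖ ≤ D * wt k ^ e) :
    RepMult (a + b) (fun k => σ k + τ k) := by
  intro u
  ext t
  rw [Pi.add_apply, Pi.add_apply, ha, hb]
  have h1 : Summable fun k => σ k * (u : ℤ → ℂ) k * expo k t := by
    simpa only [multEnd_apply] using (multEnd hσ u).2.summable_expo t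
  have h2 : Summable fun k => τ k * (u : ℤ → ℂ) k * expo k t := by
    simpa only [multEnd_apply] using (multEnd hτ u).2.summable_expo t
  simp only
  rw [← h1.tsum_add h2]
  exact tsum_congr fun k => by ring

lemma RepMult.congr {a : Op} {σ τ : ℤ → ℂ} (h : RepMult a σ) (hστ : ∀ k, σ k = τ k) : RepMult a τ := by
  obtain rfl : σ = τ := funext hστ
  exact h

/-- Convolution operators are multipliers. -/
lemma repMult_kernelOp {ℓ : ℝ → ℂ} (hp : Function.Periodic ℓ (2 * π))
    (hi : IntervalIntegrable ℓ MeasureTheory.volume 0 (2 * π)) :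
    RepMult (kernelOp fun t ζ => ℓ (t - ζ)) fun k => ∫ s in (0 : ℝ)..(2 * π), ℓ s * expo (-k) s := by
  intro u
  ext t
  have hit : IntervalIntegrable (fun ζ => ℓ (t - ζ)) MeasureTheory.volume 0 (2 * π) := by
    have h0 := hp.intervalIntegrable₀ (by positivity) hi (t - 0) (t - 2 * π)
    have := h0.comp_sub_left t
    simpa using this
  have h := integral_tsum_mul_expo u.2.summable expo continuous_expo
    (fun k s => (norm_expo k s).le) _ hit
  unfold kernelOp synth
  simp only [mul_comm (ℓ _) (∑' _, _)]
  rw [h]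
  exact tsum_congr fun k => by rw [integral_expo_mul_comp_sub hp]; ring

lemma synth_mul_synth {a : ℤ → ℂ} (ha : RapidDecay a) (u : RD) :
    synth a * synth u = synth (convEnd ha u) := by
  ext t
  have hn : Summable fun i : ℤ × ℤ => ‖a i.1 * (u : ℤ → ℂ) i.2‖ := by
    have := Summable.mul_of_nonneg ha.summable u.2.summable (fun _ => norm_nonneg _)
      (fun _ => norm_nonneg _)
    simpa [norm_mul] using this
  let e : ℤ × ℤ ≃ ℤ × ℤ :=
    { toFun := fun i => (i.1 + i.2, i.2)
      invFun := fun j => (j.1 - j.2, j.2)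
      left_inv := fun i => by ext <;> simp
      right_inv := fun j => by ext <;> simp }
  have hsum : Summable fun j : ℤ × ℤ => a (j.1 - j.2) * (u : ℤ → ℂ) j.2 * expo j.1 t := by
    rw [← e.summable_iff]
    refine Summable.of_norm_bounded hn fun i => ?_
    simp [e, norm_expo]
  rw [Pi.mul_apply]
  unfold synth
  rw [tsum_mul_tsum_of_summable_norm]
  · have he : ∀ i : ℤ × ℤ, a i.1 * expo i.1 t * ((u : ℤ → ℂ) i.2 * expo i.2 t) =
        (fun j : ℤ × ℤ => a (j.1 - j.2) * (u : ℤ → ℂ) j.2 * expo j.1 t) (e i) := by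
      intro i
      simp only [e, Equiv.coe_fn_mk, add_sub_cancel_right, expo_add]; ring
    rw [tsum_congr he, e.tsum_eq (fun j : ℤ × ℤ => a (j.1 - j.2) * (u : ℤ → ℂ) j.2 * expo j.1 t),
      hsum.tsum_prod]
    refine tsum_congr fun m => ?_
    exact tsum_mul_right (f := fun c => a (m - c) * (u : ℤ → ℂ) c) (a := expo m t)
  · simpa [norm_expo] using ha.summable
  · simpa [norm_expo] using u.2.summable

lemma rep_mulOp {f : ℝ → ℝ} (hf : SmoothPeriodic fun t => (f t : ℂ)) :
    Rep (mulOp f) (convEnd hf.rapidDecay) := by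
  intro u
  rw [← synth_mul_synth, hf.synth_eq]; rfl

/-! ### Symbols of the model operators -/

/-- Finitely many small frequencies never affect an order estimate: their quotients are added to the
constant. This lets the explicit formulas be used only where their denominators do not vanish. -/
lemma exists_wt_bound {f : ℤ → ℂ} {d : ℤ} {C : ℝ} (K : ℕ)
    (hp : ∀ n : ℕ, K ≤ n → ‖f n‖ ≤ C * wt n ^ d) (hm : ∀ n : ℕ, K ≤ n → ‖f (-n)‖ ≤ C * wt n ^ d) :
    ∃ D : ℝ, ∀ k, ‖f k‖ ≤ D * wt k ^ d := by
  have hC : 0 ≤ C := by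
    have := (norm_nonneg _).trans (hp K le_rfl)
    exact nonneg_of_mul_nonneg_left this (zpow_pos (wt_pos _) _)
  have hS : ∀ k ∈ Finset.Icc (-(K : ℤ)) K, 0 ≤ ‖f k‖ / wt k ^ d := fun k _ =>
    div_nonneg (norm_nonneg _) (zpow_pos (wt_pos k) d).le
  refine ⟨C + ∑ k ∈ Finset.Icc (-(K : ℤ)) K, ‖f k‖ / wt k ^ d, fun k => ?_⟩
  have hw := zpow_pos (wt_pos k) d
  rw [add_mul]
  by_cases hk : k ∈ Finset.Icc (-(K : ℤ)) K
  · have := Finset.single_le_sum hS hk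
    rw [div_le_iff₀ hw] at this
    have : 0 ≤ C * wt k ^ d := by positivity
    linarith
  · have h0 := mul_nonneg (Finset.sum_nonneg hS) hw.le
    have : ‖f k‖ ≤ C * wt k ^ d := by
      rw [Finset.mem_Icc, not_and_or] at hk
      rcases le_total 0 k with h | h
      · obtain ⟨n, rfl⟩ := Int.eq_ofNat_of_zero_le h
        exact hp n (by omega)
      · obtain ⟨n, hn⟩ := Int.eq_ofNat_of_zero_le (show 0 ≤ -k by omega)
        obtain rfl : k = -n := by omega
        rw [wt_neg]
        exact hm n (by omega)
    linarith

lemma logCoef_neg (k : ℤ) : logCoef (-k) = logCoef k := by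
  rcases lt_trichotomy k 0 with h | rfl | h
  · rw [logCoef_of_pos (by omega), logCoef_of_neg h]; push_cast; rw [neg_div_neg_eq]
  · rfl
  · rw [logCoef_of_neg (by omega), logCoef_of_pos h]; push_cast; rw [div_neg, neg_div]

/-- The symbol of `S₀`. -/
def symS (k : ℤ) : ℂ := if k = 0 then Complex.I else ((|(k : ℝ)|⁻¹ : ℝ) : ℂ)

/-- The symbol of `T₀`. -/
def symT (k : ℤ) : ℂ := if k = 0 then Complex.I else -((|(k : ℝ)| : ℝ) : ℂ)

/-- The symbol of `S₁`. -/
def symS₁ (k : ℤ) : ℂ := 1 / (8 * π * Complex.I) * (logCoef (k - 1) - logCoef (k + 1))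

/-- The symbol of `S₂`. -/
def symS₂ (k : ℤ) : ℂ := 1 / (32 * π) * (logCoef (k - 2) - 2 * logCoef k + logCoef (k + 2))

/-- For `k ≠ 0` this is `|k|⁻¹ · (-|k|)`; at `k = 0` it is `i · i`, which explains the factor `i` in
`M₀`. -/
lemma symS_mul_symT (k : ℤ) : symS k * symT k = -1 := by
  unfold symS symT
  split_ifs with h
  · exact Complex.I_mul_I
  · have : ((|(k : ℝ)| : ℝ) : ℂ) ≠ 0 := by simpa using h
    push_cast
    field_simp

lemma norm_symS_le (k : ℤ) : ‖symS k‖ ≤ 2 * wt k ^ (-1 : ℤ) := by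
  have hw := wt_pos k
  rw [zpow_neg_one, ← div_eq_mul_inv, le_div_iff₀ hw]
  unfold symS
  split_ifs with h
  · simp [h, wt]
  · have hk : (1 : ℝ) ≤ |(k : ℝ)| := by exact_mod_cast Int.one_le_abs h
    rw [Complex.norm_real, Real.norm_of_nonneg (by positivity), inv_mul_le_iff₀ (by positivity)]
    unfold wt; linarith

lemma norm_symT_le (k : ℤ) : ‖symT k‖ ≤ 1 * wt k ^ (1 : ℤ) := by
  rw [zpow_one, one_mul]
  unfold symT wt
  split_ifs with h
  · simp [h]
  · simp

/-- The symbol differs from the Lipschitz function `-|k|` by at most 1, and only at `k = 0`. -/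
lemma norm_symT_sub_le (m k : ℤ) : ‖symT m - symT k‖ ≤ 2 * wt (m - k) := by
  have h1 : ∀ k, ‖symT k + ((|(k : ℝ)| : ℝ) : ℂ)‖ ≤ 1 := by
    intro k
    unfold symT
    split_ifs with h
    · simp [h]
    · simp
  by_cases hmk : m = k
  · subst hmk; simp [wt]
  have h2 : ‖((|(k : ℝ)| : ℝ) : ℂ) - ((|(m : ℝ)| : ℝ) : ℂ)‖ ≤ |((m - k : ℤ) : ℝ)| := by
    rw [← Complex.ofReal_sub, Complex.norm_real, Real.norm_eq_abs]
    push_cast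
    rw [abs_sub_comm (m : ℝ)]
    exact abs_abs_sub_abs_le _ _
  calc ‖symT m - symT k‖ = ‖(symT m + ((|(m : ℝ)| : ℝ) : ℂ)) - (symT k + ((|(k : ℝ)| : ℝ) : ℂ)) +
        (((|(k : ℝ)| : ℝ) : ℂ) - ((|(m : ℝ)| : ℝ) : ℂ))‖ := by congr 1; ring
    _ ≤ 1 + 1 + |((m - k : ℤ) : ℝ)| := by
        refine (norm_add_le _ _).trans (add_le_add ((norm_sub_le _ _).trans
          (add_le_add (h1 m) (h1 k))) h2)
    _ ≤ 2 * wt (m - k) := by unfold wt; linarith [abs_nonneg ((m - k : ℤ) : ℝ)]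

lemma wt_natCast (n : ℕ) : wt n = 1 + n := by unfold wt; simp

lemma exists_symS₁_bound : ∃ C : ℝ, ∀ k, ‖symS₁ k‖ ≤ C * wt k ^ (-2 : ℤ) := by
  have hp : ∀ n : ℕ, 3 ≤ n → ‖symS₁ n‖ ≤ 4 * wt n ^ (-2 : ℤ) := by
    intro n hn
    have hx : (3 : ℝ) ≤ n := by exact_mod_cast hn
    have h1 : (0 : ℝ) < n - 1 := by linarith
    have e : symS₁ n = (((1 / (2 * (n - 1) * (n + 1)) : ℝ)) : ℂ) * Complex.I := by
      unfold symS₁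
      rw [logCoef_of_pos (by omega), logCoef_of_pos (by omega)]
      have h1C : ((n : ℂ) - 1) ≠ 0 := by exact_mod_cast h1.ne'
      have h2C : ((n : ℂ) + 1) ≠ 0 := by exact_mod_cast n.succ_ne_zero
      have hI := Complex.I_ne_zero
      have hpi : (π : ℂ) ≠ 0 := by exact_mod_cast pi_ne_zero
      push_cast
      field_simp
      linear_combination (-8) * Complex.I_sq
    rw [e, norm_mul, Complex.norm_I, mul_one, Complex.norm_real, Real.norm_of_nonneg (by positivity),
      wt_natCast, zpow_neg, ← div_eq_mul_inv, div_le_div_iff₀ (by positivity) (by positivity)]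
    have : ((1 + n : ℝ)) ^ (2 : ℤ) = (1 + n) * (1 + n) := by norm_cast; ring
    rw [this]
    nlinarith
  refine exists_wt_bound 3 hp fun n hn => ?_
  have : symS₁ (-n) = -symS₁ n := by
    unfold symS₁
    rw [← logCoef_neg, ← logCoef_neg (-(n : ℤ) + 1)]
    rw [show -(-(n : ℤ) - 1) = n + 1 by ring, show -(-(n : ℤ) + 1) = n - 1 by ring]; ring
  rw [this, norm_neg]; exact hp n hn

lemma symS₂_natCast {n : ℕ} (hn : 3 ≤ n) : symS₂ n = ((-(1 / (2 * n * (n - 2) * (n + 2))) : ℝ) : ℂ) := by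
  have hx : (3 : ℝ) ≤ n := by exact_mod_cast hn
  have h0 : (n : ℂ) ≠ 0 := by exact_mod_cast (by omega : n ≠ 0)
  have h1 : ((n : ℂ) - 2) ≠ 0 := by exact_mod_cast (by linarith : (n : ℝ) - 2 > 0).ne'
  have h2 : ((n : ℂ) + 2) ≠ 0 := by exact_mod_cast (n + 1).succ_ne_zero
  have hpi : (π : ℂ) ≠ 0 := by exact_mod_cast pi_ne_zero
  unfold symS₂
  rw [logCoef_of_pos (by omega), logCoef_of_pos (by omega), logCoef_of_pos (by omega)]
  push_cast
  field_simp
  ring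

lemma symS₂_neg (k : ℤ) : symS₂ (-k) = symS₂ k := by
  unfold symS₂
  rw [← logCoef_neg (-k - 2), ← logCoef_neg (-k + 2), logCoef_neg k]
  rw [show -(-k - 2) = k + 2 by ring, show -(-k + 2) = k - 2 by ring]; ring

lemma exists_symS₂_bound : ∃ C : ℝ, ∀ k, ‖symS₂ k‖ ≤ C * wt k ^ (-3 : ℤ) := by
  have hp : ∀ n : ℕ, 3 ≤ n → ‖symS₂ n‖ ≤ 8 * wt n ^ (-3 : ℤ) := by
    intro n hn
    have hx : (3 : ℝ) ≤ n := by exact_mod_cast hn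
    have h2 : (1 + n : ℝ) ≤ 4 * (n - 2) := by linarith
    have h3 : (1 + n : ℝ) ≤ 2 * n := by linarith
    have h2' : (0 : ℝ) < n - 2 := by linarith
    rw [symS₂_natCast hn, Complex.norm_real, norm_neg, Real.norm_of_nonneg (by positivity),
      wt_natCast, zpow_neg, ← div_eq_mul_inv, div_le_div_iff₀ (by positivity) (by positivity)]
    have : ((1 + n : ℝ)) ^ (3 : ℤ) = (1 + n) * (1 + n) * (1 + n) := by norm_cast; ring
    rw [this]
    calc 1 * ((1 + n : ℝ) * (1 + n) * (1 + n)) ≤ 1 * ((2 * n) * (4 * (n - 2)) * (n + 2)) := by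
          have h5 : (1 + n : ℝ) ≤ n + 2 := by linarith
          gcongr
      _ ≤ 8 * (2 * n * (n - 2) * (n + 2)) := by
          have : (0 : ℝ) ≤ n * (n - 2) * (n + 2) := by positivity
          linarith
  exact exists_wt_bound 3 hp fun n hn => by rw [symS₂_neg]; exact hp n hn

lemma symS_neg (k : ℤ) : symS (-k) = symS k := by unfold symS; simp

lemma symT_neg (k : ℤ) : symT (-k) = symT k := by unfold symT; simp

/-- `S₂T₀` agrees with `½ S₀S₀` up to terms of order `-3`. -/
lemma exists_symS₂_mul_symT_bound :
    ∃ C : ℝ, ∀ k, ‖symS₂ k * symT k - 1 / 2 * (symS k * symS k)‖ ≤ C * wt k ^ (-3 : ℤ) := by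
  have hp : ∀ n : ℕ, 3 ≤ n →
      ‖symS₂ n * symT n - 1 / 2 * (symS n * symS n)‖ ≤ 32 * wt n ^ (-3 : ℤ) := by
    intro n hn
    have hx : (3 : ℝ) ≤ n := by exact_mod_cast hn
    have h2 : (1 + n : ℝ) ≤ 4 * (n - 2) := by linarith
    have h3 : (1 + n : ℝ) ≤ 2 * n := by linarith
    have h2' : (0 : ℝ) < n - 2 := by linarith
    -- Here `symS₂ n * symT n = 1 / (2 (n² - 4))`, while `½ symS n ^ 2 = 1 / (2 n²)`; the leading
    -- terms cancel.
    have e : symS₂ n * symT n - 1 / 2 * (symS n * symS n) =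
        ((2 / (n * n * (n - 2) * (n + 2)) : ℝ) : ℂ) := by
      have h0 : (n : ℂ) ≠ 0 := by exact_mod_cast (by omega : n ≠ 0)
      have h1 : ((n : ℂ) - 2) ≠ 0 := by exact_mod_cast (by linarith : (n : ℝ) - 2 > 0).ne'
      have h2 : ((n : ℂ) + 2) ≠ 0 := by exact_mod_cast (n + 1).succ_ne_zero
      rw [symS₂_natCast hn]
      unfold symT symS
      rw [if_neg (by omega), if_neg (by omega)]
      have : |((n : ℤ) : ℝ)| = n := by simp
      rw [this]
      push_cast
      field_simp
      ring
    rw [e, Complex.norm_real, Real.norm_of_nonneg (by positivity),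
      wt_natCast, zpow_neg, ← div_eq_mul_inv, div_le_div_iff₀ (by positivity) (by positivity)]
    have : ((1 + n : ℝ)) ^ (3 : ℤ) = (1 + n) * (1 + n) * (1 + n) := by norm_cast; ring
    rw [this]
    calc 2 * ((1 + n : ℝ) * (1 + n) * (1 + n)) ≤ 2 * ((2 * n) * (4 * (n - 2)) * (n + 2)) := by
          have h5 : (1 + n : ℝ) ≤ n + 2 := by linarith
          gcongr
      _ = 16 * (n * (n - 2) * (n + 2)) * 1 := by ring
      _ ≤ 32 * (n * (n - 2) * (n + 2)) * n := by gcongr <;> linarith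
      _ = 32 * (n * n * (n - 2) * (n + 2)) := by ring
  exact exists_wt_bound 3 hp fun n hn => by
    rw [symS₂_neg, symS_neg, symT_neg]; exact hp n hn

/-- Multiplying the logarithm by a trigonometric polynomial shifts and combines its Fourier
coefficients. -/
lemma integral_logKer_mul {f : ℝ → ℂ} (c : ℂ) {ι : Finset ℤ} {a : ℤ → ℂ}
    (hf : ∀ s, f s = c * ∑ j ∈ ι, a j * expo j s) (k : ℤ) :
    ∫ s in (0 : ℝ)..(2 * π), logKer s * f s * expo (-k) s = c * ∑ j ∈ ι, a j * logCoef (k - j) := by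
  have hi : ∀ j, IntervalIntegrable (fun s => logKer s * expo (-(k - j)) s) MeasureTheory.volume 0
      (2 * π) := fun j =>
    (intervalIntegrable_logKer _ _).mul_continuousOn (continuous_expo _).continuousOn
  have : ∀ s, logKer s * f s * expo (-k) s =
      c * ∑ j ∈ ι, a j * (logKer s * expo (-(k - j)) s) := by
    intro s
    rw [hf, Finset.mul_sum, Finset.mul_sum, Finset.mul_sum, Finset.sum_mul]
    refine Finset.sum_congr rfl fun j _ => ?_
    rw [show -(k - j) = j + -k by ring, expo_add]; ring
  simp only [this]
  rw [intervalIntegral.integral_const_mul, intervalIntegral.integral_finsetSum fun j _ =>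
    (hi j).const_mul (a j)]
  simp only [intervalIntegral.integral_const_mul]
  rfl

lemma periodic_logKer_mul {f : ℝ → ℂ} (hf : Function.Periodic f (2 * π)) :
    Function.Periodic (fun s => logKer s * f s) (2 * π) := logKer_periodic.mul hf

lemma intervalIntegrable_logKer_mul {f : ℝ → ℂ} (hf : Continuous f) :
    IntervalIntegrable (fun s => logKer s * f s) MeasureTheory.volume 0 (2 * π) :=
  (intervalIntegrable_logKer _ _).mul_continuousOn hf.continuousOn

/-! ### Operators with logarithmic kernels -/

/-- Take `ℓ = 1` in the kernel theorem: its coefficients vanish off `k = 0`, where the weight is 1,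
so any order is allowed. -/
lemma BiSmooth.exists_rep_smooth {F : ℝ → ℝ → ℂ} (hF : BiSmooth F) (d : ℤ) :
    ∃ A, IsOrd d A ∧ Rep (kernelOp F) A := by
  have h := hF.exists_rep_kernelOp (ℓ := fun _ => 1) (fun _ => rfl) intervalIntegrable_const
    (d := d) (C := 2 * π) (fun k => by
      simp only [one_mul, integral_expo]
      split_ifs with hk
      · obtain rfl : k = 0 := by omega
        simp [wt, abs_of_pos pi_pos]
      · rw [norm_zero]; have := zpow_pos (wt_pos k) d; positivity)
  simpa only [mul_one] using h

lemma expDiff_eq (t ζ : ℝ) : expDiff t ζ = expo 1 ζ * (expo 1 (t - ζ) - 1) := by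
  unfold expDiff
  have : expo 1 t = expo 1 ζ * expo 1 (t - ζ) := by rw [← expo_add_arg]; congr 1; ring
  rw [this]; ring

lemma expo_pow (k : ℤ) (j : ℕ) (t : ℝ) : expo k t ^ j = expo (j * k) t := by
  unfold expo; rw [← Complex.exp_nat_mul]; congr 1; push_cast; ring

/-- The Fourier integrals of `(e^{is} - 1)^j ln (4 sin² (s/2))`. -/
def logDiffCoef (j : ℕ) (k : ℤ) : ℂ :=
  ∫ s in (0 : ℝ)..(2 * π), logKer s * (expo 1 s - 1) ^ j * expo (-k) s

lemma logDiffCoef_two (k : ℤ) :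
    logDiffCoef 2 k = logCoef k - 2 * logCoef (k - 1) + logCoef (k - 2) := by
  have h := integral_logKer_mul (f := fun s => (expo 1 s - 1) ^ 2) 1 (ι := {0, 1, 2})
    (a := fun j => if j = 1 then -2 else 1) (fun s => by
      have : expo 2 s = expo 1 s ^ 2 := by rw [expo_pow]; rfl
      simp [this, expo_zero]; ring) k
  unfold logDiffCoef
  rw [h]
  simp; ring

lemma logDiffCoef_three (k : ℤ) :
    logDiffCoef 3 k =
      -logCoef k + 3 * logCoef (k - 1) - 3 * logCoef (k - 2) + logCoef (k - 3) := by
  have h := integral_logKer_mul (f := fun s => (expo 1 s - 1) ^ 3) 1 (ι := {0, 1, 2, 3})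
    (a := fun j => if j = 0 then -1 else if j = 1 then 3 else if j = 2 then -3 else 1) (fun s => by
      have h2 : expo 2 s = expo 1 s ^ 2 := by rw [expo_pow]; rfl
      have h3 : expo 3 s = expo 1 s ^ 3 := by rw [expo_pow]; rfl
      simp [h2, h3, expo_zero]; ring) k
  unfold logDiffCoef
  rw [h]
  simp; ring

lemma exists_logDiffCoef_two_bound : ∃ C : ℝ, ∀ k, ‖logDiffCoef 2 k‖ ≤ C * wt k ^ (-3 : ℤ) := by
  have key : ∀ x : ℝ, 3 ≤ x → 4 * π / (x * (x - 1) * (x - 2)) ≤ 64 * π * (1 + x) ^ (-3 : ℤ) := by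
    intro x hx
    have h2 : (1 + x : ℝ) ≤ 4 * (x - 2) := by linarith
    have h1 : (1 + x : ℝ) ≤ 2 * (x - 1) := by linarith
    have h0 : (1 + x : ℝ) ≤ 2 * x := by linarith
    have e2 : (0 : ℝ) < x - 2 := by linarith
    have e1 : (0 : ℝ) < x - 1 := by linarith
    rw [zpow_neg, ← div_eq_mul_inv, div_le_div_iff₀ (by positivity) (by positivity)]
    have : ((1 + x : ℝ)) ^ (3 : ℤ) = (1 + x) * (1 + x) * (1 + x) := by norm_cast; ring
    rw [this]
    calc 4 * π * ((1 + x) * (1 + x) * (1 + x)) ≤ 4 * π * ((2 * x) * (2 * (x - 1)) * (4 * (x - 2))) := by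
          gcongr
      _ = _ := by ring
  refine exists_wt_bound (C := 64 * π) 3 (fun n hn => ?_) (fun n hn => ?_)
  · have hx : (3 : ℝ) ≤ n := by exact_mod_cast hn
    have e2 : (0 : ℝ) < n - 2 := by linarith
    have e1 : (0 : ℝ) < n - 1 := by linarith
    have e : logDiffCoef 2 n = ((-(4 * π / (n * (n - 1) * (n - 2))) : ℝ) : ℂ) := by
      have h0 : (n : ℂ) ≠ 0 := by exact_mod_cast (by omega : n ≠ 0)
      have h1 : ((n : ℂ) - 1) ≠ 0 := by exact_mod_cast e1.ne'
      have h2 : ((n : ℂ) - 2) ≠ 0 := by exact_mod_cast e2.ne'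
      rw [logDiffCoef_two, logCoef_of_pos (by omega), logCoef_of_pos (by omega),
        logCoef_of_pos (by omega)]
      push_cast
      field_simp
      ring
    rw [e, Complex.norm_real, norm_neg, Real.norm_of_nonneg (by positivity), wt_natCast]
    exact key n hx
  · have hx : (3 : ℝ) ≤ n := by exact_mod_cast hn
    -- The second difference is centred at `k - 1`, and `logCoef` is even, so the value at `-n`
    -- equals the value at `n + 2`.
    have e : logDiffCoef 2 (-n) = ((-(4 * π / ((n + 2 : ℝ) * (n + 2 - 1) * (n + 2 - 2))) : ℝ) : ℂ) := by
      have h0 : (n : ℂ) ≠ 0 := by exact_mod_cast (by omega : n ≠ 0)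
      have h1 : ((n : ℂ) + 1) ≠ 0 := by exact_mod_cast n.succ_ne_zero
      have h2 : ((n : ℂ) + 2) ≠ 0 := by exact_mod_cast (n + 1).succ_ne_zero
      rw [logDiffCoef_two, logCoef_of_neg (by omega), logCoef_of_neg (by omega),
        logCoef_of_neg (by omega)]
      have h1' : (-(n : ℂ) - 1) ≠ 0 := by rw [← neg_add']; exact neg_ne_zero.mpr h1
      have h2' : (-(n : ℂ) - 2) ≠ 0 := by rw [← neg_add']; exact neg_ne_zero.mpr h2
      have h3 : (n : ℂ) + 2 - 1 ≠ 0 := by rw [show (n : ℂ) + 2 - 1 = n + 1 by ring]; exact h1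
      have h4 : (n : ℂ) + 2 - 2 ≠ 0 := by simpa using h0
      push_cast
      field_simp
      ring
    have e1 : (0 : ℝ) < n + 2 - 1 := by linarith
    have e2 : (0 : ℝ) < n + 2 - 2 := by linarith
    rw [e, Complex.norm_real, norm_neg, Real.norm_of_nonneg (by positivity), wt_natCast]
    refine (key (n + 2) (by linarith)).trans ?_
    have h := zpow_le_zpow_left₀ (n := 3) (by norm_num) (show (0 : ℝ) ≤ 1 + n by linarith)
      (show (1 + n : ℝ) ≤ 1 + (n + 2) by linarith)
    rw [zpow_neg, zpow_neg]
    gcongr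

lemma exists_logDiffCoef_three_bound : ∃ C : ℝ, ∀ k, ‖logDiffCoef 3 k‖ ≤ C * wt k ^ (-4 : ℤ) := by
  have key : ∀ x : ℝ, 4 ≤ x →
      12 * π / (x * (x - 1) * (x - 2) * (x - 3)) ≤ 720 * π * (1 + x) ^ (-4 : ℤ) := by
    intro x hx
    have h3 : (1 + x : ℝ) ≤ 5 * (x - 3) := by linarith
    have h2 : (1 + x : ℝ) ≤ 3 * (x - 2) := by linarith
    have h1 : (1 + x : ℝ) ≤ 2 * (x - 1) := by linarith
    have h0 : (1 + x : ℝ) ≤ 2 * x := by linarith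
    have e3 : (0 : ℝ) < x - 3 := by linarith
    have e2 : (0 : ℝ) < x - 2 := by linarith
    have e1 : (0 : ℝ) < x - 1 := by linarith
    rw [zpow_neg, ← div_eq_mul_inv, div_le_div_iff₀ (by positivity) (by positivity)]
    have : ((1 + x : ℝ)) ^ (4 : ℤ) = (1 + x) * (1 + x) * (1 + x) * (1 + x) := by norm_cast; ring
    rw [this]
    calc 12 * π * ((1 + x) * (1 + x) * (1 + x) * (1 + x)) ≤
        12 * π * ((2 * x) * (2 * (x - 1)) * (3 * (x - 2)) * (5 * (x - 3))) := by
          gcongr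
      _ = _ := by ring
  refine exists_wt_bound (C := 720 * π) 4 (fun n hn => ?_) (fun n hn => ?_)
  · have hx : (4 : ℝ) ≤ n := by exact_mod_cast hn
    have e3 : (0 : ℝ) < n - 3 := by linarith
    have e2 : (0 : ℝ) < n - 2 := by linarith
    have e1 : (0 : ℝ) < n - 1 := by linarith
    have e : logDiffCoef 3 n = ((-(12 * π / (n * (n - 1) * (n - 2) * (n - 3))) : ℝ) : ℂ) := by
      have h0 : (n : ℂ) ≠ 0 := by exact_mod_cast (by omega : n ≠ 0)
      have h1 : ((n : ℂ) - 1) ≠ 0 := by exact_mod_cast e1.ne'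
      have h2 : ((n : ℂ) - 2) ≠ 0 := by exact_mod_cast e2.ne'
      have h3 : ((n : ℂ) - 3) ≠ 0 := by exact_mod_cast e3.ne'
      rw [logDiffCoef_three, logCoef_of_pos (by omega), logCoef_of_pos (by omega),
        logCoef_of_pos (by omega), logCoef_of_pos (by omega)]
      push_cast
      field_simp
      ring
    rw [e, Complex.norm_real, norm_neg, Real.norm_of_nonneg (by positivity), wt_natCast]
    exact key n hx
  · have hx : (4 : ℝ) ≤ n := by exact_mod_cast hn
    -- The third difference is odd about `k = 3/2`, so the value at `-n` is minus the value at `n +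
    -- 3`.
    have e : logDiffCoef 3 (-n) =
        ((12 * π / ((n + 3 : ℝ) * (n + 3 - 1) * (n + 3 - 2) * (n + 3 - 3)) : ℝ) : ℂ) := by
      have h0 : (n : ℂ) ≠ 0 := by exact_mod_cast (by omega : n ≠ 0)
      have h1 : ((n : ℂ) + 1) ≠ 0 := by exact_mod_cast n.succ_ne_zero
      have h2 : ((n : ℂ) + 2) ≠ 0 := by exact_mod_cast (n + 1).succ_ne_zero
      have h3 : ((n : ℂ) + 3) ≠ 0 := by exact_mod_cast (n + 2).succ_ne_zero
      rw [logDiffCoef_three, logCoef_of_neg (by omega), logCoef_of_neg (by omega),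
        logCoef_of_neg (by omega), logCoef_of_neg (by omega)]
      have h1' : (-(n : ℂ) - 1) ≠ 0 := by rw [← neg_add']; exact neg_ne_zero.mpr h1
      have h2' : (-(n : ℂ) - 2) ≠ 0 := by rw [← neg_add']; exact neg_ne_zero.mpr h2
      have h3' : (-(n : ℂ) - 3) ≠ 0 := by rw [← neg_add']; exact neg_ne_zero.mpr h3
      have h4 : (n : ℂ) + 3 - 1 ≠ 0 := by rw [show (n : ℂ) + 3 - 1 = n + 2 by ring]; exact h2
      have h5 : (n : ℂ) + 3 - 2 ≠ 0 := by rw [show (n : ℂ) + 3 - 2 = n + 1 by ring]; exact h1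
      have h6 : (n : ℂ) + 3 - 3 ≠ 0 := by simpa using h0
      push_cast
      field_simp
      ring
    have e1 : (0 : ℝ) < n + 3 - 1 := by linarith
    have e2 : (0 : ℝ) < n + 3 - 2 := by linarith
    have e3 : (0 : ℝ) < n + 3 - 3 := by linarith
    rw [e, Complex.norm_real, Real.norm_of_nonneg (by positivity), wt_natCast]
    refine (key (n + 3) (by linarith)).trans ?_
    have h := zpow_le_zpow_left₀ (n := 4) (by norm_num) (show (0 : ℝ) ≤ 1 + n by linarith)
      (show (1 + n : ℝ) ≤ 1 + (n + 3) by linarith)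
    rw [zpow_neg, zpow_neg]
    gcongr

/-- Since `e^{it} - e^{iζ} = e^{iζ} (e^{i(t-ζ)} - 1)`, the power moves into the convolution factor,
whose coefficients become `j`-th differences of those of the logarithm. -/
lemma BiSmooth.exists_rep_expDiff_pow {F : ℝ → ℝ → ℂ} (hF : BiSmooth F) {j : ℕ} {d : ℤ} {C : ℝ}
    (hC : ∀ k, ‖logDiffCoef j k‖ ≤ C * wt k ^ d) :
    ∃ A, IsOrd d A ∧ Rep (kernelOp fun t ζ => expDiff t ζ ^ j * F t ζ * logSin t ζ) A := by
  have hc : Continuous fun s => (expo 1 s - 1) ^ j :=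
    ((continuous_expo 1).sub continuous_const).pow j
  have hper : Function.Periodic (fun s => (expo 1 s - 1) ^ j) (2 * π) := fun s => by
    simp only [expo_periodic 1 s]
  have h := ((BiSmooth.ofRight (smoothPeriodic_expo j)).mul hF).exists_rep_kernelOp
    (periodic_logKer_mul hper) (intervalIntegrable_logKer_mul hc) hC
  have e : (fun t ζ => expDiff t ζ ^ j * F t ζ * logSin t ζ) =
      fun t ζ => expo j ζ * F t ζ * (logKer (t - ζ) * (expo 1 (t - ζ) - 1) ^ j) := by
    ext t ζ
    rw [logSin_eq, expDiff_eq, mul_pow, expo_pow]; simp; ring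
  rw [e]; exact h

/-! ### Integral operators with logarithmic kernels -/

/-- `a` is an integral operator with kernel `A(t,ζ) ln (4 sin² ((t-ζ)/2)) + B(t,ζ)`, where `A` and
`B` are smooth. -/
structure IsLogOp (a : Op) (A B : ℝ → ℝ → ℂ) : Prop where
  log : BiSmooth A
  smooth : BiSmooth B
  eq : ∀ u : RD, a (synth u) = kernelOp (fun t ζ => A t ζ * logSin t ζ + B t ζ) (synth u)

lemma intervalIntegrable_logSin {f : ℝ → ℂ} (hf : Continuous f) (t : ℝ) :
    IntervalIntegrable (fun ζ => logSin t ζ * f ζ) MeasureTheory.volume 0 (2 * π) := by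
  have h := (intervalIntegrable_logKer (t - 0) (t - 2 * π)).comp_sub_left t
  simp only [sub_sub_cancel] at h
  exact h.mul_continuousOn hf.continuousOn

lemma BiSmooth.continuous_right {A : ℝ → ℝ → ℂ} (h : BiSmooth A) (t : ℝ) : Continuous (A t) :=
  (h.right t).continuous

lemma intervalIntegrable_log_add {A B : ℝ → ℝ → ℂ} (hA : BiSmooth A) (hB : BiSmooth B) {φ : ℝ → ℂ}
    (hφ : Continuous φ) (t : ℝ) :
    IntervalIntegrable (fun ζ => (A t ζ * logSin t ζ + B t ζ) * φ ζ) MeasureTheory.volume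
      0 (2 * π) := by
  have h1 := intervalIntegrable_logSin ((hA.continuous_right t).mul hφ) t
  have h2 := ((hB.continuous_right t).mul hφ).intervalIntegrable (μ := MeasureTheory.volume) 0 (2 * π)
  refine (h1.add h2).congr fun ζ _ => ?_
  simp only [Pi.mul_apply]; ring

lemma IsLogOp.add {a b : Op} {A B A' B' : ℝ → ℝ → ℂ} (ha : IsLogOp a A B) (hb : IsLogOp b A' B') :
    IsLogOp (a + b) (fun t ζ => A t ζ + A' t ζ) (fun t ζ => B t ζ + B' t ζ) := by
  refine ⟨ha.log.add hb.log, ha.smooth.add hb.smooth, fun u => ?_⟩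
  have hu := u.2.smoothPeriodic.continuous
  ext t
  rw [Pi.add_apply, Pi.add_apply, ha.eq, hb.eq]
  unfold kernelOp
  rw [← intervalIntegral.integral_add (intervalIntegrable_log_add ha.log ha.smooth hu t)
    (intervalIntegrable_log_add hb.log hb.smooth hu t)]
  congr 1; ext ζ; ring

lemma IsLogOp.smul {a : Op} {A B : ℝ → ℝ → ℂ} (ha : IsLogOp a A B) (c : ℂ) :
    IsLogOp (c • a) (fun t ζ => c * A t ζ) (fun t ζ => c * B t ζ) := by
  refine ⟨(BiSmooth.const c).mul ha.log, (BiSmooth.const c).mul ha.smooth, fun u => ?_⟩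
  ext t
  rw [Pi.smul_apply, Pi.smul_apply, ha.eq]
  unfold kernelOp
  rw [smul_eq_mul, ← intervalIntegral.integral_const_mul]
  congr 1; ext ζ; ring

lemma IsLogOp.sub {a b : Op} {A B A' B' : ℝ → ℝ → ℂ} (ha : IsLogOp a A B) (hb : IsLogOp b A' B') :
    IsLogOp (a - b) (fun t ζ => A t ζ - A' t ζ) (fun t ζ => B t ζ - B' t ζ) := by
  have h := ha.add (hb.smul (-1))
  have e1 : a - b = a + (-1 : ℂ) • b := by ext; simp [sub_eq_add_neg]
  simp only [neg_one_mul, ← sub_eq_add_neg] at h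
  rw [e1]; exact h

lemma IsLogOp.mulOp_comp {a : Op} {A B : ℝ → ℝ → ℂ} (ha : IsLogOp a A B) {f : ℝ → ℝ}
    (hf : SmoothPeriodic fun t => (f t : ℂ)) :
    IsLogOp (mulOp f ∘ a) (fun t ζ => f t * A t ζ) (fun t ζ => f t * B t ζ) := by
  refine ⟨(BiSmooth.ofLeft hf).mul ha.log, (BiSmooth.ofLeft hf).mul ha.smooth, fun u => ?_⟩
  ext t
  rw [Function.comp_apply, ha.eq]
  unfold kernelOp mulOp
  rw [← intervalIntegral.integral_const_mul]
  congr 1; ext ζ; ring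

lemma exists_eq_sub_of_expDiff_eq_zero {t ζ : ℝ} (hζ : expDiff t ζ = 0) :
    ∃ n : ℤ, t - n * (2 * π) = ζ := by
  have h : expo 1 t = expo 1 ζ := sub_eq_zero.mp hζ
  unfold expo at h
  obtain ⟨n, hn⟩ := Complex.exp_eq_exp_iff_exists_int.mp h
  refine ⟨n, ?_⟩
  have h2 : (t : ℂ) = ζ + n * (2 * π) := by
    have hI := Complex.I_ne_zero
    apply mul_left_cancel₀ hI
    push_cast at hn
    linear_combination hn
  have h3 : t = ζ + n * (2 * π) := by exact_mod_cast h2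
  linarith

lemma countable_expDiff_eq_zero (t : ℝ) : {ζ : ℝ | expDiff t ζ = 0}.Countable :=
  (Set.countable_range fun n : ℤ => t - n * (2 * π)).mono fun _ hζ =>
    exists_eq_sub_of_expDiff_eq_zero hζ

/-- For fixed `t` the exceptional `ζ` are countable, hence null. The default values of logarithms
and quotients on the diagonal therefore play no role. -/
lemma isLogOp_kernelOp {χ A B : ℝ → ℝ → ℂ} (hA : BiSmooth A) (hB : BiSmooth B)
    (h : ∀ t ζ, expDiff t ζ ≠ 0 → χ t ζ = A t ζ * logSin t ζ + B t ζ) :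
    IsLogOp (kernelOp χ) A B := by
  refine ⟨hA, hB, fun u => ?_⟩
  ext t
  unfold kernelOp
  refine intervalIntegral.integral_congr_ae ?_
  filter_upwards [MeasureTheory.compl_mem_ae_iff.mpr
    ((countable_expDiff_eq_zero t).measure_zero MeasureTheory.volume)] with ζ hζ _
  rw [h t ζ hζ]

/-- If the logarithmic part of the kernel is divisible by a power of `e^{it} - e^{iζ}`, then the
order of the operator drops accordingly. -/
lemma IsLogOp.exists_rep {a : Op} {A B F : ℝ → ℝ → ℂ} (ha : IsLogOp a A B) (hF : BiSmooth F) {j : ℕ}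
    (hA : ∀ t ζ, A t ζ = expDiff t ζ ^ j * F t ζ) {d : ℤ}
    (hC : ∃ C : ℝ, ∀ k, ‖logDiffCoef j k‖ ≤ C * wt k ^ d) : ∃ A', IsOrd d A' ∧ Rep a A' := by
  obtain ⟨C, hC⟩ := hC
  obtain ⟨A₁, h1, r1⟩ := hF.exists_rep_expDiff_pow hC
  obtain ⟨A₂, h2, r2⟩ := ha.smooth.exists_rep_smooth d
  refine ⟨A₁ + A₂, h1.add h2, fun u => ?_⟩
  have hu := u.2.smoothPeriodic.continuous
  rw [LinearMap.add_apply, synth_add, ← r1, ← r2, ha.eq]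
  ext t
  rw [Pi.add_apply]
  unfold kernelOp
  have i1 := intervalIntegrable_log_add ha.log (BiSmooth.const 0) hu t
  have i2 : IntervalIntegrable (fun ζ => B t ζ * synth u ζ) MeasureTheory.volume 0 (2 * π) :=
    ((ha.smooth.continuous_right t).mul hu).intervalIntegrable _ _
  simp only [← hA]
  simp only [add_zero] at i1
  rw [← intervalIntegral.integral_add i1 i2]
  congr 1; ext ζ; ring

/-! ### The model operators -/

/-- The symbol of `M₀`. -/
def symM (k : ℤ) : ℂ := if k = 0 then Complex.I else 0

lemma norm_symM_le (d : ℤ) (k : ℤ) : ‖symM k‖ ≤ 1 * wt k ^ d := by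
  unfold symM
  split_ifs with h
  · subst h; simp [wt]
  · simpa using (zpow_pos (wt_pos k) d).le

lemma integral_synth (u : RD) :
    ∫ ζ in (0 : ℝ)..(2 * π), synth u ζ = 2 * π * (u : ℤ → ℂ) 0 := by
  have := fourierCoef_synth u.2 0
  rw [fourierCoef_eq] at this
  simp only [neg_zero, expo_zero, mul_one] at this
  rw [← this]
  have := two_pi_ne_zero'
  field_simp

lemma repMult_opM0 : RepMult opM0 symM := by
  intro u
  ext t
  unfold opM0
  rw [integral_synth, tsum_eq_single 0]
  · have := two_pi_ne_zero'
    simp only [symM, if_true, expo_zero]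
    field_simp
  · intro k hk
    simp [symM, hk]

lemma repMult_opS0tilde : RepMult opS0tilde (fun k => -(1 / (2 * π)) * logCoef k) := by
  have h := repMult_kernelOp (periodic_logKer_mul (f := fun _ => -(1 / (2 * (π : ℂ)))) fun _ => rfl)
    (intervalIntegrable_logKer_mul continuous_const)
  have e : opS0tilde = kernelOp fun t ζ => logKer (t - ζ) * (-(1 / (2 * (π : ℂ)))) := by
    unfold opS0tilde
    congr 1; ext t ζ
    rw [logSin_eq]; ring
  rw [e]
  refine h.congr fun k => ?_
  have := integral_logKer_mul (f := fun _ => -(1 / (2 * (π : ℂ)))) (-(1 / (2 * (π : ℂ))))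
    (ι := {0}) (a := fun _ => 1) (fun s => by simp [expo_zero]) k
  rw [this]; simp

lemma symS_eq (k : ℤ) : -(1 / (2 * π)) * logCoef k + symM k = symS k := by
  have hpi : (π : ℂ) ≠ 0 := by exact_mod_cast pi_ne_zero
  unfold symM symS
  rcases lt_trichotomy k 0 with h | rfl | h
  · rw [if_neg h.ne, if_neg h.ne, logCoef_of_neg h, abs_of_neg (by exact_mod_cast h)]
    have : (k : ℂ) ≠ 0 := by exact_mod_cast h.ne
    push_cast
    field_simp
    simp
  · simp [logCoef_zero]
  · rw [if_neg h.ne', if_neg h.ne', logCoef_of_pos h, abs_of_pos (by exact_mod_cast h)]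
    have : (k : ℂ) ≠ 0 := by exact_mod_cast h.ne'
    push_cast
    field_simp
    simp

lemma norm_symS0tilde_le (k : ℤ) : ‖-(1 / (2 * π)) * logCoef k‖ ≤ 3 * wt k ^ (-1 : ℤ) := by
  have e : -(1 / (2 * π)) * logCoef k = symS k - symM k := by rw [← symS_eq]; ring
  rw [e]
  refine (norm_sub_le _ _).trans ?_
  have := norm_symS_le k
  have := norm_symM_le (-1) k
  linarith

lemma repMult_opS0 : RepMult opS0 symS :=
  (repMult_opS0tilde.add repMult_opM0 norm_symS0tilde_le (norm_symM_le 0)).congr symS_eq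

lemma ofReal_sin_eq (s : ℝ) : ((Real.sin s : ℝ) : ℂ) = (expo 1 s - expo (-1) s) / (2 * Complex.I) := by
  unfold expo
  rw [Complex.ofReal_sin, Complex.sin]
  have hI := Complex.I_ne_zero
  field_simp
  rw [Complex.I_sq]
  push_cast
  rw [show (s : ℂ) * Complex.I * -1 = -(s * Complex.I) by ring]
  simp only [mul_one]
  ring_nf

lemma repMult_opS1 : RepMult opS1 symS₁ := by
  have hper : Function.Periodic (fun s => 1 / (4 * (π : ℂ)) * (Real.sin s : ℂ)) (2 * π) := fun s => by
    simp only [Real.sin_add_two_pi]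
  have hc : Continuous (fun s : ℝ => 1 / (4 * (π : ℂ)) * (Real.sin s : ℂ)) := by fun_prop
  have h := repMult_kernelOp (periodic_logKer_mul hper) (intervalIntegrable_logKer_mul hc)
  have e : opS1 = kernelOp fun t ζ =>
      logKer (t - ζ) * (1 / (4 * (π : ℂ)) * (Real.sin (t - ζ) : ℂ)) := by
    unfold opS1
    congr 1; ext t ζ
    rw [logSin_eq]; ring
  rw [e]
  refine h.congr fun k => ?_
  have := integral_logKer_mul (f := fun s => 1 / (4 * (π : ℂ)) * (Real.sin s : ℂ))
    (1 / (8 * π * Complex.I)) (ι := {1, -1}) (a := fun j => if j = 1 then 1 else -1) (fun s => by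
      rw [ofReal_sin_eq]
      have hI := Complex.I_ne_zero
      have hpi : (π : ℂ) ≠ 0 := by exact_mod_cast pi_ne_zero
      rw [Finset.sum_pair (by norm_num)]
      simp only [if_true, if_neg (show (-1 : ℤ) ≠ 1 by norm_num)]
      field_simp
      ring) k
  rw [this, Finset.sum_pair (by norm_num)]
  simp only [if_true, if_neg (show (-1 : ℤ) ≠ 1 by norm_num)]
  unfold symS₁
  rw [sub_neg_eq_add]; ring

lemma repMult_opS2 : RepMult opS2 symS₂ := by
  have hper : Function.Periodic (fun s => -(1 / (8 * (π : ℂ))) * (Real.sin s : ℂ) ^ 2) (2 * π) :=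
    fun s => by simp only [Real.sin_add_two_pi]
  have hc : Continuous (fun s : ℝ => -(1 / (8 * (π : ℂ))) * (Real.sin s : ℂ) ^ 2) := by fun_prop
  have h := repMult_kernelOp (periodic_logKer_mul hper) (intervalIntegrable_logKer_mul hc)
  have e : opS2 = kernelOp fun t ζ =>
      logKer (t - ζ) * (-(1 / (8 * (π : ℂ))) * (Real.sin (t - ζ) : ℂ) ^ 2) := by
    unfold opS2
    congr 1; ext t ζ
    rw [logSin_eq]; ring
  rw [e]
  refine h.congr fun k => ?_
  have := integral_logKer_mul (f := fun s => -(1 / (8 * (π : ℂ))) * (Real.sin s : ℂ) ^ 2)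
    (1 / (32 * π)) (ι := {2, 0, -2}) (a := fun j => if j = 0 then -2 else 1) (fun s => by
      rw [ofReal_sin_eq]
      have hI := Complex.I_ne_zero
      have hpi : (π : ℂ) ≠ 0 := by exact_mod_cast pi_ne_zero
      have e1 : expo 2 s = expo 1 s * expo 1 s := by rw [← expo_add]; rfl
      have e2 : expo (-2) s = expo (-1) s * expo (-1) s := by rw [← expo_add]; rfl
      have e3 : expo 1 s * expo (-1) s = 1 := by rw [← expo_add]; exact expo_zero s
      simp [expo_zero, e1, e2]
      field_simp
      simp only [Complex.I_sq]
      linear_combination 64 * e3) k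
  rw [this]
  simp [symS₂]
  ring

lemma isLogOp_opS0tilde : IsLogOp opS0tilde (fun _ _ => -(1 / (2 * (π : ℂ)))) (fun _ _ => 0) :=
  isLogOp_kernelOp (BiSmooth.const _) (BiSmooth.const _) fun t ζ _ => by ring

lemma biSmooth_sin : BiSmooth fun t ζ => ((Real.sin (t - ζ) : ℝ) : ℂ) := by
  refine ⟨?_, fun t ζ => ?_, fun t ζ => ?_⟩
  · exact Complex.ofRealCLM.contDiff.comp (Real.contDiff_sin.comp (contDiff_fst.sub contDiff_snd))
  · rw [show t + 2 * π - ζ = t - ζ + 2 * π by ring, Real.sin_add_two_pi]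
  · rw [show t - (ζ + 2 * π) = t - ζ - 2 * π by ring, Real.sin_sub_two_pi]

lemma isLogOp_opS1 :
    IsLogOp opS1 (fun t ζ => 1 / (4 * (π : ℂ)) * Real.sin (t - ζ)) (fun _ _ => 0) :=
  isLogOp_kernelOp ((BiSmooth.const _).mul biSmooth_sin) (BiSmooth.const _) fun t ζ _ => by ring

lemma isLogOp_opS2 :
    IsLogOp opS2 (fun t ζ => -(1 / (8 * (π : ℂ))) * (Real.sin (t - ζ) * Real.sin (t - ζ)))
      (fun _ _ => 0) :=
  isLogOp_kernelOp ((BiSmooth.const _).mul (biSmooth_sin.mul biSmooth_sin)) (BiSmooth.const _)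
    fun t ζ _ => by ring

/-! #### The hypersingular model operator -/

lemma norm_expo_sub_one_le (n : ℕ) (s : ℝ) : ‖expo n s - 1‖ ≤ n * ‖expo 1 s - 1‖ := by
  induction n with
  | zero => simp [expo_zero]
  | succ n ih =>
    have : expo ((n + 1 : ℕ) : ℤ) s - 1 = expo n s * (expo 1 s - 1) + (expo n s - 1) := by
      push_cast; rw [expo_add]; ring
    rw [this]
    refine (norm_add_le _ _).trans ?_
    rw [norm_mul, norm_expo]
    push_cast
    linarith

lemma norm_expo_sub_expo_neg_le (k : ℤ) (s : ℝ) :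
    ‖expo k s - expo (-k) s‖ ≤ 2 * |(k : ℝ)| * ‖expo 1 s - 1‖ := by
  have key : ∀ n : ℕ, ‖expo n s - expo (-n) s‖ ≤ 2 * n * ‖expo 1 s - 1‖ := by
    intro n
    have : expo (n : ℤ) s - expo (-n) s = expo (-n) s * (expo ((2 * n : ℕ) : ℤ) s - 1) := by
      rw [mul_sub, ← expo_add, mul_one]; congr 2; push_cast; ring
    rw [this, norm_mul, norm_expo, one_mul]
    simpa using norm_expo_sub_one_le (2 * n) s
  rcases le_total 0 k with h | h
  · obtain ⟨n, rfl⟩ := Int.eq_ofNat_of_zero_le h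
    simpa using key n
  · obtain ⟨n, hn⟩ := Int.eq_ofNat_of_zero_le (show 0 ≤ -k by omega)
    obtain rfl : k = -n := by omega
    rw [neg_neg, norm_sub_rev]
    simpa using key n

lemma expo_sub_one_mul_cot {s : ℝ} (hs : Real.sin (s / 2) ≠ 0) :
    (expo 1 s - 1) * (Real.cot (s / 2) : ℂ) = Complex.I * (expo 1 s + 1) := by
  have hsinC : ((Real.sin (s / 2) : ℝ) : ℂ) ≠ 0 := by exact_mod_cast hs
  have e2 : Complex.exp ((s / 2 : ℝ) * Complex.I) =
      (Real.cos (s / 2) : ℂ) + (Real.sin (s / 2) : ℂ) * Complex.I := by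
    rw [Complex.exp_mul_I]; push_cast; rfl
  have h3 : ((Real.cos (s / 2) : ℝ) : ℂ) ^ 2 + ((Real.sin (s / 2) : ℝ) : ℂ) ^ 2 = 1 := by
    exact_mod_cast Real.cos_sq_add_sin_sq (s / 2)
  have e4 : expo 1 s + 1 = (expo 1 s - 1) + 2 := by ring
  rw [e4, expo_one_sub_one, e2, Real.cot_eq_cos_div_sin]
  push_cast at *
  field_simp
  linear_combination (-Complex.sin (s / 2) ^ 2) * Complex.I_sq + h3

lemma sin_half_ne_zero {s : ℝ} (h : s ∈ uIoc 0 π) : Real.sin (s / 2) ≠ 0 := by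
  rw [uIoc_of_le pi_pos.le] at h
  exact (Real.sin_pos_of_pos_of_lt_pi (by linarith [h.1]) (by linarith [h.2, pi_pos])).ne'

/-- The pole of the cotangent at `0` is cancelled by the zero of `e^{is} - 1`, and the difference of
exponentials contains that zero with a factor of size `2|k|`. -/
lemma norm_cot_mul_le (k : ℤ) {s : ℝ} (hs : Real.sin (s / 2) ≠ 0) :
    ‖(Real.cot (s / 2) : ℂ) * (expo k s - expo (-k) s)‖ ≤ 4 * |(k : ℝ)| := by
  have h1 : ‖expo 1 s - 1‖ * ‖(Real.cot (s / 2) : ℂ)‖ ≤ 2 := by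
    rw [← norm_mul, expo_sub_one_mul_cot hs, norm_mul, Complex.norm_I, one_mul]
    refine (norm_add_le _ _).trans ?_
    rw [norm_expo, norm_one]; norm_num
  rw [norm_mul]
  calc ‖(Real.cot (s / 2) : ℂ)‖ * ‖expo k s - expo (-k) s‖ ≤
      ‖(Real.cot (s / 2) : ℂ)‖ * (2 * |(k : ℝ)| * ‖expo 1 s - 1‖) := by
        gcongr; exact norm_expo_sub_expo_neg_le k s
    _ = 2 * |(k : ℝ)| * (‖expo 1 s - 1‖ * ‖(Real.cot (s / 2) : ℂ)‖) := by ring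
    _ ≤ 2 * |(k : ℝ)| * 2 := by gcongr
    _ = _ := by ring

lemma measurable_cot_half : Measurable fun s : ℝ => (Real.cot (s / 2) : ℂ) := by
  have : Measurable fun s : ℝ => Real.cot (s / 2) := by
    simp only [Real.cot_eq_cos_div_sin]
    exact (Real.measurable_cos.comp (measurable_id.div_const 2)).div
      (Real.measurable_sin.comp (measurable_id.div_const 2))
  exact Complex.measurable_ofReal.comp this

/-- The integrals `∫₀^π cot(s/2) (e^{iks} - e^{-iks}) ds`. -/
def cotInt (k : ℤ) : ℂ := ∫ s in (0 : ℝ)..π, (Real.cot (s / 2) : ℂ) * (expo k s - expo (-k) s)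

lemma intervalIntegrable_cot_mul (k : ℤ) :
    IntervalIntegrable (fun s => (Real.cot (s / 2) : ℂ) * (expo k s - expo (-k) s))
      MeasureTheory.volume 0 π := by
  rw [intervalIntegrable_iff]
  refine MeasureTheory.Measure.integrableOn_of_bounded (M := 4 * |(k : ℝ)|) (by simp)
    (measurable_cot_half.mul ((continuous_expo k).sub
      (continuous_expo (-k))).measurable).aestronglyMeasurable ?_
  exact (MeasureTheory.ae_restrict_iff' measurableSet_uIoc).mpr
    (Filter.Eventually.of_forall fun s hs => norm_cot_mul_le k (sin_half_ne_zero hs))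

lemma integral_expo_add_expo_neg (k : ℤ) :
    ∫ s in (0 : ℝ)..π, (expo k s + expo (-k) s) = if k = 0 then 2 * (π : ℂ) else 0 := by
  split_ifs with h
  · subst h; simp [expo_zero]; ring
  · have hk : Complex.I * (k : ℂ) ≠ 0 := by simp [h]
    have : ∀ t ∈ uIcc (0 : ℝ) π,
        HasDerivAt (fun t => (Complex.I * (k : ℂ))⁻¹ * (expo k t - expo (-k) t))
          (expo k t + expo (-k) t) t := by
      intro t _
      refine (((hasDerivAt_expo k t).sub (hasDerivAt_expo (-k) t)).const_mul _).congr_deriv ?_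
      push_cast
      field_simp
      ring
    rw [intervalIntegral.integral_eq_sub_of_hasDerivAt this
      (((continuous_expo k).add (continuous_expo (-k))).intervalIntegrable _ _)]
    have h1 := expo_periodic k (-π)
    rw [show -π + 2 * π = π by ring, expo_neg_arg] at h1
    have h2 : ∀ j, expo j 0 = 1 := fun j => by simp [expo]
    rw [h1, h2, h2]; ring

/-- The difference of consecutive integrands is free of cotangents, again by `(e^{is} - 1) cot(s/2)
= i (e^{is} + 1)`. Starting from `cotInt 0 = 0` this gives `2πi` times the sign of `k`. -/
lemma cotInt_recursion (k : ℤ) :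
    cotInt (k + 1) = cotInt k +
      Complex.I * ((if k + 1 = 0 then 2 * (π : ℂ) else 0) + (if k = 0 then 2 * (π : ℂ) else 0)) := by
  have i1 : ∀ j, IntervalIntegrable (fun s => expo j s + expo (-j) s) MeasureTheory.volume 0 π :=
    fun j => ((continuous_expo j).add (continuous_expo (-j))).intervalIntegrable _ _
  rw [← sub_eq_iff_eq_add', ← integral_expo_add_expo_neg, ← integral_expo_add_expo_neg,
    ← intervalIntegral.integral_add (i1 _) (i1 _), ← intervalIntegral.integral_const_mul]
  unfold cotInt
  rw [← intervalIntegral.integral_sub (intervalIntegrable_cot_mul _) (intervalIntegrable_cot_mul _)]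
  refine intervalIntegral.integral_congr_ae (Filter.Eventually.of_forall fun s hs => ?_)
  have h := expo_sub_one_mul_cot (sin_half_ne_zero hs)
  have e1 : expo (-k) s = expo 1 s * expo (-(k + 1)) s := by rw [← expo_add]; congr 1; ring
  rw [e1, expo_add k 1]
  linear_combination (expo k s + expo (-(k + 1)) s) * h

lemma cotInt_zero : cotInt 0 = 0 := by simp [cotInt]

lemma cotInt_natCast_add_one (n : ℕ) : cotInt (n + 1) = 2 * π * Complex.I := by
  induction n with
  | zero =>
    have := cotInt_recursion 0
    simp [cotInt_zero] at this ⊢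
    rw [this]; ring
  | succ n ih =>
    have := cotInt_recursion (n + 1)
    rw [if_neg (by omega), if_neg (by omega), ih] at this
    push_cast
    rw [this]; ring

lemma cotInt_neg (k : ℤ) : cotInt (-k) = -cotInt k := by
  unfold cotInt
  rw [← intervalIntegral.integral_neg]
  congr 1; ext s; rw [neg_neg]; ring

lemma mul_cotInt (k : ℤ) : (k : ℂ) * cotInt k = 2 * π * Complex.I * (|(k : ℝ)| : ℝ) := by
  rcases lt_trichotomy k 0 with h | rfl | h
  · obtain ⟨n, hn⟩ := Int.eq_succ_of_zero_lt (show 0 < -k by omega)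
    obtain rfl : k = -(n + 1) := by omega
    rw [cotInt_neg, cotInt_natCast_add_one, abs_of_neg (by exact_mod_cast h)]
    push_cast; ring
  · simp [cotInt_zero]
  · obtain ⟨n, rfl⟩ := Int.eq_succ_of_zero_lt h
    have := cotInt_natCast_add_one n
    push_cast at this ⊢
    rw [this, abs_of_pos (by positivity)]
    push_cast; ring

lemma deriv_synth (u : RD) (t : ℝ) :
    deriv (synth u) t = ∑' k, Complex.I * k * (u : ℤ → ℂ) k * expo k t := by
  have h := u.2.smoothPeriodic
  rw [← h.deriv.synth_eq]
  exact tsum_congr fun k => by rw [fourierCoef_deriv h, fourierCoef_synth u.2]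

lemma repMult_opT0tilde : RepMult opT0tilde (fun k => -((|(k : ℝ)| : ℝ) : ℂ)) := by
  intro u
  ext t
  unfold opT0tilde
  have hw := u.2.summable_mul_wt_pow 1
  have hw2 := u.2.summable_mul_wt_pow 2
  have habs : ∀ k : ℤ, |(k : ℝ)| ≤ wt k := fun k => by unfold wt; linarith
  have hsum : ∀ s : ℝ, Summable fun k : ℤ => Complex.I * k * (u : ℤ → ℂ) k * expo k s := by
    intro s
    refine Summable.of_norm_bounded hw fun k => ?_
    rw [norm_mul, norm_mul, norm_mul, Complex.norm_I, norm_expo, one_mul, mul_one,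
      Complex.norm_intCast, pow_one, mul_comm]
    exact mul_le_mul_of_nonneg_left (habs k) (norm_nonneg _)
  have hterm : ∀ s : ℝ, HasSum (fun k : ℤ => Complex.I * k * (u : ℤ → ℂ) k * expo k t *
      ((Real.cot (s / 2) : ℂ) * (expo k s - expo (-k) s)))
      ((Real.cot (s / 2) : ℂ) * (deriv (synth u) (t + s) - deriv (synth u) (t - s))) := by
    intro s
    rw [deriv_synth, deriv_synth]
    have h := ((hsum (t + s)).hasSum.sub (hsum (t - s)).hasSum).mul_left (Real.cot (s / 2) : ℂ)
    refine h.congr_fun fun k => ?_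
    rw [sub_eq_add_neg t s, expo_add_arg, expo_add_arg, expo_neg_arg]; ring
  -- Termwise integration: differentiation contributes `|k|` and the cotangent bound `4|k|`, so the
  -- series is dominated by `4 ‖u k‖ wt k ^ 2`.
  have h := intervalIntegral.hasSum_integral_of_dominated_convergence (μ := MeasureTheory.volume)
    (a := 0) (b := π) (F := fun (k : ℤ) s => Complex.I * k * (u : ℤ → ℂ) k * expo k t *
      ((Real.cot (s / 2) : ℂ) * (expo k s - expo (-k) s)))
    (f := fun s => (Real.cot (s / 2) : ℂ) * (deriv (synth u) (t + s) - deriv (synth u) (t - s)))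
    (fun k _ => 4 * (‖(u : ℤ → ℂ) k‖ * wt k ^ 2))
    (fun k => ((intervalIntegrable_cot_mul k).const_mul _).aestronglyMeasurable_restrict_uIoc)
    (fun k => Filter.Eventually.of_forall fun s hs => ?_)
    (Filter.Eventually.of_forall fun s _ => hw2.mul_left 4)
    intervalIntegrable_const
    (Filter.Eventually.of_forall fun s _ => hterm s)
  · rw [← h.tsum_eq, ← tsum_mul_left]
    refine tsum_congr fun k => ?_
    rw [intervalIntegral.integral_const_mul]
    change 1 / (2 * (π : ℂ)) * (Complex.I * k * (u : ℤ → ℂ) k * expo k t * cotInt k) = _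
    have hpi : (π : ℂ) ≠ 0 := by exact_mod_cast pi_ne_zero
    have := mul_cotInt k
    field_simp
    linear_combination (Complex.I * (u : ℤ → ℂ) k * expo k t) * this +
      2 * π * (u : ℤ → ℂ) k * expo k t * (|(k : ℝ)| : ℝ) * Complex.I_sq
  · have h1 := norm_cot_mul_le k (sin_half_ne_zero hs)
    rw [norm_mul, norm_mul, norm_mul, norm_mul, Complex.norm_I, norm_expo, one_mul, mul_one,
      Complex.norm_intCast]
    calc |(k : ℝ)| * ‖(u : ℤ → ℂ) k‖ * _ ≤ wt k * ‖(u : ℤ → ℂ) k‖ * (4 * wt k) := by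
          gcongr
          · exact mul_nonneg (wt_pos k).le (norm_nonneg _)
          · exact habs k
          · exact h1.trans (by linarith [habs k])
      _ = _ := by ring

lemma repMult_opT0 : RepMult opT0 symT := by
  refine (repMult_opT0tilde.add repMult_opM0 (d := 1) (C := 1) (fun k => ?_)
    (norm_symM_le 0)).congr fun k => ?_
  · rw [norm_neg, Complex.norm_real, Real.norm_eq_abs, abs_abs, zpow_one, one_mul]
    unfold wt; linarith
  · unfold symT symM
    split_ifs with h
    · simp [h]
    · simp

/-- `T₀` on Fourier coefficients. -/
def endT : Module.End ℂ RD := multEnd norm_symT_le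

/-- `S₀` on Fourier coefficients. -/
def endS : Module.End ℂ RD := multEnd norm_symS_le

lemma rep_opT0 : Rep opT0 endT := repMult_opT0.rep norm_symT_le

lemma rep_opS0 : Rep opS0 endS := repMult_opS0.rep norm_symS_le

lemma isOrd_endT : IsOrd 1 endT := isOrd_multEnd _

lemma isOrd_endS : IsOrd (-1) endS := isOrd_multEnd _

lemma endS_mul_endT : endS * endT = -1 := by
  ext u m
  simp only [endS, endT, Module.End.mul_apply, multEnd_apply, LinearMap.neg_apply,
    Module.End.one_apply, Submodule.coe_neg, Pi.neg_apply]
  rw [← mul_assoc, symS_mul_symT, neg_one_mul]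

lemma endT_mul_endS : endT * endS = -1 := by
  ext u m
  simp only [endS, endT, Module.End.mul_apply, multEnd_apply, LinearMap.neg_apply,
    Module.End.one_apply, Submodule.coe_neg, Pi.neg_apply]
  rw [← mul_assoc, mul_comm (symT m), symS_mul_symT, neg_one_mul]

lemma exists_rep_opS1 : ∃ A, IsOrd (-2) A ∧ Rep opS1 A := by
  obtain ⟨C, hC⟩ := exists_symS₁_bound
  exact ⟨_, isOrd_multEnd hC, repMult_opS1.rep hC⟩

/-- `S₂` has order `-3`, commutes with `T₀`, and `S₂T₀` agrees with `½S₀S₀` to order `-3`. -/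
lemma exists_rep_opS2 : ∃ A, IsOrd (-3) A ∧ Rep opS2 A ∧ A * endT = endT * A ∧
    IsOrd (-3) (A * endT - (1 / 2 : ℂ) • (endS * endS)) := by
  obtain ⟨C, hC⟩ := exists_symS₂_bound
  obtain ⟨D, hD⟩ := exists_symS₂_mul_symT_bound
  refine ⟨_, isOrd_multEnd hC, repMult_opS2.rep hC, ?_, ?_⟩
  · ext u m
    simp only [endT, Module.End.mul_apply, multEnd_apply]; ring
  · have : multEnd hC * endT - (1 / 2 : ℂ) • (endS * endS) = multEnd hD := by
      ext u m
      simp only [endS, endT, Module.End.mul_apply, multEnd_apply, LinearMap.sub_apply,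
        LinearMap.smul_apply, Submodule.coe_sub, Submodule.coe_smul, Pi.sub_apply, Pi.smul_apply,
        smul_eq_mul]
      ring
    rw [this]; exact isOrd_multEnd hD

/-! ### Entire parts of the Bessel functions -/

lemma differentiable_tsum_mul_pow {c : ℕ → ℂ} (hc : ∀ r : ℝ, 0 ≤ r → Summable fun k => ‖c k‖ * r ^ k) :
    Differentiable ℂ fun w => ∑' k, c k * w ^ k := by
  intro w
  have h : DifferentiableOn ℂ (fun w => ∑' k, c k * w ^ k) (Metric.ball 0 (‖w‖ + 1)) := by
    refine Complex.differentiableOn_tsum_of_summable_norm (u := fun k => ‖c k‖ * (‖w‖ + 1) ^ k)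
      (hc _ (by positivity)) (fun k => ?_) Metric.isOpen_ball fun k z hz => ?_
    · exact ((differentiable_const _).mul (differentiable_pow k)).differentiableOn
    · rw [norm_mul, norm_pow]
      have : ‖z‖ ≤ ‖w‖ + 1 := by simpa using (mem_ball_zero_iff.mp hz).le
      gcongr
  exact h.differentiableAt (Metric.isOpen_ball.mem_nhds (by simp))

/-- The coefficients of the Bessel series. -/
def besselCoef (n k : ℕ) : ℂ := (-1 : ℂ) ^ k / ((k.factorial : ℂ) * ((n + k).factorial : ℂ))

lemma norm_besselCoef_le (n k : ℕ) : ‖besselCoef n k‖ ≤ 1 / (k.factorial : ℝ) := by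
  rw [besselCoef, norm_div, norm_mul, norm_pow, norm_neg, norm_one, one_pow, Complex.norm_natCast,
    Complex.norm_natCast]
  have h1 : (0 : ℝ) < k.factorial := by exact_mod_cast k.factorial_pos
  have h2 : (1 : ℝ) ≤ (n + k).factorial := by exact_mod_cast (n + k).factorial_pos
  gcongr
  nlinarith

lemma norm_digammaSucc_le (k : ℕ) : ‖digammaSucc k‖ ≤ k + 1 := by
  have h1 : ((harmonic k : ℚ) : ℝ) ≤ k := by
    have : harmonic k ≤ k := by
      rw [harmonic]
      calc ∑ i ∈ Finset.range k, ((i + 1 : ℕ) : ℚ)⁻¹ ≤ ∑ i ∈ Finset.range k, 1 := by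
            refine Finset.sum_le_sum fun i _ => inv_le_one_of_one_le₀ ?_
            push_cast
            have : (0 : ℚ) ≤ i := by positivity
            linarith
        _ = k := by simp
    exact_mod_cast this
  have h2 : (0 : ℝ) ≤ ((harmonic k : ℚ) : ℝ) := by
    have : 0 ≤ harmonic k := Finset.sum_nonneg fun i _ => by positivity
    exact_mod_cast this
  have h3 : (0 : ℝ) ≤ Real.eulerMascheroniConstant := by
    have := Real.one_half_lt_eulerMascheroniConstant; linarith
  have h4 : Real.eulerMascheroniConstant ≤ 1 := by
    have := Real.eulerMascheroniConstant_lt_two_thirds; linarith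
  calc ‖digammaSucc k‖ ≤ ‖(((harmonic k : ℚ) : ℝ) : ℂ)‖ + ‖(Real.eulerMascheroniConstant : ℂ)‖ := by
        rw [digammaSucc, Complex.ofReal_ratCast]; exact norm_sub_le _ _
    _ ≤ k + 1 := by
        rw [Complex.norm_real, Complex.norm_real, Real.norm_of_nonneg h2, Real.norm_of_nonneg h3]
        linarith

/-- The entire function `E_n` with `J_n(z) = (z/2)^n E_n(z²)`. -/
def besselE (n : ℕ) (w : ℂ) : ℂ := ∑' k : ℕ, besselCoef n k / 4 ^ k * w ^ k

/-- The entire function in the digamma series of `Y_n`. -/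
def besselD (n : ℕ) (w : ℂ) : ℂ :=
  ∑' k : ℕ, (digammaSucc k + digammaSucc (n + k)) * besselCoef n k / 4 ^ k * w ^ k

lemma differentiable_besselE (n : ℕ) : Differentiable ℂ (besselE n) := by
  refine differentiable_tsum_mul_pow fun r hr => ?_
  refine Summable.of_nonneg_of_le (fun k => by positivity) (fun k => ?_)
    (Real.summable_pow_div_factorial r)
  have h1 := norm_besselCoef_le n k
  have h4 : ‖besselCoef n k / 4 ^ k‖ ≤ ‖besselCoef n k‖ := by
    rw [norm_div, norm_pow]
    exact div_le_self (norm_nonneg _) (one_le_pow₀ (by norm_num))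
  calc _ ≤ 1 / (k.factorial : ℝ) * r ^ k := by gcongr; exact h4.trans h1
    _ = _ := by ring

/-- The digamma values grow at most linearly in `k`, which the factor `4 ^ k` in the denominator
absorbs; an exponential series remains as majorant. -/
lemma differentiable_besselD (n : ℕ) : Differentiable ℂ (besselD n) := by
  refine differentiable_tsum_mul_pow fun r hr => ?_
  refine Summable.of_nonneg_of_le (fun k => by positivity) (fun k => ?_)
    ((Real.summable_pow_div_factorial r).mul_left (2 * n + 2 : ℝ))
  have h1 := norm_besselCoef_le n k
  have h2 : (2 * k + 1 : ℝ) ≤ 4 ^ k := by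
    have := one_add_mul_le_pow (a := (3 : ℝ)) (by norm_num) k
    norm_num at this
    have hk : (0 : ℝ) ≤ k := by positivity
    linarith
  have h3 : ‖digammaSucc k + digammaSucc (n + k)‖ ≤ (2 * n + 2) * 4 ^ k := by
    refine (norm_add_le _ _).trans ?_
    have a1 := norm_digammaSucc_le k
    have a2 := norm_digammaSucc_le (n + k)
    push_cast at a2
    have hk : (0 : ℝ) ≤ k := by positivity
    have hn : (0 : ℝ) ≤ n := by positivity
    nlinarith [mul_le_mul_of_nonneg_left h2 (show (0 : ℝ) ≤ 2 * n + 2 by positivity), mul_nonneg hk hn]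
  have h4 : (0 : ℝ) < 4 ^ k := by positivity
  rw [norm_div, norm_mul, norm_pow]
  norm_num
  calc _ ≤ (2 * n + 2) * 4 ^ k * (1 / (k.factorial : ℝ)) / 4 ^ k * r ^ k := by gcongr
    _ = _ := by field_simp

lemma contDiff_besselE (n : ℕ) : ContDiff ℝ ∞ (besselE n) :=
  ((differentiable_besselE n).contDiff (n := ∞)).restrict_scalars ℝ

lemma contDiff_besselD (n : ℕ) : ContDiff ℝ ∞ (besselD n) :=
  ((differentiable_besselD n).contDiff (n := ∞)).restrict_scalars ℝ

/-- The second factor in `E_n(w) = E_n(0) + w e_n(w)`. -/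
def besselE' (n : ℕ) : ℂ → ℂ := dslope (besselE n) 0

lemma contDiff_besselE' (n : ℕ) : ContDiff ℝ ∞ (besselE' n) := by
  have h : Differentiable ℂ (besselE' n) := by
    rw [← differentiableOn_univ]
    exact (Complex.differentiableOn_dslope Filter.univ_mem).mpr
      (differentiable_besselE n).differentiableOn
  exact (h.contDiff (n := ∞)).restrict_scalars ℝ

lemma besselE_zero (n : ℕ) : besselE n 0 = besselCoef n 0 := by
  rw [besselE, tsum_eq_single 0 fun k hk => by simp [hk]]
  simp

lemma besselE_eq (n : ℕ) (w : ℂ) : besselE n w = besselCoef n 0 + w * besselE' n w := by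
  have := sub_smul_dslope (besselE n) 0 w
  rw [besselE_zero, sub_zero, smul_eq_mul] at this
  rw [besselE', this]; ring

lemma besselE'_zero (n : ℕ) : besselE' n 0 = besselCoef n 1 / 4 := by
  have hs : HasDerivAt (besselE n) (besselCoef n 1 / 4) 0 := by
    have h1 : ∀ w, besselE n w = besselCoef n 0 + w * ∑' k, besselCoef n (k + 1) / 4 ^ (k + 1) * w ^ k := by
      intro w
      have hsm : Summable fun k => besselCoef n k / 4 ^ k * w ^ k := by
        refine Summable.of_norm_bounded (g := fun k => ‖w‖ ^ k / (k.factorial : ℝ))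
          (Real.summable_pow_div_factorial _) fun k => ?_
        have h1 := norm_besselCoef_le n k
        have h4 : ‖besselCoef n k / 4 ^ k‖ ≤ ‖besselCoef n k‖ := by
          rw [norm_div, norm_pow]
          exact div_le_self (norm_nonneg _) (one_le_pow₀ (by norm_num))
        rw [norm_mul, norm_pow]
        calc _ ≤ 1 / (k.factorial : ℝ) * ‖w‖ ^ k := by gcongr; exact h4.trans h1
          _ = _ := by ring
      rw [besselE, hsm.tsum_eq_zero_add, ← tsum_mul_left]
      simp only [pow_zero, div_one, mul_one, add_right_inj]
      exact tsum_congr fun k => by ring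
    have h2 : Differentiable ℂ fun w => ∑' k, besselCoef n (k + 1) / 4 ^ (k + 1) * w ^ k := by
      refine differentiable_tsum_mul_pow fun r hr => ?_
      refine Summable.of_nonneg_of_le (fun k => by positivity) (fun k => ?_)
        (Real.summable_pow_div_factorial r)
      have h1 := norm_besselCoef_le n (k + 1)
      have h4 : ‖besselCoef n (k + 1) / 4 ^ (k + 1)‖ ≤ ‖besselCoef n (k + 1)‖ := by
        rw [norm_div, norm_pow]
        exact div_le_self (norm_nonneg _) (one_le_pow₀ (by norm_num))
      have h5 : (k.factorial : ℝ) ≤ ((k + 1).factorial : ℝ) := by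
        exact_mod_cast Nat.factorial_le (Nat.le_succ k)
      have h6 : (0 : ℝ) < k.factorial := by exact_mod_cast k.factorial_pos
      calc _ ≤ 1 / (k.factorial : ℝ) * r ^ k := by
            gcongr
            exact h4.trans (h1.trans (one_div_le_one_div_of_le h6 h5))
        _ = _ := by ring
    have h3 := ((hasDerivAt_id (0 : ℂ)).mul (h2 0).hasDerivAt).const_add (besselCoef n 0)
    have h0 : ∑' k, besselCoef n (k + 1) / 4 ^ (k + 1) * (0 : ℂ) ^ k = besselCoef n 1 / 4 := by
      rw [tsum_eq_single 0 fun k hk => by simp [hk]]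
      simp
    refine (h3.congr_deriv ?_).congr_of_eventuallyEq (Filter.Eventually.of_forall h1)
    simp [h0]
  rw [besselE', dslope_same, hs.deriv]

lemma besselJ_eq (n : ℕ) (z : ℂ) : besselJ n z = (z / 2) ^ n * besselE n (z ^ 2) := by
  rw [besselJ, besselE, ← tsum_mul_left]
  refine tsum_congr fun k => ?_
  rw [besselCoef, pow_add, pow_mul (z / 2), div_pow z 2 2, div_pow (z ^ 2), show ((2 : ℂ) ^ 2) = 4 by norm_num]
  ring

lemma tsum_digamma_eq (n : ℕ) (z : ℂ) :
    ∑' k : ℕ, (digammaSucc k + digammaSucc (n + k)) *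
        ((-1 : ℂ) ^ k / ((k.factorial : ℂ) * ((n + k).factorial : ℂ))) * (z / 2) ^ (2 * k + n) =
      (z / 2) ^ n * besselD n (z ^ 2) := by
  rw [besselD, ← tsum_mul_left]
  refine tsum_congr fun k => ?_
  rw [besselCoef, pow_add, pow_mul (z / 2), div_pow z 2 2, div_pow (z ^ 2), show ((2 : ℂ) ^ 2) = 4 by norm_num]
  ring

lemma hankel_zero_eq (z : ℂ) : hankel 0 z =
    besselE 0 (z ^ 2) + Complex.I * (2 / π * Complex.log (z / 2) * besselE 0 (z ^ 2)
      - 1 / π * besselD 0 (z ^ 2)) := by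
  rw [hankel, besselY, tsum_digamma_eq, besselJ_eq]
  simp

lemma hankel_one_eq (z : ℂ) : hankel 1 z =
    z / 2 * besselE 1 (z ^ 2) + Complex.I * (2 / π * Complex.log (z / 2) * (z / 2 * besselE 1 (z ^ 2))
      - 1 / π * (1 / (z / 2)) - 1 / π * (z / 2 * besselD 1 (z ^ 2))) := by
  rw [hankel, besselY, tsum_digamma_eq, besselJ_eq]
  simp

/-! ### Log-smooth decompositions of the Hankel functions -/

section

variable {κ ρ : ℝ}

lemma log_mul_half (hκ : 0 < κ) (hρ : 0 < ρ) :
    Complex.log (κ * ρ / 2) = (Real.log (κ / 2) : ℂ) + 1 / 2 * (Real.log (ρ ^ 2) : ℂ) := by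
  have : (κ * ρ / 2 : ℂ) = ((κ * ρ / 2 : ℝ) : ℂ) := by push_cast; ring
  rw [this, ← Complex.ofReal_log (by positivity), show κ * ρ / 2 = κ / 2 * ρ by ring,
    Real.log_mul (by positivity) (by positivity), Real.log_pow]
  push_cast; ring

lemma log_I_mul_half (hκ : 0 < κ) (hρ : 0 < ρ) :
    Complex.log (Complex.I * κ * ρ / 2) =
      (Real.log (κ / 2) : ℂ) + 1 / 2 * (Real.log (ρ ^ 2) : ℂ) + π / 2 * Complex.I := by
  have : (Complex.I * κ * ρ / 2 : ℂ) = ((κ * ρ / 2 : ℝ) : ℂ) * Complex.I := by push_cast; ring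
  rw [this, Complex.log_ofReal_mul (by positivity) Complex.I_ne_zero, Complex.log_I,
    show κ * ρ / 2 = κ / 2 * ρ by ring,
    Real.log_mul (by positivity) (by positivity), Real.log_pow]
  push_cast; ring

/-- The value at `w = ±(κρ)²` of the smooth part of a Hankel function. -/
def hankelReg (κ : ℝ) (n : ℕ) (c w L : ℂ) : ℂ :=
  besselE n w * (c + 2 * Complex.I / π * Real.log (κ / 2) + Complex.I / π * L) - Complex.I / π * besselD n w

/-- In the applications `a` is the singular part `ln(4 sin²((t-ζ)/2))` of `ln ρ²` and `L` is its
smooth part; only the coefficient of `a` matters for the order. -/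
lemma hankel_zero_real (hκ : 0 < κ) (hρ : 0 < ρ) {a L : ℂ} (hL : (Real.log (ρ ^ 2) : ℂ) = a + L) :
    hankel 0 (κ * ρ) = Complex.I / π * besselE 0 (κ ^ 2 * ρ ^ 2) * a
      + hankelReg κ 0 1 (κ ^ 2 * ρ ^ 2) L := by
  rw [hankel_zero_eq, log_mul_half hκ hρ, hL, mul_pow, hankelReg]
  ring

/-- The constant passed to `hankelReg` is 0 and not 1: the argument of `iκρ` adds `πi/2` to the
logarithm, and `1 + i (2/π) (πi/2) = 0`. -/
lemma hankel_zero_imag (hκ : 0 < κ) (hρ : 0 < ρ) {a L : ℂ} (hL : (Real.log (ρ ^ 2) : ℂ) = a + L) :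
    hankel 0 (Complex.I * κ * ρ) = Complex.I / π * besselE 0 (-(κ ^ 2 * ρ ^ 2)) * a
      + hankelReg κ 0 0 (-(κ ^ 2 * ρ ^ 2)) L := by
  rw [hankel_zero_eq, log_I_mul_half hκ hρ, hL, mul_pow, mul_pow, Complex.I_sq, hankelReg,
    show -1 * (κ : ℂ) ^ 2 * ρ ^ 2 = -(κ ^ 2 * ρ ^ 2) by ring]
  have hp : (π : ℂ) ≠ 0 := by exact_mod_cast Real.pi_ne_zero
  field_simp
  linear_combination (π * besselE 0 (-(κ ^ 2 * ρ ^ 2))) * Complex.I_sq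

/-- The last term comes from the finite sum in `Y₁`. It is the only pole; the prefactors in the
kernels `l` and `k` cancel it, and in `h` it cancels against the other singular terms. -/
lemma hankel_one_real (hκ : 0 < κ) (hρ : 0 < ρ) {a L : ℂ} (hL : (Real.log (ρ ^ 2) : ℂ) = a + L) :
    hankel 1 (κ * ρ) / ρ = κ * Complex.I / (2 * π) * besselE 1 (κ ^ 2 * ρ ^ 2) * a
      + κ / 2 * hankelReg κ 1 1 (κ ^ 2 * ρ ^ 2) L - 2 * Complex.I / (π * κ) / ρ ^ 2 := by
  rw [hankel_one_eq, log_mul_half hκ hρ, hL, mul_pow, hankelReg]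
  have hp : (π : ℂ) ≠ 0 := by exact_mod_cast Real.pi_ne_zero
  have h1 : (κ : ℂ) ≠ 0 := by exact_mod_cast hκ.ne'
  have h2 : (ρ : ℂ) ≠ 0 := by exact_mod_cast hρ.ne'
  field_simp
  ring

lemma hankel_one_imag (hκ : 0 < κ) (hρ : 0 < ρ) {a L : ℂ} (hL : (Real.log (ρ ^ 2) : ℂ) = a + L) :
    hankel 1 (Complex.I * κ * ρ) / ρ = -(κ / (2 * π)) * besselE 1 (-(κ ^ 2 * ρ ^ 2)) * a
      + Complex.I * κ / 2 * hankelReg κ 1 0 (-(κ ^ 2 * ρ ^ 2)) L - 2 / (π * κ) / ρ ^ 2 := by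
  rw [hankel_one_eq, log_I_mul_half hκ hρ, hL, mul_pow, mul_pow, Complex.I_sq, hankelReg,
    show -1 * (κ : ℂ) ^ 2 * ρ ^ 2 = -(κ ^ 2 * ρ ^ 2) by ring]
  have hp : (π : ℂ) ≠ 0 := by exact_mod_cast Real.pi_ne_zero
  have h1 : (κ : ℂ) ≠ 0 := by exact_mod_cast hκ.ne'
  have h2 : (ρ : ℂ) ≠ 0 := by exact_mod_cast hρ.ne'
  have hI := Complex.I_ne_zero
  field_simp
  generalize besselE 1 (-(κ ^ 2 * ρ ^ 2)) = e
  generalize besselD 1 (-(κ ^ 2 * ρ ^ 2)) = d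
  ring_nf
  have h3 : Complex.I ^ 3 = -Complex.I := by rw [pow_succ, Complex.I_sq]; ring
  simp only [Complex.I_sq, h3]
  ring

end

/-! ### Divided differences on the circle -/

lemma expDiff_self (t : ℝ) : expDiff t t = 0 := sub_self _

lemma expDiff_swap (t ζ : ℝ) : expDiff ζ t = -expDiff t ζ := by unfold expDiff; ring

lemma expo_neg_mul_expo (t : ℝ) : expo (-1) t * expo 1 t = 1 := by
  rw [← expo_add, neg_add_cancel, expo_zero]

lemma hasDerivAt_expDiff_left (t ζ : ℝ) :
    HasDerivAt (fun s => expDiff s ζ) (Complex.I * expo 1 t) t := by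
  have := (hasDerivAt_expo 1 t).sub_const (expo 1 ζ)
  exact this.congr_deriv (by simp)

/-- The factor vanishes only on a countable set of `ζ`, so the quotients agree on a dense set and,
by continuity, everywhere. -/
lemma BiSmooth.eq_of_expDiff_mul_eq {F H : ℝ → ℝ → ℂ} (hF : BiSmooth F) (hH : BiSmooth H)
    (h : ∀ t ζ, expDiff t ζ * F t ζ = expDiff t ζ * H t ζ) (t ζ : ℝ) : F t ζ = H t ζ := by
  have h1 : F t = H t := by
    refine Continuous.ext_on ((countable_expDiff_eq_zero t).dense_compl ℝ) (hF.continuous_right t)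
      (hH.continuous_right t) fun s hs => ?_
    exact mul_left_cancel₀ hs (h t s)
  rw [h1]

/-- The periodic substitute for the difference quotient. Symmetry follows from the uniqueness of
quotients by `expDiff`, the diagonal value from differentiating at `t = ζ`, where the derivative of
`expDiff` is `i e^{it}`. -/
lemma SmoothPeriodic.exists_divDiff {u : ℝ → ℂ} (hu : SmoothPeriodic u) :
    ∃ G, BiSmooth G ∧ (∀ t ζ, u t - u ζ = expDiff t ζ * G t ζ) ∧ (∀ t ζ, G t ζ = G ζ t) ∧
      ∀ t, G t t = -Complex.I * expo (-1) t * _root_.deriv u t := by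
  obtain ⟨G, hG, e⟩ := ((BiSmooth.ofLeft hu).sub (BiSmooth.ofRight hu)).exists_eq_expDiff_mul
    fun t => sub_self _
  refine ⟨G, hG, e, fun t ζ => ?_, fun t => ?_⟩
  · refine hG.eq_of_expDiff_mul_eq hG.swap (fun t ζ => ?_) t ζ
    linear_combination -(e t ζ) - e ζ t - G ζ t * expDiff_swap t ζ
  · have h1 : HasDerivAt (fun s => u s - u t) (_root_.deriv u t) t :=
      (hu.differentiable t).hasDerivAt.sub_const _
    have h2 : HasDerivAt (fun s => expDiff s t * G s t) _ t :=
      (hasDerivAt_expDiff_left t t).mul ((hG.left t).differentiable t).hasDerivAt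
    have h3 : (fun s => u s - u t) = fun s => expDiff s t * G s t := funext fun s => e s t
    rw [h3] at h1
    have h4 := h1.unique h2
    rw [expDiff_self, zero_mul, add_zero] at h4
    rw [h4]
    linear_combination (-(G t t)) * (expo_neg_mul_expo t) +
      G t t * expo (-1) t * expo 1 t * Complex.I_sq

/-- The value on the diagonal of the second divided difference. -/
lemma BiSmooth.diag_of_eq_expDiff_sq {F : ℝ → ℝ → ℂ} (hF : BiSmooth F) {u : ℝ → ℂ} (ζ : ℝ)
    (hu : ∀ t, u t = expDiff t ζ ^ 2 * F t ζ) :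
    F ζ ζ = -(1 / 2) * expo (-1) ζ ^ 2 * _root_.deriv (_root_.deriv u) ζ := by
  have h1 : ∀ t, HasDerivAt u (expDiff t ζ *
      (2 * (Complex.I * expo 1 t) * F t ζ + expDiff t ζ * _root_.deriv (fun s => F s ζ) t)) t := by
    intro t
    have h2 := ((hasDerivAt_expDiff_left t ζ).pow 2).mul ((hF.left ζ).differentiable t).hasDerivAt
    have h3 : u = (fun s => expDiff s ζ) ^ 2 * fun s => F s ζ := funext hu
    rw [h3]
    refine h2.congr_deriv ?_
    simp only [Pi.pow_apply]
    push_cast; ring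
  have h2 : _root_.deriv u = fun t => expDiff t ζ *
      (2 * (Complex.I * expo 1 t) * F t ζ + expDiff t ζ * _root_.deriv (fun s => F s ζ) t) :=
    funext fun t => (h1 t).deriv
  have h3 : SmoothPeriodic fun t =>
      2 * (Complex.I * expo 1 t) * F t ζ + expDiff t ζ * _root_.deriv (fun s => F s ζ) t := by
    refine SmoothPeriodic.add (SmoothPeriodic.mul ?_ (hF.left ζ))
      ((biSmooth_expDiff.left ζ).mul (hF.left ζ).deriv)
    exact ((BiSmooth.const 2).mul ((BiSmooth.const Complex.I).mul
      (BiSmooth.ofLeft (smoothPeriodic_expo 1)))).left 0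
  -- Only the term in which the remaining zero is differentiated survives on the diagonal, so `u'' =
  -- 2 (i e^{iζ})² F`.
  have h4 := (hasDerivAt_expDiff_left ζ ζ).mul (h3.differentiable ζ).hasDerivAt
  rw [h2]
  refine Eq.trans ?_ (congrArg (fun x => -(1 / 2) * expo (-1) ζ ^ 2 * x) h4.deriv.symm)
  rw [expDiff_self]
  linear_combination (-(F ζ ζ)) * (expo (-1) ζ * expo 1 ζ + 1) * (expo_neg_mul_expo ζ) +
    F ζ ζ * (expo (-1) ζ * expo 1 ζ) ^ 2 * Complex.I_sq

/-- The quotient of `sin (t - ζ)` by `e^{it} - e^{iζ}`. -/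
def sinQuot (t ζ : ℝ) : ℂ := -Complex.I / 2 * (expo (-1) t + expo (-1) ζ)

lemma biSmooth_sinQuot : BiSmooth sinQuot :=
  (BiSmooth.const _).mul ((BiSmooth.ofLeft (smoothPeriodic_expo _)).add
    (BiSmooth.ofRight (smoothPeriodic_expo _)))

lemma sin_sub_eq (t ζ : ℝ) : (Real.sin (t - ζ) : ℂ) = expDiff t ζ * sinQuot t ζ := by
  have h1 := expo_neg_mul_expo t
  have h2 := expo_neg_mul_expo ζ
  have h3 : (Real.sin (t - ζ) : ℂ) = (expo (-1) t * expo 1 ζ - expo 1 t * expo (-1) ζ) * Complex.I / 2 := by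
    rw [Complex.ofReal_sin, Complex.sin]
    unfold expo
    rw [← Complex.exp_add, ← Complex.exp_add]
    congr 4 <;> (push_cast; ring)
  rw [h3, expDiff, sinQuot]
  linear_combination (Complex.I / 2) * (h1 - h2)

lemma sinQuot_self (t : ℝ) : sinQuot t t = -Complex.I * expo (-1) t := by unfold sinQuot; ring

/-- `|e^{it} - e^{iζ}|²` as a smooth function. -/
def expDist (t ζ : ℝ) : ℂ := -(expDiff t ζ ^ 2 * (expo (-1) t * expo (-1) ζ))

lemma biSmooth_expo_neg_mul : BiSmooth fun t ζ => expo (-1) t * expo (-1) ζ :=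
  (BiSmooth.ofLeft (smoothPeriodic_expo _)).mul (BiSmooth.ofRight (smoothPeriodic_expo _))

lemma biSmooth_expo_mul : BiSmooth fun t ζ => expo 1 t * expo 1 ζ :=
  (BiSmooth.ofLeft (smoothPeriodic_expo _)).mul (BiSmooth.ofRight (smoothPeriodic_expo _))

lemma expDist_eq (t ζ : ℝ) : expDist t ζ = ((4 * Real.sin ((t - ζ) / 2) ^ 2 : ℝ) : ℂ) := by
  have h1 := expo_neg_mul_expo t
  have h2 := expo_neg_mul_expo ζ
  have h3 : (Real.cos (t - ζ) : ℂ) = (expo (-1) t * expo 1 ζ + expo 1 t * expo (-1) ζ) / 2 := by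
    rw [Complex.ofReal_cos, Complex.cos]
    unfold expo
    rw [← Complex.exp_add, ← Complex.exp_add, add_comm]
    congr 3 <;> (push_cast; ring)
  have h4 : 4 * Real.sin ((t - ζ) / 2) ^ 2 = 2 - 2 * Real.cos (t - ζ) := by
    rw [Real.sin_sq_eq_half_sub]; ring_nf
  rw [h4, Complex.ofReal_sub, Complex.ofReal_mul, h3, expDist, expDiff]
  push_cast
  linear_combination -(expo 1 t * expo (-1) ζ) * h1 - (expo 1 ζ * expo (-1) t) * h2 + 
    (2 : ℂ) * (expo (-1) ζ * expo 1 ζ) * h1 + 2 * h2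

lemma expDist_ne_zero {t ζ : ℝ} (h : expDiff t ζ ≠ 0) : expDist t ζ ≠ 0 :=
  neg_ne_zero.mpr (mul_ne_zero (pow_ne_zero 2 h) (mul_ne_zero (expo_ne_zero _ _) (expo_ne_zero _ _)))

/-! ### Smooth closed curves -/

/-- A smooth `2π`-periodic curve in the plane. -/
def SmoothCurve (α : ℝ → Plane) : Prop := ContDiff ℝ ∞ α ∧ Function.Periodic α (2 * π)

/-- The complexified components of a curve. -/
def cc (α : ℝ → Plane) (c : Fin 2) (t : ℝ) : ℂ := (α t c : ℂ)

lemma SmoothCurve.cc {α : ℝ → Plane} (h : SmoothCurve α) (c : Fin 2) : SmoothPeriodic (cc α c) := by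
  refine ⟨Complex.ofRealCLM.contDiff.comp ((contDiff_euclidean.mp h.1) c), fun t => ?_⟩
  unfold BiharmonicCavity.cc; rw [h.2 t]

lemma SmoothCurve.deriv {α : ℝ → Plane} (h : SmoothCurve α) : SmoothCurve (deriv α) := by
  refine ⟨(contDiff_infty_iff_deriv.mp h.1).2, fun t => ?_⟩
  have := deriv_comp_add_const α (2 * π) t
  rw [← this]; congr 1; ext s; rw [h.2 s]

lemma SmoothCurve.deriv_cc {α : ℝ → Plane} (h : SmoothCurve α) (c : Fin 2) :
    _root_.deriv (BiharmonicCavity.cc α c) = BiharmonicCavity.cc (_root_.deriv α) c := by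
  ext t
  have h1 : HasDerivAt α (_root_.deriv α t) t := (h.1.differentiable (by simp) t).hasDerivAt
  have h2 : HasDerivAt (fun s => α s c) (_root_.deriv α t c) t :=
    (EuclideanSpace.proj (𝕜 := ℝ) c).hasFDerivAt.comp_hasDerivAt t h1
  exact h2.ofReal_comp.deriv

lemma IsBoundaryCurve.smoothCurve {γ : ℝ → Plane} (h : IsBoundaryCurve γ) : SmoothCurve γ :=
  ⟨contDiff_iff_contDiffAt.mpr fun t => (h.analytic t (mem_univ t)).contDiffAt, h.periodic⟩

/-- The complexified inner product of the values of two curves. -/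
def cdot (α β : ℝ → Plane) (t ζ : ℝ) : ℂ := cc α 0 t * cc β 0 ζ + cc α 1 t * cc β 1 ζ

lemma ofReal_inner (u v : Plane) :
    ((inner ℝ u v : ℝ) : ℂ) = (u 0 : ℂ) * v 0 + (u 1 : ℂ) * v 1 := by
  rw [PiLp.inner_apply, Fin.sum_univ_two]
  simp only [RCLike.inner_apply, conj_trivial]
  push_cast; ring

lemma ofReal_inner_eq_cdot (α β : ℝ → Plane) (t ζ : ℝ) :
    ((inner ℝ (α t) (β ζ) : ℝ) : ℂ) = cdot α β t ζ := ofReal_inner _ _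

lemma ofReal_inner_sub (v : Plane) (γ : ℝ → Plane) (t ζ : ℝ) :
    ((inner ℝ v (γ t - γ ζ) : ℝ) : ℂ) =
      (v 0 : ℂ) * (cc γ 0 t - cc γ 0 ζ) + (v 1 : ℂ) * (cc γ 1 t - cc γ 1 ζ) := by
  rw [ofReal_inner]; simp [cc]

lemma SmoothCurve.cdot {α β : ℝ → Plane} (hα : SmoothCurve α) (hβ : SmoothCurve β) :
    BiSmooth (cdot α β) :=
  ((BiSmooth.ofLeft (hα.cc 0)).mul (BiSmooth.ofRight (hβ.cc 0))).add
    ((BiSmooth.ofLeft (hα.cc 1)).mul (BiSmooth.ofRight (hβ.cc 1)))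

lemma SmoothCurve.cdot_diag {α β : ℝ → Plane} (hα : SmoothCurve α) (hβ : SmoothCurve β) :
    SmoothPeriodic fun t => BiharmonicCavity.cdot α β t t :=
  ((hα.cc 0).mul (hβ.cc 0)).add ((hα.cc 1).mul (hβ.cc 1))

lemma cdot_comm (α β : ℝ → Plane) (t ζ : ℝ) : cdot α β t ζ = cdot β α ζ t := by
  unfold cdot; ring

lemma cc_normal_zero (γ : ℝ → Plane) (t : ℝ) : cc (normal γ) 0 t = cc (deriv γ) 1 t := by
  simp [cc, normal]

lemma cc_normal_one (γ : ℝ → Plane) (t : ℝ) : cc (normal γ) 1 t = -cc (deriv γ) 0 t := by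
  simp [cc, normal]

lemma cdot_normal_normal (γ : ℝ → Plane) (t ζ : ℝ) :
    cdot (normal γ) (normal γ) t ζ = cdot (deriv γ) (deriv γ) t ζ := by
  simp only [cdot, cc_normal_zero, cc_normal_one]; ring

lemma SmoothCurve.normal {γ : ℝ → Plane} (h : SmoothCurve γ) : SmoothCurve (normal γ) := by
  have h1 := h.deriv
  refine ⟨contDiff_euclidean.mpr fun i => ?_, fun t => ?_⟩
  · fin_cases i
    · simpa [BiharmonicCavity.normal] using (contDiff_euclidean.mp h1.1) 1
    · simpa [BiharmonicCavity.normal] using ((contDiff_euclidean.mp h1.1) 0).neg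
  · unfold BiharmonicCavity.normal; rw [h1.2 t]

lemma ofReal_norm_sq (v : Plane) : ((‖v‖ ^ 2 : ℝ) : ℂ) = (v 0 : ℂ) ^ 2 + (v 1 : ℂ) ^ 2 := by
  rw [← real_inner_self_eq_norm_sq, ofReal_inner]; ring

lemma IsBoundaryCurve.ne_of_expDiff_ne_zero {γ : ℝ → Plane} (h : IsBoundaryCurve γ) {t ζ : ℝ}
    (hq : expDiff t ζ ≠ 0) : γ t ≠ γ ζ := by
  intro he
  have hp : (0 : ℝ) < 2 * π := by positivity
  -- The pair `(γ, e^{it})` is reduced to one period, so that the same representative serves for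
  -- both components.
  obtain ⟨s, hs, e⟩ := Function.Periodic.exists_mem_Ico₀
    (f := fun t => (γ t, expo 1 t)) (fun t => Prod.ext (h.periodic t) (expo_periodic 1 t)) hp t
  obtain ⟨s', hs', e'⟩ := Function.Periodic.exists_mem_Ico₀
    (f := fun t => (γ t, expo 1 t)) (fun t => Prod.ext (h.periodic t) (expo_periodic 1 t)) hp ζ
  obtain ⟨e1, e2⟩ := Prod.mk.inj e
  obtain ⟨e1', e2'⟩ := Prod.mk.inj e'
  have := h.simple hs hs' (by rw [← e1, ← e1', he])
  exact hq (sub_eq_zero.mpr (by rw [e2, e2', this]))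

/-! ### The chord function -/

/-- Divided differences `G₀, G₁` of the components of a boundary curve and the quotient `g` of
`|γ(t) - γ(ζ)|²` by `|e^{it} - e^{iζ}|²`. -/
structure IsChordData (γ : ℝ → Plane) (g G₀ G₁ : ℝ → ℝ → ℂ) : Prop where
  curve : SmoothCurve γ
  smooth : BiSmooth g
  smooth₀ : BiSmooth G₀
  smooth₁ : BiSmooth G₁
  eq₀ : ∀ t ζ, cc γ 0 t - cc γ 0 ζ = expDiff t ζ * G₀ t ζ
  eq₁ : ∀ t ζ, cc γ 1 t - cc γ 1 ζ = expDiff t ζ * G₁ t ζ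
  symm₀ : ∀ t ζ, G₀ t ζ = G₀ ζ t
  symm₁ : ∀ t ζ, G₁ t ζ = G₁ ζ t
  diag₀ : ∀ t, G₀ t t = -Complex.I * expo (-1) t * cc (deriv γ) 0 t
  diag₁ : ∀ t, G₁ t t = -Complex.I * expo (-1) t * cc (deriv γ) 1 t
  g_eq : ∀ t ζ, g t ζ = -(expo 1 t * expo 1 ζ * (G₀ t ζ ^ 2 + G₁ t ζ ^ 2))
  pos : ∀ t ζ, ∃ r : ℝ, 0 < r ∧ g t ζ = r
  chord_pos : ∀ t ζ, expDiff t ζ ≠ 0 → 0 < chord γ t ζ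

lemma chord_sq (γ : ℝ → Plane) (t ζ : ℝ) : (chord γ t ζ : ℂ) ^ 2 =
    (cc γ 0 t - cc γ 0 ζ) ^ 2 + (cc γ 1 t - cc γ 1 ζ) ^ 2 := by
  rw [chord, ← Complex.ofReal_pow, ofReal_norm_sq]; simp [cc]

lemma neg_mul_diag_sq (z : ℝ) (a b : ℂ) :
    -(expo 1 z * expo 1 z * ((-Complex.I * expo (-1) z * a) ^ 2 + (-Complex.I * expo (-1) z * b) ^ 2)) =
      a ^ 2 + b ^ 2 := by
  linear_combination (a ^ 2 + b ^ 2) * (expo (-1) z * expo 1 z + 1) * expo_neg_mul_expo z -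
    (a ^ 2 + b ^ 2) * (expo (-1) z * expo 1 z) ^ 2 * Complex.I_sq

lemma IsBoundaryCurve.exists_chordData {γ : ℝ → Plane} (h : IsBoundaryCurve γ) :
    ∃ g G₀ G₁, IsChordData γ g G₀ G₁ := by
  have hγ := h.smoothCurve
  obtain ⟨G₀, s0, e0, y0, d0⟩ := (hγ.cc 0).exists_divDiff
  obtain ⟨G₁, s1, e1, y1, d1⟩ := (hγ.cc 1).exists_divDiff
  simp only [hγ.deriv_cc] at d0 d1
  set g : ℝ → ℝ → ℂ := fun t ζ => -(expo 1 t * expo 1 ζ * (G₀ t ζ ^ 2 + G₁ t ζ ^ 2)) with hg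
  have hgs : BiSmooth g := by
    simp only [hg, sq]
    exact (biSmooth_expo_mul.mul ((s0.mul s0).add (s1.mul s1))).neg
  -- On the diagonal `g` is `|γ'|²`, positive by regularity; off it `g` is a quotient of squared
  -- distances, positive because the curve is simple.
  have hdiag : ∀ t, ∃ r : ℝ, 0 < r ∧ g t t = r := fun t => by
    refine ⟨‖deriv γ t‖ ^ 2, by have := norm_pos_iff.mpr (h.regular t); positivity, ?_⟩
    rw [ofReal_norm_sq]
    simp only [hg, d0, d1]
    exact neg_mul_diag_sq _ _ _
  have hch : ∀ t ζ, expDiff t ζ ≠ 0 → 0 < chord γ t ζ := fun t ζ hq =>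
    norm_pos_iff.mpr (sub_ne_zero.mpr (h.ne_of_expDiff_ne_zero hq))
  refine ⟨g, G₀, G₁, hγ, hgs, s0, s1, e0, e1, y0, y1, d0, d1, fun _ _ => rfl, fun t ζ => ?_, hch⟩
  by_cases hq : expDiff t ζ = 0
  · obtain ⟨n, rfl⟩ := exists_eq_sub_of_expDiff_eq_zero hq
    obtain ⟨r, hr, e⟩ := hdiag t
    -- Zeros of `expDiff` are the points congruent modulo `2π`, which periodicity brings back to the
    -- diagonal.
    exact ⟨r, hr, (Function.Periodic.sub_int_mul_eq (hgs.right t).2 n).trans e⟩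
  · have h1 : (chord γ t ζ : ℂ) ^ 2 = expDist t ζ * g t ζ := by
      rw [chord_sq, e0, e1, expDist, hg]
      linear_combination (-(expDiff t ζ ^ 2) * (G₀ t ζ ^ 2 + G₁ t ζ ^ 2)) *
        ((expo (-1) ζ * expo 1 ζ) * expo_neg_mul_expo t + expo_neg_mul_expo ζ)
    have h2 : 4 * Real.sin ((t - ζ) / 2) ^ 2 ≠ 0 := by
      have := expDist_ne_zero hq
      rw [expDist_eq] at this
      exact_mod_cast this
    have h3 : 0 < 4 * Real.sin ((t - ζ) / 2) ^ 2 := lt_of_le_of_ne (by positivity) h2.symm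
    refine ⟨chord γ t ζ ^ 2 / (4 * Real.sin ((t - ζ) / 2) ^ 2), by
      have := hch t ζ hq; positivity, ?_⟩
    rw [Complex.ofReal_div, ← expDist_eq, Complex.ofReal_pow, h1, mul_comm,
      mul_div_cancel_right₀ _ (expDist_ne_zero hq)]

namespace IsChordData

variable {γ : ℝ → Plane} {g G₀ G₁ : ℝ → ℝ → ℂ} (h : IsChordData γ g G₀ G₁)
include h

lemma ne_zero (t ζ : ℝ) : g t ζ ≠ 0 := by
  obtain ⟨r, hr, e⟩ := h.pos t ζ
  rw [e]; exact_mod_cast hr.ne'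

lemma inv : BiSmooth fun t ζ => (g t ζ)⁻¹ := h.smooth.inv h.ne_zero

lemma log : BiSmooth fun t ζ => Complex.log (g t ζ) := by
  refine ⟨contDiff_iff_contDiffAt.mpr fun x => ?_, fun t ζ => by rw [h.smooth.periodic_left],
    fun t ζ => by rw [h.smooth.periodic_right]⟩
  have h1 : g x.1 x.2 ∈ Complex.slitPlane := by
    obtain ⟨r, hr, e⟩ := h.pos x.1 x.2
    rw [e]; exact Complex.ofReal_mem_slitPlane.mpr hr
  exact ((Complex.contDiffAt_log h1).restrict_scalars ℝ).comp x h.smooth.contDiff.contDiffAt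

lemma chord_sq_eq (t ζ : ℝ) : (chord γ t ζ : ℂ) ^ 2 = expDist t ζ * g t ζ := by
  rw [chord_sq, h.eq₀, h.eq₁, expDist, h.g_eq]
  linear_combination (-(expDiff t ζ ^ 2) * (G₀ t ζ ^ 2 + G₁ t ζ ^ 2)) *
    ((expo (-1) ζ * expo 1 ζ) * expo_neg_mul_expo t + expo_neg_mul_expo ζ)

lemma g_diag (t : ℝ) : g t t = cdot (deriv γ) (deriv γ) t t := by
  rw [h.g_eq, h.diag₀, h.diag₁, neg_mul_diag_sq, cdot]; ring

/-- The splitting `ln ρ² = a + L` required by the Hankel decompositions, with `L = ln g` smooth. -/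
lemma log_chord {t ζ : ℝ} (hq : expDiff t ζ ≠ 0) :
    (Real.log (chord γ t ζ ^ 2) : ℂ) = logSin t ζ + Complex.log (g t ζ) := by
  obtain ⟨r, hr, e⟩ := h.pos t ζ
  have h1 := h.chord_sq_eq t ζ
  have h2 := expDist_ne_zero hq
  rw [e, expDist_eq] at h1
  rw [expDist_eq] at h2
  have h3 : chord γ t ζ ^ 2 = 4 * Real.sin ((t - ζ) / 2) ^ 2 * r := by exact_mod_cast h1
  have h4 : 4 * Real.sin ((t - ζ) / 2) ^ 2 ≠ 0 := by exact_mod_cast h2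
  rw [h3, Real.log_mul h4 hr.ne', e, Complex.ofReal_add, Complex.ofReal_log hr.le, logSin]

lemma biSmooth_chord_sq : BiSmooth fun t ζ => (chord γ t ζ : ℂ) ^ 2 := by
  simp only [h.chord_sq_eq, expDist, sq]
  exact ((biSmooth_expDiff.mul biSmooth_expDiff).mul biSmooth_expo_neg_mul).neg.mul h.smooth

/-- The second divided difference of `n(ζ) · (γ(t) - γ(ζ))`. -/
lemma exists_normal_quot : ∃ F, BiSmooth F ∧
    (∀ t ζ, cc (normal γ) 0 ζ * (cc γ 0 t - cc γ 0 ζ) + cc (normal γ) 1 ζ * (cc γ 1 t - cc γ 1 ζ) =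
      expDiff t ζ ^ 2 * F t ζ) ∧
    ∀ t, F t t = -(1 / 2) * expo (-1) t ^ 2 * cdot (normal γ) (iteratedDeriv 2 γ) t t := by
  have hn := h.curve.normal
  have hs : BiSmooth fun t ζ => cc (normal γ) 0 ζ * G₀ t ζ + cc (normal γ) 1 ζ * G₁ t ζ :=
    ((BiSmooth.ofRight (hn.cc 0)).mul h.smooth₀).add ((BiSmooth.ofRight (hn.cc 1)).mul h.smooth₁)
  -- The second zero is the orthogonality of `n` and `γ'`.
  obtain ⟨F, hF, e⟩ := hs.exists_eq_expDiff_mul fun t => by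
    rw [h.diag₀, h.diag₁, cc_normal_zero, cc_normal_one]; ring
  have e2 : ∀ t ζ, cc (normal γ) 0 ζ * (cc γ 0 t - cc γ 0 ζ) +
      cc (normal γ) 1 ζ * (cc γ 1 t - cc γ 1 ζ) = expDiff t ζ ^ 2 * F t ζ := fun t ζ => by
    rw [h.eq₀, h.eq₁]
    linear_combination expDiff t ζ * e t ζ
  refine ⟨F, hF, e2, fun ζ => ?_⟩
  rw [hF.diag_of_eq_expDiff_sq ζ fun t => e2 t ζ]
  congr 1
  have d1 : deriv (fun t => cc (normal γ) 0 ζ * (cc γ 0 t - cc γ 0 ζ) +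
      cc (normal γ) 1 ζ * (cc γ 1 t - cc γ 1 ζ)) = fun t =>
      cc (normal γ) 0 ζ * cc (deriv γ) 0 t + cc (normal γ) 1 ζ * cc (deriv γ) 1 t := by
    ext t
    have a0 := ((h.curve.cc 0).differentiable t).hasDerivAt
    have a1 := ((h.curve.cc 1).differentiable t).hasDerivAt
    rw [h.curve.deriv_cc] at a0 a1
    exact (((a0.sub_const _).const_mul _).add ((a1.sub_const _).const_mul _)).deriv
  rw [d1]
  have a0 := ((h.curve.deriv.cc 0).differentiable ζ).hasDerivAt
  have a1 := ((h.curve.deriv.cc 1).differentiable ζ).hasDerivAt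
  rw [h.curve.deriv.deriv_cc] at a0 a1
  rw [iteratedDeriv_succ, iteratedDeriv_one]
  exact ((a0.const_mul _).add (a1.const_mul _)).deriv

/-- The first divided difference of `γ'(t) · γ'(ζ) - |γ'(t)|²`. -/
lemma exists_tangent_quot : ∃ W, BiSmooth W ∧
    ∀ t ζ, cdot (deriv γ) (deriv γ) t ζ - cdot (deriv γ) (deriv γ) t t +
      cdot (deriv γ) (iteratedDeriv 2 γ) t t * Real.sin (t - ζ) = expDiff t ζ ^ 2 * W t ζ := by
  have hd := h.curve.deriv
  obtain ⟨K₀, s0, e0, -, d0⟩ := (hd.cc 0).exists_divDiff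
  obtain ⟨K₁, s1, e1, -, d1⟩ := (hd.cc 1).exists_divDiff
  simp only [hd.deriv_cc] at d0 d1
  have hi : iteratedDeriv 2 γ = deriv (deriv γ) := by rw [iteratedDeriv_succ, iteratedDeriv_one]
  rw [hi]
  have hs : BiSmooth fun t ζ => cdot (deriv γ) (deriv (deriv γ)) t t * sinQuot t ζ -
      (cc (deriv γ) 0 t * K₀ t ζ + cc (deriv γ) 1 t * K₁ t ζ) :=
    ((BiSmooth.ofLeft (hd.cdot_diag hd.deriv)).mul biSmooth_sinQuot).sub
      (((BiSmooth.ofLeft (hd.cc 0)).mul s0).add ((BiSmooth.ofLeft (hd.cc 1)).mul s1))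
  -- The sine term is the first order Taylor term of `γ'(t) · γ'(ζ)` at `ζ = t`, so the first
  -- quotients agree on the diagonal.
  obtain ⟨W, hW, e⟩ := hs.exists_eq_expDiff_mul fun t => by
    rw [d0, d1, sinQuot_self, cdot]; ring
  refine ⟨W, hW, fun t ζ => ?_⟩
  rw [sin_sub_eq]
  have a0 := e0 t ζ
  have a1 := e1 t ζ
  unfold cdot at e ⊢
  linear_combination expDiff t ζ * e t ζ - cc (deriv γ) 0 t * a0 - cc (deriv γ) 1 t * a1

/-- The singular parts of the kernel `h` cancel. -/
lemma exists_singular_quot : ∃ W, BiSmooth W ∧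
    ∀ t ζ, cdot (deriv γ) (deriv γ) t ζ * g t ζ +
      2 * (expo 1 t * expo 1 ζ) * (cc (deriv γ) 0 t * G₀ t ζ + cc (deriv γ) 1 t * G₁ t ζ) *
        (cc (deriv γ) 0 ζ * G₀ t ζ + cc (deriv γ) 1 ζ * G₁ t ζ) + g t ζ ^ 2 =
        expDiff t ζ ^ 2 * W t ζ := by
  have hd := h.curve.deriv
  set Z : ℝ → ℝ → ℂ := fun t ζ => cdot (deriv γ) (deriv γ) t ζ * g t ζ +
      2 * (expo 1 t * expo 1 ζ) * (cc (deriv γ) 0 t * G₀ t ζ + cc (deriv γ) 1 t * G₁ t ζ) *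
        (cc (deriv γ) 0 ζ * G₀ t ζ + cc (deriv γ) 1 ζ * G₁ t ζ) + g t ζ ^ 2 with hZdef
  have hZ : BiSmooth Z := by
    simp only [hZdef, sq]
    exact (((hd.cdot hd).mul h.smooth).add ((((BiSmooth.const 2).mul biSmooth_expo_mul).mul
      (((BiSmooth.ofLeft (hd.cc 0)).mul h.smooth₀).add ((BiSmooth.ofLeft (hd.cc 1)).mul h.smooth₁))).mul
      (((BiSmooth.ofRight (hd.cc 0)).mul h.smooth₀).add
        ((BiSmooth.ofRight (hd.cc 1)).mul h.smooth₁)))).add (h.smooth.mul h.smooth)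
  obtain ⟨V, hV, e⟩ := hZ.exists_eq_expDiff_mul fun t => by
    simp only [hZdef]
    rw [h.g_diag, h.diag₀, h.diag₁, cdot]
    linear_combination (2 * (cc (deriv γ) 0 t ^ 2 + cc (deriv γ) 1 t ^ 2) ^ 2) *
      (Complex.I_sq * (expo (-1) t * expo 1 t) ^ 2 -
        (expo (-1) t * expo 1 t + 1) * expo_neg_mul_expo t)
  -- `Z` is symmetric and `expDiff` antisymmetric, so the quotient `V` is antisymmetric. It vanishes
  -- on the diagonal and can be divided once more, with no further derivatives of the curve to
  -- compute.
  have hsymm : ∀ t ζ, Z t ζ = Z ζ t := fun t ζ => by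
    simp only [hZdef]
    rw [cdot_comm (deriv γ) (deriv γ) t ζ, h.g_eq t ζ, h.g_eq ζ t, h.symm₀ ζ t, h.symm₁ ζ t]
    ring
  have hV0 : ∀ t ζ, V t ζ = -V ζ t := fun t ζ => by
    refine hV.eq_of_expDiff_mul_eq hV.swap.neg (fun t ζ => ?_) t ζ
    linear_combination hsymm t ζ + e ζ t - e t ζ + V ζ t * expDiff_swap t ζ
  obtain ⟨W, hW, e'⟩ := hV.exists_eq_expDiff_mul fun t => by
    have := hV0 t t
    linear_combination this / 2
  refine ⟨W, hW, fun t ζ => ?_⟩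
  have h1 : Z t ζ = expDiff t ζ ^ 2 * W t ζ := by
    linear_combination e t ζ + expDiff t ζ * e' t ζ
  exact h1

end IsChordData

/-! ### The coefficients of the multiplication operators -/

section Coefficients

variable {γ : ℝ → Plane} (κ : ℝ)

lemma iteratedDeriv_two_eq (γ : ℝ → Plane) : iteratedDeriv 2 γ = deriv (deriv γ) := by
  rw [iteratedDeriv_succ, iteratedDeriv_one]

lemma iteratedDeriv_three_eq (γ : ℝ → Plane) : iteratedDeriv 3 γ = deriv (deriv (deriv γ)) := by
  rw [iteratedDeriv_succ, iteratedDeriv_two_eq]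

lemma ofReal_norm_sq_eq_cdot (α : ℝ → Plane) (t : ℝ) : (‖α t‖ : ℂ) ^ 2 = cdot α α t t := by
  rw [← Complex.ofReal_pow, ofReal_norm_sq, cdot, cc, cc]; ring

lemma coef₁_eq (γ : ℝ → Plane) (t : ℝ) : ((κ ^ 2 * ‖deriv γ t‖ ^ 2 : ℝ) : ℂ) =
    κ ^ 2 * cdot (deriv γ) (deriv γ) t t := by
  rw [← ofReal_norm_sq_eq_cdot]; push_cast; rfl

lemma coef₂_eq (γ : ℝ → Plane) (t : ℝ) :
    ((κ ^ 2 * inner ℝ (normal γ t) (iteratedDeriv 2 γ t) : ℝ) : ℂ) =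
      κ ^ 2 * cdot (normal γ) (iteratedDeriv 2 γ) t t := by
  rw [← ofReal_inner_eq_cdot]; push_cast; rfl

lemma coef₃_eq (γ : ℝ → Plane) (t : ℝ) :
    ((κ ^ 2 * inner ℝ (deriv γ t) (iteratedDeriv 2 γ t) : ℝ) : ℂ) =
      κ ^ 2 * cdot (deriv γ) (iteratedDeriv 2 γ) t t := by
  rw [← ofReal_inner_eq_cdot]; push_cast; rfl

lemma coef₄_eq (γ : ℝ → Plane) (t : ℝ) :
    ((κ ^ 4 * ‖deriv γ t‖ ^ 4 + 2 * κ ^ 2 * inner ℝ (deriv γ t) (iteratedDeriv 3 γ t) : ℝ) : ℂ) =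
      κ ^ 4 * (cdot (deriv γ) (deriv γ) t t * cdot (deriv γ) (deriv γ) t t) +
        2 * κ ^ 2 * cdot (deriv γ) (iteratedDeriv 3 γ) t t := by
  rw [← ofReal_norm_sq_eq_cdot, ← ofReal_inner_eq_cdot]; push_cast; ring

lemma coef₅_eq (γ : ℝ → Plane) (t : ℝ) :
    ((-(3 / 4) * κ ^ 4 * ‖deriv γ t‖ ^ 4 + κ ^ 2 * inner ℝ (deriv γ t) (iteratedDeriv 3 γ t) : ℝ) : ℂ) =
      -(3 / 4) * κ ^ 4 * (cdot (deriv γ) (deriv γ) t t * cdot (deriv γ) (deriv γ) t t) +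
        κ ^ 2 * cdot (deriv γ) (iteratedDeriv 3 γ) t t := by
  rw [← ofReal_norm_sq_eq_cdot, ← ofReal_inner_eq_cdot]; push_cast; ring

lemma SmoothPeriodic.const_mul {φ : ℝ → ℂ} (h : SmoothPeriodic φ) (c : ℂ) :
    SmoothPeriodic fun t => c * φ t :=
  ⟨contDiff_const.mul h.1, fun t => congrArg (c * ·) (h.2 t)⟩

lemma SmoothCurve.coef₁ (h : SmoothCurve γ) :
    SmoothPeriodic fun t => ((κ ^ 2 * ‖_root_.deriv γ t‖ ^ 2 : ℝ) : ℂ) := by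
  simp only [coef₁_eq]
  exact (h.deriv.cdot_diag h.deriv).const_mul _

lemma SmoothCurve.coef₂ (h : SmoothCurve γ) : SmoothPeriodic fun t =>
    ((κ ^ 2 * inner ℝ (BiharmonicCavity.normal γ t) (iteratedDeriv 2 γ t) : ℝ) : ℂ) := by
  simp only [coef₂_eq]; rw [iteratedDeriv_two_eq]
  exact (h.normal.cdot_diag h.deriv.deriv).const_mul _

lemma SmoothCurve.coef₃ (h : SmoothCurve γ) : SmoothPeriodic fun t =>
    ((κ ^ 2 * inner ℝ (_root_.deriv γ t) (iteratedDeriv 2 γ t) : ℝ) : ℂ) := by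
  simp only [coef₃_eq]; rw [iteratedDeriv_two_eq]
  exact (h.deriv.cdot_diag h.deriv.deriv).const_mul _

lemma SmoothCurve.coef₄ (h : SmoothCurve γ) : SmoothPeriodic fun t =>
    ((κ ^ 4 * ‖_root_.deriv γ t‖ ^ 4 +
      2 * κ ^ 2 * inner ℝ (_root_.deriv γ t) (iteratedDeriv 3 γ t) : ℝ) : ℂ) := by
  have h1 := h.deriv.cdot_diag h.deriv
  simp only [coef₄_eq]; rw [iteratedDeriv_three_eq]
  exact ((h1.mul h1).const_mul _).add ((h.deriv.cdot_diag h.deriv.deriv.deriv).const_mul _)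

lemma SmoothCurve.coef₅ (h : SmoothCurve γ) : SmoothPeriodic fun t =>
    ((-(3 / 4) * κ ^ 4 * ‖_root_.deriv γ t‖ ^ 4 +
      κ ^ 2 * inner ℝ (_root_.deriv γ t) (iteratedDeriv 3 γ t) : ℝ) : ℂ) := by
  have h1 := h.deriv.cdot_diag h.deriv
  simp only [coef₅_eq]; rw [iteratedDeriv_three_eq]
  exact ((h1.mul h1).const_mul _).add ((h.deriv.cdot_diag h.deriv.deriv.deriv).const_mul _)

end Coefficients

lemma besselE_zero_eq (w : ℂ) : besselE 0 w = 1 + w * besselE' 0 w := by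
  rw [besselE_eq]; simp [besselCoef]

lemma besselE_one_eq (w : ℂ) : besselE 1 w = 1 + w * besselE' 1 w := by
  rw [besselE_eq]; simp [besselCoef]

lemma besselE'_zero_zero : besselE' 0 0 = -(1 / 4) := by
  rw [besselE'_zero]; simp [besselCoef]; norm_num

lemma BiSmooth.expDiff_sq_mul {F : ℝ → ℝ → ℂ} (hF : BiSmooth F) :
    BiSmooth fun t ζ => expDiff t ζ ^ 2 * F t ζ := by
  simp only [sq]
  exact (biSmooth_expDiff.mul biSmooth_expDiff).mul hF

/-! ### Decompositions of the kernels -/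

namespace IsChordData

variable {γ : ℝ → Plane} {g G₀ G₁ : ℝ → ℝ → ℂ} (h : IsChordData γ g G₀ G₁) {κ : ℝ}
include h

lemma biSmooth_kappa_chord (κ : ℝ) : BiSmooth fun t ζ => (κ : ℂ) ^ 2 * (chord γ t ζ : ℂ) ^ 2 :=
  (BiSmooth.const _).mul h.biSmooth_chord_sq

lemma biSmooth_hankelReg (κ : ℝ) (n : ℕ) (c : ℂ) {w : ℝ → ℝ → ℂ} (hw : BiSmooth w) :
    BiSmooth fun t ζ => hankelReg κ n c (w t ζ) (Complex.log (g t ζ)) := by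
  unfold hankelReg
  exact ((hw.comp (contDiff_besselE n)).mul ((BiSmooth.const _).add
    ((BiSmooth.const _).mul h.log))).sub ((BiSmooth.const _).mul (hw.comp (contDiff_besselD n)))

/-- A double zero on the diagonal cancels the pole `1/ρ²` and leaves a smooth function. -/
lemma mul_inv_chord_sq {t ζ : ℝ} (hq : expDiff t ζ ≠ 0) (f : ℂ) :
    expDiff t ζ ^ 2 * f / (chord γ t ζ : ℂ) ^ 2 = -(expo 1 t * expo 1 ζ * f * (g t ζ)⁻¹) := by
  have h1 := h.ne_zero t ζ
  have h2 := expo_neg_mul_expo t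
  have h3 := expo_neg_mul_expo ζ
  have h4 := expo_ne_zero (-1) t
  have h5 := expo_ne_zero (-1) ζ
  rw [h.chord_sq_eq, expDist]
  field_simp
  linear_combination f * ((expo (-1) ζ * expo 1 ζ) * h2 + h3)

lemma isLogOp_opS (hκ : 0 < κ) : IsLogOp (opS γ κ)
    (fun t ζ => -(1 / (2 * (π : ℂ))) * besselE 0 (-(κ ^ 2 * (chord γ t ζ : ℂ) ^ 2)))
    (fun t ζ => Complex.I / 2 *
      hankelReg κ 0 0 (-(κ ^ 2 * (chord γ t ζ : ℂ) ^ 2)) (Complex.log (g t ζ))) := by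
  have hX := (h.biSmooth_kappa_chord κ).neg
  refine isLogOp_kernelOp ((BiSmooth.const _).mul (hX.comp (contDiff_besselE 0)))
    ((BiSmooth.const _).mul (h.biSmooth_hankelReg κ 0 0 hX)) fun t ζ hq => ?_
  rw [kerS, hankel_zero_imag hκ (h.chord_pos t ζ hq) (h.log_chord hq)]
  linear_combination (1 / (2 * (π : ℂ)) * besselE 0 (-(κ ^ 2 * (chord γ t ζ : ℂ) ^ 2)) *
    logSin t ζ) * Complex.I_sq

lemma isLogOp_opL (hκ : 0 < κ) {F : ℝ → ℝ → ℂ} (hF : BiSmooth F)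
    (e : ∀ t ζ, cc (normal γ) 0 ζ * (cc γ 0 t - cc γ 0 ζ) +
      cc (normal γ) 1 ζ * (cc γ 1 t - cc γ 1 ζ) = expDiff t ζ ^ 2 * F t ζ) :
    IsLogOp (opL γ κ)
      (fun t ζ => -(κ ^ 2 / (4 * (π : ℂ))) * (expDiff t ζ ^ 2 * F t ζ) *
        besselE 1 (κ ^ 2 * (chord γ t ζ : ℂ) ^ 2))
      (fun t ζ => Complex.I * κ ^ 2 / 4 * (expDiff t ζ ^ 2 * F t ζ) *
        hankelReg κ 1 1 (κ ^ 2 * (chord γ t ζ : ℂ) ^ 2) (Complex.log (g t ζ)) +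
        -(1 / (π : ℂ)) * (expo 1 t * expo 1 ζ * F t ζ * (g t ζ)⁻¹)) := by
  have hX := h.biSmooth_kappa_chord κ
  have hN := hF.expDiff_sq_mul
  refine isLogOp_kernelOp (((BiSmooth.const _).mul hN).mul (hX.comp (contDiff_besselE 1)))
    ((((BiSmooth.const _).mul hN).mul (h.biSmooth_hankelReg κ 1 1 hX)).add
      ((BiSmooth.const _).mul ((biSmooth_expo_mul.mul hF).mul h.inv))) fun t ζ hq => ?_
  have hp : (π : ℂ) ≠ 0 := by exact_mod_cast Real.pi_ne_zero
  have hk : (κ : ℂ) ≠ 0 := by exact_mod_cast hκ.ne'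
  rw [kerL, hankel_one_real hκ (h.chord_pos t ζ hq) (h.log_chord hq), ofReal_inner_sub]
  change Complex.I * κ / 2 * (cc (normal γ) 0 ζ * _ + cc (normal γ) 1 ζ * _) * _ = _
  rw [e]
  have h1 := h.mul_inv_chord_sq hq (F t ζ)
  -- The pole of `H₁/ρ` meets the double zero of `n(ζ) · (γ(t) - γ(ζ))`.
  have h2 : Complex.I * κ / 2 * (expDiff t ζ ^ 2 * F t ζ) *
      (2 * Complex.I / (π * κ) / (chord γ t ζ : ℂ) ^ 2) =
        -(1 / (π : ℂ)) * -(expo 1 t * expo 1 ζ * F t ζ * (g t ζ)⁻¹) := by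
    rw [← h1]
    field_simp
    rw [Complex.I_sq]
    ring
  rw [mul_sub, h2]
  linear_combination ((κ : ℂ) ^ 2 / (4 * π) * (expDiff t ζ ^ 2 * F t ζ) *
        besselE 1 (κ ^ 2 * (chord γ t ζ : ℂ) ^ 2) * logSin t ζ) * Complex.I_sq

lemma isLogOp_opK (hκ : 0 < κ) {F : ℝ → ℝ → ℂ} (hF : BiSmooth F)
    (e : ∀ t ζ, cc (normal γ) 0 ζ * (cc γ 0 t - cc γ 0 ζ) +
      cc (normal γ) 1 ζ * (cc γ 1 t - cc γ 1 ζ) = expDiff t ζ ^ 2 * F t ζ) :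
    IsLogOp (opK γ κ)
      (fun t ζ => -(κ ^ 2 / (4 * (π : ℂ))) * (expDiff t ζ ^ 2 * -F ζ t) *
        besselE 1 (-(κ ^ 2 * (chord γ t ζ : ℂ) ^ 2)))
      (fun t ζ => Complex.I * κ ^ 2 / 4 * (expDiff t ζ ^ 2 * -F ζ t) *
        hankelReg κ 1 0 (-(κ ^ 2 * (chord γ t ζ : ℂ) ^ 2)) (Complex.log (g t ζ)) +
        1 / (π : ℂ) * (expo 1 t * expo 1 ζ * -F ζ t * (g t ζ)⁻¹)) := by
  have hX := (h.biSmooth_kappa_chord κ).neg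
  have hF' := hF.swap.neg
  have hN := hF'.expDiff_sq_mul
  refine isLogOp_kernelOp (((BiSmooth.const _).mul hN).mul (hX.comp (contDiff_besselE 1)))
    ((((BiSmooth.const _).mul hN).mul (h.biSmooth_hankelReg κ 1 0 hX)).add
      ((BiSmooth.const _).mul ((biSmooth_expo_mul.mul hF').mul h.inv))) fun t ζ hq => ?_
  have hp : (π : ℂ) ≠ 0 := by exact_mod_cast Real.pi_ne_zero
  have hk : (κ : ℂ) ≠ 0 := by exact_mod_cast hκ.ne'
  -- Here the normal is taken at `t`; exchanging the arguments leaves the square of `expDiff`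
  -- unchanged and changes the sign of the quotient.
  have e' : cc (normal γ) 0 t * (cc γ 0 t - cc γ 0 ζ) +
      cc (normal γ) 1 t * (cc γ 1 t - cc γ 1 ζ) = expDiff t ζ ^ 2 * -F ζ t := by
    have := e ζ t
    rw [expDiff_swap] at this
    linear_combination -this
  rw [kerK, hankel_one_imag hκ (h.chord_pos t ζ hq) (h.log_chord hq), ofReal_inner_sub]
  change (κ : ℂ) / 2 * (cc (normal γ) 0 t * _ + cc (normal γ) 1 t * _) * _ = _
  rw [e']
  have h1 := h.mul_inv_chord_sq hq (-F ζ t)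
  have h2 : (κ : ℂ) / 2 * (expDiff t ζ ^ 2 * -F ζ t) *
      (2 / (π * κ) / (chord γ t ζ : ℂ) ^ 2) =
        (1 / (π : ℂ)) * -(expo 1 t * expo 1 ζ * -F ζ t * (g t ζ)⁻¹) := by
    rw [← h1]
    field_simp
  rw [mul_sub, h2]
  ring

lemma isLogOp_opR (hκ : 0 < κ) : IsLogOp (opR γ κ)
    (fun t ζ => -(κ ^ 2 / (2 * (π : ℂ))) * cdot (deriv γ) (deriv γ) t ζ *
      besselE 0 (κ ^ 2 * (chord γ t ζ : ℂ) ^ 2))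
    (fun t ζ => Complex.I * κ ^ 2 / 2 * cdot (deriv γ) (deriv γ) t ζ *
      hankelReg κ 0 1 (κ ^ 2 * (chord γ t ζ : ℂ) ^ 2) (Complex.log (g t ζ))) := by
  have hX := h.biSmooth_kappa_chord κ
  have hd := h.curve.deriv.cdot h.curve.deriv
  refine isLogOp_kernelOp (((BiSmooth.const _).mul hd).mul (hX.comp (contDiff_besselE 0)))
    (((BiSmooth.const _).mul hd).mul (h.biSmooth_hankelReg κ 0 1 hX)) fun t ζ hq => ?_
  rw [kerR, hankel_zero_real hκ (h.chord_pos t ζ hq) (h.log_chord hq), ofReal_inner_eq_cdot,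
    cdot_normal_normal]
  linear_combination ((κ : ℂ) ^ 2 / (2 * π) * cdot (deriv γ) (deriv γ) t ζ *
        besselE 0 (κ ^ 2 * (chord γ t ζ : ℂ) ^ 2) * logSin t ζ) * Complex.I_sq

/-- The smooth extension of `h̃`. -/
lemma exists_hTilde : ∃ η, BiSmooth η ∧
    (∀ t ζ, η t ζ * g t ζ = -(expo 1 t * expo 1 ζ *
      (cc (deriv γ) 0 t * G₀ t ζ + cc (deriv γ) 1 t * G₁ t ζ) *
        (cc (deriv γ) 0 ζ * G₀ t ζ + cc (deriv γ) 1 ζ * G₁ t ζ))) ∧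
    ∀ t ζ, expDiff t ζ ≠ 0 → (hTilde γ t ζ : ℂ) = η t ζ := by
  have hd := h.curve.deriv
  refine ⟨fun t ζ => -(expo 1 t * expo 1 ζ *
      (cc (deriv γ) 0 t * G₀ t ζ + cc (deriv γ) 1 t * G₁ t ζ) *
        (cc (deriv γ) 0 ζ * G₀ t ζ + cc (deriv γ) 1 ζ * G₁ t ζ)) * (g t ζ)⁻¹, ?_, fun t ζ => ?_,
      fun t ζ hq => ?_⟩
  · exact ((biSmooth_expo_mul.mul (((BiSmooth.ofLeft (hd.cc 0)).mul h.smooth₀).add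
      ((BiSmooth.ofLeft (hd.cc 1)).mul h.smooth₁))).mul (((BiSmooth.ofRight (hd.cc 0)).mul
        h.smooth₀).add ((BiSmooth.ofRight (hd.cc 1)).mul h.smooth₁))).neg.mul h.inv
  · rw [mul_assoc, inv_mul_cancel₀ (h.ne_zero t ζ), mul_one]
  · have h1 := h.mul_inv_chord_sq hq ((cc (deriv γ) 0 t * G₀ t ζ + cc (deriv γ) 1 t * G₁ t ζ) *
        (cc (deriv γ) 0 ζ * G₀ t ζ + cc (deriv γ) 1 ζ * G₁ t ζ))
    unfold hTilde
    rw [Complex.ofReal_div, Complex.ofReal_mul, ofReal_inner_sub, ofReal_inner_sub, h.eq₀, h.eq₁,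
      Complex.ofReal_pow]
    refine Eq.trans ?_ (h1.trans (by ring))
    change (cc (deriv γ) 0 t * _ + cc (deriv γ) 1 t * _) *
      (cc (deriv γ) 0 ζ * _ + cc (deriv γ) 1 ζ * _) / _ = _
    ring

/-- The logarithmic coefficient keeps `η` only in the combination `E₀ - E₁`, which vanishes at `ρ =
0`. The three poles of the kernel cancel by `exists_singular_quot`. -/
lemma exists_isLogOp_opH (hκ : 0 < κ) : ∃ η B, BiSmooth η ∧ IsLogOp (opH γ κ)
    (fun t ζ => -(κ ^ 2 / (2 * (π : ℂ))) * η t ζ * (besselE 0 (κ ^ 2 * (chord γ t ζ : ℂ) ^ 2) -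
        besselE 1 (κ ^ 2 * (chord γ t ζ : ℂ) ^ 2)) +
      -(κ ^ 2 / (4 * (π : ℂ))) * cdot (deriv γ) (deriv γ) t ζ *
      besselE 1 (κ ^ 2 * (chord γ t ζ : ℂ) ^ 2)) B := by
  have hX := h.biSmooth_kappa_chord κ
  have hd := h.curve.deriv.cdot h.curve.deriv
  obtain ⟨η, hη, e1, e2⟩ := h.exists_hTilde
  obtain ⟨W, hW, eW⟩ := h.exists_singular_quot
  have hR0 := h.biSmooth_hankelReg κ 0 1 hX
  have hR1 := h.biSmooth_hankelReg κ 1 1 hX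
  refine ⟨η, fun t ζ => Complex.I * κ ^ 2 / 2 * η t ζ * (
      hankelReg κ 0 1 (κ ^ 2 * (chord γ t ζ : ℂ) ^ 2) (Complex.log (g t ζ)) -
      hankelReg κ 1 1 (κ ^ 2 * (chord γ t ζ : ℂ) ^ 2) (Complex.log (g t ζ))) +
      Complex.I * κ ^ 2 / 4 * cdot (deriv γ) (deriv γ) t ζ *
      hankelReg κ 1 1 (κ ^ 2 * (chord γ t ζ : ℂ) ^ 2) (Complex.log (g t ζ)) +
      -(1 / (π : ℂ)) * (expo 1 t * expo 1 ζ * W t ζ * (g t ζ)⁻¹) * (g t ζ)⁻¹, hη,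
      isLogOp_kernelOp (((((BiSmooth.const _).mul hη).mul ((hX.comp (contDiff_besselE 0)).sub
        (hX.comp (contDiff_besselE 1)))).add (((BiSmooth.const _).mul hd).mul
          (hX.comp (contDiff_besselE 1)))))
      (((((BiSmooth.const _).mul hη).mul (hR0.sub hR1)).add
        (((BiSmooth.const _).mul hd).mul hR1)).add (((BiSmooth.const _).mul
          ((biSmooth_expo_mul.mul hW).mul h.inv)).mul h.inv)) fun t ζ hq => ?_⟩
  have hp : (π : ℂ) ≠ 0 := by exact_mod_cast Real.pi_ne_zero
  have hk : (κ : ℂ) ≠ 0 := by exact_mod_cast hκ.ne'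
  have hc := h.chord_pos t ζ hq
  have hc' : (chord γ t ζ : ℂ) ≠ 0 := by exact_mod_cast hc.ne'
  have hg := h.ne_zero t ζ
  have hx := h.chord_sq_eq t ζ
  have hsin : (Real.sin ((t - ζ) / 2) : ℂ) ^ 2 = expDist t ζ / 4 := by
    rw [expDist_eq]; push_cast; ring
  have hden := expDist_ne_zero hq
  have h1 := h.mul_inv_chord_sq hq (W t ζ)
  -- Over a common denominator the poles form the numerator of `exists_singular_quot`, which has a
  -- double zero; the quotient by `ρ²` is smooth.
  have hsing : cdot (deriv γ) (deriv γ) t ζ / π / (chord γ t ζ : ℂ) ^ 2 -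
      2 * η t ζ / π / (chord γ t ζ : ℂ) ^ 2 + 1 / (4 * (π : ℂ)) * (1 / (expDist t ζ / 4)) =
      -(1 / (π : ℂ)) * (expo 1 t * expo 1 ζ * W t ζ * (g t ζ)⁻¹) * (g t ζ)⁻¹ := by
    have h2 : -(1 / (π : ℂ)) * (expo 1 t * expo 1 ζ * W t ζ * (g t ζ)⁻¹) * (g t ζ)⁻¹ =
        1 / π * (expDiff t ζ ^ 2 * W t ζ / (chord γ t ζ : ℂ) ^ 2) * (g t ζ)⁻¹ := by
      rw [h1]; ring
    rw [h2, ← eW, hx]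
    field_simp
    linear_combination (-2 : ℂ) * e1 t ζ
  rw [kerH, e2 t ζ hq, hsin, ← hsing,
    hankel_zero_real hκ hc (h.log_chord hq), ofReal_inner_eq_cdot]
  have hk1 := hankel_one_real hκ hc (h.log_chord hq)
  have k1 : 2 * κ * hankel 1 (κ * chord γ t ζ) / chord γ t ζ =
      2 * κ * (hankel 1 (κ * chord γ t ζ) / chord γ t ζ) := by ring
  have k2 : Complex.I * κ * cdot (deriv γ) (deriv γ) t ζ / (2 * chord γ t ζ) * hankel 1 (κ * chord γ t ζ) =
      Complex.I * κ * cdot (deriv γ) (deriv γ) t ζ / 2 * (hankel 1 (κ * chord γ t ζ) / chord γ t ζ) := by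
    field_simp
  rw [k1, k2, hk1]
  generalize hankelReg κ 0 1 (κ ^ 2 * (chord γ t ζ : ℂ) ^ 2) (Complex.log (g t ζ)) = r0
  generalize hankelReg κ 1 1 (κ ^ 2 * (chord γ t ζ : ℂ) ^ 2) (Complex.log (g t ζ)) = r1
  generalize besselE 0 (κ ^ 2 * (chord γ t ζ : ℂ) ^ 2) = b0
  generalize besselE 1 (κ ^ 2 * (chord γ t ζ : ℂ) ^ 2) = b1
  generalize cdot (deriv γ) (deriv γ) t ζ = d
  generalize η t ζ = v
  generalize (logSin t ζ : ℂ) = s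
  field_simp
  ring_nf
  simp only [Complex.I_sq]
  ring

end IsChordData

/-! ### Orders of the remainders -/

namespace IsChordData

variable {γ : ℝ → Plane} {g G₀ G₁ : ℝ → ℝ → ℂ} (h : IsChordData γ g G₀ G₁) {κ : ℝ}
include h

/-- The quotient of `|γ(t) - γ(ζ)|²` by `(e^{it} - e^{iζ})²`. -/
lemma chord_sq_eq_expDiff (t ζ : ℝ) : (chord γ t ζ : ℂ) ^ 2 =
    expDiff t ζ ^ 2 * -(expo (-1) t * expo (-1) ζ * g t ζ) := by
  rw [h.chord_sq_eq, expDist]; ring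

lemma biSmooth_chordQuot : BiSmooth fun t ζ => -(expo (-1) t * expo (-1) ζ * g t ζ) :=
  (biSmooth_expo_neg_mul.mul h.smooth).neg

/-- Since `E₀(w) = 1 - w/4 + ...`, the coefficient `-(1/2π) E₀(-κ²ρ²)` is `-1/2π - κ²ρ²/8π + ...`.
The constant is removed by `S̃₀` and the quadratic term by `E₁S₂`, as `ρ²` and `|γ'|² sin²(t-ζ)`
agree to second order. A triple zero remains, hence order -4. -/
lemma exists_rep_opStilde (hκ : 0 < κ) : ∃ A, IsOrd (-4) A ∧ Rep (opStilde γ κ) A := by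
  have hX := (h.biSmooth_kappa_chord κ).neg
  have hlog := ((h.isLogOp_opS hκ).sub isLogOp_opS0tilde).sub
    (isLogOp_opS2.mulOp_comp (h.curve.coef₁ κ))
  have hW : BiSmooth fun t ζ => -(1 / (2 * (π : ℂ))) * (-(κ ^ 2 * -(expo (-1) t * expo (-1) ζ * g t ζ)) *
      besselE' 0 (-(κ ^ 2 * (chord γ t ζ : ℂ) ^ 2))) +
      κ ^ 2 * cdot (deriv γ) (deriv γ) t t * (1 / (8 * (π : ℂ)) * (sinQuot t ζ * sinQuot t ζ)) :=
    ((BiSmooth.const _).mul ((((BiSmooth.const _).mul h.biSmooth_chordQuot).neg).mul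
      (hX.comp (contDiff_besselE' 0)))).add (((BiSmooth.const _).mul (BiSmooth.ofLeft
        (h.curve.deriv.cdot_diag h.curve.deriv))).mul ((BiSmooth.const _).mul
          (biSmooth_sinQuot.mul biSmooth_sinQuot)))
  obtain ⟨F, hF, e⟩ := hW.exists_eq_expDiff_mul fun t => by
    rw [h.chord_sq_eq_expDiff, expDiff_self, sinQuot_self, h.g_diag]
    norm_num
    rw [besselE'_zero_zero]
    linear_combination ((κ : ℂ) ^ 2 * cdot (deriv γ) (deriv γ) t t * (1 / (8 * (π : ℂ))) *
      expo (-1) t ^ 2) * Complex.I_sq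
  refine hlog.exists_rep hF (j := 3) (fun t ζ => ?_) exists_logDiffCoef_three_bound
  have e := e t ζ
  rw [besselE_zero_eq, sin_sub_eq, coef₁_eq]
  nth_rewrite 1 [h.chord_sq_eq_expDiff]
  linear_combination expDiff t ζ ^ 2 * e

/-- To leading order `n(ζ) · (γ(t) - γ(ζ))` is `½ n · γ'' (t-ζ)²`, and `E₂S₂` removes exactly this
term. -/
lemma exists_rep_opLtilde (hκ : 0 < κ) : ∃ A, IsOrd (-4) A ∧ Rep (opLtilde γ κ) A := by
  have hX := h.biSmooth_kappa_chord κ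
  obtain ⟨N, hN, eN, dN⟩ := h.exists_normal_quot
  have hlog := (h.isLogOp_opL hκ hN eN).sub (isLogOp_opS2.mulOp_comp (h.curve.coef₂ κ))
  have hW : BiSmooth fun t ζ => -(κ ^ 2 / (4 * (π : ℂ))) * N t ζ *
        besselE 1 (κ ^ 2 * (chord γ t ζ : ℂ) ^ 2) +
      κ ^ 2 * cdot (normal γ) (deriv (deriv γ)) t t * (1 / (8 * (π : ℂ)) * (sinQuot t ζ * sinQuot t ζ)) :=
    (((BiSmooth.const _).mul hN).mul (hX.comp (contDiff_besselE 1))).add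
      (((BiSmooth.const _).mul (BiSmooth.ofLeft
        (h.curve.normal.cdot_diag h.curve.deriv.deriv))).mul ((BiSmooth.const _).mul
          (biSmooth_sinQuot.mul biSmooth_sinQuot)))
  obtain ⟨F, hF, e⟩ := hW.exists_eq_expDiff_mul fun t => by
    rw [besselE_one_eq, h.chord_sq_eq_expDiff, expDiff_self, sinQuot_self, dN, iteratedDeriv_two_eq]
    linear_combination ((κ : ℂ) ^ 2 * cdot (normal γ) (deriv (deriv γ)) t t * (1 / (8 * (π : ℂ))) *
      expo (-1) t ^ 2) * Complex.I_sq
  refine hlog.exists_rep hF (j := 3) (fun t ζ => ?_) exists_logDiffCoef_three_bound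
  have e := e t ζ
  rw [sin_sub_eq, coef₂_eq, iteratedDeriv_two_eq]
  linear_combination expDiff t ζ ^ 2 * e

/-- As for `L̃`, with the opposite sign because the normal sits at the other point. -/
lemma exists_rep_opKtilde (hκ : 0 < κ) : ∃ A, IsOrd (-4) A ∧ Rep (opKtilde γ κ) A := by
  have hX := (h.biSmooth_kappa_chord κ).neg
  obtain ⟨N, hN, eN, dN⟩ := h.exists_normal_quot
  have hlog := (h.isLogOp_opK hκ hN eN).add (isLogOp_opS2.mulOp_comp (h.curve.coef₂ κ))
  have hW : BiSmooth fun t ζ => -(κ ^ 2 / (4 * (π : ℂ))) * -N ζ t *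
        besselE 1 (-(κ ^ 2 * (chord γ t ζ : ℂ) ^ 2)) -
      κ ^ 2 * cdot (normal γ) (deriv (deriv γ)) t t * (1 / (8 * (π : ℂ)) * (sinQuot t ζ * sinQuot t ζ)) :=
    (((BiSmooth.const _).mul hN.swap.neg).mul (hX.comp (contDiff_besselE 1))).sub
      (((BiSmooth.const _).mul (BiSmooth.ofLeft
        (h.curve.normal.cdot_diag h.curve.deriv.deriv))).mul ((BiSmooth.const _).mul
          (biSmooth_sinQuot.mul biSmooth_sinQuot)))
  obtain ⟨F, hF, e⟩ := hW.exists_eq_expDiff_mul fun t => by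
    rw [besselE_one_eq, h.chord_sq_eq_expDiff, expDiff_self, sinQuot_self, dN, iteratedDeriv_two_eq]
    linear_combination -((κ : ℂ) ^ 2 * cdot (normal γ) (deriv (deriv γ)) t t * (1 / (8 * (π : ℂ))) *
      expo (-1) t ^ 2) * Complex.I_sq
  refine hlog.exists_rep hF (j := 3) (fun t ζ => ?_) exists_logDiffCoef_three_bound
  have e := e t ζ
  rw [sin_sub_eq, coef₂_eq, iteratedDeriv_two_eq]
  linear_combination expDiff t ζ ^ 2 * e

/-- `E₁S̃₀` and `2E₃S₁` remove the zeroth and first order terms of `γ'(t) · γ'(ζ)` on the diagonal.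
A double zero remains, which gives order -3; the `S₂` term has a double zero by itself, so no
matching of its coefficient is needed. -/
lemma exists_rep_opRtilde (hκ : 0 < κ) : ∃ A, IsOrd (-3) A ∧ Rep (opRtilde γ κ) A := by
  have hX := h.biSmooth_kappa_chord κ
  have hd := h.curve.deriv
  obtain ⟨W, hW, eW⟩ := h.exists_tangent_quot
  have hlog := (((h.isLogOp_opR hκ).sub (isLogOp_opS0tilde.mulOp_comp (h.curve.coef₁ κ))).sub
    ((isLogOp_opS1.mulOp_comp (h.curve.coef₃ κ)).smul 2)).sub
    (isLogOp_opS2.mulOp_comp (h.curve.coef₄ κ))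
  have hF : BiSmooth fun t ζ => -(κ ^ 2 / (2 * (π : ℂ))) * (W t ζ + cdot (deriv γ) (deriv γ) t ζ *
      (κ ^ 2 * -(expo (-1) t * expo (-1) ζ * g t ζ) * besselE' 0 (κ ^ 2 * (chord γ t ζ : ℂ) ^ 2))) +
      ((κ ^ 4 * ‖deriv γ t‖ ^ 4 + 2 * κ ^ 2 * inner ℝ (deriv γ t) (iteratedDeriv 3 γ t) : ℝ) : ℂ) *
        (1 / (8 * (π : ℂ)) * (sinQuot t ζ * sinQuot t ζ)) :=
    ((BiSmooth.const _).mul (hW.add ((hd.cdot hd).mul (((BiSmooth.const _).mul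
      h.biSmooth_chordQuot).mul (hX.comp (contDiff_besselE' 0)))))).add
      ((BiSmooth.ofLeft (h.curve.coef₄ κ)).mul ((BiSmooth.const _).mul
        (biSmooth_sinQuot.mul biSmooth_sinQuot)))
  refine hlog.exists_rep hF (j := 2) (fun t ζ => ?_) exists_logDiffCoef_two_bound
  have e := eW t ζ
  rw [besselE_zero_eq, coef₁_eq, coef₃_eq]
  generalize hs : (Real.sin (t - ζ) : ℂ) = s at e ⊢
  have hs2 : s = expDiff t ζ * sinQuot t ζ := by rw [← hs, sin_sub_eq]
  have hx := h.chord_sq_eq_expDiff t ζ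
  linear_combination (-(κ : ℂ) ^ 2 / (2 * π)) * e +
    ((κ ^ 4 * ‖deriv γ t‖ ^ 4 + 2 * κ ^ 2 * inner ℝ (deriv γ t) (iteratedDeriv 3 γ t) : ℝ) : ℂ) *
      (1 / (8 * (π : ℂ))) * (s + expDiff t ζ * sinQuot t ζ) * hs2 -
    (κ ^ 2 / (2 * (π : ℂ))) * cdot (deriv γ) (deriv γ) t ζ * κ ^ 2 *
      besselE' 0 (κ ^ 2 * (chord γ t ζ : ℂ) ^ 2) * hx

/-- As for `R̃`, with half the coefficients. The term with `h̃` already has a double zero, since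
`E₀` and `E₁` agree at the origin. -/
lemma exists_rep_opHtilde (hκ : 0 < κ) : ∃ A, IsOrd (-3) A ∧ Rep (opHtilde γ κ) A := by
  have hX := h.biSmooth_kappa_chord κ
  have hd := h.curve.deriv
  obtain ⟨W, hW, eW⟩ := h.exists_tangent_quot
  obtain ⟨η, B, hη, hH⟩ := h.exists_isLogOp_opH hκ
  have hlog := ((hH.sub ((isLogOp_opS0tilde.mulOp_comp (h.curve.coef₁ κ)).smul (1 / 2))).sub
    (isLogOp_opS1.mulOp_comp (h.curve.coef₃ κ))).sub
    (isLogOp_opS2.mulOp_comp (h.curve.coef₅ κ))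
  have hQ := (BiSmooth.const ((κ : ℂ) ^ 2)).mul h.biSmooth_chordQuot
  have hF : BiSmooth fun t ζ => -(κ ^ 2 / (4 * (π : ℂ))) * (W t ζ + cdot (deriv γ) (deriv γ) t ζ *
      (κ ^ 2 * -(expo (-1) t * expo (-1) ζ * g t ζ) * besselE' 1 (κ ^ 2 * (chord γ t ζ : ℂ) ^ 2))) +
      -(κ ^ 2 / (2 * (π : ℂ))) * η t ζ * (κ ^ 2 * -(expo (-1) t * expo (-1) ζ * g t ζ) *
        (besselE' 0 (κ ^ 2 * (chord γ t ζ : ℂ) ^ 2) - besselE' 1 (κ ^ 2 * (chord γ t ζ : ℂ) ^ 2))) +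
      ((-(3 / 4) * κ ^ 4 * ‖deriv γ t‖ ^ 4 +
        κ ^ 2 * inner ℝ (deriv γ t) (iteratedDeriv 3 γ t) : ℝ) : ℂ) *
        (1 / (8 * (π : ℂ)) * (sinQuot t ζ * sinQuot t ζ)) :=
    (((BiSmooth.const _).mul (hW.add ((hd.cdot hd).mul (hQ.mul (hX.comp (contDiff_besselE' 1)))))).add
      (((BiSmooth.const _).mul hη).mul (hQ.mul ((hX.comp (contDiff_besselE' 0)).sub
        (hX.comp (contDiff_besselE' 1)))))).add
      ((BiSmooth.ofLeft (h.curve.coef₅ κ)).mul ((BiSmooth.const _).mul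
        (biSmooth_sinQuot.mul biSmooth_sinQuot)))
  refine hlog.exists_rep hF (j := 2) (fun t ζ => ?_) exists_logDiffCoef_two_bound
  have e := eW t ζ
  rw [besselE_zero_eq, besselE_one_eq, coef₁_eq, coef₃_eq]
  generalize hs : (Real.sin (t - ζ) : ℂ) = s at e ⊢
  have hs2 : s = expDiff t ζ * sinQuot t ζ := by rw [← hs, sin_sub_eq]
  have hx := h.chord_sq_eq_expDiff t ζ
  linear_combination (-(κ : ℂ) ^ 2 / (4 * π)) * e +
    ((-(3 / 4) * κ ^ 4 * ‖deriv γ t‖ ^ 4 +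
        κ ^ 2 * inner ℝ (deriv γ t) (iteratedDeriv 3 γ t) : ℝ) : ℂ) *
      (1 / (8 * (π : ℂ))) * (s + expDiff t ζ * sinQuot t ζ) * hs2 -
    (κ ^ 2 / (4 * (π : ℂ))) * cdot (deriv γ) (deriv γ) t ζ * κ ^ 2 *
      besselE' 1 (κ ^ 2 * (chord γ t ζ : ℂ) ^ 2) * hx -
    (κ ^ 2 / (2 * (π : ℂ))) * η t ζ * κ ^ 2 * (besselE' 0 (κ ^ 2 * (chord γ t ζ : ℂ) ^ 2) -
      besselE' 1 (κ ^ 2 * (chord γ t ζ : ℂ) ^ 2)) * hx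

end IsChordData

/-! ### Order calculus in a filtered ring -/

/-- A predicate `O d a`, read as "`a` has order `d`", compatible with the ring operations. -/
structure IsOrderCalculus {R : Type*} [Ring R] (O : ℤ → R → Prop) : Prop where
  mono : ∀ {d e a}, O d a → d ≤ e → O e a
  add : ∀ {d a b}, O d a → O d b → O d (a + b)
  sub : ∀ {d a b}, O d a → O d b → O d (a - b)
  mul : ∀ {d e a b}, O d a → O e b → O (d + e) (a * b)

/-- The square of the block operator of the boundary integral equations differs from the model
operator by an operator of order `-3`. -/
lemma IsOrderCalculus.sq_sub_order {R : Type*} [Ring R] {O : ℤ → R → Prop} (h : IsOrderCalculus O)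
    {S T S₂ E E' E₂ C Q P L K V W : R} (hS : O (-1) S) (hT : O 1 T) (hS₂ : O (-3) S₂)
    (hE : O 0 E) (hE' : O 0 E') (hE₂ : O 0 E₂) (hC : O (-2) C) (hQ : O (-3) Q)
    (hL : O (-4) L) (hK : O (-4) K) (hV : O (-4) V) (hW : O (-3) W)
    (hST : S * T = -1) (hTS : T * S = -1) (hcomm : S₂ * T = T * S₂) (hS₂T : S₂ * T = Q + P)
    (hP : P + P = S * S) (hEE : E = E' + E')
    (hTE : O 0 (T * E - E * T)) (hTE' : O 0 (T * E' - E' * T)) (hTE₂ : O 0 (T * E₂ - E₂ * T))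
    (i j : Fin 2) :
    O (-3) ((!![1 + (E₂ * S₂ + L), S + (E * S₂ + V); T + (E' * S + C + W), -1 + (K - E₂ * S₂)] *
      !![1 + (E₂ * S₂ + L), S + (E * S₂ + V); T + (E' * S + C + W), -1 + (K - E₂ * S₂)] -
      !![1 + S * T + E * (S * S), 0; 0, 1 + T * S + E * (S * S)]) i j) := by
  have hEP : E * P = E' * (S * S) := by
    rw [hEE, add_mul, ← hP, mul_add]
  -- Because `T` is minus the inverse of `S`, a commutator with `S` is the commutator with `T`
  -- sandwiched between two copies of `S`, which gives order -2.
  have hSE : O (-2) (S * E' - E' * S) := by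
    have : S * E' - E' * S = S * (T * E' - E' * T) * S := by
      have h1 : S * (T * E' - E' * T) * S = (S * T) * E' * S - S * E' * (T * S) := by noncomm_ring
      rw [h1, hST, hTS]; noncomm_ring
    rw [this]
    exact h.mul (h.mul hS hTE') hS
  have oa : O (-3) (E₂ * S₂ + L) := h.add (h.mul hE₂ hS₂) (h.mono hL (by norm_num))
  have od : O (-3) (K - E₂ * S₂) := h.sub (h.mono hK (by norm_num)) (h.mul hE₂ hS₂)
  have oX : O (-3) (E * S₂ + V) := h.add (h.mul hE hS₂) (h.mono hV (by norm_num))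
  have oY : O (-1) (E' * S + C + W) :=
    h.add (h.add (h.mul hE' hS) (h.mono hC (by norm_num))) (h.mono hW (by norm_num))
  have oCW : O (-2) (C + W) := h.add hC (h.mono hW (by norm_num))
  have oEQ : O (-3) (E * Q) := h.mul hE hQ
  fin_cases i <;> fin_cases j
  -- The contributions of order -2 are `SE'S` from `½E₁S₀` and `ES₂T = EQ + E'S²` from `E₁S₂`. Their
  -- sum matches `ES² = 2E'S²` up to `EQ` and the commutator of `S` with `E'`.
  · have e : (!![1 + (E₂ * S₂ + L), S + (E * S₂ + V); T + (E' * S + C + W), -1 + (K - E₂ * S₂)] *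
        !![1 + (E₂ * S₂ + L), S + (E * S₂ + V); T + (E' * S + C + W), -1 + (K - E₂ * S₂)] -
        !![1 + S * T + E * (S * S), 0; 0, 1 + T * S + E * (S * S)]) 0 0 =
        (E₂ * S₂ + L) + (E₂ * S₂ + L) + (E₂ * S₂ + L) * (E₂ * S₂ + L) + E * Q + V * T +
          (S * E' - E' * S) * S + S * (C + W) + (E * S₂ + V) * (E' * S + C + W) := by
      have h1 : E * (S₂ * T) = E * Q + E' * (S * S) := by rw [hS₂T, mul_add, hEP]
      have h2 : E * (S * S) = E' * (S * S) + E' * (S * S) := by rw [hEE, add_mul]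
      rw [Matrix.sub_apply, Matrix.mul_apply, Fin.sum_univ_two]
      simp only [Matrix.of_apply, Matrix.cons_val_zero, Matrix.cons_val_one, Matrix.cons_val']
      linear_combination (norm := noncomm_ring) h1 - h2
    change O (-3) (_ : R)
    refine Eq.mpr (congrArg (O (-3)) e) ?_
    exact h.add (h.add (h.add (h.add (h.add (h.add (h.add oa oa) (h.mono (h.mul oa oa) (by norm_num)))
      oEQ) (h.mul hV hT)) (h.mul hSE hS)) (h.mul hS oCW)) (h.mono (h.mul oX oY) (by norm_num))
  · have e : (!![1 + (E₂ * S₂ + L), S + (E * S₂ + V); T + (E' * S + C + W), -1 + (K - E₂ * S₂)] *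
        !![1 + (E₂ * S₂ + L), S + (E * S₂ + V); T + (E' * S + C + W), -1 + (K - E₂ * S₂)] -
        !![1 + S * T + E * (S * S), 0; 0, 1 + T * S + E * (S * S)]) 0 1 =
        (E₂ * S₂ + L) * (S + (E * S₂ + V)) + (S + (E * S₂ + V)) * (K - E₂ * S₂) := by
      rw [Matrix.sub_apply, Matrix.mul_apply, Fin.sum_univ_two]
      simp only [Matrix.of_apply, Matrix.cons_val_zero, Matrix.cons_val_one, Matrix.cons_val']
      noncomm_ring
    refine Eq.mpr (congrArg (O (-3)) e) ?_
    have oX' := h.add hS (h.mono oX (show (-3 : ℤ) ≤ -1 by norm_num))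
    exact h.add (h.mono (h.mul oa oX') (by norm_num)) (h.mono (h.mul oX' od) (by norm_num))
  -- The terms `TE₂S₂` and `-E₂S₂T` have order -2 each. As `S₂` commutes with `T`, the opposite
  -- signs on the diagonal of `𝒩` combine them into a commutator of `T` with `E₂`.
  · have e : (!![1 + (E₂ * S₂ + L), S + (E * S₂ + V); T + (E' * S + C + W), -1 + (K - E₂ * S₂)] *
        !![1 + (E₂ * S₂ + L), S + (E * S₂ + V); T + (E' * S + C + W), -1 + (K - E₂ * S₂)] -
        !![1 + S * T + E * (S * S), 0; 0, 1 + T * S + E * (S * S)]) 1 0 =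
        (T * E₂ - E₂ * T) * S₂ + T * L + K * T + (E' * S + C + W) * (E₂ * S₂ + L) +
          (K - E₂ * S₂) * (E' * S + C + W) := by
      have h1 : E₂ * (S₂ * T) = E₂ * (T * S₂) := by rw [hcomm]
      rw [Matrix.sub_apply, Matrix.mul_apply, Fin.sum_univ_two]
      simp only [Matrix.of_apply, Matrix.cons_val_zero, Matrix.cons_val_one, Matrix.cons_val']
      linear_combination (norm := noncomm_ring) -h1
    refine Eq.mpr (congrArg (O (-3)) e) ?_
    exact h.add (h.add (h.add (h.add (h.mul hTE₂ hS₂) (h.mul hT hL)) (h.mul hK hT))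
      (h.mono (h.mul oY oa) (by norm_num))) (h.mono (h.mul od oY) (by norm_num))
  · have e : (!![1 + (E₂ * S₂ + L), S + (E * S₂ + V); T + (E' * S + C + W), -1 + (K - E₂ * S₂)] *
        !![1 + (E₂ * S₂ + L), S + (E * S₂ + V); T + (E' * S + C + W), -1 + (K - E₂ * S₂)] -
        !![1 + S * T + E * (S * S), 0; 0, 1 + T * S + E * (S * S)]) 1 1 =
        (T * E - E * T) * S₂ + E * Q + T * V + (C + W) * S + (E' * S + C + W) * (E * S₂ + V) -
          ((K - E₂ * S₂) + (K - E₂ * S₂)) + (K - E₂ * S₂) * (K - E₂ * S₂) := by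
      have h1 : E * (S₂ * T) = E * Q + E' * (S * S) := by rw [hS₂T, mul_add, hEP]
      have h2 : E * (S * S) = E' * (S * S) + E' * (S * S) := by rw [hEE, add_mul]
      have h3 : E * (S₂ * T) = E * (T * S₂) := by rw [hcomm]
      rw [Matrix.sub_apply, Matrix.mul_apply, Fin.sum_univ_two]
      simp only [Matrix.of_apply, Matrix.cons_val_zero, Matrix.cons_val_one, Matrix.cons_val']
      linear_combination (norm := noncomm_ring) h1 - h2 - h3
    refine Eq.mpr (congrArg (O (-3)) e) ?_
    exact h.add (h.sub (h.add (h.add (h.add (h.add (h.mul hTE hS₂) oEQ) (h.mul hT hV))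
      (h.mul oCW hS)) (h.mono (h.mul oY oX) (by norm_num))) (h.add od od))
      (h.mono (h.mul od od) (by norm_num))

lemma isOrderCalculus_isOrd : IsOrderCalculus IsOrd :=
  ⟨fun h hd => h.mono hd, fun h h' => h.add h', fun h h' => h.sub h', fun h h' => h.mul h'⟩

/-! ### Representation of block operators -/

/-- The pair operator `a` acts on Fourier coefficients as the block matrix `A`. -/
def RepPair (a : PairOp) (A : Matrix (Fin 2) (Fin 2) (Module.End ℂ RD)) : Prop :=
  ∀ u v : RD, a (synth u, synth v) = (synth (A 0 0 u + A 0 1 v : RD), synth (A 1 0 u + A 1 1 v : RD))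

lemma repPair_block {a b c d : Op} {A B C D : Module.End ℂ RD} (ha : Rep a A) (hb : Rep b B)
    (hc : Rep c C) (hd : Rep d D) : RepPair (block a b c d) !![A, B; C, D] := fun u v => by
  simp only [block, ha u, hb v, hc u, hd v, synth_add]; rfl

lemma RepPair.add {a b : PairOp} {A B : Matrix (Fin 2) (Fin 2) (Module.End ℂ RD)} (ha : RepPair a A)
    (hb : RepPair b B) : RepPair (a + b) (A + B) := fun u v => by
  rw [Pi.add_apply, ha, hb, Prod.mk_add_mk, ← synth_add, ← synth_add]
  simp only [Matrix.add_apply, LinearMap.add_apply]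
  congr 3 <;> abel

lemma RepPair.sub {a b : PairOp} {A B : Matrix (Fin 2) (Fin 2) (Module.End ℂ RD)} (ha : RepPair a A)
    (hb : RepPair b B) : RepPair (a - b) (A - B) := fun u v => by
  rw [Pi.sub_apply, ha, hb, Prod.mk_sub_mk, ← synth_sub, ← synth_sub]
  simp only [Matrix.sub_apply, LinearMap.sub_apply]
  congr 3 <;> abel

lemma RepPair.comp {a b : PairOp} {A B : Matrix (Fin 2) (Fin 2) (Module.End ℂ RD)} (ha : RepPair a A)
    (hb : RepPair b B) : RepPair (a ∘ b) (A * B) := fun u v => by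
  rw [Function.comp_apply, hb, ha]
  simp only [Matrix.mul_apply, Fin.sum_univ_two, LinearMap.add_apply, Module.End.mul_apply, map_add]
  congr 3 <;> abel

lemma RepPair.congr {a : PairOp} {A B : Matrix (Fin 2) (Fin 2) (Module.End ℂ RD)} (ha : RepPair a A)
    (h : A = B) : RepPair a B := h ▸ ha

/-! ### The operators of the collocation equation -/

/-- All model operators cancel, and the `M₀` in `𝒟` undo those hidden in `S₀`. Through this identity
the standing assumption becomes injectivity of `𝒜`. -/
lemma opA_eq_coupledOp (γ : ℝ → Plane) (κ : ℝ) : opA γ κ = coupledOp γ κ := by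
  funext ψ
  refine Prod.ext (funext fun t => ?_) (funext fun t => ?_)
  · simp only [opA, opN, opD, coupledOp, block, opLtilde, opStilde, opS0, Pi.add_apply, Pi.sub_apply,
      Prod.fst_add, Function.comp_apply]
    ring
  · simp only [opA, opN, opD, coupledOp, block, opRtilde, opHtilde, opKtilde, opE6, opS0, Pi.add_apply,
      Pi.sub_apply, Pi.smul_apply, Pi.neg_apply, Prod.snd_add, Function.comp_apply, opE1, mulOp,
      smul_eq_mul]
    ring

lemma IsBoundaryCurve.smoothPeriodic_coef₁_inv {γ : ℝ → Plane} (h : IsBoundaryCurve γ) {κ : ℝ}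
    (hκ : 0 < κ) : SmoothPeriodic fun t => (((κ ^ 2 * ‖deriv γ t‖ ^ 2)⁻¹ : ℝ) : ℂ) := by
  have h1 := h.smoothCurve.coef₁ κ
  simp only [Complex.ofReal_inv]
  refine ⟨h1.1.inv fun t => ?_, fun t => congrArg (·⁻¹) (h1.2 t)⟩
  have := norm_pos_iff.mpr (h.regular t)
  exact_mod_cast (show 0 < κ ^ 2 * ‖deriv γ t‖ ^ 2 by positivity).ne'

lemma rep_eq {a : Op} {A B : Module.End ℂ RD} (hA : Rep a A) (hB : Rep a B) : A = B :=
  LinearMap.ext fun u => RD.synth_inj.mp ((hA u).symm.trans (hB u))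

lemma mul_eq_add_mul_sub {R : Type*} [Ring R] {a b c d : R} (h : a * c = d) :
    a * b = d + a * (b - c) := by rw [← h]; noncomm_ring

/-- The operators of the collocation equation as block matrices. -/
theorem IsBoundaryCurve.exists_repPair {γ : ℝ → Plane} (hγ : IsBoundaryCurve γ) {κ : ℝ} (hκ : 0 < κ) :
    ∃ A D D' B : Matrix (Fin 2) (Fin 2) (Module.End ℂ RD),
      RepPair (opA γ κ) A ∧ RepPair (opEinv γ κ) D ∧ D' * D = 1 ∧
      RepPair (opEinv γ κ ∘ opU γ κ) !![endS * endS, 0; 0, endS * endS] ∧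
      RepPair (opEinv γ κ ∘ (opJ γ κ + opV γ κ)) B ∧ (∀ i j, IsOrd (-3) (B i j)) ∧
      D * (A * A) = !![endS * endS, 0; 0, endS * endS] + B := by
  obtain ⟨g, G₀, G₁, h⟩ := hγ.exists_chordData
  have hc := h.curve
  obtain ⟨L, oL, rL⟩ := h.exists_rep_opLtilde hκ
  obtain ⟨K, oK, rK⟩ := h.exists_rep_opKtilde hκ
  obtain ⟨V, oV, rV⟩ := h.exists_rep_opStilde hκ
  obtain ⟨R, oR, rR⟩ := h.exists_rep_opRtilde hκ
  obtain ⟨H, oH, rH⟩ := h.exists_rep_opHtilde hκ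
  obtain ⟨S₁, oS₁, rS₁⟩ := exists_rep_opS1
  obtain ⟨S₂, oS₂, rS₂, cS₂, qS₂⟩ := exists_rep_opS2
  -- `M₀` has rank one and a single nonzero coefficient, so it has every order; -4 is what the
  -- remainder `S̃ - M₀` requires.
  have rM := repMult_opM0.rep (norm_symM_le (-4))
  have oM := isOrd_multEnd (norm_symM_le (-4))
  set M := multEnd (norm_symM_le (-4))
  have rE₁ : Rep (opE1 γ κ) _ := rep_mulOp (hc.coef₁ κ)
  have rE₂ : Rep (opE2 γ κ) _ := rep_mulOp (hc.coef₂ κ)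
  have rE₃ : Rep (opE3 γ κ) _ := rep_mulOp (hc.coef₃ κ)
  have rE₄ : Rep (opE4 γ κ) _ := rep_mulOp (hc.coef₄ κ)
  have rE₅ : Rep (opE5 γ κ) _ := rep_mulOp (hc.coef₅ κ)
  have rE₁' : Rep (opE1inv γ κ) _ := rep_mulOp (hγ.smoothPeriodic_coef₁_inv hκ)
  have tE₁ := isOrd_commutator norm_symT_le norm_symT_sub_le (hc.coef₁ κ).rapidDecay
  have tE₂ := isOrd_commutator norm_symT_le norm_symT_sub_le (hc.coef₂ κ).rapidDecay
  have oE₁ := isOrd_convEnd (hc.coef₁ κ).rapidDecay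
  have oE₂ := isOrd_convEnd (hc.coef₂ κ).rapidDecay
  have oE₃ := isOrd_convEnd (hc.coef₃ κ).rapidDecay
  have oE₄ := isOrd_convEnd (hc.coef₄ κ).rapidDecay
  have oE₅ := isOrd_convEnd (hc.coef₅ κ).rapidDecay
  have oE₁' := isOrd_convEnd (hγ.smoothPeriodic_coef₁_inv hκ).rapidDecay
  set E₁ := convEnd (hc.coef₁ κ).rapidDecay
  set E₂ := convEnd (hc.coef₂ κ).rapidDecay
  set E₃ := convEnd (hc.coef₃ κ).rapidDecay
  set E₄ := convEnd (hc.coef₄ κ).rapidDecay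
  set E₅ := convEnd (hc.coef₅ κ).rapidDecay
  set E₁' := convEnd (hγ.smoothPeriodic_coef₁_inv hκ).rapidDecay
  have hne : ∀ t, ((κ ^ 2 * ‖deriv γ t‖ ^ 2 : ℝ) : ℂ) ≠ 0 := fun t => by
    have := norm_pos_iff.mpr (hγ.regular t)
    exact_mod_cast (show 0 < κ ^ 2 * ‖deriv γ t‖ ^ 2 by positivity).ne'
  have hE₁E₁' : E₁ * E₁' = 1 := rep_eq (rE₁.comp rE₁') fun u => by
    ext t
    simp only [Function.comp_apply, opE1, opE1inv, mulOp, Module.End.one_apply, Complex.ofReal_inv]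
    rw [← mul_assoc, mul_inv_cancel₀ (hne t), one_mul]
  have hE₁'E₁ : E₁' * E₁ = 1 := rep_eq (rE₁'.comp rE₁) fun u => by
    ext t
    simp only [Function.comp_apply, opE1, opE1inv, mulOp, Module.End.one_apply, Complex.ofReal_inv]
    rw [← mul_assoc, inv_mul_cancel₀ (hne t), one_mul]
  have rN : RepPair (opN γ κ) _ :=
    (repPair_block Rep.id Rep.zero rep_opT0 Rep.id.neg).add
      (repPair_block (rE₂.comp rS₂) (rep_opS0.add (rE₁.comp rS₂))
        ((((rE₁.comp rep_opS0).smul (1 / 2)).add (rE₃.comp rS₁)).add ((rE₄.sub rE₅).comp rS₂))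
        (rE₂.comp rS₂).neg)
  have rD : RepPair (opD γ κ) _ :=
    repPair_block rL (rV.sub rM) (((rR.sub rH).sub rM).sub ((rE₁.comp rM).smul (1 / 2))) rK
  have rU : RepPair (opU γ κ) _ :=
    repPair_block ((Rep.id.add (rep_opS0.comp rep_opT0)).add (rE₁.comp (rep_opS0.comp rep_opS0)))
      Rep.zero Rep.zero
      ((Rep.id.add (rep_opT0.comp rep_opS0)).add (rE₁.comp (rep_opS0.comp rep_opS0)))
  have rDinv : RepPair (opEinv γ κ) _ := repPair_block rE₁' Rep.zero Rep.zero rE₁'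
  have rA : RepPair (opA γ κ) _ := rN.add rD
  have rJV : RepPair (opJ γ κ + opV γ κ) _ :=
    ((rN.comp rN).sub rU).add (((rN.comp rD).add (rD.comp rN)).add (rD.comp rD))
  generalize hNm : !![(1 : Module.End ℂ RD), 0; endT, -1] + !![E₂ * S₂, endS + E₁ * S₂;
    (1 / 2 : ℂ) • (E₁ * endS) + E₃ * S₁ + (E₄ - E₅) * S₂, -(E₂ * S₂)] = Nm at rN rA rJV
  generalize hDm : !![L, V - M; R - H - M - (1 / 2 : ℂ) • (E₁ * M), K] = Dm at rD rA rJV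
  generalize hUm : !![1 + endS * endT + E₁ * (endS * endS), 0; 0,
    1 + endT * endS + E₁ * (endS * endS)] = Um at rU rJV
  have hDU : !![E₁', 0; 0, E₁'] * Um = !![endS * endS, 0; 0, endS * endS] := by
    rw [← hUm, endS_mul_endT, endT_mul_endS, Matrix.mul_fin_two]
    have : E₁' * (1 + -1 + E₁ * (endS * endS)) = endS * endS := by
      have h0 : (1 : Module.End ℂ RD) + -1 = 0 := LinearMap.ext fun u => by simp
      rw [h0, zero_add, ← mul_assoc, hE₁'E₁, one_mul]
    simp [this]
  -- The splitting into `𝒥` and `𝒱` is recombined: `𝒥 + 𝒱 = 𝒜² - 𝒰`.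
  have hJV : Nm * Nm - Um + (Nm * Dm + Dm * Nm + Dm * Dm) = (Nm + Dm) * (Nm + Dm) - Um := by
    noncomm_ring
  rw [hJV] at rJV
  refine ⟨Nm + Dm, !![E₁', 0; 0, E₁'], !![E₁, 0; 0, E₁],
    !![E₁', 0; 0, E₁'] * ((Nm + Dm) * (Nm + Dm) - Um), rA, rDinv, ?_,
    (rDinv.comp rU).congr hDU, rDinv.comp rJV, ?_, ?_⟩
  · rw [Matrix.mul_fin_two, Matrix.one_fin_two]
    simp [hE₁E₁']
  · have hsum : Nm + Dm = !![1 + (E₂ * S₂ + L), endS + (E₁ * S₂ + (V - M));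
        endT + (((1 / 2 : ℂ) • E₁) * endS + E₃ * S₁ +
          ((E₄ - E₅) * S₂ + (R - H - M - (1 / 2 : ℂ) • (E₁ * M)))), -1 + (K - E₂ * S₂)] := by
      rw [← hNm, ← hDm]
      ext i j : 1
      fin_cases i <;> fin_cases j <;> simp <;> abel
    have key : ∀ i j, IsOrd (-3) (((Nm + Dm) * (Nm + Dm) - Um) i j) := by
      rw [hsum, ← hUm]
      have o3 : (-4 : ℤ) ≤ -3 := by norm_num
      -- The remaining roles are `E' = ½E₁`, `C = E₃S₁`, `V = S̃ - M₀`, and `W` collects `E₆S₂` with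
      -- the remainders of `R` and `H` and the mean value terms.
      refine isOrderCalculus_isOrd.sq_sub_order (Q := S₂ * endT - (1 / 2 : ℂ) • (endS * endS))
        (P := (1 / 2 : ℂ) • (endS * endS)) isOrd_endS isOrd_endT oS₂ oE₁ (oE₁.smul _) oE₂
        (oE₃.mul oS₁) qS₂ oL oK (oV.sub oM) ?_ endS_mul_endT endT_mul_endS cS₂ ?_ ?_ ?_ tE₁ ?_ tE₂
      · exact ((oE₄.sub oE₅).mul oS₂).add (((oR.sub oH).sub (oM.mono o3)).sub
          (((oE₁.mul oM).mono (by norm_num)).smul _))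
      · exact LinearMap.ext fun u => by simp
      · rw [← add_smul]; norm_num
      · rw [← add_smul]; norm_num
      · have : endT * ((1 / 2 : ℂ) • E₁) - ((1 / 2 : ℂ) • E₁) * endT =
            (1 / 2 : ℂ) • (endT * E₁ - E₁ * endT) := by
          rw [mul_smul_comm, smul_mul_assoc]
          exact LinearMap.ext fun u => by simp [smul_sub]
        rw [this]
        exact tE₁.smul _
    intro i j
    rw [Matrix.mul_apply, Fin.sum_univ_two]
    have z0 : ∀ i j, IsOrd 0 ((!![E₁', 0; 0, E₁'] : Matrix (Fin 2) (Fin 2) (Module.End ℂ RD)) i j) := by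
      have hz : IsOrd 0 (0 : Module.End ℂ RD) := by
        have e : E₁ - E₁ = 0 := LinearMap.ext fun u => by simp
        exact e ▸ oE₁.sub oE₁
      intro i j
      fin_cases i <;> fin_cases j
      exacts [oE₁', hz, hz, oE₁']
    exact ((z0 i 0).mul (key 0 j)).add ((z0 i 1).mul (key 1 j))
  · exact mul_eq_add_mul_sub (R := Matrix (Fin 2) (Fin 2) (Module.End ℂ RD)) hDU

/-! ### Hilbert–Schmidt operators -/

section HilbertSchmidt

variable {ι : Type*}

/-- Square-summable families. -/
abbrev L2 (ι : Type*) : Type _ := lp (fun _ : ι => ℂ) 2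

lemma L2.norm_sq (x : L2 ι) : ‖x‖ ^ 2 = ∑' i, ‖x i‖ ^ 2 := by
  have := lp.norm_rpow_eq_tsum (p := 2) (by simp) x
  simpa using this

lemma L2.summable_sq (x : L2 ι) : Summable fun i => ‖x i‖ ^ 2 := by
  have := (lp.memℓp x).summable (by simp)
  simpa using this

lemma memℓp_two_iff {f : ι → ℂ} : Memℓp f 2 ↔ Summable fun i => ‖f i‖ ^ 2 := by
  rw [memℓp_gen_iff (by simp)]; simp

lemma summable_norm_inner_sq {r : ι → L2 ι} (hr : Summable fun i => ‖r i‖ ^ 2) (x : L2 ι) :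
    (Summable fun i => ‖inner ℂ (r i) x‖ ^ 2) ∧
      ∑' i, ‖inner ℂ (r i) x‖ ^ 2 ≤ (∑' i, ‖r i‖ ^ 2) * ‖x‖ ^ 2 := by
  have hb : ∀ i, ‖inner ℂ (r i) x‖ ^ 2 ≤ ‖r i‖ ^ 2 * ‖x‖ ^ 2 := fun i => by
    rw [← mul_pow]
    exact pow_le_pow_left₀ (norm_nonneg _) (norm_inner_le_norm _ _) 2
  have hs : Summable fun i => ‖inner ℂ (r i) x‖ ^ 2 :=
    Summable.of_nonneg_of_le (fun _ => by positivity) hb (hr.mul_right _)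
  refine ⟨hs, ?_⟩
  rw [← tsum_mul_right]
  exact hs.tsum_le_tsum hb (hr.mul_right _)

/-- The linear map whose rows are the functionals `⟪r i, ·⟫`. -/
def rowMap (r : ι → L2 ι) (hr : Summable fun i => ‖r i‖ ^ 2) : L2 ι →ₗ[ℂ] L2 ι where
  toFun x := ⟨fun i => inner ℂ (r i) x, memℓp_two_iff.mpr (summable_norm_inner_sq hr x).1⟩
  map_add' x y := by ext i; exact inner_add_right _ _ _
  map_smul' c x := by ext i; exact inner_smul_right _ _ _

lemma norm_rowMap_le (r : ι → L2 ι) (hr : Summable fun i => ‖r i‖ ^ 2) (x : L2 ι) :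
    ‖rowMap r hr x‖ ≤ Real.sqrt (∑' i, ‖r i‖ ^ 2) * ‖x‖ := by
  rw [← Real.sqrt_sq (norm_nonneg x), ← Real.sqrt_mul (tsum_nonneg fun _ => by positivity)]
  refine Real.le_sqrt_of_sq_le ?_
  rw [L2.norm_sq]
  exact (summable_norm_inner_sq hr x).2

/-- The bounded operator whose rows are the functionals `⟪r i, ·⟫`. -/
def rowOp (r : ι → L2 ι) (hr : Summable fun i => ‖r i‖ ^ 2) : L2 ι →L[ℂ] L2 ι :=
  LinearMap.mkContinuous (rowMap r hr) _ (norm_rowMap_le r hr)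

lemma rowOp_apply (r : ι → L2 ι) (hr : Summable fun i => ‖r i‖ ^ 2) (x : L2 ι) (i : ι) :
    rowOp r hr x i = inner ℂ (r i) x := rfl

lemma norm_rowOp_le (r : ι → L2 ι) (hr : Summable fun i => ‖r i‖ ^ 2) :
    ‖rowOp r hr‖ ≤ Real.sqrt (∑' i, ‖r i‖ ^ 2) :=
  LinearMap.mkContinuous_norm_le _ (Real.sqrt_nonneg _) _

lemma isCompactOperator_smulRight {E F : Type*} [NormedAddCommGroup E] [NormedSpace ℂ E]
    [NormedAddCommGroup F] [NormedSpace ℂ F] (f : E →L[ℂ] ℂ) (c : F) :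
    IsCompactOperator (f.smulRight c) := by
  have h : IsCompactOperator (ContinuousLinearMap.toSpanSingleton ℂ c) :=
    isCompactOperator_of_locallyCompactSpace_rng _
  exact h.comp_clm f

open Filter Topology in
lemma isCompactOperator_rowOp [DecidableEq ι] (r : ι → L2 ι) (hr : Summable fun i => ‖r i‖ ^ 2) :
    IsCompactOperator (rowOp r hr) := by
  set F : Finset ι → L2 ι →L[ℂ] L2 ι := fun s =>
    ∑ i ∈ s, (innerSL ℂ (r i)).smulRight (lp.single 2 i (1 : ℂ)) with hF
  have hFa : ∀ s x i, F s x i = if i ∈ s then inner ℂ (r i) x else 0 := fun s x i => by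
    simp only [hF, _root_.sum_apply, ContinuousLinearMap.smulRight_apply,
      innerSL_apply_apply, lp.coeFn_sum, Finset.sum_apply, lp.coeFn_smul, Pi.smul_apply,
      smul_eq_mul, lp.single_apply, Pi.single_apply]
    simp
  have hr' : ∀ s : Finset ι, Summable fun i => ‖if i ∈ s then (0 : L2 ι) else r i‖ ^ 2 := fun s =>
    Summable.of_nonneg_of_le (fun _ => by positivity) (fun i => by split_ifs <;> simp) hr
  have hsub : ∀ s, rowOp r hr - F s = rowOp _ (hr' s) := fun s => by
    ext x i
    rw [_root_.sub_apply, lp.coeFn_sub, Pi.sub_apply, hFa, rowOp_apply, rowOp_apply]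
    split_ifs <;> simp
  have hlim : Tendsto F atTop (𝓝 (rowOp r hr)) := by
    rw [tendsto_iff_norm_sub_tendsto_zero]
    have h0 : Tendsto (fun s : Finset ι => Real.sqrt (∑' i : {i // i ∉ s}, ‖r i‖ ^ 2)) atTop (𝓝 0) := by
      have := (tendsto_tsum_compl_atTop_zero fun i => ‖r i‖ ^ 2).sqrt
      rwa [Real.sqrt_zero] at this
    refine squeeze_zero (fun _ => norm_nonneg _) (fun s => ?_) h0
    rw [norm_sub_rev, hsub]
    refine (norm_rowOp_le _ _).trans (Real.sqrt_le_sqrt (le_of_eq ?_))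
    have h1 := tsum_subtype {i | i ∉ s} fun i => ‖r i‖ ^ 2
    refine Eq.trans ?_ h1.symm
    refine tsum_congr fun i => ?_
    by_cases hi : i ∈ s <;> simp [hi, Set.indicator]
  refine isCompactOperator_of_tendsto hlim (Eventually.of_forall fun s => ?_)
  exact Submodule.sum_mem (compactOperator (RingHom.id ℂ) (L2 ι) (L2 ι))
    fun i _ => isCompactOperator_smulRight _ _

/-- The Fredholm alternative for an infinite matrix with square-summable entries. -/
lemma exists_solution_of_summable_sq [DecidableEq ι] {a : ι → ι → ℂ}
    (ha : Summable fun z : ι × ι => ‖a z.1 z.2‖ ^ 2)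
    (hinj : ∀ x : L2 ι, (∀ i, x i + ∑' k, a i k * x k = 0) → x = 0) :
    (∀ f : L2 ι, ∃ x : L2 ι, ∀ i, x i + ∑' k, a i k * x k = f i) ∧
      ∃ C : ℝ, 0 ≤ C ∧ ∀ x f : L2 ι, (∀ i, x i + ∑' k, a i k * x k = f i) → ‖x‖ ≤ C * ‖f‖ := by
  -- The rows are conjugated because the inner product is conjugate linear in its first argument.
  have hm : ∀ i, Memℓp (fun k => (starRingEnd ℂ) (a i k)) 2 := fun i => by
    rw [memℓp_two_iff]
    simpa using ha.prod_factor i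
  set r : ι → L2 ι := fun i => ⟨_, hm i⟩ with hrdef
  have hr : Summable fun i => ‖r i‖ ^ 2 := by
    have h1 := ha.prod
    refine h1.congr fun i => ?_
    rw [L2.norm_sq]
    simp [hrdef]
  set T := rowOp r hr
  have hT : ∀ x i, T x i = ∑' k, a i k * x k := fun x i => by
    rw [rowOp_apply, lp.inner_eq_tsum]
    refine tsum_congr fun k => ?_
    simp [hrdef, mul_comm]
  have hc : IsCompactOperator T := isCompactOperator_rowOp r hr
  -- For compact `T` the point -1 is an eigenvalue or in the resolvent set; an eigenvector would
  -- solve the homogeneous equation.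
  have hne : ¬ Module.End.HasEigenvalue (T : Module.End ℂ (L2 ι)) (-1) := by
    intro h
    obtain ⟨x, hx⟩ := h.exists_hasEigenvector
    refine hx.2 (hinj x fun i => ?_)
    have h1 : T x = (-1 : ℂ) • x := hx.apply_eq_smul
    rw [← hT, h1]
    simp
  have hres := (hc.hasEigenvalue_or_mem_resolventSet (μ := (-1 : ℂ)) (by simp)).resolve_left hne
  have hu : IsUnit (1 + T) := by
    rw [spectrum.mem_resolventSet_iff] at hres
    have e : algebraMap ℂ (L2 ι →L[ℂ] L2 ι) (-1) - T = -(1 + T) := by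
      rw [map_neg, map_one]; abel
    rw [e] at hres
    simpa using hres.neg
  obtain ⟨v, hv⟩ := hu
  have hval : ∀ x i, (1 + T) x i = x i + ∑' k, a i k * x k := fun x i => by
    rw [_root_.add_apply, lp.coeFn_add, Pi.add_apply, hT]; rfl
  have h1 : (1 + T) * ↑v⁻¹ = 1 := by rw [← hv]; exact v.mul_inv
  have h2 : ↑v⁻¹ * (1 + T) = 1 := by rw [← hv]; exact v.inv_mul
  refine ⟨fun f => ⟨(↑v⁻¹ : L2 ι →L[ℂ] L2 ι) f, fun i => ?_⟩, ‖(↑v⁻¹ : L2 ι →L[ℂ] L2 ι)‖, norm_nonneg _, fun x f hx => ?_⟩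
  · rw [← hval]
    exact congrArg (fun z : L2 ι => z i) (congrArg (fun A : L2 ι →L[ℂ] L2 ι => A f) h1)
  · have h3 : (1 + T) x = f := by ext i; rw [hval, hx]
    have h4 : (↑v⁻¹ : L2 ι →L[ℂ] L2 ι) ((1 + T) x) = x := congrArg (fun A : L2 ι →L[ℂ] L2 ι => A x) h2
    rw [← h4, h3]
    exact ContinuousLinearMap.le_opNorm _ _

end HilbertSchmidt

/-! ### Weighted sequences -/

/-- The weight `(1 + m²)^{p/2}`. -/
def jap (p : ℝ) (m : ℤ) : ℝ := (1 + (m : ℝ) ^ 2) ^ (p / 2)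

lemma jap_pos (p : ℝ) (m : ℤ) : 0 < jap p m := Real.rpow_pos_of_pos (by positivity) _

lemma jap_ne_zero (p : ℝ) (m : ℤ) : (jap p m : ℂ) ≠ 0 := by exact_mod_cast (jap_pos p m).ne'

lemma one_le_jap {p : ℝ} (hp : 0 ≤ p) (m : ℤ) : 1 ≤ jap p m :=
  Real.one_le_rpow (by nlinarith [sq_nonneg (m : ℝ)]) (by positivity)

lemma one_add_sq_le_wt_sq (m : ℤ) : 1 + (m : ℝ) ^ 2 ≤ wt m ^ 2 := by
  unfold wt
  nlinarith [abs_nonneg (m : ℝ), sq_abs (m : ℝ)]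

lemma wt_sq_le (m : ℤ) : wt m ^ 2 ≤ 2 * (1 + (m : ℝ) ^ 2) := by
  unfold wt
  nlinarith [abs_nonneg (m : ℝ), sq_abs (m : ℝ), sq_nonneg (|(m : ℝ)| - 1)]

lemma jap_add (p q : ℝ) (m : ℤ) : jap (p + q) m = jap p m * jap q m := by
  unfold jap
  rw [← Real.rpow_add (by positivity), add_div]

lemma jap_le_wt_pow {p : ℝ} {P : ℕ} (hP : p ≤ 2 * P) (m : ℤ) : jap p m ≤ wt m ^ (2 * P) := by
  unfold jap
  calc (1 + (m : ℝ) ^ 2) ^ (p / 2) ≤ (1 + (m : ℝ) ^ 2) ^ (P : ℝ) :=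
        Real.rpow_le_rpow_of_exponent_le (by nlinarith [sq_nonneg (m : ℝ)]) (by linarith)
    _ ≤ (wt m ^ 2) ^ P := by
        rw [Real.rpow_natCast]
        exact pow_le_pow_left₀ (by positivity) (one_add_sq_le_wt_sq m) P
    _ = _ := by rw [pow_mul]

/-- Peetre's inequality for the Sobolev weights of real exponent. The integer `P` keeps the
off-diagonal cost a natural power, as in `OrdMat`. -/
lemma jap_le_mul {p : ℝ} (hp : 0 ≤ p) {P : ℕ} (hP : p ≤ 2 * P) (m k : ℤ) :
    jap p m ≤ 2 ^ P * wt (m - k) ^ (2 * P) * jap p k := by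
  have h1 : 1 + (m : ℝ) ^ 2 ≤ (2 * wt (m - k) ^ 2) * (1 + (k : ℝ) ^ 2) := by
    calc 1 + (m : ℝ) ^ 2 ≤ wt m ^ 2 := one_add_sq_le_wt_sq m
      _ ≤ (wt k * wt (m - k)) ^ 2 := pow_le_pow_left₀ (wt_pos m).le (wt_le_mul_sub m k) 2
      _ = wt k ^ 2 * wt (m - k) ^ 2 := mul_pow _ _ _
      _ ≤ (2 * (1 + (k : ℝ) ^ 2)) * wt (m - k) ^ 2 := by
          have := wt_sq_le k; gcongr
      _ = _ := by ring
  have h2 : 1 ≤ 2 * wt (m - k) ^ 2 := by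
    have := one_le_pow₀ (one_le_wt (m - k)) (n := 2); linarith
  calc jap p m ≤ ((2 * wt (m - k) ^ 2) * (1 + (k : ℝ) ^ 2)) ^ (p / 2) :=
        Real.rpow_le_rpow (by positivity) h1 (by positivity)
    _ = (2 * wt (m - k) ^ 2) ^ (p / 2) * jap p k := Real.mul_rpow (by positivity) (by positivity)
    _ ≤ (2 * wt (m - k) ^ 2) ^ (P : ℝ) * jap p k := by
        have h3 := Real.rpow_le_rpow_of_exponent_le h2 (show p / 2 ≤ P by linarith)
        have := jap_pos p k
        gcongr
    _ = _ := by rw [Real.rpow_natCast, mul_pow, pow_mul]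

lemma exists_nat_half_le (p : ℝ) : ∃ P : ℕ, p ≤ 2 * P := by
  obtain ⟨P, hP⟩ := exists_nat_ge p
  exact ⟨P, by have : (0 : ℝ) ≤ P := by positivity
               linarith⟩

lemma RapidDecay.summable_jap_sq {u : ℤ → ℂ} (hu : RapidDecay u) (p : ℝ) :
    Summable fun m => ‖(jap p m : ℂ) * u m‖ ^ 2 := by
  obtain ⟨P, hP⟩ := exists_nat_half_le p
  obtain ⟨C, hC⟩ := hu (2 * P + 1)
  refine Summable.of_nonneg_of_le (fun _ => by positivity) (fun m => ?_)
    (summable_inv_wt_sq.mul_left (C ^ 2))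
  have hw := wt_pos m
  have h1 : ‖(jap p m : ℂ) * u m‖ ≤ C * (wt m)⁻¹ := by
    rw [norm_mul, Complex.norm_real, Real.norm_of_nonneg (jap_pos p m).le]
    calc jap p m * ‖u m‖ ≤ wt m ^ (2 * P) * (C / wt m ^ (2 * P + 1)) := by
          gcongr
          · exact jap_le_wt_pow hP m
          · exact hC m
      _ = _ := by rw [pow_succ]; field_simp
  calc _ ≤ (C * (wt m)⁻¹) ^ 2 := pow_le_pow_left₀ (norm_nonneg _) h1 2
    _ = _ := by rw [mul_pow, inv_pow]

/-! ### Pairs of rapidly decaying sequences -/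

lemma summable_fin_two_prod {f : Fin 2 × ℤ → ℂ} (h : ∀ j, Summable fun k => ‖f (j, k)‖) :
    Summable fun z => ‖f z‖ :=
  (summable_prod_of_nonneg fun _ => norm_nonneg _).mpr ⟨h, summable_of_hasFiniteSupport (Set.toFinite _)⟩

lemma tsum_fin_two_prod {f : Fin 2 × ℤ → ℂ} (h : ∀ j, Summable fun k => ‖f (j, k)‖) :
    ∑' z, f z = ∑' k, f (0, k) + ∑' k, f (1, k) := by
  rw [(summable_fin_two_prod h).of_norm.tsum_prod, tsum_fintype, Fin.sum_univ_two]

/-- The action of a block matrix on a pair of sequences. -/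
def act (A : Matrix (Fin 2) (Fin 2) (Module.End ℂ RD)) (U : Fin 2 → RD) : Fin 2 → RD :=
  fun i => A i 0 (U 0) + A i 1 (U 1)

lemma memℓp_jap (p : ℝ) (U : Fin 2 → RD) :
    Memℓp (fun z : Fin 2 × ℤ => (jap p z.2 : ℂ) * (U z.1 : ℤ → ℂ) z.2) 2 := by
  rw [memℓp_two_iff]
  have h := summable_fin_two_prod (f := fun z => ((‖(jap p z.2 : ℂ) * (U z.1 : ℤ → ℂ) z.2‖ ^ 2 : ℝ) : ℂ))
    fun j => by
      have h1 := (U j).2.summable_jap_sq p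
      refine h1.congr fun k => ?_
      rw [Complex.norm_real, Real.norm_of_nonneg (by positivity)]
  refine h.congr fun z => ?_
  rw [Complex.norm_real, Real.norm_of_nonneg (by positivity)]

/-- The weighted vector `((1 + m²)^{p/2} u_i(m))`. -/
def weighted (p : ℝ) (U : Fin 2 → RD) : L2 (Fin 2 × ℤ) := ⟨_, memℓp_jap p U⟩

lemma weighted_apply (p : ℝ) (U : Fin 2 → RD) (i : Fin 2) (m : ℤ) :
    weighted p U (i, m) = (jap p m : ℂ) * (U i : ℤ → ℂ) m := rfl

/-- Solutions of a second kind equation with an operator of order `-1` decay rapidly. -/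
lemma rapidDecay_of_fixed {g : Fin 2 → Fin 2 → ℤ → ℤ → ℂ} (hg : ∀ i j, OrdMat (-1) (g i j))
    {u : Fin 2 → ℤ → ℂ} {C : ℝ} (hu : ∀ i k, ‖u i k‖ ≤ C) (F : Fin 2 → RD)
    (h : ∀ i m, u i m + (matApply (g i 0) (u 0) m + matApply (g i 1) (u 1) m) = (F i : ℤ → ℂ) m)
    (i : Fin 2) : RapidDecay (u i) := by
  have key : ∀ N : ℕ, ∃ C : ℝ, ∀ i k, ‖u i k‖ ≤ C * wt k ^ (-(N : ℤ)) := by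
    intro N
    induction N with
    | zero => exact ⟨C, fun i k => by simpa using hu i k⟩
    | succ N ih =>
      obtain ⟨C, hC⟩ := ih
      have hstep : ∀ i, ∃ D : ℝ, 0 ≤ D ∧ ∀ k, ‖u i k‖ ≤ D * wt k ^ (-((N + 1 : ℕ) : ℤ)) := by
        intro i
        obtain ⟨D, hD0, hD⟩ := (F i).2.zpow (-((N + 1 : ℕ) : ℤ))
        obtain ⟨D₀, h0, hD₀⟩ := ((hg i 0).apply_bound (hC 0)).2
        obtain ⟨D₁, h1, hD₁⟩ := ((hg i 1).apply_bound (hC 1)).2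
        refine ⟨D + D₀ + D₁, by positivity, fun k => ?_⟩
        have e : u i k = (F i : ℤ → ℂ) k - (matApply (g i 0) (u 0) k + matApply (g i 1) (u 1) k) := by
          rw [← h]; ring
        have e2 : (-((N + 1 : ℕ) : ℤ)) = -1 + -(N : ℤ) := by push_cast; ring
        rw [e, e2]
        rw [e2] at hD
        calc _ ≤ ‖(F i : ℤ → ℂ) k‖ + (‖matApply (g i 0) (u 0) k‖ + ‖matApply (g i 1) (u 1) k‖) :=
              (norm_sub_le _ _).trans (by gcongr; exact norm_add_le _ _)
          _ ≤ _ := by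
              have := hD k
              have := hD₀ k
              have := hD₁ k
              unfold matApply
              linarith
      choose D hD0 hD using hstep
      refine ⟨D 0 + D 1, fun i k => (hD i k).trans ?_⟩
      have hw := zpow_pos (wt_pos k) (-((N + 1 : ℕ) : ℤ))
      have hle : D i ≤ D 0 + D 1 := by
        fin_cases i
        · simpa using hD0 1
        · simpa using hD0 0
      gcongr
  refine rapidDecay_of_zpow fun N => ?_
  obtain ⟨C, hC⟩ := key N
  exact ⟨C, fun k => hC i k⟩

/-- The matrix of an operator in weighted coordinates. -/
def weightedMat (p : ℝ) (g : Fin 2 → Fin 2 → ℤ → ℤ → ℂ) (z y : Fin 2 × ℤ) : ℂ :=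
  (jap p z.2 : ℂ) * g z.1 y.1 z.2 y.2 / jap p y.2

lemma tsum_weightedMat {g : Fin 2 → Fin 2 → ℤ → ℤ → ℂ} (hg : ∀ i j, OrdMat (-1) (g i j)) (p : ℝ)
    {u : Fin 2 → ℤ → ℂ} {C : ℝ} (hu : ∀ j k, ‖u j k‖ ≤ C) (i : Fin 2) (m : ℤ) :
    ∑' y, weightedMat p g (i, m) y * ((jap p y.2 : ℂ) * u y.1 y.2) =
      jap p m * (matApply (g i 0) (u 0) m + matApply (g i 1) (u 1) m) := by
  have e : ∀ j k, weightedMat p g (i, m) (j, k) * ((jap p k : ℂ) * u j k) =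
      jap p m * (g i j m k * u j k) := by
    intro j k
    have := jap_ne_zero p k
    unfold weightedMat
    field_simp
  have hs : ∀ j, Summable fun k => ‖weightedMat p g (i, m) (j, k) * ((jap p k : ℂ) * u j k)‖ := fun j => by
    have := ((hg i j).apply_bound (r := 0) (C := C) fun k => by simpa using hu j k).1 m
    simp only [e, norm_mul (jap p m : ℂ)]
    exact this.mul_left _
  rw [tsum_fin_two_prod (f := fun y => weightedMat p g (i, m) y * ((jap p y.2 : ℂ) * u y.1 y.2)) hs,
    tsum_congr (e 0), tsum_congr (e 1), tsum_mul_left, tsum_mul_left, ← mul_add]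
  rfl

/-- The entries of an operator of order `-1` are square summable, with weights. -/
lemma summable_sq_weightedMat {g : Fin 2 → Fin 2 → ℤ → ℤ → ℂ} (hg : ∀ i j, OrdMat (-1) (g i j))
    {p : ℝ} (hp : 0 ≤ p) : Summable fun z : (Fin 2 × ℤ) × (Fin 2 × ℤ) =>
      ‖weightedMat p g z.1 z.2‖ ^ 2 := by
  obtain ⟨P, hP⟩ := exists_nat_half_le p
  -- The `2P` powers pay for the quotient of weights at `m` and `k`. One further power and the order
  -- -1 leave `(wt k * wt (m - k))⁻¹`, which is square summable over both indices.
  choose C hC0 hC using fun i j => hg i j (2 * P + 1)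
  set K := ∑ i, ∑ j, C i j
  have hK : ∀ i j, C i j ≤ K := fun i j =>
    (Finset.single_le_sum (fun j _ => hC0 i j) (Finset.mem_univ j)).trans
      (Finset.single_le_sum (f := fun i => ∑ j, C i j)
        (fun i _ => Finset.sum_nonneg fun j _ => hC0 i j) (Finset.mem_univ i))
  have hs : Summable fun y : ℤ × ℤ => (wt y.2 ^ 2)⁻¹ * (wt (y.1 - y.2) ^ 2)⁻¹ := by
    have h0 : Summable fun y : ℤ × ℤ => (wt y.2 ^ 2)⁻¹ * (wt y.1 ^ 2)⁻¹ := by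
      have := Summable.mul_of_nonneg summable_inv_wt_sq summable_inv_wt_sq
        (fun x => inv_nonneg.mpr (sq_nonneg _)) (fun x => inv_nonneg.mpr (sq_nonneg _))
      exact this.congr fun y => mul_comm _ _
    let e : ℤ × ℤ ≃ ℤ × ℤ :=
      { toFun := fun i => (i.1 - i.2, i.2)
        invFun := fun j => (j.1 + j.2, j.2)
        left_inv := fun i => by ext <;> simp
        right_inv := fun j => by ext <;> simp }
    exact (e.summable_iff (f := fun y : ℤ × ℤ => (wt y.2 ^ 2)⁻¹ * (wt y.1 ^ 2)⁻¹)).mpr h0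
  have hs2 : Summable fun y : (Fin 2 × Fin 2) × (ℤ × ℤ) =>
      (1 : ℝ) * ((wt y.2.2 ^ 2)⁻¹ * (wt (y.2.1 - y.2.2) ^ 2)⁻¹) :=
    Summable.mul_of_nonneg (f := fun _ : Fin 2 × Fin 2 => (1 : ℝ))
      (summable_of_hasFiniteSupport (Set.toFinite _)) hs (fun _ => zero_le_one)
      (fun y => by have := wt_pos y.2; have := wt_pos (y.1 - y.2); positivity)
  have hs3 := ((Equiv.prodProdProdComm (Fin 2) ℤ (Fin 2) ℤ).summable_iff).mpr hs2
  refine Summable.of_nonneg_of_le (fun _ => by positivity) (fun z => ?_)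
    (hs3.mul_left ((K * 2 ^ P) ^ 2))
  obtain ⟨⟨i, m⟩, ⟨j, k⟩⟩ := z
  simp only [Function.comp_apply, Equiv.prodProdProdComm_apply, one_mul, weightedMat]
  have hk := wt_pos k
  have hmk := wt_pos (m - k)
  have hj := jap_pos p k
  have h1 : ‖(jap p m : ℂ) * g i j m k / jap p k‖ ≤ K * 2 ^ P * ((wt k)⁻¹ * (wt (m - k))⁻¹) := by
    rw [norm_div, norm_mul, Complex.norm_real, Complex.norm_real, Real.norm_of_nonneg hj.le,
      Real.norm_of_nonneg (jap_pos p m).le, div_le_iff₀ hj]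
    have h2 : ‖g i j m k‖ ≤ K * (wt k)⁻¹ / wt (m - k) ^ (2 * P + 1) := by
      refine (hC i j m k).trans ?_
      rw [zpow_neg_one]
      have := hK i j
      gcongr
    calc jap p m * ‖g i j m k‖ ≤ (2 ^ P * wt (m - k) ^ (2 * P) * jap p k) *
          (K * (wt k)⁻¹ / wt (m - k) ^ (2 * P + 1)) := by
          gcongr
          exact jap_le_mul hp hP m k
      _ = _ := by rw [pow_succ]; field_simp
  calc _ ≤ (K * 2 ^ P * ((wt k)⁻¹ * (wt (m - k))⁻¹)) ^ 2 := pow_le_pow_left₀ (norm_nonneg _) h1 2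
    _ = _ := by simp only [mul_pow, inv_pow]

/-- Unique solvability of second kind equations with an operator of order `-1`. -/
theorem exists_solution_act {G : Matrix (Fin 2) (Fin 2) (Module.End ℂ RD)}
    (hG : ∀ i j, IsOrd (-1) (G i j)) (hinj : ∀ U, U + act G U = 0 → U = 0) :
    (∀ F, ∃ U, U + act G U = F) ∧
      ∀ p : ℝ, 0 ≤ p → ∃ C : ℝ, 0 ≤ C ∧ ∀ U, ‖weighted p U‖ ≤ C * ‖weighted p (U + act G U)‖ := by
  choose g hg hgA using hG
  have hact : ∀ U i m, ((U + act G U) i : ℤ → ℂ) m =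
      (U i : ℤ → ℂ) m + (matApply (g i 0) (U 0) m + matApply (g i 1) (U 1) m) := fun U i m => by
    rw [← hgA, ← hgA]; rfl
  have main : ∀ p : ℝ, 0 ≤ p → (∀ F, ∃ U, U + act G U = F) ∧
      ∃ C : ℝ, 0 ≤ C ∧ ∀ U, ‖weighted p U‖ ≤ C * ‖weighted p (U + act G U)‖ := by
    intro p hp
    have hsum := summable_sq_weightedMat hg hp
    -- Undoing the weight gives a bounded sequence because `jap p ≥ 1` for `p ≥ 0`; boundedness is
    -- all that the regularity argument needs to start.
    have hvec : ∀ x : L2 (Fin 2 × ℤ), ∃ u : Fin 2 → ℤ → ℂ, ∃ C : ℝ, (∀ j k, ‖u j k‖ ≤ C) ∧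
        ∀ z : Fin 2 × ℤ, x z = (jap p z.2 : ℂ) * u z.1 z.2 := by
      intro x
      refine ⟨fun i m => x (i, m) / jap p m, ‖x‖, fun j k => ?_, fun z => ?_⟩
      · rw [norm_div, Complex.norm_real, Real.norm_of_nonneg (jap_pos p k).le]
        exact (div_le_self (norm_nonneg _) (one_le_jap hp k)).trans
          (lp.norm_apply_le_norm (by simp) x (j, k))
      · have := jap_ne_zero p z.2
        field_simp
    have hsolve : ∀ (F : Fin 2 → RD) (x : L2 (Fin 2 × ℤ)),
        (∀ z, x z + ∑' y, weightedMat p g z y * x y = weighted p F z) → ∃ U, U + act G U = F ∧ x = weighted p U := by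
      intro F x hx
      obtain ⟨u, C, hu, hxu⟩ := hvec x
      have h1 : ∀ i m, u i m + (matApply (g i 0) (u 0) m + matApply (g i 1) (u 1) m) =
          (F i : ℤ → ℂ) m := by
        intro i m
        have h2 := hx (i, m)
        simp only [hxu] at h2
        rw [tsum_weightedMat hg p hu, weighted_apply] at h2
        refine mul_left_cancel₀ (jap_ne_zero p m) ?_
        rw [← h2]; ring
      have hr := rapidDecay_of_fixed hg hu F h1
      refine ⟨fun i => ⟨u i, hr i⟩, ?_, ?_⟩
      · ext i m
        rw [hact]
        exact h1 i m
      · ext z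
        rw [hxu]; rfl
    have hfor : ∀ U z, weighted p U z + ∑' y, weightedMat p g z y * weighted p U y = weighted p (U + act G U) z := by
      intro U z
      obtain ⟨C₀, -, h0⟩ := (U 0).2.zpow 0
      obtain ⟨C₁, -, h1⟩ := (U 1).2.zpow 0
      simp only [zpow_zero, mul_one] at h0 h1
      have hb : ∀ j k, ‖(U j : ℤ → ℂ) k‖ ≤ max C₀ C₁ := by
        intro j k
        fin_cases j
        · exact (h0 k).trans (le_max_left _ _)
        · exact (h1 k).trans (le_max_right _ _)
      have := tsum_weightedMat hg p (u := fun j => (U j : ℤ → ℂ)) hb z.1 z.2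
      rw [show weighted p (U + act G U) z = _ from weighted_apply p _ z.1 z.2, hact, mul_add, ← this]
      rfl
    -- A null vector in `ℓ²` is first shown to be rapidly decaying, so injectivity on smooth data
    -- suffices.
    have hfred := exists_solution_of_summable_sq hsum fun x hx => by
      obtain ⟨U, hU, rfl⟩ := hsolve 0 x fun z => by
        rw [hx]
        have := weighted_apply p 0 z.1 z.2
        simp only [Pi.zero_apply, ZeroMemClass.coe_zero, mul_zero] at this
        exact this.symm
      rw [hinj U hU]
      ext z
      have := weighted_apply p 0 z.1 z.2
      simp only [Pi.zero_apply, ZeroMemClass.coe_zero, mul_zero] at this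
      exact this
    refine ⟨fun F => ?_, ?_⟩
    · obtain ⟨x, hx⟩ := hfred.1 (weighted p F)
      obtain ⟨U, hU, -⟩ := hsolve F x hx
      exact ⟨U, hU⟩
    · obtain ⟨C, hC0, hC⟩ := hfred.2
      exact ⟨C, hC0, fun U => hC _ _ (hfor U)⟩
  -- Solvability in rapidly decaying sequences does not mention `p`, so any admissible exponent
  -- proves it.
  exact ⟨(main 0 le_rfl).1, fun p hp => (main p hp).2⟩

/-! ### Weighted norms -/

lemma memℓp_jap_single (p : ℝ) (u : RD) : Memℓp (fun m => (jap p m : ℂ) * (u : ℤ → ℂ) m) 2 :=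
  memℓp_two_iff.mpr (u.2.summable_jap_sq p)

/-- The weighted vector `((1 + m²)^{p/2} u(m))`. -/
def wvec (p : ℝ) (u : RD) : L2 ℤ := ⟨_, memℓp_jap_single p u⟩

lemma wvec_apply (p : ℝ) (u : RD) (m : ℤ) : wvec p u m = (jap p m : ℂ) * (u : ℤ → ℂ) m := rfl

lemma norm_wvec_sq (p : ℝ) (u : RD) : ‖wvec p u‖ ^ 2 = ∑' m, (jap p m * ‖(u : ℤ → ℂ) m‖) ^ 2 := by
  rw [L2.norm_sq]
  refine tsum_congr fun m => ?_
  rw [wvec_apply, norm_mul, Complex.norm_real, Real.norm_of_nonneg (jap_pos p m).le]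

lemma summable_wvec_sq (p : ℝ) (u : RD) : Summable fun m => (jap p m * ‖(u : ℤ → ℂ) m‖) ^ 2 := by
  refine (u.2.summable_jap_sq p).congr fun m => ?_
  rw [norm_mul, Complex.norm_real, Real.norm_of_nonneg (jap_pos p m).le]

lemma wvec_add (p : ℝ) (u v : RD) : wvec p (u + v) = wvec p u + wvec p v := by
  ext m; exact mul_add _ _ _

lemma wvec_sub (p : ℝ) (u v : RD) : wvec p (u - v) = wvec p u - wvec p v := by
  ext m; exact mul_sub _ _ _

lemma jap_mul_norm_le (p : ℝ) (u : RD) (m : ℤ) : jap p m * ‖(u : ℤ → ℂ) m‖ ≤ ‖wvec p u‖ := by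
  have := lp.norm_apply_le_norm (by simp) (wvec p u) m
  rwa [wvec_apply, norm_mul, Complex.norm_real, Real.norm_of_nonneg (jap_pos p m).le] at this

lemma norm_weighted_sq (p : ℝ) (U : Fin 2 → RD) :
    ‖weighted p U‖ ^ 2 = ‖wvec p (U 0)‖ ^ 2 + ‖wvec p (U 1)‖ ^ 2 := by
  rw [L2.norm_sq, L2.norm_sq, L2.norm_sq, (L2.summable_sq (weighted p U)).tsum_prod, tsum_fintype,
    Fin.sum_univ_two]
  rfl

lemma norm_wvec_le_weighted (p : ℝ) (U : Fin 2 → RD) (i : Fin 2) : ‖wvec p (U i)‖ ≤ ‖weighted p U‖ := by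
  have h := norm_weighted_sq p U
  refine le_of_sq_le_sq ?_ (norm_nonneg _)
  fin_cases i
  · have := sq_nonneg ‖wvec p (U 1)‖
    simp only [Fin.zero_eta]
    linarith
  · have := sq_nonneg ‖wvec p (U 0)‖
    simp only [Fin.mk_one]
    linarith

lemma norm_weighted_le (p : ℝ) (U : Fin 2 → RD) :
    ‖weighted p U‖ ≤ ‖wvec p (U 0)‖ + ‖wvec p (U 1)‖ := by
  have h := norm_weighted_sq p U
  refine le_of_sq_le_sq ?_ (by positivity)
  nlinarith [norm_nonneg (wvec p (U 0)), norm_nonneg (wvec p (U 1))]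

/-- On smooth functions the extended-valued norm is finite, so the final estimate can be proved for
real numbers. -/
lemma sobolevNorm_synth (p : ℝ) (u : RD) : sobolevNorm p (synth u) = ENNReal.ofReal ‖wvec p u‖ := by
  unfold sobolevNorm
  have h : ∀ m : ℤ, ENNReal.ofReal ((1 + (m : ℝ) ^ 2) ^ p * ‖fourierCoef (synth u) m‖ ^ 2) =
      ENNReal.ofReal ((jap p m * ‖(u : ℤ → ℂ) m‖) ^ 2) := fun m => by
    have hj : jap p m ^ 2 = (1 + (m : ℝ) ^ 2) ^ p := by
      unfold jap
      rw [← Real.rpow_natCast ((1 + (m : ℝ) ^ 2) ^ (p / 2)) 2, ← Real.rpow_mul (by positivity)]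
      congr 1
      push_cast; ring
    rw [fourierCoef_synth u.2, mul_pow, hj]
  simp only [h]
  rw [← ENNReal.ofReal_tsum_of_nonneg (fun m => sq_nonneg _) (summable_wvec_sq p u), ← norm_wvec_sq,
    ENNReal.ofReal_rpow_of_nonneg (by positivity) (by norm_num), ← Real.sqrt_eq_rpow,
    Real.sqrt_sq (norm_nonneg _)]

/-! ### Boundedness of operators of order `-3` -/

/-- Young's inequality for convolution with a summable sequence. -/
lemma tsum_sq_conv_le {h x : ℤ → ℝ} (h0 : ∀ k, 0 ≤ h k) (hh : Summable h) (x0 : ∀ k, 0 ≤ x k)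
    (hx : Summable fun k => x k ^ 2) :
    (∀ m, Summable fun k => h (m - k) * x k) ∧ (Summable fun m => (∑' k, h (m - k) * x k) ^ 2) ∧
      ∑' m, (∑' k, h (m - k) * x k) ^ 2 ≤ (∑' k, h k) ^ 2 * ∑' k, x k ^ 2 := by
  have hh' : ∀ m, Summable fun k => h (m - k) := fun m => (Equiv.subLeft m).summable_iff.mpr hh
  have hsum : ∀ m, ∑' k, h (m - k) = ∑' k, h k := fun m => (Equiv.subLeft m).tsum_eq h
  have hd : Summable fun z : ℤ × ℤ => h (z.1 - z.2) * x z.2 ^ 2 := by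
    have h1 : Summable fun z : ℤ × ℤ => h z.1 * x z.2 ^ 2 :=
      Summable.mul_of_nonneg hh hx h0 fun _ => sq_nonneg _
    let e : ℤ × ℤ ≃ ℤ × ℤ :=
      { toFun := fun i => (i.1 - i.2, i.2)
        invFun := fun j => (j.1 + j.2, j.2)
        left_inv := fun i => by ext <;> simp
        right_inv := fun j => by ext <;> simp }
    exact (e.summable_iff (f := fun z : ℤ × ℤ => h z.1 * x z.2 ^ 2)).mpr h1
  have hcs : ∀ m, (Summable fun k => h (m - k) * x k) ∧
      (∑' k, h (m - k) * x k) ^ 2 ≤ (∑' k, h k) * ∑' k, h (m - k) * x k ^ 2 := by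
    -- Cauchy–Schwarz after splitting `h` as `√h · √h`.
    intro m
    have e1 : ∀ k, Real.sqrt (h (m - k)) * (Real.sqrt (h (m - k)) * x k) = h (m - k) * x k := fun k => by
      rw [← mul_assoc, Real.mul_self_sqrt (h0 _)]
    have e2 : ∀ k, Real.sqrt (h (m - k)) ^ (2 : ℝ) = h (m - k) := fun k => by
      rw [Real.rpow_two, Real.sq_sqrt (h0 _)]
    have e3 : ∀ k, (Real.sqrt (h (m - k)) * x k) ^ (2 : ℝ) = h (m - k) * x k ^ 2 := fun k => by
      rw [Real.rpow_two, mul_pow, Real.sq_sqrt (h0 _)]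
    have key := Real.summable_and_inner_le_Lp_mul_Lq_tsum_of_nonneg (p := 2) (q := 2)
      (f := fun k => Real.sqrt (h (m - k))) (g := fun k => Real.sqrt (h (m - k)) * x k)
      Real.HolderConjugate.two_two (fun _ => Real.sqrt_nonneg _)
      (fun k => mul_nonneg (Real.sqrt_nonneg _) (x0 k)) (by simpa only [e2] using hh' m)
      (by simpa only [e3] using hd.prod_factor m)
    simp only [e1, e2, e3, hsum] at key
    refine ⟨key.1, ?_⟩
    have hA : 0 ≤ ∑' k, h k := tsum_nonneg h0
    have hB : 0 ≤ ∑' k, h (m - k) * x k ^ 2 := tsum_nonneg fun k => mul_nonneg (h0 _) (sq_nonneg _)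
    have h0' : 0 ≤ ∑' k, h (m - k) * x k := tsum_nonneg fun k => mul_nonneg (h0 _) (x0 k)
    calc _ ≤ ((∑' k, h k) ^ (1 / 2 : ℝ) * (∑' k, h (m - k) * x k ^ 2) ^ (1 / 2 : ℝ)) ^ 2 :=
          pow_le_pow_left₀ h0' key.2 2
      _ = _ := by
          rw [mul_pow, ← Real.sqrt_eq_rpow, ← Real.sqrt_eq_rpow, Real.sq_sqrt hA, Real.sq_sqrt hB]
  have hs2 : Summable fun m => ∑' k, h (m - k) * x k ^ 2 := hd.prod
  have hs3 : Summable fun m => (∑' k, h (m - k) * x k) ^ 2 :=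
    Summable.of_nonneg_of_le (fun _ => sq_nonneg _) (fun m => (hcs m).2) (hs2.mul_left _)
  refine ⟨fun m => (hcs m).1, hs3, ?_⟩
  calc _ ≤ ∑' m, (∑' k, h k) * ∑' k, h (m - k) * x k ^ 2 :=
        hs3.tsum_le_tsum (fun m => (hcs m).2) (hs2.mul_left _)
    _ = (∑' k, h k) * ∑' m, ∑' k, h (m - k) * x k ^ 2 := tsum_mul_left
    _ = (∑' k, h k) * ∑' k, ∑' m, h (m - k) * x k ^ 2 := by
        congr 1
        exact Summable.tsum_comm (f := fun k m => h (m - k) * x k ^ 2) hd.prod_symm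
    _ = (∑' k, h k) * ∑' k, (∑' j, h j) * x k ^ 2 := by
        congr 1
        refine tsum_congr fun k => ?_
        rw [tsum_mul_right]
        congr 1
        exact (Equiv.subRight k).tsum_eq h
    _ = _ := by rw [tsum_mul_left]; ring

lemma jap_three_le (k : ℤ) : jap 3 k ≤ wt k ^ 3 := by
  unfold jap
  calc (1 + (k : ℝ) ^ 2) ^ ((3 : ℝ) / 2) ≤ (wt k ^ 2) ^ ((3 : ℝ) / 2) :=
        Real.rpow_le_rpow (by positivity) (one_add_sq_le_wt_sq k) (by norm_num)
    _ = wt k ^ 3 := by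
        rw [← Real.rpow_natCast _ 2, ← Real.rpow_mul (wt_pos k).le, ← Real.rpow_natCast _ 3]
        norm_num

/-- In weighted coordinates the matrix is dominated by convolution with a summable sequence, and
Young's inequality applies. The three orders gained are turned into three Sobolev exponents. -/
lemma IsOrd.exists_bound {B : Module.End ℂ RD} (hB : IsOrd (-3) B) {p : ℝ} (hp : 0 ≤ p) :
    ∃ C : ℝ, 0 ≤ C ∧ ∀ u, ‖wvec (p + 3) (B u)‖ ≤ C * ‖wvec p u‖ := by
  obtain ⟨g, hg, hBg⟩ := hB
  obtain ⟨P, hP⟩ := exists_nat_half_le (p + 3)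
  obtain ⟨C, hC0, hC⟩ := hg (2 * P + 2)
  set h : ℤ → ℝ := fun k => C * 2 ^ P * (wt k ^ 2)⁻¹ with hdef
  have h0 : ∀ k, 0 ≤ h k := fun k => by have := wt_pos k; positivity
  have hh : Summable h := summable_inv_wt_sq.mul_left _
  have hb : ∀ m k, jap (p + 3) m * ‖g m k‖ ≤ h (m - k) * jap p k := by
    intro m k
    have hk := wt_pos k
    have hmk := wt_pos (m - k)
    have hj := jap_pos p k
    calc jap (p + 3) m * ‖g m k‖ ≤ (2 ^ P * wt (m - k) ^ (2 * P) * jap (p + 3) k) *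
          (C * wt k ^ (-3 : ℤ) / wt (m - k) ^ (2 * P + 2)) := by
          gcongr
          · have := jap_pos (p + 3) k; positivity
          · exact jap_le_mul (by linarith) hP m k
          · exact hC m k
      _ ≤ (2 ^ P * wt (m - k) ^ (2 * P) * (jap p k * wt k ^ 3)) *
          (C * wt k ^ (-3 : ℤ) / wt (m - k) ^ (2 * P + 2)) := by
          rw [jap_add]
          have := jap_three_le k
          gcongr
      _ = _ := by
          rw [hdef, zpow_neg, show (3 : ℤ) = ((3 : ℕ) : ℤ) by rfl, zpow_natCast, pow_add]
          field_simp
  refine ⟨∑' k, h k, tsum_nonneg h0, fun u => ?_⟩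
  obtain ⟨s1, s2, s3⟩ := tsum_sq_conv_le h0 hh (x := fun k => jap p k * ‖(u : ℤ → ℂ) k‖)
    (fun k => mul_nonneg (jap_pos p k).le (norm_nonneg _)) (summable_wvec_sq p u)
  have hpt : ∀ m, jap (p + 3) m * ‖(B u : ℤ → ℂ) m‖ ≤ ∑' k, h (m - k) * (jap p k * ‖(u : ℤ → ℂ) k‖) := by
    intro m
    have hm := jap_pos (p + 3) m
    obtain ⟨D, -, hD⟩ := u.2.zpow 0
    have hs := (hg.apply_bound hD).1 m
    rw [hBg, matApply]
    calc jap (p + 3) m * ‖∑' k, g m k * (u : ℤ → ℂ) k‖ ≤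
          jap (p + 3) m * ∑' k, ‖g m k * (u : ℤ → ℂ) k‖ := by
          gcongr; exact norm_tsum_le_tsum_norm hs
      _ = ∑' k, jap (p + 3) m * ‖g m k * (u : ℤ → ℂ) k‖ := tsum_mul_left.symm
      _ ≤ _ := by
          refine (hs.mul_left _).tsum_le_tsum (fun k => ?_) (s1 m)
          rw [norm_mul, ← mul_assoc, ← mul_assoc]
          exact mul_le_mul_of_nonneg_right (hb m k) (norm_nonneg _)
  refine le_of_sq_le_sq ?_ (mul_nonneg (tsum_nonneg h0) (norm_nonneg _))
  rw [norm_wvec_sq, mul_pow, norm_wvec_sq]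
  refine le_trans ?_ s3
  refine (summable_wvec_sq _ _).tsum_le_tsum (fun m => ?_) s2
  exact pow_le_pow_left₀ (mul_nonneg (jap_pos _ m).le (norm_nonneg _)) (hpt m) 2

lemma exists_bound_act {B : Matrix (Fin 2) (Fin 2) (Module.End ℂ RD)} (hB : ∀ i j, IsOrd (-3) (B i j))
    {p : ℝ} (hp : 0 ≤ p) :
    ∃ C : ℝ, 0 ≤ C ∧ ∀ U i, ‖wvec (p + 3) (act B U i)‖ ≤ C * ‖weighted p U‖ := by
  choose C hC0 hC using fun i j => (hB i j).exists_bound hp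
  have key : ∀ U i, ‖wvec (p + 3) (act B U i)‖ ≤ (C i 0 + C i 1) * ‖weighted p U‖ := by
    intro U i
    unfold act
    rw [wvec_add, add_mul]
    refine (norm_add_le _ _).trans (add_le_add ?_ ?_)
    · exact (hC i 0 _).trans (mul_le_mul_of_nonneg_left (norm_wvec_le_weighted p U 0) (hC0 i 0))
    · exact (hC i 1 _).trans (mul_le_mul_of_nonneg_left (norm_wvec_le_weighted p U 1) (hC0 i 1))
  refine ⟨(C 0 0 + C 0 1) + (C 1 0 + C 1 1),
    add_nonneg (add_nonneg (hC0 0 0) (hC0 0 1)) (add_nonneg (hC0 1 0) (hC0 1 1)), fun U i =>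
    (key U i).trans (mul_le_mul_of_nonneg_right ?_ (norm_nonneg _))⟩
  have a := add_nonneg (hC0 0 0) (hC0 0 1)
  have b := add_nonneg (hC0 1 0) (hC0 1 1)
  fin_cases i
  · simp only [Fin.zero_eta]; linarith
  · simp only [Fin.mk_one]; linarith

/-! ### Trigonometric polynomials and interpolation -/

lemma rapidDecay_of_support {u : ℤ → ℂ} {n : ℕ} (h : ∀ m : ℤ, n < m.natAbs → u m = 0) :
    RapidDecay u := by
  intro N
  refine ⟨∑ k ∈ Finset.Icc (-(n : ℤ)) n, ‖u k‖ * wt k ^ N, fun k => ?_⟩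
  rw [le_div_iff₀ (pow_pos (wt_pos k) N)]
  have h0 : ∀ i ∈ Finset.Icc (-(n : ℤ)) n, 0 ≤ ‖u i‖ * wt i ^ N := fun i _ => by
    have := wt_pos i
    positivity
  by_cases hk : k ∈ Finset.Icc (-(n : ℤ)) n
  · exact Finset.single_le_sum (f := fun i => ‖u i‖ * wt i ^ N) h0 hk
  · rw [h k (by rw [Finset.mem_Icc] at hk; omega)]
    simpa using Finset.sum_nonneg h0

lemma sum_Icc_neg_eq (n : ℕ) (f : ℤ → ℂ) :
    ∑ m ∈ Finset.Icc (-(n : ℤ)) n, f m =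
      f 0 + ∑ k ∈ Finset.range n, (f (k + 1) + f (-((k : ℤ) + 1))) := by
  induction n with
  | zero => simp
  | succ n ih =>
    have e : Finset.Icc (-((n + 1 : ℕ) : ℤ)) ((n + 1 : ℕ) : ℤ) =
        insert ((n : ℤ) + 1) (insert (-((n : ℤ) + 1)) (Finset.Icc (-(n : ℤ)) n)) := by
      ext m
      simp only [Finset.mem_Icc, Finset.mem_insert]
      omega
    rw [e, Finset.sum_insert (by simp only [Finset.mem_Icc, Finset.mem_insert]; omega),
      Finset.sum_insert (by simp only [Finset.mem_Icc]; omega), ih, Finset.sum_range_succ]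
    ring

lemma synth_of_support {u : ℤ → ℂ} {n : ℕ} (h : ∀ m : ℤ, n < m.natAbs → u m = 0) (t : ℝ) :
    synth u t = ∑ m ∈ Finset.Icc (-(n : ℤ)) n, u m * expo m t :=
  tsum_eq_sum fun m hm => by
    rw [h m (by rw [Finset.mem_Icc] at hm; omega), zero_mul]

lemma expo_natCast_eq (k : ℕ) (t : ℝ) :
    expo k t = (Real.cos (k * t) : ℂ) + (Real.sin (k * t) : ℂ) * Complex.I := by
  rw [expo_eq, Complex.exp_mul_I]
  push_cast
  rfl

lemma expo_neg_natCast_eq (k : ℕ) (t : ℝ) :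
    expo (-(k : ℤ)) t = (Real.cos (k * t) : ℂ) - (Real.sin (k * t) : ℂ) * Complex.I := by
  rw [expo_eq, Complex.exp_mul_I]
  push_cast
  rw [neg_mul, Complex.cos_neg, Complex.sin_neg]
  ring

/-- The coefficient sequences of the functions in `X_n`. -/
def trigSpace (n : ℕ) : Submodule ℂ RD where
  carrier := {u | (∀ m : ℤ, n < m.natAbs → (u : ℤ → ℂ) m = 0) ∧ (u : ℤ → ℂ) n = (u : ℤ → ℂ) (-n)}
  add_mem' := fun {u v} hu hv => ⟨fun m hm => by
    change (u : ℤ → ℂ) m + (v : ℤ → ℂ) m = 0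
    rw [hu.1 m hm, hv.1 m hm, add_zero], by
    change (u : ℤ → ℂ) n + (v : ℤ → ℂ) n = (u : ℤ → ℂ) (-n) + (v : ℤ → ℂ) (-n)
    rw [hu.2, hv.2]⟩
  zero_mem' := ⟨fun _ _ => rfl, rfl⟩
  smul_mem' := fun c u hu => ⟨fun m hm => by
    change c * (u : ℤ → ℂ) m = 0
    rw [hu.1 m hm, mul_zero], by
    change c * (u : ℤ → ℂ) n = c * (u : ℤ → ℂ) (-n)
    rw [hu.2]⟩

lemma synth_eq_trig {n : ℕ} (hn : 1 ≤ n) {u : ℤ → ℂ} (h : ∀ m : ℤ, n < m.natAbs → u m = 0)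
    (hs : u n = u (-n)) (t : ℝ) :
    synth u t = ∑ m ∈ Finset.range (n + 1),
        (if m = 0 then u 0 else u m + u (-m)) * (Real.cos (m * t) : ℂ)
      + ∑ m ∈ Finset.Ico 1 n, Complex.I * (u m - u (-m)) * (Real.sin (m * t) : ℂ) := by
  obtain ⟨N, rfl⟩ : ∃ N, n = N + 1 := ⟨n - 1, by omega⟩
  have hsin : ∑ m ∈ Finset.Ico 1 (N + 1), Complex.I * (u m - u (-m)) * (Real.sin (m * t) : ℂ) =
      ∑ k ∈ Finset.range (N + 1), Complex.I * (u ((k + 1 : ℕ) : ℤ) - u (-((k + 1 : ℕ) : ℤ))) *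
        (Real.sin ((k + 1 : ℕ) * t) : ℂ) := by
    -- The sine of frequency `n` has coefficient `u n - u (-n) = 0`, so it may be added to make both
    -- sums range over the same indices.
    rw [Finset.sum_range_succ, hs, sub_self, mul_zero, zero_mul, add_zero,
      Finset.sum_Ico_eq_sum_range]
    simp only [Nat.add_sub_cancel, add_comm 1]
  rw [hsin, Finset.sum_range_succ', synth_of_support h, sum_Icc_neg_eq]
  simp only [Nat.add_eq_zero_iff, one_ne_zero, and_false, if_false, if_true, Nat.cast_zero, zero_mul,
    Real.cos_zero, Complex.ofReal_one, expo_zero, mul_one]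
  rw [add_comm (∑ k ∈ _, _) (u 0), add_assoc, ← Finset.sum_add_distrib]
  congr 1
  refine Finset.sum_congr rfl fun k _ => ?_
  rw [← Nat.cast_add_one, expo_natCast_eq, expo_neg_natCast_eq]
  ring

lemma isTrigPoly_synth {n : ℕ} (hn : 1 ≤ n) {u : RD} (hu : u ∈ trigSpace n) : IsTrigPoly n (synth u) :=
  ⟨_, _, fun t => synth_eq_trig hn hu.1 hu.2 t⟩

lemma IsTrigPoly.exists_synth {n : ℕ} (hn : 1 ≤ n) {φ : ℝ → ℂ} (h : IsTrigPoly n φ) :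
    ∃ u ∈ trigSpace n, synth (u : RD) = φ := by
  obtain ⟨a, b, hab⟩ := h
  -- At the edge `|m| = n` only the cosine contributes, half to each sign, which makes the two edge
  -- coefficients equal.
  let u : ℤ → ℂ := fun m => if m = 0 then a 0 else if n < m.natAbs then 0 else
    a m.natAbs / 2 + if m.natAbs = n then 0 else m.sign * b m.natAbs / (2 * Complex.I)
  have hu : ∀ m : ℤ, n < m.natAbs → u m = 0 := fun m hm => by
    simp only [u]
    rw [if_neg (by omega), if_pos hm]
  have hs : u n = u (-n) := by simp [u]
  refine ⟨⟨u, rapidDecay_of_support hu⟩, ⟨hu, hs⟩, funext fun t => ?_⟩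
  change synth u t = φ t
  rw [hab, synth_eq_trig hn hu hs]
  congr 1
  · refine Finset.sum_congr rfl fun m hm => ?_
    rw [Finset.mem_range] at hm
    congr 1
    split_ifs with h0
    · simp [u, h0]
    · have h1 : ¬ n < m := by omega
      have h2 : (m : ℤ).sign = 1 := Int.sign_eq_one_of_pos (by omega)
      simp only [u, neg_eq_zero, Int.natCast_eq_zero, h0, if_false, Int.natAbs_natCast, Int.natAbs_neg, h1,
        Int.sign_neg, h2]
      split_ifs <;> push_cast <;> ring
  · refine Finset.sum_congr rfl fun m hm => ?_
    rw [Finset.mem_Ico] at hm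
    congr 1
    have h0 : m ≠ 0 := by omega
    have h1 : ¬ n < m := by omega
    have h2 : (m : ℤ).sign = 1 := Int.sign_eq_one_of_pos (by omega)
    have h3 : m ≠ n := by omega
    simp only [u, neg_eq_zero, Int.natCast_eq_zero, h0, if_false, Int.natAbs_natCast, Int.natAbs_neg, h1,
      Int.sign_neg, h2, h3]
    push_cast
    field_simp
    ring

instance finiteDimensional_trigSpace (n : ℕ) : FiniteDimensional ℂ (trigSpace n) := by
  let f : trigSpace n →ₗ[ℂ] (Finset.Icc (-(n : ℤ)) n → ℂ) :=
    { toFun := fun u m => ((u : RD) : ℤ → ℂ) m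
      map_add' := fun _ _ => rfl
      map_smul' := fun _ _ => rfl }
  refine FiniteDimensional.of_injective f fun u v huv => ?_
  ext m
  by_cases hm : m ∈ Finset.Icc (-(n : ℤ)) n
  · exact congrFun huv ⟨m, hm⟩
  · have : n < m.natAbs := by rw [Finset.mem_Icc] at hm; omega
    rw [u.2.1 m this, v.2.1 m this]

/-! #### Discrete orthogonality -/

lemma expo_node (n j : ℕ) (l : ℤ) : expo l (node n j) = expo l (π / n) ^ j := by
  unfold expo node
  rw [← Complex.exp_nat_mul]
  congr 1
  push_cast
  ring

lemma expo_pi_div_eq_one_iff {n : ℕ} (hn : 1 ≤ n) (l : ℤ) :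
    expo l (π / n) = 1 ↔ (2 * n : ℤ) ∣ l := by
  have hn' : (n : ℂ) ≠ 0 := by exact_mod_cast (by omega : n ≠ 0)
  have hpi : (π : ℂ) ≠ 0 := by exact_mod_cast Real.pi_ne_zero
  unfold expo
  rw [Complex.exp_eq_one_iff]
  refine exists_congr fun k => ?_
  push_cast
  constructor
  · intro h
    have : (l : ℂ) = (2 * n * k : ℤ) := by
      field_simp at h
      push_cast
      linear_combination h
    exact_mod_cast this
  · rintro rfl
    push_cast
    field_simp

lemma sum_expo_node {n : ℕ} (hn : 1 ≤ n) (l : ℤ) :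
    ∑ j ∈ Finset.range (2 * n), expo l (node n j) = if (2 * n : ℤ) ∣ l then 2 * (n : ℂ) else 0 := by
  simp only [expo_node]
  split_ifs with h
  · rw [(expo_pi_div_eq_one_iff hn l).mpr h]
    simp
  · have h1 : expo l (π / n) ≠ 1 := mt (expo_pi_div_eq_one_iff hn l).mp h
    have h2 : expo l (π / n) ^ (2 * n) = 1 := by
      rw [← expo_node, node]
      have hn' : (n : ℝ) ≠ 0 := by exact_mod_cast (by omega : n ≠ 0)
      have : π * ((2 * n : ℕ) : ℝ) / n = 0 + 2 * π := by push_cast; field_simp; ring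
      rw [this, expo_periodic]
      simp [expo]
    rw [geom_sum_eq h1, h2, sub_self, zero_div]

/-! #### The interpolation operator on coefficient sequences -/

/-- The weight `1`, `1/2`, `0` of the index `m` in `X_n` for `|m| < n`, `|m| = n`, `|m| > n`. -/
def edgeWeight (n : ℕ) (m : ℤ) : ℂ :=
  if m.natAbs < n then 1 else if m.natAbs = n then 1 / 2 else 0

lemma edgeWeight_of_lt {n : ℕ} {m : ℤ} (h : n < m.natAbs) : edgeWeight n m = 0 := by
  unfold edgeWeight
  rw [if_neg (by omega), if_neg (by omega)]

lemma lagrangeTrig_eq {n : ℕ} (hn : 1 ≤ n) (j : ℕ) (t : ℝ) :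
    (lagrangeTrig n j t : ℂ) =
      ∑ m ∈ Finset.Icc (-(n : ℤ)) n, edgeWeight n m / (2 * n) * expo m (t - node n j) := by
  obtain ⟨N, rfl⟩ : ∃ N, n = N + 1 := ⟨n - 1, by omega⟩
  set s := t - node (N + 1) j with hs
  have hcos : ∀ k ∈ Finset.range N, edgeWeight (N + 1) ((k : ℤ) + 1) / (2 * (N + 1 : ℕ)) * expo (k + 1) s +
      edgeWeight (N + 1) (-((k : ℤ) + 1)) / (2 * (N + 1 : ℕ)) * expo (-((k : ℤ) + 1)) s =
      1 / (2 * (N + 1 : ℕ)) * (2 * (Real.cos ((1 + k : ℕ) * s) : ℂ)) := fun k hk => by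
    rw [Finset.mem_range] at hk
    rw [← Nat.cast_add_one, expo_natCast_eq, expo_neg_natCast_eq, edgeWeight, edgeWeight,
      if_pos (by omega), if_pos (by omega), add_comm 1 k]
    ring
  rw [sum_Icc_neg_eq, Finset.sum_range_succ, Finset.sum_congr rfl hcos, ← Finset.mul_sum,
    ← Finset.mul_sum, ← Nat.cast_add_one, expo_natCast_eq, expo_neg_natCast_eq, expo_zero]
  have h1 : edgeWeight (N + 1) ((N + 1 : ℕ) : ℤ) = 1 / 2 := by
    rw [edgeWeight, if_neg (by omega), if_pos (by omega)]
  have h2 : edgeWeight (N + 1) (-((N + 1 : ℕ) : ℤ)) = 1 / 2 := by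
    rw [edgeWeight, if_neg (by omega), if_pos (by omega)]
  have h0 : edgeWeight (N + 1) 0 = 1 := by
    rw [edgeWeight, if_pos (by simp)]
  rw [h0, h1, h2, lagrangeTrig, Finset.sum_Ico_eq_sum_range, ← hs]
  simp only [Nat.add_sub_cancel]
  push_cast
  ring

/-- The Fourier coefficients of the trigonometric interpolant. -/
def interpCoef (n : ℕ) (φ : ℝ → ℂ) (m : ℤ) : ℂ :=
  edgeWeight n m / (2 * n) * ∑ j ∈ Finset.range (2 * n), φ (node n j) * expo (-m) (node n j)

lemma interpCoef_of_lt {n : ℕ} (φ : ℝ → ℂ) {m : ℤ} (h : n < m.natAbs) : interpCoef n φ m = 0 := by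
  rw [interpCoef, edgeWeight_of_lt h, zero_div, zero_mul]

lemma interp_eq_synth {n : ℕ} (hn : 1 ≤ n) (φ : ℝ → ℂ) : interp n φ = synth (interpCoef n φ) := by
  funext t
  rw [synth_of_support fun m hm => interpCoef_of_lt φ hm, interp]
  simp only [lagrangeTrig_eq hn, interpCoef, Finset.mul_sum, Finset.sum_mul]
  rw [Finset.sum_comm]
  refine Finset.sum_congr rfl fun m _ => Finset.sum_congr rfl fun j _ => ?_
  rw [sub_eq_add_neg, expo_add_arg, expo_neg_arg]
  ring

/-- The interpolation operator `P_n` on coefficient sequences. -/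
def interpEnd (n : ℕ) : Module.End ℂ RD where
  toFun u := ⟨interpCoef n (synth u), rapidDecay_of_support fun _ hm => interpCoef_of_lt _ hm⟩
  map_add' u v := by
    ext m
    change interpCoef n _ m = interpCoef n _ m + interpCoef n _ m
    rw [interpCoef, interpCoef, interpCoef, synth_add, ← mul_add, ← Finset.sum_add_distrib]
    simp only [Pi.add_apply, add_mul]
  map_smul' c u := by
    ext m
    change interpCoef n _ m = c * interpCoef n _ m
    rw [interpCoef, interpCoef, synth_smul, mul_left_comm, Finset.mul_sum _ _ c]
    simp only [Pi.smul_apply, smul_eq_mul, mul_assoc]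

lemma interp_synth {n : ℕ} (hn : 1 ≤ n) (u : RD) : interp n (synth u) = synth (interpEnd n u : RD) :=
  interp_eq_synth hn _

/-- At the nodes `e^{inx} = e^{-inx}`, so the two edge coefficients agree. -/
lemma interpEnd_mem {n : ℕ} (hn : 1 ≤ n) (u : RD) : interpEnd n u ∈ trigSpace n := by
  refine ⟨fun m hm => interpCoef_of_lt _ hm, ?_⟩
  change interpCoef n _ _ = interpCoef n _ _
  unfold interpCoef
  congr 1
  · simp [edgeWeight]
  · refine Finset.sum_congr rfl fun j _ => ?_
    congr 1
    rw [neg_neg, show (n : ℤ) = 2 * n + -n by ring, expo_add, expo_node n j (2 * n),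
      (expo_pi_div_eq_one_iff hn _).mpr dvd_rfl, one_pow, one_mul]
    congr 1
    ring

/-- Aliasing: interpolation sums the coefficients over residue classes modulo `2n`. -/
lemma interpEnd_apply {n : ℕ} (hn : 1 ≤ n) (u : RD) (m : ℤ) :
    (interpEnd n u : ℤ → ℂ) m = edgeWeight n m * ∑' j : ℤ, (u : ℤ → ℂ) (m + 2 * n * j) := by
  change interpCoef n (synth u) m = _
  have hn' : (n : ℂ) ≠ 0 := by exact_mod_cast (by omega : n ≠ 0)
  have hsum : ∀ j : ℕ, Summable fun k => (u : ℤ → ℂ) k * expo k (node n j) * expo (-m) (node n j) :=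
    fun j => (u.2.summable_expo _).mul_right _
  have h1 : ∑ j ∈ Finset.range (2 * n), synth u (node n j) * expo (-m) (node n j) =
      ∑' k, (u : ℤ → ℂ) k * if (2 * n : ℤ) ∣ k - m then 2 * (n : ℂ) else 0 := by
    unfold synth
    simp only [← tsum_mul_right]
    rw [← Summable.tsum_finsetSum fun j _ => hsum j]
    refine tsum_congr fun k => ?_
    rw [← sum_expo_node hn, Finset.mul_sum]
    refine Finset.sum_congr rfl fun j _ => ?_
    rw [expo_sub, mul_assoc]
  have hinj : Function.Injective fun j : ℤ => m + 2 * n * j := fun a b hab => by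
    have h2 : (2 * n : ℤ) ≠ 0 := by omega
    exact mul_left_cancel₀ h2 (add_left_cancel hab)
  -- By discrete orthogonality only the frequencies congruent to `m` modulo `2n` survive.
  have h2 := hinj.tsum_eq (f := fun k => (u : ℤ → ℂ) k * if (2 * n : ℤ) ∣ k - m then 2 * (n : ℂ) else 0)
    (fun k hk => by
      by_contra hcon
      apply hk
      have : ¬ (2 * n : ℤ) ∣ k - m := fun ⟨j, hj⟩ => hcon ⟨j, by simp only; omega⟩
      simp only [if_neg this, mul_zero])
  rw [interpCoef, h1, ← h2]
  simp only [add_sub_cancel_left, dvd_mul_right, if_true]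
  rw [tsum_mul_right]
  field_simp

/-! ### The interpolation error -/

lemma wt_le_two_abs {j : ℤ} (hj : j ≠ 0) : wt j ≤ 2 * |(j : ℝ)| := by
  have h1 : (1 : ℝ) ≤ |(j : ℝ)| := by exact_mod_cast Int.one_le_abs hj
  unfold wt
  linarith

/-- For `|m| ≤ n` the aliased frequency `k = m + 2nj` satisfies `|k| ≥ n|j|`. One Sobolev exponent
supplies `1/n`; the two exponents common to both sides also yield `j⁻²`, since `m` is bounded by `n`
alone. -/
lemma jap_alias_le {p : ℝ} (hp : 0 ≤ p) {n : ℕ} (hn : 1 ≤ n) {m j : ℤ} (hm : m.natAbs ≤ n) (hj : j ≠ 0) :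
    jap (p + 2) m ≤ 8 / n * (wt j ^ 2)⁻¹ * jap (p + 3) (m + 2 * n * j) := by
  have hn' : (1 : ℝ) ≤ n := by exact_mod_cast hn
  have hj1 : (1 : ℝ) ≤ |(j : ℝ)| := by exact_mod_cast Int.one_le_abs hj
  have hm' : |(m : ℝ)| ≤ n := by
    rw [← Int.cast_abs, ← Nat.cast_natAbs]
    exact_mod_cast hm
  set k : ℤ := m + 2 * n * j with hk
  have hk1 : n * |(j : ℝ)| ≤ |(k : ℝ)| := by
    have h1 : |(2 * n * j : ℝ)| ≤ |(k : ℝ)| + |(m : ℝ)| := by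
      have : (2 * n * j : ℝ) = k - m := by rw [hk]; push_cast; ring
      rw [this]
      exact abs_sub _ _
    rw [abs_mul, abs_of_nonneg (by positivity : (0 : ℝ) ≤ 2 * n)] at h1
    nlinarith
  have hk2 : (n : ℝ) ^ 2 * (j : ℝ) ^ 2 ≤ (k : ℝ) ^ 2 := by
    rw [← sq_abs (k : ℝ), ← sq_abs (j : ℝ), ← mul_pow]
    exact pow_le_pow_left₀ (by positivity) hk1 2
  have hm2 : (m : ℝ) ^ 2 ≤ (n : ℝ) ^ 2 := by
    rw [← sq_abs (m : ℝ)]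
    exact pow_le_pow_left₀ (abs_nonneg _) hm' 2
  have hj2 : (1 : ℝ) ≤ (j : ℝ) ^ 2 := by
    rw [← sq_abs]
    exact one_le_pow₀ hj1
  have hpm : jap p m ≤ jap p k := by
    refine Real.rpow_le_rpow (by positivity) ?_ (by positivity)
    nlinarith
  have h2 : ∀ m : ℤ, jap 2 m = 1 + (m : ℝ) ^ 2 := fun m => by
    rw [jap, div_self two_ne_zero, Real.rpow_one]
  have h1 : |(k : ℝ)| ≤ jap 1 k := by
    rw [jap, ← Real.sqrt_eq_rpow]
    exact Real.abs_le_sqrt (by linarith)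
  have h3 : jap 2 m ≤ 8 / n * (wt j ^ 2)⁻¹ * (jap 2 k * jap 1 k) := by
    have hw : wt j ^ 2 ≤ 4 * (j : ℝ) ^ 2 := by
      have := pow_le_pow_left₀ (wt_pos j).le (wt_le_two_abs hj) 2
      rw [mul_pow, sq_abs] at this
      linarith
    have hwp := wt_pos j
    have hn1 : (n : ℝ) ≤ jap 1 k := le_trans (by nlinarith) (hk1.trans h1)
    have : jap 2 m * (n * wt j ^ 2) ≤ 8 * (jap 2 k * jap 1 k) := by
      calc jap 2 m * (n * wt j ^ 2) ≤ (1 + (n : ℝ) ^ 2) * (jap 1 k * (4 * (j : ℝ) ^ 2)) := by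
            rw [h2]
            gcongr
            exact (jap_pos _ _).le
        _ = jap 1 k * (4 * ((1 + (n : ℝ) ^ 2) * (j : ℝ) ^ 2)) := by ring
        _ ≤ jap 1 k * (4 * (2 * jap 2 k)) := by
            refine mul_le_mul_of_nonneg_left (mul_le_mul_of_nonneg_left ?_ (by norm_num)) (jap_pos _ _).le
            rw [h2]
            nlinarith [mul_le_mul_of_nonneg_right (one_le_pow₀ hn' : (1 : ℝ) ≤ (n : ℝ) ^ 2)
                (sq_nonneg (j : ℝ))]
        _ = 8 * (jap 2 k * jap 1 k) := by ring
    rw [show 8 / (n : ℝ) * (wt j ^ 2)⁻¹ * (jap 2 k * jap 1 k) = 8 * (jap 2 k * jap 1 k) / (n * wt j ^ 2) by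
      field_simp, le_div_iff₀ (by positivity)]
    exact this
  calc jap (p + 2) m = jap p m * jap 2 m := jap_add _ _ _
    _ ≤ jap p k * (8 / n * (wt j ^ 2)⁻¹ * (jap 2 k * jap 1 k)) :=
        mul_le_mul hpm h3 (jap_pos _ _).le (jap_pos _ _).le
    _ = 8 / n * (wt j ^ 2)⁻¹ * (jap p k * (jap 2 k * jap 1 k)) := by ring
    _ = _ := by rw [← jap_add, ← jap_add]; norm_num

lemma jap_edge_le {p : ℝ} {n : ℕ} (hn : 1 ≤ n) {m : ℤ} (hm : n ≤ m.natAbs) :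
    jap (p + 2) m ≤ 1 / n * jap (p + 3) m := by
  have hn' : (1 : ℝ) ≤ n := by exact_mod_cast hn
  have hm' : (n : ℝ) ≤ |(m : ℝ)| := by
    rw [← Int.cast_abs, ← Nat.cast_natAbs]
    exact_mod_cast hm
  have h1 : (n : ℝ) ≤ jap 1 m := by
    rw [jap, ← Real.sqrt_eq_rpow]
    exact hm'.trans (Real.abs_le_sqrt (by linarith))
  rw [show p + 3 = p + 2 + 1 by ring, jap_add (p + 2) 1, div_mul_eq_mul_div, one_mul, le_div_iff₀ (by positivity)]
  exact mul_le_mul_of_nonneg_left h1 (jap_pos _ _).le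

lemma norm_edgeWeight_le (n : ℕ) (m : ℤ) : ‖edgeWeight n m‖ ≤ 1 := by
  unfold edgeWeight
  split_ifs <;> norm_num

lemma norm_edgeWeight_sub_one_le (n : ℕ) (m : ℤ) : ‖edgeWeight n m - 1‖ ≤ 1 := by
  unfold edgeWeight
  split_ifs <;> norm_num

lemma RD.summable_alias {n : ℕ} (hn : 1 ≤ n) (u : RD) (m : ℤ) :
    Summable fun j : ℤ => (u : ℤ → ℂ) (m + 2 * n * j) := by
  refine u.2.summable.of_norm.comp_injective (i := fun j : ℤ => m + 2 * n * j) fun a b hab => ?_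
  have h2 : (2 * n : ℤ) ≠ 0 := by omega
  exact mul_left_cancel₀ h2 (add_left_cancel hab)

lemma jap_mul_norm_tsum_alias_le {p : ℝ} (hp : 0 ≤ p) {n : ℕ} (hn : 1 ≤ n) (u : RD) {m : ℤ}
    (hm : m.natAbs ≤ n) :
    jap (p + 2) m * ‖∑' j : ℤ, (u : ℤ → ℂ) (m + 2 * n * j) - (u : ℤ → ℂ) m‖ ≤
      8 * wtSum / n * ‖wvec (p + 3) u‖ := by
  have hs := RD.summable_alias hn u m
  rw [hs.tsum_eq_add_tsum_ite 0, mul_zero, add_zero, add_sub_cancel_left, ← le_div_iff₀' (jap_pos _ _)]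
  refine tsum_of_norm_bounded
    (g := fun j => 8 / n * ‖wvec (p + 3) u‖ / jap (p + 2) m * (wt j ^ 2)⁻¹) ?_ fun j => ?_
  · have e : 8 * wtSum / n * ‖wvec (p + 3) u‖ / jap (p + 2) m =
        8 / n * ‖wvec (p + 3) u‖ / jap (p + 2) m * wtSum := by ring
    rw [e]
    exact summable_inv_wt_sq.hasSum.mul_left _
  · have hw := wt_pos j
    have hJ := jap_pos (p + 2) m
    split_ifs with hj
    · rw [norm_zero]; positivity
    · have h1 := jap_alias_le hp hn hm hj
      have h2 := jap_mul_norm_le (p + 3) u (m + 2 * n * j)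
      rw [div_mul_eq_mul_div, le_div_iff₀ hJ]
      calc ‖(u : ℤ → ℂ) (m + 2 * n * j)‖ * jap (p + 2) m
          ≤ ‖(u : ℤ → ℂ) (m + 2 * n * j)‖ * (8 / n * (wt j ^ 2)⁻¹ * jap (p + 3) (m + 2 * n * j)) := by
            gcongr
        _ = 8 / n * (wt j ^ 2)⁻¹ * (jap (p + 3) (m + 2 * n * j) * ‖(u : ℤ → ℂ) (m + 2 * n * j)‖) := by ring
        _ ≤ 8 / n * (wt j ^ 2)⁻¹ * ‖wvec (p + 3) u‖ := by gcongr
        _ = _ := by ring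

/-- The first term is the truncation error for `|m| > n` together with the half weight at `|m| = n`;
the second is the aliasing error inside the band. -/
lemma jap_mul_norm_interp_sub_le {p : ℝ} (hp : 0 ≤ p) {n : ℕ} (hn : 1 ≤ n) (u : RD) (m : ℤ) :
    jap (p + 2) m * ‖(interpEnd n u - u : ℤ → ℂ) m‖ ≤ 1 / n * (jap (p + 3) m * ‖(u : ℤ → ℂ) m‖) +
      if m ∈ Finset.Icc (-(n : ℤ)) n then 8 * wtSum / n * ‖wvec (p + 3) u‖ else 0 := by
  have hJ := jap_pos (p + 2) m
  have hJ3 := jap_pos (p + 3) m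
  have hw := wtSum_nonneg
  change _ * ‖(interpEnd n u : ℤ → ℂ) m - (u : ℤ → ℂ) m‖ ≤ _
  by_cases hm : n < m.natAbs
  · rw [if_neg (by rw [Finset.mem_Icc]; omega), interpEnd_apply hn, edgeWeight_of_lt hm, zero_mul, zero_sub,
      norm_neg, add_zero, ← mul_assoc]
    exact mul_le_mul_of_nonneg_right (jap_edge_le hn hm.le) (norm_nonneg _)
  · rw [if_pos (by rw [Finset.mem_Icc]; omega), interpEnd_apply hn]
    have key := jap_mul_norm_tsum_alias_le hp hn u (not_lt.mp hm)
    set a := ∑' j : ℤ, (u : ℤ → ℂ) (m + 2 * n * j)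
    have e : edgeWeight n m * a - (u : ℤ → ℂ) m =
        (edgeWeight n m - 1) * (u : ℤ → ℂ) m + edgeWeight n m * (a - (u : ℤ → ℂ) m) := by ring
    have h1 : jap (p + 2) m * ‖(edgeWeight n m - 1) * (u : ℤ → ℂ) m‖ ≤
        1 / n * (jap (p + 3) m * ‖(u : ℤ → ℂ) m‖) := by
      by_cases hlt : m.natAbs < n
      · rw [edgeWeight, if_pos hlt, sub_self, zero_mul, norm_zero, mul_zero]
        positivity
      · rw [norm_mul, ← mul_assoc (1 / (n : ℝ))]
        calc _ ≤ jap (p + 2) m * (1 * ‖(u : ℤ → ℂ) m‖) := by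
              gcongr
              exact norm_edgeWeight_sub_one_le n m
          _ = jap (p + 2) m * ‖(u : ℤ → ℂ) m‖ := by rw [one_mul]
          _ ≤ _ := mul_le_mul_of_nonneg_right (jap_edge_le hn (not_lt.mp hlt)) (norm_nonneg _)
    have h2 : jap (p + 2) m * ‖edgeWeight n m * (a - (u : ℤ → ℂ) m)‖ ≤
        8 * wtSum / n * ‖wvec (p + 3) u‖ := by
      rw [norm_mul]
      refine le_trans ?_ key
      gcongr
      exact mul_le_of_le_one_left (norm_nonneg _) (norm_edgeWeight_le n m)
    rw [e]
    calc _ ≤ jap (p + 2) m * (‖(edgeWeight n m - 1) * (u : ℤ → ℂ) m‖ +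
          ‖edgeWeight n m * (a - (u : ℤ → ℂ) m)‖) := by gcongr; exact norm_add_le _ _
      _ ≤ _ := by rw [mul_add]; exact add_le_add h1 h2

/-- The interpolation error in terms of a norm with one more derivative. -/
lemma norm_wvec_interp_sub_sq_le {p : ℝ} (hp : 0 ≤ p) {n : ℕ} (hn : 1 ≤ n) (u : RD) :
    ‖wvec (p + 2) (interpEnd n u - u)‖ ^ 2 ≤ (2 + 384 * wtSum ^ 2) / n * ‖wvec (p + 3) u‖ ^ 2 := by
  set W := ‖wvec (p + 3) u‖ with hW
  have hn' : (1 : ℝ) ≤ n := by exact_mod_cast hn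
  -- The aliasing bound is uniform in `m`, so its square is summed over `2n + 1 ≤ 3n` indices. This
  -- costs a factor `n` and gives the rate `n^{-1/2}`, with `384 = 3 · 2 · 8²`.
  set b : ℤ → ℝ := fun m => if m ∈ Finset.Icc (-(n : ℤ)) n then 2 * (8 * wtSum / n * W) ^ 2 else 0 with hb
  have hbs : HasSum b (∑ m ∈ Finset.Icc (-(n : ℤ)) n, b m) :=
    hasSum_sum_of_ne_finset_zero fun m hm => by simp only [b, if_neg hm]
  have hbsum : ∑ m ∈ Finset.Icc (-(n : ℤ)) n, b m = (2 * n + 1) * (2 * (8 * wtSum / n * W) ^ 2) := by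
    have hc : ∀ m ∈ Finset.Icc (-(n : ℤ)) n, b m = 2 * (8 * wtSum / n * W) ^ 2 := fun m hm => by
      simp only [b, if_pos hm]
    rw [Finset.sum_congr rfl hc, Finset.sum_const, Int.card_Icc, nsmul_eq_mul]
    congr 1
    rw [show ((n : ℤ) + 1 - -(n : ℤ)).toNat = 2 * n + 1 by omega]
    push_cast; ring
  have ha := (summable_wvec_sq (p + 3) u).mul_left (2 / (n : ℝ) ^ 2)
  rw [norm_wvec_sq]
  calc ∑' m, (jap (p + 2) m * ‖((interpEnd n u - u : RD) : ℤ → ℂ) m‖) ^ 2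
      ≤ ∑' m, (2 / (n : ℝ) ^ 2 * (jap (p + 3) m * ‖(u : ℤ → ℂ) m‖) ^ 2 + b m) := by
        refine Summable.tsum_le_tsum (fun m => ?_) (summable_wvec_sq _ _) (ha.add hbs.summable)
        have h0 := jap_mul_norm_interp_sub_le hp hn u m
        have hJ := jap_pos (p + 2) m
        refine (pow_le_pow_left₀ (by positivity) h0 2).trans ?_
        simp only [b]
        split_ifs
        · refine (add_sq_le (a := _) (b := _)).trans (le_of_eq ?_)
          ring
        · have := sq_nonneg (jap (p + 3) m * ‖(u : ℤ → ℂ) m‖)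
          rw [add_zero, add_zero, mul_pow, div_pow, one_pow]
          gcongr
          norm_num
    _ = 2 / (n : ℝ) ^ 2 * W ^ 2 + (2 * n + 1) * (2 * (8 * wtSum / n * W) ^ 2) := by
        rw [ha.tsum_add hbs.summable, tsum_mul_left, ← norm_wvec_sq, hbs.tsum_eq, hbsum]
    _ ≤ 2 / (n : ℝ) ^ 2 * W ^ 2 * n + (3 * n) * (2 * (8 * wtSum / n * W) ^ 2) := by
        refine add_le_add (le_mul_of_one_le_right (by positivity) hn')
          (mul_le_mul_of_nonneg_right (by linarith) (by positivity))
    _ = _ := by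
        field_simp
        ring

/-! ### Algebra of block matrices acting on pairs of sequences -/

lemma act_mul (A B : Matrix (Fin 2) (Fin 2) (Module.End ℂ RD)) (U : Fin 2 → RD) :
    act (A * B) U = act A (act B U) := by
  funext i
  simp only [act, Matrix.mul_apply, Fin.sum_univ_two, LinearMap.add_apply, Module.End.mul_apply, map_add]
  abel

lemma act_add_matrix (A B : Matrix (Fin 2) (Fin 2) (Module.End ℂ RD)) (U : Fin 2 → RD) :
    act (A + B) U = act A U + act B U := by
  funext i
  simp only [act, Matrix.add_apply, LinearMap.add_apply, Pi.add_apply]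
  abel

lemma act_add (A : Matrix (Fin 2) (Fin 2) (Module.End ℂ RD)) (U V : Fin 2 → RD) :
    act A (U + V) = act A U + act A V := by
  funext i
  simp only [act, Pi.add_apply, map_add]
  abel

lemma act_sub (A : Matrix (Fin 2) (Fin 2) (Module.End ℂ RD)) (U V : Fin 2 → RD) :
    act A (U - V) = act A U - act A V := by
  funext i
  simp only [act, Pi.sub_apply, map_sub]
  abel

lemma act_smul (A : Matrix (Fin 2) (Fin 2) (Module.End ℂ RD)) (c : ℂ) (U : Fin 2 → RD) :
    act A (c • U) = c • act A U := by
  funext i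
  simp only [act, Pi.smul_apply, map_smul, smul_add]

lemma act_zero (A : Matrix (Fin 2) (Fin 2) (Module.End ℂ RD)) : act A 0 = 0 := by
  funext i
  simp only [act, Pi.zero_apply, map_zero, add_zero]

lemma act_scalar (S : Module.End ℂ RD) (U : Fin 2 → RD) (i : Fin 2) :
    act !![S, 0; 0, S] U i = S (U i) := by
  fin_cases i <;> simp [act]

lemma act_one (U : Fin 2 → RD) : act 1 U = U := by
  rw [Matrix.one_fin_two]
  exact funext fun i => act_scalar 1 U i

/-! ### Stability of the collocation scheme -/

lemma endT_endT_endS_endS (u : RD) : endT (endT (endS (endS u))) = u := by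
  have h : ∀ v, endT (endS v) = -v := fun v => congrArg (fun f => f v) endT_mul_endS
  rw [h, map_neg, h, neg_neg]

lemma endS_endS_endT_endT (u : RD) : endS (endS (endT (endT u))) = u := by
  have h : ∀ v, endS (endT v) = -v := fun v => congrArg (fun f => f v) endS_mul_endT
  rw [h, map_neg, h, neg_neg]

lemma norm_wvec_endT_endT_le (p : ℝ) (u : RD) : ‖wvec p (endT (endT u))‖ ≤ ‖wvec (p + 2) u‖ := by
  refine le_of_sq_le_sq ?_ (norm_nonneg _)
  rw [norm_wvec_sq, norm_wvec_sq]
  refine (summable_wvec_sq _ _).tsum_le_tsum (fun m => ?_) (summable_wvec_sq _ _)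
  have hJ := jap_pos p m
  refine pow_le_pow_left₀ (by positivity) ?_ 2
  unfold endT
  rw [multEnd_apply, multEnd_apply, ← mul_assoc (symT m), norm_mul, ← mul_assoc, jap_add]
  have h2 : jap 2 m = 1 + (m : ℝ) ^ 2 := by rw [jap, div_self two_ne_zero, Real.rpow_one]
  gcongr
  rw [h2]
  unfold symT
  split_ifs with h
  · simp [h]
  · rw [neg_mul_neg, ← Complex.ofReal_mul, abs_mul_abs_self, Complex.norm_real,
      Real.norm_of_nonneg (mul_self_nonneg _)]
    nlinarith

/-- The operator `B` preconditioned by `T₀²`. -/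
def precond (B : Matrix (Fin 2) (Fin 2) (Module.End ℂ RD)) : Matrix (Fin 2) (Fin 2) (Module.End ℂ RD) :=
  Matrix.of fun i j => endT * endT * B i j

lemma act_precond (B : Matrix (Fin 2) (Fin 2) (Module.End ℂ RD)) (U : Fin 2 → RD) (i : Fin 2) :
    act (precond B) U i = endT (endT (act B U i)) := by
  simp only [act, map_add]
  rfl

lemma isOrd_precond {B : Matrix (Fin 2) (Fin 2) (Module.End ℂ RD)} (hB : ∀ i j, IsOrd (-3) (B i j))
    (i j : Fin 2) : IsOrd (-1) (precond B i j) :=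
  (isOrd_endT.mul isOrd_endT).mul (hB i j)

/-- Apply `S₀²`, the inverse of `T₀²`, to the preconditioned equation. -/
lemma precond_injective {B : Matrix (Fin 2) (Fin 2) (Module.End ℂ RD)}
    (hinj : ∀ U, act (!![endS * endS, 0; 0, endS * endS] + B) U = 0 → U = 0) (U : Fin 2 → RD)
    (hU : U + act (precond B) U = 0) : U = 0 := by
  refine hinj U (funext fun i => ?_)
  have h := congrArg (fun v => endS (endS v)) (congrFun hU i)
  simp only [Pi.add_apply, act_precond, map_add, endS_endS_endT_endT, Pi.zero_apply, map_zero] at h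
  rw [act_add_matrix, Pi.add_apply, act_scalar]
  exact h

/-- Stability of the projected equation. -/
theorem exists_stability {B : Matrix (Fin 2) (Fin 2) (Module.End ℂ RD)} (hB : ∀ i j, IsOrd (-3) (B i j))
    (hinj : ∀ U, act (!![endS * endS, 0; 0, endS * endS] + B) U = 0 → U = 0) {p : ℝ} (hp : 0 ≤ p) :
    ∃ C : ℝ, 0 ≤ C ∧ ∃ N : ℕ, 1 ≤ N ∧ ∀ n, N ≤ n → ∀ W r : Fin 2 → RD,
      (∀ i, endS (endS (W i)) + interpEnd n (act B W i) = r i) →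
      ‖weighted p W‖ ≤ C * (‖wvec (p + 2) (r 0)‖ + ‖wvec (p + 2) (r 1)‖) := by
  obtain ⟨C₁, hC₁, h₁⟩ := (exists_solution_act (isOrd_precond hB) (precond_injective hinj)).2 p hp
  obtain ⟨C₂, hC₂, h₂⟩ := exists_bound_act hB hp
  set K : ℝ := 2 + 384 * wtSum ^ 2 with hK
  -- This threshold makes the interpolation error of each component at most a quarter of `w` after
  -- multiplication by `C₁`.
  obtain ⟨N, hN⟩ := exists_nat_ge (16 * C₁ ^ 2 * K * C₂ ^ 2)
  refine ⟨2 * C₁, by positivity, N + 1, by omega, fun n hn W r hr => ?_⟩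
  set w := ‖weighted p W‖ with hw
  have hw0 : 0 ≤ w := norm_nonneg _
  have hn1 : 1 ≤ n := by omega
  have hn0 : (0 : ℝ) < n := by exact_mod_cast hn1
  have hNn : (N : ℝ) ≤ n := by exact_mod_cast (by omega : N ≤ n)
  have herr : ∀ i, C₁ * ‖wvec (p + 2) (interpEnd n (act B W i) - act B W i)‖ ≤ w / 4 := by
    intro i
    refine le_of_sq_le_sq ?_ (by positivity)
    calc (C₁ * ‖wvec (p + 2) (interpEnd n (act B W i) - act B W i)‖) ^ 2
        ≤ C₁ ^ 2 * (K / n * ‖wvec (p + 3) (act B W i)‖ ^ 2) := by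
          rw [mul_pow]
          gcongr
          exact norm_wvec_interp_sub_sq_le hp hn1 _
      _ ≤ C₁ ^ 2 * (K / n * (C₂ * w) ^ 2) := by
          gcongr
          exact h₂ W i
      _ = 16 * C₁ ^ 2 * K * C₂ ^ 2 / n * (w ^ 2 / 16) := by ring
      _ ≤ 1 * (w ^ 2 / 16) := by
          gcongr
          rw [div_le_one hn0]
          exact hN.trans hNn
      _ = (w / 4) ^ 2 := by ring
  have hpt : ∀ i, ‖wvec p ((W + act (precond B) W) i)‖ ≤
      ‖wvec (p + 2) (r i)‖ + ‖wvec (p + 2) (interpEnd n (act B W i) - act B W i)‖ := by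
    intro i
    -- The projected equation is the exact one with the interpolation error moved to the right;
    -- applying `T₀²`, which costs two Sobolev exponents, makes it an equation of the second kind.
    have e : (W + act (precond B) W) i =
        endT (endT (r i - (interpEnd n (act B W i) - act B W i))) := by
      have h3 : ∀ x y z : RD, x + y - (y - z) = x + z := fun x y z => by abel
      rw [← hr i, h3, map_add, map_add, endT_endT_endS_endS, Pi.add_apply, act_precond]
    rw [e]
    refine (norm_wvec_endT_endT_le _ _).trans ?_
    rw [wvec_sub]
    exact norm_sub_le _ _
  have h := (h₁ W).trans (mul_le_mul_of_nonneg_left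
    ((norm_weighted_le p _).trans (add_le_add (hpt 0) (hpt 1))) hC₁)
  have h0 := herr 0
  have h1 := herr 1
  -- The two components of the error add up to `w / 2`, which is absorbed on the left and doubles
  -- the constant.
  nlinarith

/-! ### Unique solvability of the projected equation -/

lemma endS_mem_trigSpace {n : ℕ} {u : RD} (hu : u ∈ trigSpace n) : endS u ∈ trigSpace n := by
  refine ⟨fun m hm => ?_, ?_⟩
  · rw [endS, multEnd_apply, hu.1 m hm, mul_zero]
  · rw [endS, multEnd_apply, multEnd_apply, hu.2]
    congr 1
    simp [symS]

/-- The operator `S₀² + 𝒫_n B` on `X_n²`. -/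
def collocationMap (B : Matrix (Fin 2) (Fin 2) (Module.End ℂ RD)) {n : ℕ} (hn : 1 ≤ n) :
    (Fin 2 → trigSpace n) →ₗ[ℂ] (Fin 2 → trigSpace n) where
  toFun U i := ⟨endS (endS (U i)) + interpEnd n (act B (fun j => (U j : RD)) i),
    (trigSpace n).add_mem (endS_mem_trigSpace (endS_mem_trigSpace (U i).2)) (interpEnd_mem hn _)⟩
  map_add' U V := by
    funext i
    apply Subtype.ext
    have h := act_add B (fun j => (U j : RD)) (fun j => (V j : RD))
    change endS (endS ((U i : RD) + V i)) + interpEnd n (act B ((fun j => (U j : RD)) + fun j => (V j : RD)) i) =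
      (endS (endS (U i)) + interpEnd n (act B (fun j => (U j : RD)) i)) +
        (endS (endS (V i)) + interpEnd n (act B (fun j => (V j : RD)) i))
    rw [h, Pi.add_apply, map_add, map_add, map_add]
    abel
  map_smul' c U := by
    funext i
    apply Subtype.ext
    have h := act_smul B c (fun j => (U j : RD))
    change endS (endS (c • (U i : RD))) + interpEnd n (act B (c • fun j => (U j : RD)) i) =
      c • (endS (endS (U i)) + interpEnd n (act B (fun j => (U j : RD)) i))
    rw [h, Pi.smul_apply, map_smul, map_smul, map_smul, smul_add]

lemma eq_zero_of_weighted {p : ℝ} {U : Fin 2 → RD} (h : ‖weighted p U‖ ≤ 0) : U = 0 := by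
  funext i
  ext m
  have h1 := (jap_mul_norm_le p (U i) m).trans ((norm_wvec_le_weighted p U i).trans h)
  have h2 := jap_pos p m
  have h3 : ‖(U i : ℤ → ℂ) m‖ ≤ 0 := by
    by_contra hcon
    exact absurd h1 (not_le.mpr (mul_pos h2 (not_le.mp hcon)))
  exact norm_le_zero_iff.mp h3

/-- On the finite-dimensional space `X_n²` injectivity implies surjectivity; `S₀²` maps `X_n` to
itself because its symbol is even. -/
lemma exists_collocation_solution {B : Matrix (Fin 2) (Fin 2) (Module.End ℂ RD)} {n : ℕ} (hn : 1 ≤ n)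
    (hinj : ∀ W : Fin 2 → RD, (∀ i, endS (endS (W i)) + interpEnd n (act B W i) = 0) → W = 0)
    (F : Fin 2 → RD) :
    ∃ U : Fin 2 → RD, (∀ i, U i ∈ trigSpace n) ∧
      ∀ i, endS (endS (U i)) + interpEnd n (act B U i) = interpEnd n (F i) := by
  have hi : Function.Injective (collocationMap B hn) := by
    rw [injective_iff_map_eq_zero]
    intro U hU
    have h := hinj (fun j => (U j : RD)) fun i => congrArg Subtype.val (congrFun hU i)
    exact funext fun i => Subtype.ext (congrFun h i)
  have hs : Function.Surjective (collocationMap B hn) :=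
    LinearMap.surjective_of_injective (K := ℂ) (V := Fin 2 → trigSpace n) (f := collocationMap B hn) hi
  obtain ⟨U, hU⟩ := hs fun i => ⟨interpEnd n (F i), interpEnd_mem hn _⟩
  exact ⟨fun j => U j, fun i => (U i).2, fun i => congrArg Subtype.val (congrFun hU i)⟩

/-! ### Pairs of functions -/

/-- The pair of functions with the given Fourier coefficients. -/
def synthPair (U : Fin 2 → RD) : (ℝ → ℂ) × (ℝ → ℂ) := (synth (U 0), synth (U 1))

lemma smoothPeriodicPair_synthPair (U : Fin 2 → RD) : SmoothPeriodicPair (synthPair U) :=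
  ⟨(U 0).2.smoothPeriodic, (U 1).2.smoothPeriodic⟩

lemma synthPair_injective : Function.Injective synthPair := fun U V h => by
  funext i
  fin_cases i
  · exact RD.synth_inj.mp (congrArg Prod.fst h)
  · exact RD.synth_inj.mp (congrArg Prod.snd h)

lemma SmoothPeriodicPair.exists_synthPair {ψ : (ℝ → ℂ) × (ℝ → ℂ)} (h : SmoothPeriodicPair ψ) :
    ∃ U, synthPair U = ψ := by
  obtain ⟨u, hu⟩ := h.1.exists_synth
  obtain ⟨v, hv⟩ := h.2.exists_synth
  exact ⟨![u, v], Prod.ext hu hv⟩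

lemma RepPair.apply {a : PairOp} {A : Matrix (Fin 2) (Fin 2) (Module.End ℂ RD)} (ha : RepPair a A)
    (U : Fin 2 → RD) : a (synthPair U) = synthPair (act A U) := ha (U 0) (U 1)

lemma synthPair_add (U V : Fin 2 → RD) : synthPair (U + V) = synthPair U + synthPair V :=
  Prod.ext (synth_add _ _) (synth_add _ _)

lemma synthPair_sub (U V : Fin 2 → RD) : synthPair (U - V) = synthPair U - synthPair V :=
  Prod.ext (synth_sub _ _) (synth_sub _ _)

lemma interpPair_synthPair {n : ℕ} (hn : 1 ≤ n) (U : Fin 2 → RD) :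
    interpPair n (synthPair U) = synthPair fun i => interpEnd n (U i) :=
  Prod.ext (interp_synth hn _) (interp_synth hn _)

lemma sobolevNormPair_synthPair (p : ℝ) (U : Fin 2 → RD) :
    sobolevNormPair p (synthPair U) = ENNReal.ofReal (‖wvec p (U 0)‖ + ‖wvec p (U 1)‖) := by
  rw [ENNReal.ofReal_add (norm_nonneg _) (norm_nonneg _), ← sobolevNorm_synth, ← sobolevNorm_synth]
  rfl

/-- The scheme in Fourier coefficients. It uses that `ℰ⁻¹𝒰` is represented by `S₀²` on each
component. -/
lemma isSemiDiscreteSolution_iff {γ : ℝ → Plane} {κ : ℝ}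
    {B D A : Matrix (Fin 2) (Fin 2) (Module.End ℂ RD)} (hA : RepPair (opA γ κ) A)
    (hD : RepPair (opEinv γ κ) D)
    (hU : RepPair (opEinv γ κ ∘ opU γ κ) !![endS * endS, 0; 0, endS * endS])
    (hB : RepPair (opEinv γ κ ∘ (opJ γ κ + opV γ κ)) B) {n : ℕ} (hn : 1 ≤ n) (H : Fin 2 → RD)
    (φ : (ℝ → ℂ) × (ℝ → ℂ)) :
    IsSemiDiscreteSolution γ κ n (synthPair H) φ ↔ ∃ U : Fin 2 → RD, (∀ i, U i ∈ trigSpace n) ∧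
      (∀ i, endS (endS (U i)) + interpEnd n (act B U i) = interpEnd n (act (D * A) H i)) ∧
      synthPair U = φ := by
  have key : ∀ U : Fin 2 → RD, (opEinv γ κ (opU γ κ (synthPair U)) +
      interpPair n (opEinv γ κ ((opJ γ κ + opV γ κ) (synthPair U))) =
        interpPair n (opEinv γ κ (opA γ κ (synthPair H)))) ↔
      ∀ i, endS (endS (U i)) + interpEnd n (act B U i) = interpEnd n (act (D * A) H i) := by
    intro U
    have e1 : opEinv γ κ (opU γ κ (synthPair U)) = _ := hU.apply U
    have e2 : opEinv γ κ ((opJ γ κ + opV γ κ) (synthPair U)) = _ := hB.apply U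
    have e3 : opEinv γ κ (opA γ κ (synthPair H)) = _ := (hD.comp hA).apply H
    rw [e1, e2, e3, interpPair_synthPair hn, interpPair_synthPair hn, ← synthPair_add,
      synthPair_injective.eq_iff, funext_iff]
    refine forall_congr' fun i => ?_
    rw [Pi.add_apply, act_scalar]
    rfl
  constructor
  · rintro ⟨⟨h1, h2⟩, h3⟩
    obtain ⟨u, hu, hu'⟩ := h1.exists_synth hn
    obtain ⟨v, hv, hv'⟩ := h2.exists_synth hn
    have e : synthPair ![u, v] = φ := Prod.ext hu' hv'
    refine ⟨![u, v], fun i => ?_, (key _).mp (by rw [e]; exact h3), e⟩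
    fin_cases i
    · exact hu
    · exact hv
  · rintro ⟨U, hU', h, rfl⟩
    exact ⟨⟨isTrigPoly_synth hn (hU' 0), isTrigPoly_synth hn (hU' 1)⟩, (key U).mpr h⟩

end BiharmonicCavity

end

/-! ### The convergence theorem -/

theorem theorem4p1 (γ : ℝ → Plane) (hγ : IsBoundaryCurve γ) (κ : ℝ) (hκ : 0 < κ)
    (huniq : ∀ ψ φ : (ℝ → ℂ) × (ℝ → ℂ), SmoothPeriodicPair ψ → SmoothPeriodicPair φ →
      coupledOp γ κ ψ = coupledOp γ κ φ → ψ = φ)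
    (p : ℝ) (hp : 0 ≤ p) :
    ∃ C : ℝ≥0, 0 < C ∧ ∃ N : ℕ, 1 ≤ N ∧ ∀ η : (ℝ → ℂ) × (ℝ → ℂ), SmoothPeriodicPair η →
      ∃ ψ : (ℝ → ℂ) × (ℝ → ℂ), SmoothPeriodicPair ψ ∧ opA γ κ ψ = η ∧
        (∀ φ : (ℝ → ℂ) × (ℝ → ℂ), SmoothPeriodicPair φ → opA γ κ φ = η → φ = ψ) ∧
        ∀ n : ℕ, N ≤ n → ∃ ψn : (ℝ → ℂ) × (ℝ → ℂ), IsSemiDiscreteSolution γ κ n η ψn ∧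
          (∀ φ : (ℝ → ℂ) × (ℝ → ℂ), IsSemiDiscreteSolution γ κ n η φ → φ = ψn) ∧
          sobolevNormPair p (ψn - ψ)
            ≤ C * sobolevNormPair (p + 2)
                (interpPair n (opEinv γ κ (opU γ κ ψ)) - opEinv γ κ (opU γ κ ψ)) := by
  obtain ⟨A, D, D', B, hA, hD, hD', hU, hB, oB, hsq⟩ := hγ.exists_repPair hκ
  have hAinj : ∀ U V, act A U = act A V → U = V := fun U V h => synthPair_injective <|
    huniq _ _ (smoothPeriodicPair_synthPair U) (smoothPeriodicPair_synthPair V) <| by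
      rw [← opA_eq_coupledOp, hA.apply, hA.apply, h]
  have hDinj : ∀ U V, act D U = act D V → U = V := fun U V h => by
    rw [← act_one U, ← act_one V, ← hD', act_mul, act_mul, h]
  -- `S₀² + B` represents `ℰ⁻¹𝒜²`, a product of injective operators.
  have hinj : ∀ U, act (!![endS * endS, 0; 0, endS * endS] + B) U = 0 → U = 0 := fun U h => by
    rw [← hsq, act_mul, act_mul] at h
    refine hAinj _ _ (hAinj _ _ (hDinj _ _ ?_))
    rw [h, act_zero, act_zero, act_zero]
  obtain ⟨C, hC, N, hN, hstab⟩ := exists_stability oB hinj hp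
  -- The factor 2 comes from the two components, each bounded by the joint weighted norm; adding 1
  -- makes the constant positive.
  refine ⟨(2 * C + 1).toNNReal, Real.toNNReal_pos.mpr (by positivity), N, hN, fun η hη => ?_⟩
  obtain ⟨H, rfl⟩ := hη.exists_synthPair
  -- Solve the squared equation `ℰ⁻¹𝒜²X = ℰ⁻¹η` in preconditioned form; `𝒜X` is then the solution of
  -- the original equation.
  obtain ⟨X, hX⟩ := (exists_solution_act (isOrd_precond oB) (precond_injective hinj)).1
    fun i => endT (endT (act D H i))
  have hX' : act (!![endS * endS, 0; 0, endS * endS] + B) X = act D H := funext fun i => by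
    have h := congrArg (fun v => endS (endS v)) (congrFun hX i)
    simp only [Pi.add_apply, act_precond, map_add, endS_endS_endT_endT] at h
    rw [act_add_matrix, Pi.add_apply, act_scalar]
    exact h
  set Ψ := act A X with hΨ
  have hAΨ : act A Ψ = H := by
    rw [← hsq, act_mul, act_mul] at hX'
    exact hDinj _ _ hX'
  refine ⟨synthPair Ψ, smoothPeriodicPair_synthPair Ψ, by rw [hA.apply, hAΨ], fun φ hφ h => ?_,
    fun n hn => ?_⟩
  · obtain ⟨Φ, rfl⟩ := hφ.exists_synthPair
    rw [hA.apply] at h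
    rw [hAinj Φ Ψ ((synthPair_injective h).trans hAΨ.symm)]
  have hn1 : 1 ≤ n := hN.trans hn
  -- Stability with zero right-hand side. It holds for all rapidly decaying pairs, so it yields
  -- uniqueness and, by dimension, existence in `X_n²`.
  have hzero : ∀ W : Fin 2 → RD, (∀ i, endS (endS (W i)) + interpEnd n (act B W i) = 0) → W = 0 := by
    intro W hW
    refine eq_zero_of_weighted ((hstab n hn W 0 hW).trans (le_of_eq ?_))
    have h0 : ‖wvec (p + 2) 0‖ = 0 := by
      have := wvec_sub (p + 2) 0 0
      rw [sub_zero, sub_self] at this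
      rw [this, norm_zero]
    rw [Pi.zero_apply, Pi.zero_apply, h0]
    ring
  have hiff := isSemiDiscreteSolution_iff hA hD hU hB hn1 H
  obtain ⟨V, hV, hVeq⟩ := exists_collocation_solution hn1 hzero (act (D * A) H)
  have hdiff : ∀ V W : Fin 2 → RD, ∀ i, endS (endS ((V - W) i)) + interpEnd n (act B (V - W) i) =
      (endS (endS (V i)) + interpEnd n (act B V i)) - (endS (endS (W i)) + interpEnd n (act B W i)) := by
    intro V W i
    rw [act_sub, Pi.sub_apply, Pi.sub_apply, map_sub, map_sub, map_sub]
    abel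
  refine ⟨synthPair V, (hiff _).mpr ⟨V, hV, hVeq, rfl⟩, fun φ hφ => ?_, ?_⟩
  · obtain ⟨W, -, hW, rfl⟩ := (hiff _).mp hφ
    rw [sub_eq_zero.mp (hzero (W - V) fun i => by rw [hdiff, hW, hVeq, sub_self])]
  set r : Fin 2 → RD := fun i => interpEnd n (endS (endS (Ψ i))) - endS (endS (Ψ i)) with hr
  -- Since `ℰ⁻¹𝒜η = ℰ⁻¹𝒜²ψ = S₀²ψ + Bψ`, the interpolated terms with `B` cancel in the equation for
  -- `ψⁿ - ψ`, and only the interpolation error of `S₀²ψ` remains.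
  have hW : ∀ i, endS (endS ((V - Ψ) i)) + interpEnd n (act B (V - Ψ) i) = r i := by
    intro i
    have e : act (D * A) H i = endS (endS (Ψ i)) + act B Ψ i := by
      rw [← hAΨ, ← act_mul, mul_assoc, hsq, act_add_matrix, Pi.add_apply, act_scalar]
      rfl
    rw [hdiff, hVeq, e, map_add]
    simp only [hr]
    abel
  have hEU : opEinv γ κ (opU γ κ (synthPair Ψ)) = synthPair fun i => endS (endS (Ψ i)) := by
    have h : opEinv γ κ (opU γ κ (synthPair Ψ)) = _ := hU.apply Ψ
    rw [h]
    exact congrArg synthPair (funext fun i => act_scalar _ _ _)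
  rw [hEU, interpPair_synthPair hn1, ← synthPair_sub, ← synthPair_sub, sobolevNormPair_synthPair,
    sobolevNormPair_synthPair]
  have hc : (((2 * C + 1).toNNReal : ℝ≥0) : ℝ≥0∞) = ENNReal.ofReal (2 * C + 1) := rfl
  rw [hc, ← ENNReal.ofReal_mul (by positivity)]
  refine ENNReal.ofReal_le_ofReal ?_
  have hmain := hstab n hn _ r hW
  have h0 := norm_wvec_le_weighted p (V - Ψ) 0
  have h1 := norm_wvec_le_weighted p (V - Ψ) 1
  have hr0 : 0 ≤ ‖wvec (p + 2) (r 0)‖ + ‖wvec (p + 2) (r 1)‖ := by positivity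
  change _ ≤ (2 * C + 1) * (‖wvec (p + 2) (r 0)‖ + ‖wvec (p + 2) (r 1)‖)
  linarith
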